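/- Let $F$ be a number field and $\ell$ a prime number. For a finite place $\mathfrak p$ of $F$ over the prime number $p$ let $\tilde f_{\mathfrak p}=[F_{\mathfrak p}\cap\widehat{\mathbb Q}_p^{c}:\mathbb Q_p]$, where $\widehat{\mathbb Q}_p^{c}$ is the compositum of the cyclotomic $\mathbb Z_q$-extensions of $\mathbb Q_p$ over all primes $q$. Put $\deg_F\mathfrak p=\tilde f_{\mathfrak p}\deg_\ell p$, where $\deg_\ell p=\operatorname{Log}_\ell p$ (Iwasawa logarithm, $\operatorname{Log}_\ell\ell=0$) if $p\neq\ell$, $\deg_\ell \ell=\ell$ if $\ell\neq2$, and $\deg_2 2=4$. The logarithmic valuation of $x\in F_{\mathfrak p}^\times$ is $\tilde v_{\mathfrak p}(x)=-\operatorname{Log}_\ell\bigl(|N_{F_{\mathfrak p}/\mathbb Q_p}(x)|\bigr)/\deg_F\mathfrak p\in\mathbb Z_\ell$, where $|y|=y$ if $p=\ell$ and $|y|=p^{-v_p(y)}$ if $p\ne\ell$. Let $\mathcal R_F=\mathbb Z_\ell\otimes_{\mathbb Z}F^\times$, to which the valuations $\tilde v_{\mathfrak p}$ and the usual valuations $v_{\mathfrak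 p}$ extend $\mathbb Z_\ell$-linearly. Let - $\mathcal D\ell_F=\bigoplus_{\mathfrak p}\mathbb Z_\ell\,\mathfrak p$ (all finite places), $\deg_F(\sum n_{\mathfrak p}\mathfrak p)=\sum n_{\mathfrak p}\deg_F\mathfrak p$, and $\widetilde{\mathcal D\ell}_F=\ker\deg_F$; - $\widetilde{\mathcal P\ell}_F$ the image of $\operatorname{div}_F$, $a\mapsto\sum_{\mathfrak p}\tilde v_{\mathfrak p}(a)\,\mathfrak p$, on $\mathcal R_F$, and $\widetilde{\mathcal C\ell}_F=\widetilde{\mathcal D\ell}_F/\widetilde{\mathcal P\ell}_F$ (the logarithmic $\ell$-class group); - $Id_F=\{\prod_{\mathfrak p\nmid\ell}\mathfrak p^{\alpha_{\mathfrak p}}:\alpha_{\mathfrak p}\in\mathbb Z_\ell\text{, almost all }0\}$ the group of $\ell$-ideals, and $d_F:Id_F\to\mathcal D\ell_F$, $\prod\mathfrak p^{\alpha_{\mathfrak p}}\mapsto\sum\lambda_{\mathfrak p}\alpha_{\mathfrak p}\,\mathfrak p$, where $\lambda_{\mathfrak p}=f_{\mathfrak p}/\tilde f_{\mathfrak p}$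 and $f_{\mathfrak p}$ is the usual inertia degree; - $\widetilde{Id}_F=\{\mathfrak a\in Id_F:\deg_F d_F(\mathfrak a)=0\}$ and $\widetilde{Pr}_F=\{\prod_{\mathfrak p\nmid\ell}\mathfrak p^{v_{\mathfrak p}(a)}: a\in\mathcal R_F,\ \tilde v_{\mathfrak p}(a)=0\ \ \forall\,\mathfrak p\mid\ell\}$. Let $m\ge0$ be an integer such that $\ell^m$ annihilates $\widetilde{\mathcal C\ell}_F$, and set $$\widetilde{Id}_F^{(\ell^m)}=\{\mathfrak a\in Id_F:\deg_F d_F(\mathfrak a)\in\ell^m\deg_F\mathcal D\ell_F\},\qquad \widetilde{Pr}_F^{(\ell^m)}=\widetilde{Pr}_F\,Id_F^{\ell^m}.$$ Then $\widetilde{\mathcal P\ell}_F\subseteq\widetilde{\mathcal D\ell}_F$, $\widetilde{Id}_F^{(\ell^m)}=\widetilde{Id}_F\,Id_F^{\ell^m}$, $\widetilde{Pr}_F^{(\ell^m)}\subseteq\widetilde{Id}_F^{(\ell^m)}$, and there is an isomorphism of $\mathbb Z_\ell$-modules $$\widetilde{\mathcal C\ell}_F\simeq\widetilde{Id}_F^{(\ell^m)}/\widetilde{Pr}_F^{(\ell^m)}$$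 such that for every $\mathfrak a\in\widetilde{Id}_F$ one has $d_F(\mathfrak a)\in\widetilde{\mathcal D\ell}_F$, and the class of $d_F(\mathfrak a)$ is sent to the class of $\mathfrak a$. -/

import Mathlib

open Filter Topology NumberField IsDedekindDomain
open scoped TensorProduct Pointwise
noncomputable section
namespace LogClass

section


variable (p : ℕ) [Fact p.Prime]

/-- The `p`-adic logarithm series `log u = ∑ (-1)^n (u-1)^(n+1) / (n+1)`, convergent for `‖u - 1‖ < 1`. -/
def logSeries (u : ℚ_[p]) : ℚ_[p] :=
  ∑' n : ℕ, (-1) ^ n * (u - 1) ^ (n + 1) / ((n : ℚ_[p]) + 1)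

variable {p}

theorem norm_inv_natCast_succ_le (k : ℕ) : ‖((k : ℚ_[p]) + 1)⁻¹‖ ≤ (k : ℝ) + 1 := by
  have hp : (0 : ℝ) < p := by exact_mod_cast (Fact.out : p.Prime).pos
  have h0 : ((k + 1 : ℕ) : ℚ_[p]) ≠ 0 := by exact_mod_cast Nat.succ_ne_zero k
  have h1 : ((k : ℚ_[p]) + 1) = ((k + 1 : ℕ) : ℚ_[p]) := by push_cast; rfl
  rw [h1, norm_inv, Padic.norm_eq_zpow_neg_valuation h0, Padic.valuation_natCast, zpow_neg,
    inv_inv, zpow_natCast]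
  have := Nat.le_of_dvd (Nat.succ_pos k) (pow_padicValNat_dvd (p := p) (n := k + 1))
  exact_mod_cast this

theorem tendsto_pow_p : Tendsto (fun N : ℕ ↦ (p : ℚ_[p]) ^ N) atTop (𝓝 0) :=
  tendsto_pow_atTop_nhds_zero_of_norm_lt_one (Padic.norm_p_lt_one)

theorem tendsto_choose (k : ℕ) :
    Tendsto (fun N : ℕ ↦ (((p ^ N - 1).choose k : ℕ) : ℚ_[p])) atTop (𝓝 ((-1) ^ k)) := by
  induction k with
  | zero => simp
  | succ k ih =>
    have key : ∀ N : ℕ, (((p ^ N - 1).choose (k + 1) : ℕ) : ℚ_[p]) =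
        (((p ^ N - 1).choose k : ℕ) : ℚ_[p]) * ((p : ℚ_[p]) ^ N - 1 - k) * ((k : ℚ_[p]) + 1)⁻¹ := by
      intro N
      have hk : ((k : ℚ_[p]) + 1) ≠ 0 := by exact_mod_cast Nat.succ_ne_zero k
      rw [eq_mul_inv_iff_mul_eq₀ hk]
      have h1 : 1 ≤ p ^ N := Nat.one_le_pow _ _ (Fact.out : p.Prime).pos
      have h2 := Nat.choose_succ_right_eq (p ^ N - 1) k
      rcases le_or_gt k (p ^ N - 1) with h | h
      · have h3 := congrArg (Nat.cast : ℕ → ℚ_[p]) h2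
        push_cast [Nat.cast_sub h, Nat.cast_sub h1] at h3
        exact h3
      · rw [Nat.choose_eq_zero_of_lt h, Nat.choose_eq_zero_of_lt (by omega)]; simp
    simp_rw [key]
    have := (ih.mul ((tendsto_pow_p (p := p)).sub_const 1 |>.sub_const (k : ℚ_[p]))).mul_const
      ((k : ℚ_[p]) + 1)⁻¹
    have hk : ((k : ℚ_[p]) + 1) ≠ 0 := by exact_mod_cast Nat.succ_ne_zero k
    convert this using 2
    field_simp
    ring

theorem logSeries_tendsto {u : ℚ_[p]} (hu : ‖u - 1‖ < 1) :
    Tendsto (fun N : ℕ ↦ (u ^ p ^ N - 1) / (p : ℚ_[p]) ^ N) atTop (𝓝 (logSeries p u)) := by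
  set t := u - 1 with ht
  have hut : u = 1 + t := by rw [ht]; ring
  have hp : (p : ℚ_[p]) ≠ 0 := by exact_mod_cast (Fact.out : p.Prime).ne_zero
  have key : ∀ N : ℕ, (u ^ p ^ N - 1) / (p : ℚ_[p]) ^ N =
      ∑' k : ℕ, (((p ^ N - 1).choose k : ℕ) : ℚ_[p]) * t ^ (k + 1) * ((k : ℚ_[p]) + 1)⁻¹ := by
    intro N
    have h1 : 1 ≤ p ^ N := Nat.one_le_pow _ _ (Fact.out : p.Prime).pos
    obtain ⟨M, hM⟩ : ∃ M, p ^ N = M + 1 := ⟨p ^ N - 1, by omega⟩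
    have hM' : (p : ℚ_[p]) ^ N = (M : ℚ_[p]) + 1 := by exact_mod_cast congrArg (Nat.cast : ℕ → ℚ_[p]) hM
    have hM0 : (M : ℚ_[p]) + 1 ≠ 0 := by rw [← hM']; exact pow_ne_zero _ hp
    rw [hM', hM, Nat.add_sub_cancel, tsum_eq_sum (s := Finset.range (M + 1))]
    · rw [hut, add_comm 1 t, add_pow, Finset.sum_range_succ']
      simp only [one_pow, mul_one, pow_zero, Nat.choose_zero_right, Nat.cast_one,
        add_sub_cancel_right, Finset.sum_div]
      refine Finset.sum_congr rfl fun k _ ↦ ?_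
      have hk : ((k : ℚ_[p]) + 1) ≠ 0 := by exact_mod_cast Nat.succ_ne_zero k
      have h3 := congrArg (Nat.cast : ℕ → ℚ_[p]) (Nat.add_one_mul_choose_eq M k)
      push_cast at h3
      rw [div_eq_iff hM0]
      field_simp
      linear_combination (-t ^ (k+1)) * h3
    · intro k hk
      rw [Nat.choose_eq_zero_of_lt (by simpa using hk)]; simp
  simp_rw [key]
  have e : logSeries p u = ∑' k : ℕ, (-1) ^ k * t ^ (k + 1) * ((k : ℚ_[p]) + 1)⁻¹ := rfl
  rw [e]
  refine tendsto_tsum_of_dominated_convergence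
    (bound := fun k : ℕ ↦ ((k : ℝ) + 1) * ‖t‖ ^ (k + 1)) ?_ ?_ ?_
  · have := summable_pow_mul_geometric_of_norm_lt_one (R := ℝ) 1 (r := ‖t‖) (by simpa using hu)
    have := (summable_nat_add_iff 1).2 this
    simpa using this
  · intro k
    exact ((tendsto_choose k).mul_const _).mul_const _
  · refine Eventually.of_forall fun N k ↦ ?_
    rw [norm_mul, norm_mul, norm_pow, mul_comm ((k : ℝ) + 1)]
    gcongr
    · calc _ ≤ 1 * ‖t‖ ^ (k + 1) := by
            gcongr
            exact_mod_cast Padic.norm_int_le_one (p := p) ((p ^ N - 1).choose k : ℤ)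
        _ = _ := one_mul _
    · exact norm_inv_natCast_succ_le k

theorem logSeries_mul {u w : ℚ_[p]} (hu : ‖u - 1‖ < 1) (hw : ‖w - 1‖ < 1) :
    logSeries p (u * w) = logSeries p u + logSeries p w := by
  have hp : (p : ℚ_[p]) ≠ 0 := by exact_mod_cast (Fact.out : p.Prime).ne_zero
  have hw1 : ‖w‖ ≤ 1 := by
    have : w = (w - 1) + 1 := by ring
    rw [this]
    exact (Padic.nonarchimedean _ _).trans (max_le hw.le (by simp))
  have huw : ‖u * w - 1‖ < 1 := by
    have : u * w - 1 = (u - 1) * w + (w - 1) := by ring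
    rw [this]
    refine (Padic.nonarchimedean _ _).trans_lt (max_lt ?_ hw)
    rw [norm_mul]
    calc _ ≤ ‖u - 1‖ * 1 := by gcongr
      _ < 1 := by simpa using hu
  refine tendsto_nhds_unique (logSeries_tendsto huw) ?_
  have h1 := logSeries_tendsto hu
  have h2 := logSeries_tendsto hw
  have h3 : Tendsto (fun N : ℕ ↦ w ^ p ^ N) atTop (𝓝 1) := by
    have := (h2.mul (tendsto_pow_p (p := p))).add_const 1
    simp only [mul_zero, zero_add] at this
    refine this.congr fun N ↦ ?_
    have := pow_ne_zero N hp
    field_simp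
    try ring
  have := (h1.mul h3).add h2
  rw [mul_one] at this
  refine this.congr fun N ↦ ?_
  have := pow_ne_zero N hp
  field_simp
  ring

variable (p)
/-- The Iwasawa logarithm on `ℚ_pˣ` (with `Log p = 0`): write `x = p^k u` with `u` a unit; then
`Log x = log (u^(p-1)) / (p-1)`, where `u^(p-1)` is a principal unit. -/
def iwasawaLog (x : ℚ_[p]) : ℚ_[p] :=
  logSeries p ((x * (p : ℚ_[p]) ^ (-x.valuation)) ^ (p - 1)) / ((p - 1 : ℕ) : ℚ_[p])
variable {p}

theorem norm_unit_pow_sub_one_lt {u : ℚ_[p]} (hu : ‖u‖ = 1) : ‖u ^ (p - 1) - 1‖ < 1 := by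
  let z : ℤ_[p] := ⟨u, hu.le⟩
  have hz : ‖z‖ = 1 := hu
  have : ‖z ^ (p - 1) - 1‖ < 1 := by
    rw [← PadicInt.mem_nonunits, ← IsLocalRing.mem_maximalIdeal, ← PadicInt.ker_toZMod,
      RingHom.mem_ker, map_sub, map_pow, map_one, ZMod.pow_card_sub_one_eq_one, sub_self]
    intro h
    rw [← RingHom.mem_ker, PadicInt.ker_toZMod, IsLocalRing.mem_maximalIdeal,
      PadicInt.mem_nonunits] at h
    exact h.ne hz
  exact this

theorem norm_mul_p_zpow {x : ℚ_[p]} (hx : x ≠ 0) : ‖x * (p : ℚ_[p]) ^ (-x.valuation)‖ = 1 := by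
  have hp : (p : ℝ) ≠ 0 := by exact_mod_cast (Fact.out : p.Prime).ne_zero
  rw [norm_mul, Padic.norm_p_zpow, Padic.norm_eq_zpow_neg_valuation hx, ← zpow_add₀ hp]
  simp

theorem iwasawaLog_mul {x y : ℚ_[p]} (hx : x ≠ 0) (hy : y ≠ 0) :
    iwasawaLog p (x * y) = iwasawaLog p x + iwasawaLog p y := by
  have hp : (p : ℚ_[p]) ≠ 0 := by exact_mod_cast (Fact.out : p.Prime).ne_zero
  unfold iwasawaLog
  rw [← add_div, ← logSeries_mul (norm_unit_pow_sub_one_lt (norm_mul_p_zpow hx))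
    (norm_unit_pow_sub_one_lt (norm_mul_p_zpow hy)), Padic.valuation_mul hx hy, neg_add,
    zpow_add₀ hp]
  congr 2
  ring

theorem iwasawaLog_one : iwasawaLog p 1 = 0 := by
  simpa using iwasawaLog_mul (p := p) one_ne_zero one_ne_zero


end

section
variable (K L : Type*) [Field K] [Field L] [Algebra K L]

/-- The field `K(μ_{q^∞})` inside `L`. -/
def qPowerCyclotomic (q : ℕ) : IntermediateField K L :=
  IntermediateField.adjoin K {ζ : L | ∃ n : ℕ, ζ ^ q ^ n = 1}

/-- The cyclotomic `ℤ_q`-extension of `K` inside `L`: the subfield of `K(μ_{q^∞})` fixed by the torsion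
of `Gal(K(μ_{q^∞})/K)`. For `K = ℚ_p` and `L` algebraically closed, it is the unique `ℤ_q`-extension
of `K` in `K(μ_{q^∞})`. -/
def cyclotomicZq (q : ℕ) : IntermediateField K L :=
  IntermediateField.lift (IntermediateField.fixedField
    (Subgroup.closure {σ : Gal(qPowerCyclotomic K L q/K) | IsOfFinOrder σ}))

/-- The compositum of the cyclotomic `ℤ_q`-extensions of `K` over all primes `q`. -/
def cyclotomicZHat : IntermediateField K L := ⨆ q : Nat.Primes, cyclotomicZq K L q

/-- The logarithmic inertia degree `[L ∩ K̂ᶜ : K]`, where `K̂ᶜ` is the compositum of all cyclotomic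
`ℤ_q`-extensions of `K`; the intersection is taken in an algebraic closure of `L`. -/
def logInertiaDegree : ℕ :=
  Module.finrank K
    ((IsScalarTower.toAlgHom K L (AlgebraicClosure L)).fieldRange ⊓
      cyclotomicZHat K (AlgebraicClosure L) : IntermediateField K (AlgebraicClosure L))
end

section
variable {F : Type*} [Field F] [NumberField F]

/-- The prime number below a finite place. -/
def residueChar (v : HeightOneSpectrum (𝓞 F)) : ℕ := Ideal.absNorm (v.asIdeal.under ℤ)

instance (v : HeightOneSpectrum (𝓞 F)) : Fact (residueChar v).Prime :=
  haveI : NeZero v.asIdeal := ⟨v.ne_bot⟩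
  ⟨Nat.absNorm_under_prime v.asIdeal⟩

theorem residueChar_mem (v : HeightOneSpectrum (𝓞 F)) : (residueChar v : 𝓞 F) ∈ v.asIdeal :=
  Int.absNorm_under_mem v.asIdeal

theorem liesOver_primesEquiv (p : ℕ) [Fact p.Prime] (v : HeightOneSpectrum (𝓞 F))
    (hv : (p : 𝓞 F) ∈ v.asIdeal) :
    v.asIdeal.LiesOver
      ((Rat.HeightOneSpectrum.primesEquiv (R := ℤ)).symm ⟨p, Fact.out⟩).asIdeal := by
  set w := (Rat.HeightOneSpectrum.primesEquiv (R := ℤ)).symm ⟨p, Fact.out⟩ with hw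
  have h1 : w.asIdeal ≤ v.asIdeal.under ℤ := by
    have hg : Rat.HeightOneSpectrum.natGenerator w = p := by
      have := congrArg Subtype.val
        ((Rat.HeightOneSpectrum.primesEquiv (R := ℤ)).apply_symm_apply ⟨p, Fact.out⟩)
      exact this
    have hs := Rat.HeightOneSpectrum.span_natGenerator w
    intro x hx
    have hx' : Rat.IsIntegralClosure.intEquiv ℤ x ∈ w.asIdeal.map (Rat.IsIntegralClosure.intEquiv ℤ) :=
      Ideal.mem_map_of_mem _ hx
    rw [← hs, hg, Ideal.mem_span_singleton] at hx'
    have e : Rat.IsIntegralClosure.intEquiv ℤ x = x := by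
      simpa using map_intCast (Rat.IsIntegralClosure.intEquiv ℤ) x
    rw [e] at hx'
    obtain ⟨y, rfl⟩ := hx'
    rw [Ideal.under_def, Ideal.mem_comap]
    simpa using Ideal.mul_mem_right _ _ hv
  refine ⟨?_⟩
  exact (w.isMaximal.eq_of_le (Ideal.IsPrime.ne_top inferInstance) h1)

/-- For a finite place `v` over `p`, the embedding `ℚ_p → F_v`, extending `ℚ → F` by continuity. -/
def padicToCompletion (p : ℕ) [Fact p.Prime] (v : HeightOneSpectrum (𝓞 F))
    (hv : (p : 𝓞 F) ∈ v.asIdeal) : ℚ_[p] →+* v.adicCompletion F :=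
  let w := (Rat.HeightOneSpectrum.primesEquiv (R := ℤ)).symm ⟨p, Fact.out⟩
  haveI := liesOver_primesEquiv p v hv
  (HeightOneSpectrum.adicCompletion.equiv F v).symm.toRingHom.comp
    ((UniformSpace.Completion.mapRingHom
      (algebraMap (WithVal (w.valuation ℚ)) (WithVal (v.valuation F)))
      (HeightOneSpectrum.uniformContinuous_algebraMap_liesOver ℚ F w v).continuous).comp
      ((HeightOneSpectrum.adicCompletion.equiv ℚ w).toRingHom.comp
        (Padic.adicCompletionEquiv ℤ ⟨p, Fact.out⟩).toAlgEquiv.toRingEquiv.toRingHom))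

theorem continuous_padicToCompletion (p : ℕ) [Fact p.Prime] (v : HeightOneSpectrum (𝓞 F))
    (hv : (p : 𝓞 F) ∈ v.asIdeal) : Continuous (padicToCompletion p v hv) := by
  refine (HeightOneSpectrum.adicCompletion.continuous_ofCompletion F v).comp ?_
  refine UniformSpace.Completion.continuous_map.comp ?_
  exact (HeightOneSpectrum.adicCompletion.continuous_toCompletion ℚ _).comp
    (Padic.adicCompletionEquiv ℤ ⟨p, Fact.out⟩).continuous_toFun

/-- The local norm `N_{F_v/ℚ_p} : F_v → ℚ_p`. -/
def localNorm (p : ℕ) [Fact p.Prime] (v : HeightOneSpectrum (𝓞 F))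
    (hv : (p : 𝓞 F) ∈ v.asIdeal) : v.adicCompletion F →* ℚ_[p] :=
  letI := (padicToCompletion p v hv).toAlgebra
  Algebra.norm ℚ_[p]

/-- The absolute logarithmic inertia degree `f̃_v = [F_v ∩ ℚ̂_pᶜ : ℚ_p]`. -/
def localLogInertia (v : HeightOneSpectrum (𝓞 F)) : ℕ :=
  letI := (padicToCompletion (residueChar v) v (residueChar_mem v)).toAlgebra
  logInertiaDegree ℚ_[residueChar v] (v.adicCompletion F)

theorem norm_localNorm_le_one (p : ℕ) [Fact p.Prime] (v : HeightOneSpectrum (𝓞 F))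
    (hv : (p : 𝓞 F) ∈ v.asIdeal) (a : 𝓞 F) :
    ‖localNorm p v hv (algebraMap F (v.adicCompletion F) a)‖ ≤ 1 := by
  let _ := (padicToCompletion p v hv).toAlgebra
  change ‖Algebra.norm ℚ_[p] (algebraMap F (v.adicCompletion F) a)‖ ≤ 1
  let _ : Algebra ℤ_[p] (v.adicCompletion F) :=
    ((algebraMap ℚ_[p] (v.adicCompletion F)).comp (algebraMap ℤ_[p] ℚ_[p])).toAlgebra
  have : IsScalarTower ℤ_[p] ℚ_[p] (v.adicCompletion F) := .of_algebraMap_eq fun _ ↦ rfl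
  have h1 : IsIntegral ℤ_[p] (algebraMap F (v.adicCompletion F) a) := by
    obtain ⟨P, hP, hx⟩ := RingOfIntegers.isIntegral_coe a
    refine ⟨P.map (Int.castRingHom ℤ_[p]), hP.map _, ?_⟩
    rw [Polynomial.eval₂_map]
    have := congrArg (algebraMap F (v.adicCompletion F)) hx
    rw [map_zero, Polynomial.hom_eval₂] at this
    rw [← this]
    exact Polynomial.eval₂_congr (RingHom.ext_int _ _) rfl rfl
  obtain ⟨y, hy⟩ := IsIntegrallyClosed.isIntegral_iff.1 (Algebra.isIntegral_norm ℚ_[p] h1)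
  rw [← hy]
  exact y.2

theorem valuation_localNorm_eq_zero (v : HeightOneSpectrum (𝓞 F)) (a : 𝓞 F) (n : ℕ)
    (hn : (n : 𝓞 F) ∉ v.asIdeal) (han : a ∣ n) :
    (localNorm (residueChar v) v (residueChar_mem v)
      (algebraMap F (v.adicCompletion F) a)).valuation = 0 := by
  set p := residueChar v with hp
  obtain ⟨b, hb⟩ := han
  have hnp : ‖(n : ℚ_[p])‖ = 1 := by
    rw [← Int.cast_natCast]
    refine le_antisymm (Padic.norm_int_le_one _) (not_lt.1 fun h ↦ hn ?_)
    rw [Padic.norm_intCast_lt_one_iff] at h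
    exact_mod_cast (Int.cast_mem_ideal_iff (I := v.asIdeal) (d := (n : ℤ))).2 h
  have h : localNorm p v (residueChar_mem v) (algebraMap F (v.adicCompletion F) a) *
      localNorm p v (residueChar_mem v) (algebraMap F (v.adicCompletion F) b) =
      (n : ℚ_[p]) ^ (@Module.finrank ℚ_[p] (v.adicCompletion F) _ _
        (padicToCompletion p v (residueChar_mem v)).toAlgebra.toModule) := by
    letI := (padicToCompletion p v (residueChar_mem v)).toAlgebra
    have e : algebraMap ℚ_[p] (v.adicCompletion F) (n : ℚ_[p]) =
        algebraMap F (v.adicCompletion F) a * algebraMap F (v.adicCompletion F) b := by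
      rw [← map_mul, ← map_mul, ← hb]
      simp
    rw [← map_mul, ← e]
    exact Algebra.norm_algebraMap _
  have h1 := norm_localNorm_le_one p v (residueChar_mem v) a
  have h2 := norm_localNorm_le_one p v (residueChar_mem v) b
  have h3 := congrArg norm h
  rw [norm_mul, norm_pow, hnp, one_pow] at h3
  have h4 : ‖localNorm p v (residueChar_mem v) (algebraMap F (v.adicCompletion F) a)‖ = 1 := by
    apply le_antisymm h1
    rw [← h3]
    exact mul_le_of_le_one_right (norm_nonneg _) h2
  have h0 : localNorm p v (residueChar_mem v) (algebraMap F (v.adicCompletion F) a) ≠ 0 := by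
    intro h0
    rw [h0, norm_zero] at h4
    exact zero_ne_one h4
  have hp1 : (1 : ℝ) < p := by exact_mod_cast (Fact.out : p.Prime).one_lt
  rw [Padic.norm_eq_zpow_neg_valuation h0, zpow_eq_one_iff_right₀ (by linarith) hp1.ne'] at h4
  simpa using h4

theorem localNorm_ne_zero (p : ℕ) [Fact p.Prime] (v : HeightOneSpectrum (𝓞 F))
    (hv : (p : 𝓞 F) ∈ v.asIdeal) {x : v.adicCompletion F} (hx : x ≠ 0) :
    localNorm p v hv x ≠ 0 := ((IsUnit.mk0 x hx).map (localNorm p v hv)).ne_zero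

end

section
variable {R M : Type*} [CommRing R] [AddCommGroup M] [Module R M]

/-- The quotient `A / B` of two submodules; it is only used for `B ≤ A`. -/
def Subquotient (A B : Submodule R M) : Type _ := ↥A ⧸ B.submoduleOf A

instance (A B : Submodule R M) : AddCommGroup (Subquotient A B) :=
  inferInstanceAs (AddCommGroup (↥A ⧸ B.submoduleOf A))

instance (A B : Submodule R M) : Module R (Subquotient A B) :=
  inferInstanceAs (Module R (↥A ⧸ B.submoduleOf A))

/-- The class in `A / B` of an element of `A`. -/
def Subquotient.mk (A B : Submodule R M) : ↥A →ₗ[R] Subquotient A B := (B.submoduleOf A).mkQ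
end

section
variable (F : Type*) [Field F] [NumberField F] (ℓ : ℕ) [Fact ℓ.Prime]

open Classical in
/-- `Log_ℓ (N_{F_v/ℚ_p} x)`. If `p = ℓ` this is the Iwasawa logarithm of the norm. If `p ≠ ℓ`, the norm
lies in `ℚ_p` and its logarithm is that of its absolute value `p^(-v_p(N x))`, seen in `ℚ_ℓ`. -/
def logAbs (v : HeightOneSpectrum (𝓞 F)) (x : v.adicCompletion F) : ℚ_[ℓ] :=
  if h : (ℓ : 𝓞 F) ∈ v.asIdeal then iwasawaLog ℓ (localNorm ℓ v h x)
  else iwasawaLog ℓ ((residueChar v : ℚ_[ℓ]) ^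
    (-(localNorm (residueChar v) v (residueChar_mem v) x).valuation))

/-- `deg_ℓ p`. -/
def degPrime (p : ℕ) : ℚ_[ℓ] :=
  if p = ℓ then (if ℓ = 2 then 4 else (ℓ : ℚ_[ℓ])) else iwasawaLog ℓ p

/-- The `ℓ`-adic degree `deg_F v = f̃_v · deg_ℓ p` of a finite place. -/
def degPlace (v : HeightOneSpectrum (𝓞 F)) : ℚ_[ℓ] :=
  (localLogInertia v : ℚ_[ℓ]) * degPrime ℓ (residueChar v)

/-- The logarithmic valuation `ṽ_v (x) = - Log_ℓ (N_{F_v/ℚ_p} x) / deg_F v`. -/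
def logVal (v : HeightOneSpectrum (𝓞 F)) (x : v.adicCompletion F) : ℚ_[ℓ] :=
  -logAbs F ℓ v x / degPlace F ℓ v

variable {F ℓ}

theorem logVal_mul (v : HeightOneSpectrum (𝓞 F)) {x y : v.adicCompletion F}
    (hx : x ≠ 0) (hy : y ≠ 0) : logVal F ℓ v (x * y) = logVal F ℓ v x + logVal F ℓ v y := by
  have key : logAbs F ℓ v (x * y) = logAbs F ℓ v x + logAbs F ℓ v y := by
    unfold logAbs
    split_ifs with h
    · rw [map_mul, iwasawaLog_mul (localNorm_ne_zero _ _ _ hx) (localNorm_ne_zero _ _ _ hy)]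
    · have hp : (residueChar v : ℚ_[ℓ]) ≠ 0 := by
        exact_mod_cast (Fact.out : (residueChar v).Prime).ne_zero
      rw [map_mul, Padic.valuation_mul (localNorm_ne_zero _ _ _ hx) (localNorm_ne_zero _ _ _ hy),
        neg_add, zpow_add₀ hp, iwasawaLog_mul (zpow_ne_zero _ hp) (zpow_ne_zero _ hp)]
  rw [logVal, key, neg_add, add_div]
  rfl

theorem finite_dvd (n : ℕ) (hn : n ≠ 0) :
    {v : HeightOneSpectrum (𝓞 F) | (n : 𝓞 F) ∈ v.asIdeal}.Finite := by
  have h : Ideal.span {(n : 𝓞 F)} ≠ ⊥ := by simpa using hn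
  refine (Ideal.finite_factors h).subset fun v hv ↦ ?_
  simpa [Ideal.dvd_span_singleton] using hv

theorem finite_logVal_ne_zero {x : F} (hx : x ≠ 0) :
    {v : HeightOneSpectrum (𝓞 F) |
      logVal F ℓ v (algebraMap F (v.adicCompletion F) x) ≠ 0}.Finite := by
  obtain ⟨a, b, hb, rfl⟩ := IsFractionRing.div_surjective (A := 𝓞 F) x
  have hb0 : b ≠ 0 := nonZeroDivisors.ne_zero hb
  have ha0 : a ≠ 0 := by rintro rfl; simp at hx
  set n := ℓ * (Ideal.absNorm (Ideal.span {a}) * Ideal.absNorm (Ideal.span {b})) with hn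
  have hn0 : n ≠ 0 := by
    refine mul_ne_zero (Fact.out : ℓ.Prime).ne_zero (mul_ne_zero ?_ ?_) <;>
    simpa [Ideal.absNorm_eq_zero_iff]
  have hna : a ∣ n := by
    rw [hn]; push_cast
    exact ((Ideal.mem_span_singleton.1 (Ideal.absNorm_mem (Ideal.span {a}))).mul_right _).mul_left _
  have hnb : b ∣ n := by
    rw [hn]; push_cast
    exact ((Ideal.mem_span_singleton.1 (Ideal.absNorm_mem (Ideal.span {b}))).mul_left _).mul_left _
  refine (finite_dvd n hn0).subset fun v hv ↦ ?_
  by_contra hnv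
  have hnv : (n : 𝓞 F) ∉ v.asIdeal := hnv
  have hl : (ℓ : 𝓞 F) ∉ v.asIdeal := fun h ↦ hnv (by
    rw [hn, Nat.cast_mul]; exact Ideal.mul_mem_right _ _ h)
  have key : ∀ c : 𝓞 F, c ∣ n → logVal F ℓ v (algebraMap F (v.adicCompletion F) c) = 0 := by
    intro c hc
    rw [logVal, logAbs, dif_neg hl, valuation_localNorm_eq_zero v c n hnv hc]
    simp [iwasawaLog_one]
  apply hv
  have hinj := (algebraMap F (v.adicCompletion F)).injective
  have hb1 : (algebraMap (𝓞 F) F b) ≠ 0 := by simpa using hb0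
  have h := logVal_mul (F := F) (ℓ := ℓ) v
    (x := algebraMap F (v.adicCompletion F) (algebraMap (𝓞 F) F a / algebraMap (𝓞 F) F b))
    (y := algebraMap F (v.adicCompletion F) (algebraMap (𝓞 F) F b))
    ((map_ne_zero _).2 hx) ((map_ne_zero _).2 hb1)
  rw [← map_mul, div_mul_cancel₀ _ hb1] at h
  have h1 := key a hna
  have h2 := key b hnb
  rw [h2, add_zero] at h
  rw [← h]
  exact h1

variable (F ℓ)

/-- `x ↦ ∑_v ṽ_v(x) v` on `Fˣ`. -/
def logValHom : Additive Fˣ →+ (HeightOneSpectrum (𝓞 F) →₀ ℚ_[ℓ]) where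
  toFun x := Finsupp.ofSupportFinite
    (fun v ↦ logVal F ℓ v (algebraMap F (v.adicCompletion F) (x.toMul : F)))
    (finite_logVal_ne_zero x.toMul.ne_zero)
  map_zero' := by
    ext v
    simpa [Finsupp.ofSupportFinite] using logVal_mul (F := F) (ℓ := ℓ) v one_ne_zero one_ne_zero
  map_add' x y := by
    ext v
    exact (congrArg (logVal F ℓ v) (map_mul (algebraMap F (v.adicCompletion F)) _ _)).trans
      (logVal_mul (F := F) (ℓ := ℓ) v (by simp) (by simp))

/-- `ℛ_F = ℤ_ℓ ⊗ Fˣ`. -/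
abbrev PrincipalIdeles : Type _ := ℤ_[ℓ] ⊗[ℤ] Additive Fˣ

/-- `div_F : ℛ_F → ⊕_v ℚ_ℓ v`, the `ℤ_ℓ`-linear extension of `x ↦ ∑_v ṽ_v(x) v`. -/
def logDiv : PrincipalIdeles F ℓ →ₗ[ℤ_[ℓ]] (HeightOneSpectrum (𝓞 F) →₀ ℚ_[ℓ]) :=
  (logValHom F ℓ).toIntLinearMap.liftBaseChange ℤ_[ℓ]

/-- The group `⊕_v ℤ_ℓ v` of logarithmic divisors, inside `⊕_v ℚ_ℓ v`. -/
def LogDivisors : Submodule ℤ_[ℓ] (HeightOneSpectrum (𝓞 F) →₀ ℚ_[ℓ]) where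
  carrier := {D | ∀ v, ‖D v‖ ≤ 1}
  zero_mem' v := by simp
  add_mem' hD hE v := (Padic.nonarchimedean _ _).trans (max_le (hD v) (hE v))
  smul_mem' c D hD v := by
    rw [Finsupp.smul_apply, Algebra.smul_def, norm_mul]
    exact mul_le_one₀ c.2 (norm_nonneg _) (hD v)

/-- The degree `∑ n_v v ↦ ∑ n_v deg_F v`. -/
def deg : (HeightOneSpectrum (𝓞 F) →₀ ℚ_[ℓ]) →ₗ[ℤ_[ℓ]] ℚ_[ℓ] :=
  Finsupp.lsum ℤ_[ℓ] fun v ↦ LinearMap.mulRight ℤ_[ℓ] (degPlace F ℓ v)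

/-- Logarithmic divisors of degree zero. -/
def LogDivisorsZero : Submodule ℤ_[ℓ] (HeightOneSpectrum (𝓞 F) →₀ ℚ_[ℓ]) :=
  LogDivisors F ℓ ⊓ LinearMap.ker (deg F ℓ)

/-- Principal logarithmic divisors: the image of `div_F`. -/
def PrincipalLogDivisors : Submodule ℤ_[ℓ] (HeightOneSpectrum (𝓞 F) →₀ ℚ_[ℓ]) :=
  LinearMap.range (logDiv F ℓ)

/-- The logarithmic `ℓ`-class group: divisors of degree zero modulo principal ones. -/
abbrev LogClassGroup : Type _ := Subquotient (LogDivisorsZero F ℓ) (PrincipalLogDivisors F ℓ)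

/-- The group of `ℓ`-ideals `∏_{v ∤ ℓ} v^{α_v}`, `α_v ∈ ℤ_ℓ`, written additively: a product of subgroups
becomes `⊔` and the subgroup of `n`-th powers becomes `n • ⊤`. -/
abbrev LIdeals : Type _ := {v : HeightOneSpectrum (𝓞 F) // (ℓ : 𝓞 F) ∉ v.asIdeal} →₀ ℤ_[ℓ]

/-- `λ_v = f_v / f̃_v` (equal to `ẽ_v / e_v`). -/
def lambdaPlace (v : HeightOneSpectrum (𝓞 F)) : ℚ_[ℓ] :=
  (v.asIdeal.inertiaDeg ℤ : ℚ_[ℓ]) / localLogInertia v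

/-- The map `∏ v^{α_v} ↦ ∑ λ_v α_v v` from `ℓ`-ideals to divisors. -/
def toLogDiv : LIdeals F ℓ →ₗ[ℤ_[ℓ]] (HeightOneSpectrum (𝓞 F) →₀ ℚ_[ℓ]) :=
  Finsupp.lsum ℤ_[ℓ] fun v ↦
    LinearMap.toSpanSingleton ℤ_[ℓ] _ (Finsupp.single v.1 (lambdaPlace F ℓ v.1))

variable {F} in
/-- The ordinary normalized valuation `v(x)`. -/
def ord (v : HeightOneSpectrum (𝓞 F)) (x : F) : ℤ := -WithZero.log (v.valuation F x)

theorem finite_ord_ne_zero {x : F} (hx : x ≠ 0) :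
    {v : {v : HeightOneSpectrum (𝓞 F) // (ℓ : 𝓞 F) ∉ v.asIdeal} |
      (ord v.1 x : ℤ_[ℓ]) ≠ 0}.Finite := by
  have h := ((HeightOneSpectrum.Support.finite (𝓞 F) x).union
    (HeightOneSpectrum.Support.finite (𝓞 F) x⁻¹)).preimage
      (Subtype.val_injective (p := fun v : HeightOneSpectrum (𝓞 F) ↦ (ℓ : 𝓞 F) ∉ v.asIdeal)).injOn
  refine h.subset fun v hv ↦ ?_
  by_contra hcon
  apply hv
  rw [Set.mem_preimage, Set.mem_union, not_or] at hcon
  have h1 : v.1.valuation F x ≤ 1 := not_lt.1 hcon.1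
  have h2 : (v.1.valuation F x)⁻¹ ≤ 1 := by
    rw [← map_inv₀]; exact not_lt.1 hcon.2
  have h3 : v.1.valuation F x = 1 :=
    le_antisymm h1 ((inv_le_one₀ (zero_lt_iff.2 ((Valuation.ne_zero_iff _).2 hx))).1 h2)
  simp [ord, h3]

/-- `x ↦ ∏_{v ∤ ℓ} v^{v(x)}` on `Fˣ`. -/
def ordHom : Additive Fˣ →+ LIdeals F ℓ where
  toFun x := Finsupp.ofSupportFinite (fun v ↦ (ord v.1 (x.toMul : F) : ℤ_[ℓ]))
    (finite_ord_ne_zero F ℓ x.toMul.ne_zero)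
  map_zero' := by
    ext v
    simp [Finsupp.ofSupportFinite, ord]
  map_add' x y := by
    ext v
    have hx := (Valuation.ne_zero_iff (v.1.valuation F)).2 x.toMul.ne_zero
    have hy := (Valuation.ne_zero_iff (v.1.valuation F)).2 y.toMul.ne_zero
    have h : ord v.1 ((x + y).toMul : F) = ord v.1 (x.toMul : F) + ord v.1 (y.toMul : F) := by
      rw [toMul_add, Units.val_mul, ord, map_mul, WithZero.log_mul hx hy, neg_add]
      rfl
    have h' := congrArg (Int.cast : ℤ → ℤ_[ℓ]) h
    rw [Int.cast_add] at h'
    exact h'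

/-- `a ↦ ∏_{v ∤ ℓ} v^{v(a)}` on `ℛ_F`. -/
def principalIdeal : PrincipalIdeles F ℓ →ₗ[ℤ_[ℓ]] LIdeals F ℓ :=
  (ordHom F ℓ).toIntLinearMap.liftBaseChange ℤ_[ℓ]

/-- The `ℓ`-ideals of degree zero. -/
def LIdealsZero : Submodule ℤ_[ℓ] (LIdeals F ℓ) :=
  LinearMap.ker (deg F ℓ ∘ₗ toLogDiv F ℓ)

/-- The `ℓ`-ideals `∏_{v ∤ ℓ} v^{v(a)}` of those `a ∈ ℛ_F` with `ṽ_v(a) = 0` for all `v ∣ ℓ`. -/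
def PrincipalLIdeals : Submodule ℤ_[ℓ] (LIdeals F ℓ) where
  carrier := {I | ∃ a : PrincipalIdeles F ℓ,
    (∀ v : HeightOneSpectrum (𝓞 F), (ℓ : 𝓞 F) ∈ v.asIdeal → logDiv F ℓ a v = 0) ∧
      principalIdeal F ℓ a = I}
  zero_mem' := ⟨0, by simp⟩
  add_mem' := by
    rintro _ _ ⟨a, ha, rfl⟩ ⟨b, hb, rfl⟩
    exact ⟨a + b, fun v hv ↦ by simp [ha v hv, hb v hv], map_add _ _ _⟩
  smul_mem' := by
    rintro c _ ⟨a, ha, rfl⟩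
    exact ⟨c • a, fun v hv ↦ by simp [ha v hv], map_smul _ _ _⟩

/-- The `ℓ`-ideals whose degree lies in `ℓ^m deg(Dl)`. -/
def LIdealsPow (m : ℕ) : Submodule ℤ_[ℓ] (LIdeals F ℓ) :=
  ((ℓ : ℤ_[ℓ]) ^ m • (LogDivisors F ℓ).map (deg F ℓ)).comap (deg F ℓ ∘ₗ toLogDiv F ℓ)

/-- Principal `ℓ`-ideals times `ℓ^m`-th powers of `ℓ`-ideals. -/
def PrincipalLIdealsPow (m : ℕ) : Submodule ℤ_[ℓ] (LIdeals F ℓ) :=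
  PrincipalLIdeals F ℓ ⊔ (ℓ : ℤ_[ℓ]) ^ m • ⊤

end
end LogClass

end

open Filter Topology NumberField IsDedekindDomain
open scoped TensorProduct Pointwise

namespace LogClass

/-! ### The Iwasawa logarithm near 1 and on units -/

section IwasawaLog

/-! Both quotients are quotients of $\widetilde{Id}_F$ by the same submodule. The map $\mathfrak
a\mapsto[d_F(\mathfrak a)]$ to $\widetilde{\mathcal C\ell}_F$ is surjective because every divisor
can be moved away from $\ell$ by a principal one (`exists_logDiv_add_toLogDiv`). Its kernel is
$\widetilde{Pr}_F$: if $d_F(\mathfrak a)=\operatorname{div}_F(a)$, then $a$ automatically has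
trivial logarithmic valuations above $\ell$. The map
$\widetilde{Id}_F\to\widetilde{Id}_F^{(\ell^m)}/\widetilde{Pr}_F^{(\ell^m)}$ is surjective by
`lIdealsPow_eq`. If $\mathfrak a=\mathfrak b\,\mathfrak c^{\ell^m}$ with $\mathfrak b$ principal,
then $\mathfrak c$ has degree zero, since $\mathbb Q_\ell$ is torsion-free, and $\mathfrak
c^{\ell^m}$ is principal, since $\ell^m$ kills the class group. So this kernel is $\widetilde{Pr}_F$
too.

The global inputs are the product formula `sum_degPlace_mul_logVal` and the surjectivity of
$\mathcal R_F\to\prod_{\mathfrak p\mid\ell}\mathbb Z_\ell$ (`logValAbove_surjective`), which follows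
from weak approximation and Nakayama's lemma.

The local inputs are that $\lambda_{\mathfrak p}$ is an $\ell$-adic unit for $\mathfrak p\nmid\ell$,
and that $\operatorname{Log}_\ell N(F_{\mathfrak p}^\times)=\deg_F\mathfrak p\,\mathbb Z_\ell$ for
$\mathfrak p\mid\ell$. In both cases the $\ell$-part of $\tilde f$ is the index of
$\operatorname{Log}\chi(G_K)$ in $\operatorname{Log}\chi(G_{\mathbb Q_p})$, for $\chi$ the
$\ell$-adic cyclotomic character (`logInertia_aux`). For $p\ne\ell$ the image of $G_K$ is generated
by $f\operatorname{Log}p$, through Frobenius. For $p=\ell$ the equality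
$\operatorname{Log}N(K^\times)=\operatorname{Log}\chi(G_K)$ belongs to local class field theory. It
is proved here by hand, with a norm operator on polynomials that gives congruences for norms from
cyclotomic fields. The inclusion $\subseteq$ is
`norm_logInertia_eq_and_norm_iwasawaLog_algebraNorm_le`. For the other one,
`exists_norm_iwasawaLog_algebraNorm_eq` computes the norm of a uniformizer in the fixed field of a
Frobenius lift. -/

theorem zmod_two_mul_add_one : ∀ z : ZMod 2, z * (z + 1) = 0 := by decide

variable {p : ℕ} [Fact p.Prime]

/-- The integer `q` with `Log_p ℤ_pˣ = q ℤ_p`: `4` if `p = 2`, and `p` otherwise. -/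
def logConductor (p : ℕ) : ℕ := if p = 2 then 4 else p

theorem norm_logConductor_le : ‖(logConductor p : ℚ_[p])‖ ≤ ‖(p : ℚ_[p])‖ := by
  unfold logConductor
  split_ifs with h
  · subst h
    have : ((4 : ℕ) : ℚ_[2]) = (2 : ℕ) * (2 : ℕ) := by norm_num
    rw [this, norm_mul]
    exact mul_le_of_le_one_left (norm_nonneg _) Padic.norm_p_lt_one.le
  · exact le_rfl

theorem norm_logConductor_lt_one : ‖(logConductor p : ℚ_[p])‖ < 1 :=
  norm_logConductor_le.trans_lt Padic.norm_p_lt_one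

theorem logConductor_ne_zero : logConductor p ≠ 0 := by
  unfold logConductor
  split_ifs
  · norm_num
  · exact (Fact.out : p.Prime).ne_zero

/-- With $c=v_p(q)$ the claim is $v_p(n+2)+1\le c(n+1)$. For $p=2$ and $c=1$ it fails at $n=0$,
which is why the conductor of $2$ is $4$. -/
theorem norm_pow_div_succ_le {t : ℚ_[p]} (ht : ‖t‖ ≤ ‖(logConductor p : ℚ_[p])‖) (n : ℕ) :
    ‖t ^ (n + 1) / ((n + 1 : ℕ) + 1 : ℚ_[p])‖ ≤ ‖(p : ℚ_[p])‖ := by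
  have hp := (Fact.out : p.Prime)
  have hp0 : (0 : ℝ) < p := by exact_mod_cast hp.pos
  have h1 : (1 : ℝ) ≤ p := by exact_mod_cast hp.one_lt.le
  have h0 : ((n + 2 : ℕ) : ℚ_[p]) ≠ 0 := by exact_mod_cast Nat.succ_ne_zero (n + 1)
  have e : ((n + 1 : ℕ) + 1 : ℚ_[p]) = ((n + 2 : ℕ) : ℚ_[p]) := by push_cast; ring
  set v := padicValNat p (n + 2) with hv
  have hdvd : p ^ v ≤ n + 2 := Nat.le_of_dvd (by omega) pow_padicValNat_dvd
  have hnorm : ‖((n + 2 : ℕ) : ℚ_[p])‖ = (p : ℝ) ^ (-(v : ℤ)) := by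
    rw [Padic.norm_eq_zpow_neg_valuation h0, Padic.valuation_natCast]
  obtain ⟨c, hc1, hc2⟩ : ∃ c : ℕ, ‖(logConductor p : ℚ_[p])‖ = (p : ℝ) ^ (-(c : ℤ)) ∧
      v + 1 ≤ c * (n + 1) := by
    unfold logConductor
    split_ifs with h
    · refine ⟨2, ?_, ?_⟩
      · subst h
        have : ((4 : ℕ) : ℚ_[2]) = (2 : ℕ) ^ 2 := by norm_num
        rw [this, norm_pow, Padic.norm_p]; norm_num
      · have : v < p ^ v := Nat.lt_pow_self hp.one_lt
        omega
    · refine ⟨1, by rw [Padic.norm_p]; simp, ?_⟩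
      have h3 : 3 ≤ p := by have := hp.two_le; omega
      rcases Nat.eq_zero_or_pos v with h0 | h0
      · omega
      · have h4 : 3 ^ v ≤ p ^ v := Nat.pow_le_pow_left h3 v
        have h5 : ∀ m : ℕ, 0 < m → m + 2 ≤ 3 ^ m := by
          intro m hm
          induction m, hm using Nat.le_induction with
          | base => norm_num
          | succ k hk ih => rw [pow_succ]; omega
        have := h5 v h0
        omega
  rw [e, norm_div, norm_pow, hnorm, Padic.norm_p]
  rw [hc1] at ht
  calc ‖t‖ ^ (n + 1) / (p : ℝ) ^ (-(v : ℤ)) ≤ ((p : ℝ) ^ (-(c : ℤ))) ^ (n + 1) / (p : ℝ) ^ (-(v : ℤ)) := by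
        gcongr
    _ = (p : ℝ) ^ (-((c * (n + 1) : ℕ) : ℤ) + v) := by
        rw [zpow_add₀ hp0.ne', ← zpow_natCast, ← zpow_mul, zpow_neg _ (v : ℤ), div_inv_eq_mul]
        push_cast; ring_nf
    _ ≤ (p : ℝ) ^ (-1 : ℤ) := zpow_le_zpow_right₀ h1 (by omega)
    _ = (p : ℝ)⁻¹ := by simp

theorem summable_logSeries {u : ℚ_[p]} (hu : ‖u - 1‖ < 1) :
    Summable fun n : ℕ ↦ (-1) ^ n * (u - 1) ^ (n + 1) / ((n : ℚ_[p]) + 1) := by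
  have := summable_pow_mul_geometric_of_norm_lt_one (R := ℝ) 1 (r := ‖u - 1‖) (by simpa using hu)
  have := (summable_nat_add_iff 1).2 this
  refine Summable.of_norm_bounded this fun n ↦ ?_
  rw [div_eq_mul_inv, norm_mul, norm_mul, norm_pow, norm_pow, norm_neg, norm_one, one_pow, one_mul,
    mul_comm]
  gcongr
  simpa using norm_inv_natCast_succ_le n

/-- Each later term of the series is $u-1$ times a factor of norm at most $\|p\|$, so the first term
dominates. -/
theorem norm_logSeries {u : ℚ_[p]} (hu : ‖u - 1‖ ≤ ‖(logConductor p : ℚ_[p])‖) :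
    ‖logSeries p u‖ = ‖u - 1‖ := by
  have hu1 : ‖u - 1‖ < 1 := hu.trans_lt norm_logConductor_lt_one
  rcases eq_or_ne (u - 1) 0 with h0 | h0
  · unfold logSeries; simp [h0]
  unfold logSeries
  rw [(summable_logSeries hu1).tsum_eq_zero_add]
  have h1 : ‖∑' n : ℕ, (-1) ^ (n + 1) * (u - 1) ^ (n + 1 + 1) / (((n + 1 : ℕ) : ℚ_[p]) + 1)‖ <
      ‖u - 1‖ := by
    refine lt_of_le_of_lt (b := ‖(p : ℚ_[p])‖ * ‖u - 1‖) ?_ ?_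
    · refine IsUltrametricDist.norm_tsum_le_of_forall_le_of_nonneg (by positivity) fun n ↦ ?_
      have := norm_pow_div_succ_le hu n
      have e : (-1) ^ (n + 1) * (u - 1) ^ (n + 1 + 1) / (((n + 1 : ℕ) : ℚ_[p]) + 1) =
        (-1) ^ (n + 1) * ((u - 1) ^ (n + 1) / (((n + 1 : ℕ) : ℚ_[p]) + 1) * (u - 1)) := by ring
      rw [e, norm_mul, norm_pow, norm_neg, norm_one, one_pow, one_mul, norm_mul]
      gcongr
    · exact mul_lt_of_lt_one_left (norm_pos_iff.2 h0) Padic.norm_p_lt_one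
  rw [add_comm, IsUltrametricDist.norm_add_eq_max_of_norm_ne_norm]
  · simp only [pow_zero, zero_add, pow_one, one_mul, Nat.cast_zero, div_one]
    exact max_eq_right h1.le
  · simpa using h1.ne

theorem iwasawaLog_pow {x : ℚ_[p]} (hx : x ≠ 0) (n : ℕ) :
    iwasawaLog p (x ^ n) = n * iwasawaLog p x := by
  induction n with
  | zero => simp [iwasawaLog_one]
  | succ n ih => rw [pow_succ, iwasawaLog_mul (pow_ne_zero _ hx) hx, ih]; push_cast; ring

theorem iwasawaLog_inv {x : ℚ_[p]} (hx : x ≠ 0) : iwasawaLog p x⁻¹ = -iwasawaLog p x := by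
  have := iwasawaLog_mul (inv_ne_zero hx) hx
  rw [inv_mul_cancel₀ hx, iwasawaLog_one] at this
  linear_combination -this

theorem iwasawaLog_div {x y : ℚ_[p]} (hx : x ≠ 0) (hy : y ≠ 0) :
    iwasawaLog p (x / y) = iwasawaLog p x - iwasawaLog p y := by
  rw [div_eq_mul_inv, iwasawaLog_mul hx (inv_ne_zero hy), iwasawaLog_inv hy, sub_eq_add_neg]

theorem iwasawaLog_zpow {x : ℚ_[p]} (hx : x ≠ 0) (n : ℤ) :
    iwasawaLog p (x ^ n) = n * iwasawaLog p x := by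
  cases n with
  | ofNat n => simpa using iwasawaLog_pow hx n
  | negSucc n =>
    rw [zpow_negSucc, iwasawaLog_inv (pow_ne_zero _ hx), iwasawaLog_pow hx]
    push_cast; ring

theorem iwasawaLog_eq_zero_of_pow_eq_one {x : ℚ_[p]} {n : ℕ} (hn : n ≠ 0) (h : x ^ n = 1) :
    iwasawaLog p x = 0 := by
  have hx : x ≠ 0 := by rintro rfl; simp [hn] at h
  have := iwasawaLog_pow hx n
  rw [h, iwasawaLog_one] at this
  simpa [hn] using this.symm

theorem iwasawaLog_neg {x : ℚ_[p]} (hx : x ≠ 0) : iwasawaLog p (-x) = iwasawaLog p x := by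
  rw [neg_eq_neg_one_mul, iwasawaLog_mul (by simp) hx,
    iwasawaLog_eq_zero_of_pow_eq_one (n := 2) two_ne_zero (by norm_num), zero_add]

theorem iwasawaLog_self : iwasawaLog p (p : ℚ_[p]) = 0 := by
  have hp : (p : ℚ_[p]) ≠ 0 := by exact_mod_cast (Fact.out : p.Prime).ne_zero
  unfold iwasawaLog
  rw [Padic.valuation_p, zpow_neg_one, mul_inv_cancel₀ hp, one_pow]
  simp [logSeries]

theorem natCast_pred_ne_zero : ((p - 1 : ℕ) : ℚ_[p]) ≠ 0 := by
  have := (Fact.out : p.Prime).one_lt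
  exact_mod_cast (by omega : p - 1 ≠ 0)

/-- The series is additive on principal units, so the $(p-1)$-st power in the definition cancels
against the division by $p-1$. -/
theorem iwasawaLog_eq_logSeries {u : ℚ_[p]} (hu : ‖u - 1‖ < 1) :
    iwasawaLog p u = logSeries p u := by
  have h1 : ‖u‖ = 1 := by
    have := IsUltrametricDist.norm_add_eq_max_of_norm_ne_norm (x := u - 1) (y := 1)
      (by simpa using hu.ne)
    simpa [hu.le] using this
  have h0 : u ≠ 0 := by rintro rfl; simp at h1
  have hv : u.valuation = 0 := by
    have hp1 : (1 : ℝ) < p := by exact_mod_cast (Fact.out : p.Prime).one_lt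
    rw [Padic.norm_eq_zpow_neg_valuation h0, zpow_eq_one_iff_right₀ (by linarith) hp1.ne'] at h1
    simpa using h1
  have key : ∀ n : ℕ, ‖u ^ n - 1‖ < 1 ∧ logSeries p (u ^ n) = n * logSeries p u := by
    intro n
    induction n with
    | zero => simp [logSeries]
    | succ n ih =>
      refine ⟨?_, ?_⟩
      · have : u ^ (n + 1) - 1 = (u ^ n - 1) * u + (u - 1) := by ring
        rw [this]
        refine (Padic.nonarchimedean _ _).trans_lt (max_lt ?_ hu)
        rw [norm_mul, h1, mul_one]; exact ih.1
      · rw [pow_succ, logSeries_mul ih.1 hu, ih.2]; push_cast; ring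
  unfold iwasawaLog
  rw [hv, neg_zero, zpow_zero, mul_one, (key _).2, mul_div_cancel_left₀ _ natCast_pred_ne_zero]

theorem norm_iwasawaLog {u : ℚ_[p]} (hu : ‖u - 1‖ ≤ ‖(logConductor p : ℚ_[p])‖) :
    ‖iwasawaLog p u‖ = ‖u - 1‖ := by
  rw [iwasawaLog_eq_logSeries (hu.trans_lt norm_logConductor_lt_one), norm_logSeries hu]

theorem norm_natCast_of_prime_ne {n : ℕ} (hn : n.Prime) (h : n ≠ p) : ‖(n : ℚ_[p])‖ = 1 := by
  rw [Padic.norm_natCast_eq_one_iff]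
  exact (Nat.coprime_primes (Fact.out : p.Prime) hn).2 h.symm

/-- A unit of `ℤ_p` raised to a suitable power gets close to `1`. -/
theorem exists_norm_pow_sub_one_le {u : ℚ_[p]} (hu : ‖u‖ = 1) :
    ∃ n : ℕ, n ≠ 0 ∧ ‖u ^ n - 1‖ ≤ ‖(n : ℚ_[p])‖ * ‖(logConductor p : ℚ_[p])‖ := by
  have h1 := norm_unit_pow_sub_one_lt hu
  have hp := (Fact.out : p.Prime)
  by_cases h : p = 2
  · subst h
    refine ⟨2, two_ne_zero, ?_⟩
    have h2 : ‖u - 1‖ ≤ ‖((2 : ℕ) : ℚ_[2])‖ := by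
      simp only [Nat.add_one_sub_one, pow_one] at h1
      rw [Padic.norm_p]
      have := (Padic.norm_le_pow_iff_norm_lt_pow_add_one (u - 1) (-1)).2 (by simpa using h1)
      simpa using this
    have key : ∃ w : ℤ_[2], u = 1 + 2 * w := by
      have hn : ‖(u - 1) / 2‖ ≤ 1 := by
        rw [norm_div]
        exact div_le_one_of_le₀ (by simpa using h2) (norm_nonneg _)
      exact ⟨⟨(u - 1) / 2, hn⟩, by change u = 1 + 2 * ((u - 1) / 2); ring⟩
    obtain ⟨w, rfl⟩ := key
    have h3 : ‖w * (w + 1)‖ ≤ ‖((2 : ℕ) : ℤ_[2])‖ := by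
      have hz : w * (w + 1) ∈ RingHom.ker (PadicInt.toZMod (p := 2)) := by
        rw [RingHom.mem_ker, map_mul, map_add, map_one]
        exact zmod_two_mul_add_one _
      rw [PadicInt.ker_toZMod, PadicInt.maximalIdeal_eq_span_p, Ideal.mem_span_singleton] at hz
      obtain ⟨y, hy⟩ := hz
      rw [hy, norm_mul]
      exact mul_le_of_le_one_right (norm_nonneg _) y.2
    have h3' : ‖(w : ℚ_[2]) * (w + 1)‖ ≤ ‖((2 : ℕ) : ℚ_[2])‖ := by exact_mod_cast h3
    -- The product $w(w+1)$ is even. This supplies the factor $\|n\|=\|2\|$ required beyond the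
    -- conductor $4$.
    have e : (1 + 2 * (w : ℚ_[2])) ^ 2 - 1 = (4 : ℕ) * (w * (w + 1)) := by push_cast; ring
    rw [e, norm_mul]
    unfold logConductor
    simp only [if_true]
    rw [mul_comm ‖((2 : ℕ) : ℚ_[2])‖]
    gcongr
  · refine ⟨p - 1, by have := hp.one_lt; omega, ?_⟩
    have h2 : ‖((p - 1 : ℕ) : ℚ_[p])‖ = 1 := by
      rw [Padic.norm_natCast_eq_one_iff]
      exact ((Nat.coprime_self_sub_right hp.one_lt.le).2 (Nat.coprime_one_right p))
    rw [h2, one_mul, logConductor, if_neg h, Padic.norm_p]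
    have := (Padic.norm_le_pow_iff_norm_lt_pow_add_one (u ^ (p - 1) - 1) (-1)).2 (by simpa using h1)
    simpa using this

/-- Compare $\operatorname{Log}(u^n)=n\operatorname{Log}u$ with the isometry near 1. The factor
$\|n\|$ gained in `exists_norm_pow_sub_one_le` cancels. -/
theorem norm_iwasawaLog_le {u : ℚ_[p]} (hu : ‖u‖ = 1) :
    ‖iwasawaLog p u‖ ≤ ‖(logConductor p : ℚ_[p])‖ := by
  obtain ⟨n, hn, h⟩ := exists_norm_pow_sub_one_le hu
  have hu0 : u ≠ 0 := by rintro rfl; simp at hu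
  have hn0 : (n : ℚ_[p]) ≠ 0 := by exact_mod_cast hn
  have h1 : ‖u ^ n - 1‖ ≤ ‖(logConductor p : ℚ_[p])‖ := h.trans
    (mul_le_of_le_one_left (norm_nonneg _) (by simpa using Padic.norm_int_le_one (p := p) (n : ℤ)))
  have h2 := norm_iwasawaLog h1
  rw [iwasawaLog_pow hu0, norm_mul] at h2
  rw [← h2] at h
  exact le_of_mul_le_mul_left h (norm_pos_iff.2 hn0)

theorem exists_pow_eq_one_of_iwasawaLog_eq_zero {u : ℚ_[p]} (hu : ‖u‖ = 1)
    (h : iwasawaLog p u = 0) : ∃ n : ℕ, n ≠ 0 ∧ u ^ n = 1 := by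
  obtain ⟨n, hn, h'⟩ := exists_norm_pow_sub_one_le hu
  have hu0 : u ≠ 0 := by rintro rfl; simp at hu
  have h1 : ‖u ^ n - 1‖ ≤ ‖(logConductor p : ℚ_[p])‖ := h'.trans
    (mul_le_of_le_one_left (norm_nonneg _) (by simpa using Padic.norm_int_le_one (p := p) (n : ℤ)))
  have h2 := norm_iwasawaLog h1
  rw [iwasawaLog_pow hu0, h, mul_zero, norm_zero, eq_comm, norm_eq_zero, sub_eq_zero] at h2
  exact ⟨n, hn, h2⟩

/-- A unit with zero logarithm is a root of unity, and a prime number is not one. -/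
theorem iwasawaLog_natCast_ne_zero {n : ℕ} (hn : n.Prime) (h : n ≠ p) :
    iwasawaLog p (n : ℚ_[p]) ≠ 0 := by
  intro h0
  obtain ⟨m, hm, h1⟩ := exists_pow_eq_one_of_iwasawaLog_eq_zero (norm_natCast_of_prime_ne hn h) h0
  have h2 : n ^ m = 1 := by exact_mod_cast h1
  rw [Nat.pow_eq_one] at h2
  exact h2.elim hn.one_lt.ne' hm

/-- The Iwasawa logarithm on units is continuous. -/
theorem norm_iwasawaLog_sub_le {u w : ℚ_[p]} (hw : ‖w‖ = 1)
    (h : ‖u - w‖ ≤ ‖(logConductor p : ℚ_[p])‖) :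
    ‖iwasawaLog p u - iwasawaLog p w‖ = ‖u - w‖ := by
  have hw0 : w ≠ 0 := by rintro rfl; simp at hw
  have hu0 : u ≠ 0 := by
    rintro rfl
    rw [zero_sub, norm_neg, hw] at h
    exact absurd h (not_le.2 norm_logConductor_lt_one)
  have e : ‖u / w - 1‖ = ‖u - w‖ := by
    rw [div_sub_one hw0, norm_div, hw, div_one]
  rw [← iwasawaLog_div hu0 hw0, norm_iwasawaLog (by rwa [e]), e]

end IwasawaLog

/-! ### The logarithm of the cyclotomic character and the cyclotomic $\mathbb Z_q$-extensions -/

section LogChar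
variable {k Ω : Type*} [Field k] [Field Ω] [Algebra k Ω]

variable (k Ω) in
/-- The logarithm of the `ℓ`-adic cyclotomic character. -/
noncomputable def logChar (ℓ : ℕ) [Fact ℓ.Prime] (σ : Gal(Ω/k)) : ℚ_[ℓ] :=
  iwasawaLog ℓ ((cyclotomicCharacter Ω ℓ (σ : Ω ≃+* Ω) : ℤ_[ℓ]) : ℚ_[ℓ])

variable (ℓ : ℕ) [hℓ : Fact ℓ.Prime]

theorem norm_units_val (u : ℤ_[ℓ]ˣ) : ‖((u : ℤ_[ℓ]) : ℚ_[ℓ])‖ = 1 :=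
  PadicInt.isUnit_iff.1 u.isUnit

theorem units_val_ne_zero (u : ℤ_[ℓ]ˣ) : ((u : ℤ_[ℓ]) : ℚ_[ℓ]) ≠ 0 := by
  intro h
  simpa [h] using norm_units_val ℓ u

theorem cyclotomicCharacter_mul (σ τ : Gal(Ω/k)) :
    cyclotomicCharacter Ω ℓ ((σ * τ : Gal(Ω/k)) : Ω ≃+* Ω) =
      cyclotomicCharacter Ω ℓ (σ : Ω ≃+* Ω) * cyclotomicCharacter Ω ℓ (τ : Ω ≃+* Ω) :=
  map_mul (cyclotomicCharacter Ω ℓ) (σ : Ω ≃+* Ω) (τ : Ω ≃+* Ω)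

theorem cyclotomicCharacter_pow (σ : Gal(Ω/k)) (n : ℕ) :
    cyclotomicCharacter Ω ℓ ((σ ^ n : Gal(Ω/k)) : Ω ≃+* Ω) =
      cyclotomicCharacter Ω ℓ (σ : Ω ≃+* Ω) ^ n := by
  induction n with
  | zero =>
    rw [pow_zero, pow_zero]
    exact map_one (cyclotomicCharacter Ω ℓ)
  | succ n ih => rw [pow_succ, cyclotomicCharacter_mul, ih, pow_succ]

theorem logChar_mul (σ τ : Gal(Ω/k)) :
    logChar k Ω ℓ (σ * τ) = logChar k Ω ℓ σ + logChar k Ω ℓ τ := by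
  unfold logChar
  rw [cyclotomicCharacter_mul, Units.val_mul, PadicInt.coe_mul,
    iwasawaLog_mul (units_val_ne_zero _ _) (units_val_ne_zero _ _)]

theorem logChar_one : logChar k Ω ℓ (1 : Gal(Ω/k)) = 0 := by
  simpa using logChar_mul ℓ (1 : Gal(Ω/k)) 1

theorem logChar_inv (σ : Gal(Ω/k)) : logChar k Ω ℓ σ⁻¹ = -logChar k Ω ℓ σ := by
  have := logChar_mul ℓ σ⁻¹ σ
  rw [inv_mul_cancel, logChar_one] at this
  linear_combination -this

theorem logChar_pow (σ : Gal(Ω/k)) (n : ℕ) : logChar k Ω ℓ (σ ^ n) = n * logChar k Ω ℓ σ := by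
  induction n with
  | zero => simp [logChar_one]
  | succ n ih => rw [pow_succ, logChar_mul, ih]; push_cast; ring

theorem continuous_logChar : Continuous (logChar k Ω ℓ) := by
  have h1 : Continuous fun u : ℤ_[ℓ]ˣ ↦ iwasawaLog ℓ ((u : ℤ_[ℓ]) : ℚ_[ℓ]) := by
    rw [continuous_iff_continuousAt]
    intro w
    have hc : Continuous fun u : ℤ_[ℓ]ˣ ↦ ((u : ℤ_[ℓ]) : ℚ_[ℓ]) :=
      (continuous_subtype_val (p := fun x : ℚ_[ℓ] ↦ ‖x‖ ≤ 1)).comp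
        (Units.continuous_val (M := ℤ_[ℓ]))
    have h0 : Tendsto (fun u : ℤ_[ℓ]ˣ ↦ ‖((u : ℤ_[ℓ]) : ℚ_[ℓ]) - ((w : ℤ_[ℓ]) : ℚ_[ℓ])‖) (𝓝 w)
        (𝓝 0) := by
      have := (hc.sub (continuous_const (y := ((w : ℤ_[ℓ]) : ℚ_[ℓ])))).norm.tendsto w
      simpa using this
    rw [ContinuousAt, tendsto_iff_norm_sub_tendsto_zero]
    refine h0.congr' ?_
    have hq : 0 < ‖(logConductor ℓ : ℚ_[ℓ])‖ :=
      norm_pos_iff.2 (by exact_mod_cast logConductor_ne_zero)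
    filter_upwards [h0.eventually_le_const hq] with u hu
    exact (norm_iwasawaLog_sub_le (norm_units_val ℓ w) hu).symm
  exact h1.comp (cyclotomicCharacter.continuous ℓ k Ω)

variable [IsAlgClosed Ω] [CharZero Ω]

instance hasEnoughRootsOfUnity_prime_pow (i : ℕ) : HasEnoughRootsOfUnity Ω (ℓ ^ i) :=
  haveI : NeZero ((ℓ : ℕ) : Ω) := ⟨by exact_mod_cast hℓ.out.ne_zero⟩
  inferInstance

theorem apply_eq_pow_of_pow_eq_one (σ : Gal(Ω/k)) {n : ℕ} {ζ : Ω} (hζ : ζ ^ ℓ ^ n = 1) :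
    σ ζ = ζ ^ ((cyclotomicCharacter Ω ℓ (σ : Ω ≃+* Ω) : ℤ_[ℓ]).toZModPow n).val :=
  cyclotomicCharacter.spec ℓ (σ : Ω ≃+* Ω) ζ hζ

theorem toZModPow_cyclotomicCharacter {σ : Gal(Ω/k)} {n a : ℕ} {ζ : Ω}
    (hζ : IsPrimitiveRoot ζ (ℓ ^ n)) (h : σ ζ = ζ ^ a) :
    (cyclotomicCharacter Ω ℓ (σ : Ω ≃+* Ω) : ℤ_[ℓ]).toZModPow n = a := by
  have := apply_eq_pow_of_pow_eq_one ℓ σ hζ.pow_eq_one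
  have hn : ℓ ^ n ≠ 0 := pow_ne_zero _ hℓ.out.ne_zero
  rw [h, (isOfFinOrder_iff_pow_eq_one.2 ⟨_, Nat.pos_of_ne_zero hn, hζ.pow_eq_one⟩ :
    IsOfFinOrder ζ).pow_eq_pow_iff_modEq, ← hζ.eq_orderOf, ← ZMod.natCast_eq_natCast_iff] at this
  rw [this]
  have : NeZero (ℓ ^ n) := ⟨hn⟩
  simp

theorem norm_le_pow_of_toZModPow_eq_zero {x : ℤ_[ℓ]} {n : ℕ} (h : x.toZModPow n = 0) :
    ‖x‖ ≤ ‖(ℓ : ℚ_[ℓ]) ^ n‖ := by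
  rw [← RingHom.mem_ker, PadicInt.ker_toZModPow, Ideal.mem_span_singleton] at h
  obtain ⟨y, rfl⟩ := h
  rw [norm_mul]
  refine (mul_le_of_le_one_right (norm_nonneg _) y.2).trans ?_
  simp

theorem norm_cyclotomicCharacter_sub_le {σ : Gal(Ω/k)} {n a : ℕ} {ζ : Ω}
    (hζ : IsPrimitiveRoot ζ (ℓ ^ n)) (h : σ ζ = ζ ^ a) :
    ‖((cyclotomicCharacter Ω ℓ (σ : Ω ≃+* Ω) : ℤ_[ℓ]) : ℚ_[ℓ]) - a‖ ≤ ‖(ℓ : ℚ_[ℓ]) ^ n‖ := by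
  have := norm_le_pow_of_toZModPow_eq_zero ℓ (n := n)
    (x := (cyclotomicCharacter Ω ℓ (σ : Ω ≃+* Ω) : ℤ_[ℓ]) - a)
    (by rw [map_sub, map_natCast, toZModPow_cyclotomicCharacter ℓ hζ h, sub_self])
  rw [PadicInt.norm_def] at this
  simpa only [PadicInt.coe_sub, PadicInt.coe_natCast] using this

theorem cyclotomicCharacter_eq_one {σ : Gal(Ω/k)}
    (h : ∀ n : ℕ, ∀ ζ : Ω, ζ ^ ℓ ^ n = 1 → σ ζ = ζ) :
    cyclotomicCharacter Ω ℓ (σ : Ω ≃+* Ω) = 1 := by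
  apply Units.ext
  refine PadicInt.ext_of_toZModPow.1 fun n ↦ ?_
  obtain ⟨ζ, hζ⟩ := HasEnoughRootsOfUnity.exists_primitiveRoot Ω (ℓ ^ n)
  rw [toZModPow_cyclotomicCharacter ℓ (a := 1) hζ (by rw [h n ζ hζ.pow_eq_one, pow_one])]
  simp

theorem apply_eq_self_of_cyclotomicCharacter_eq_one {σ : Gal(Ω/k)}
    (h : cyclotomicCharacter Ω ℓ (σ : Ω ≃+* Ω) = 1) {n : ℕ} {ζ : Ω} (hζ : ζ ^ ℓ ^ n = 1) :
    σ ζ = ζ := by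
  -- Level $n+1$ is used because at $n=0$ the ring $\mathbb Z/\ell^n$ is trivial and the
  -- representative of $1$ would be $0$.
  have h1 : ζ ^ ℓ ^ (n + 1) = 1 := by rw [pow_succ, pow_mul, hζ, one_pow]
  have : Fact (1 < ℓ ^ (n + 1)) := ⟨Nat.one_lt_pow (by omega) hℓ.out.one_lt⟩
  have := apply_eq_pow_of_pow_eq_one ℓ σ h1
  rwa [h, Units.val_one, map_one, ZMod.val_one, pow_one] at this

theorem apply_eq_self_of_mem_qPowerCyclotomic {σ : Gal(Ω/k)}
    (h : cyclotomicCharacter Ω ℓ (σ : Ω ≃+* Ω) = 1) {x : Ω} (hx : x ∈ qPowerCyclotomic k Ω ℓ) :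
    σ x = x := by
  have : qPowerCyclotomic k Ω ℓ ≤ IntermediateField.fixedField (Subgroup.zpowers σ) := by
    refine IntermediateField.adjoin_le_iff.2 fun ζ ⟨n, hζ⟩ ↦ ?_
    rw [SetLike.mem_coe, IntermediateField.mem_fixedField_iff]
    have h1 : σ ∈ MulAction.stabilizer Gal(Ω/k) ζ :=
      apply_eq_self_of_cyclotomicCharacter_eq_one ℓ h hζ
    exact fun τ hτ ↦ Subgroup.zpowers_le.2 h1 hτ
  exact (IntermediateField.mem_fixedField_iff _ _).1 (this hx) σ (Subgroup.mem_zpowers σ)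

section Normal
variable [Normal k Ω]

instance normal_qPowerCyclotomic : Normal k (qPowerCyclotomic k Ω ℓ) := by
  rw [IntermediateField.normal_iff_forall_map_le']
  intro σ
  unfold qPowerCyclotomic
  rw [IntermediateField.adjoin_map]
  refine IntermediateField.adjoin.mono _ _ _ ?_
  rintro _ ⟨ζ, ⟨n, hζ⟩, rfl⟩
  exact ⟨n, by rw [← map_pow, hζ, map_one]⟩

/-- The cyclotomic character is faithful on $k(\mu_{\ell^\infty})$, so torsion automorphisms of that
field are the restrictions of the $\sigma$ with torsion character value. -/
theorem mem_cyclotomicZq_iff {x : Ω} :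
    x ∈ cyclotomicZq k Ω ℓ ↔ x ∈ qPowerCyclotomic k Ω ℓ ∧ ∀ σ : Gal(Ω/k),
      (∃ n ≠ 0, cyclotomicCharacter Ω ℓ (σ : Ω ≃+* Ω) ^ n = 1) → σ x = x := by
  constructor
  · intro hx
    have hx' := IntermediateField.lift_le _ hx
    refine ⟨hx', fun σ ⟨n, hn, hσ⟩ ↦ ?_⟩
    have h1 := (IntermediateField.mem_lift (⟨x, hx'⟩ : qPowerCyclotomic k Ω ℓ)).1 hx
    have h2 : IsOfFinOrder (AlgEquiv.restrictNormalHom (qPowerCyclotomic k Ω ℓ) σ) := by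
      refine isOfFinOrder_iff_pow_eq_one.2 ⟨n, Nat.pos_of_ne_zero hn, ?_⟩
      rw [← map_pow]
      ext y
      rw [AlgEquiv.restrictNormalHom_apply]
      exact apply_eq_self_of_mem_qPowerCyclotomic ℓ (by rw [cyclotomicCharacter_pow, hσ]) y.2
    have h3 := (IntermediateField.mem_fixedField_iff _ _).1 h1 _ (Subgroup.subset_closure h2)
    rw [← AlgEquiv.restrictNormalHom_apply (qPowerCyclotomic k Ω ℓ) σ ⟨x, hx'⟩, h3]
  · rintro ⟨hx, h⟩
    refine (IntermediateField.mem_lift (⟨x, hx⟩ : qPowerCyclotomic k Ω ℓ)).2 ?_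
    rw [IntermediateField.mem_fixedField_iff]
    have key : Subgroup.closure {σ : Gal(qPowerCyclotomic k Ω ℓ/k) | IsOfFinOrder σ} ≤
        MulAction.stabilizer _ (⟨x, hx⟩ : qPowerCyclotomic k Ω ℓ) := by
      rw [Subgroup.closure_le]
      intro τ hτ
      obtain ⟨n, hn, hτn⟩ := isOfFinOrder_iff_pow_eq_one.1 hτ
      obtain ⟨σ, rfl⟩ := AlgEquiv.restrictNormalHom_surjective Ω τ
      change AlgEquiv.restrictNormalHom (qPowerCyclotomic k Ω ℓ) σ _ = _
      apply Subtype.ext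
      rw [AlgEquiv.restrictNormalHom_apply]
      refine h σ ⟨n, hn.ne', ?_⟩
      rw [← cyclotomicCharacter_pow]
      refine cyclotomicCharacter_eq_one ℓ fun i ζ hζ ↦ ?_
      have hm : ζ ∈ qPowerCyclotomic k Ω ℓ := IntermediateField.subset_adjoin _ _ ⟨i, hζ⟩
      have := AlgEquiv.restrictNormalHom_apply (qPowerCyclotomic k Ω ℓ) (σ ^ n) ⟨ζ, hm⟩
      rw [map_pow, hτn] at this
      exact this.symm
    exact fun τ hτ ↦ key hτ

theorem apply_eq_self_of_logChar_eq_zero {σ : Gal(Ω/k)} (h : logChar k Ω ℓ σ = 0) {x : Ω}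
    (hx : x ∈ cyclotomicZq k Ω ℓ) : σ x = x := by
  refine ((mem_cyclotomicZq_iff ℓ).1 hx).2 σ ?_
  obtain ⟨n, hn, h1⟩ := exists_pow_eq_one_of_iwasawaLog_eq_zero (norm_units_val ℓ _) h
  exact ⟨n, hn, Units.ext (Subtype.ext (by simpa using h1))⟩

end Normal

section Galois
variable [IsGalois k Ω]

theorem tendsto_pow_prime_pow {p : ℕ} [Fact p.Prime] {u : ℚ_[p]} (hu : ‖u - 1‖ < 1) :
    Tendsto (fun i : ℕ ↦ u ^ p ^ i) atTop (𝓝 1) := by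
  have h := ((logSeries_tendsto hu).mul (tendsto_pow_p (p := p))).add_const 1
  simp only [mul_zero, zero_add] at h
  refine h.congr fun i ↦ ?_
  have hp : (p : ℚ_[p]) ^ i ≠ 0 := pow_ne_zero _ (by exact_mod_cast (Fact.out : p.Prime).ne_zero)
  rw [div_mul_cancel₀ _ hp, sub_add_cancel]

/-- Every automorphism acts on the cyclotomic `ℤ_q`-extension with `q`-power order at each element. -/
theorem exists_prime_pow_apply_eq_self (τ : Gal(Ω/k)) {x : Ω} (hx : x ∈ cyclotomicZq k Ω ℓ) :
    ∃ i : ℕ, (τ ^ ℓ ^ i) x = x := by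
  -- A cluster point $\omega$ of $\tau^{\ell^i}$ satisfies
  -- $\chi(\omega)^{\ell-1}=\lim\chi(\tau)^{(\ell-1)\ell^i}=1$, so it fixes $x$. The stabilizer of
  -- $x$ being open, some $\tau^{\ell^i}$ agrees with $\omega$ at $x$.
  obtain ⟨ω, hω⟩ := exists_clusterPt_of_compactSpace (map (fun i : ℕ ↦ τ ^ ℓ ^ i) atTop)
  have hω : MapClusterPt ω atTop (fun i : ℕ ↦ τ ^ ℓ ^ i) := hω
  let c : Gal(Ω/k) → ℚ_[ℓ] := fun σ ↦ ((cyclotomicCharacter Ω ℓ (σ : Ω ≃+* Ω) : ℤ_[ℓ]) : ℚ_[ℓ])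
  have hc : Continuous c := (continuous_subtype_val (p := fun x : ℚ_[ℓ] ↦ ‖x‖ ≤ 1)).comp
    ((Units.continuous_val (M := ℤ_[ℓ])).comp (cyclotomicCharacter.continuous ℓ k Ω))
  have h1 : MapClusterPt (c ω ^ (ℓ - 1)) atTop (fun i : ℕ ↦ c (τ ^ ℓ ^ i) ^ (ℓ - 1)) :=
    hω.continuousAt_comp (f := fun σ ↦ c σ ^ (ℓ - 1)) (hc.pow _).continuousAt
  have h2 : Tendsto (fun i : ℕ ↦ c (τ ^ ℓ ^ i) ^ (ℓ - 1)) atTop (𝓝 1) := by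
    refine (tendsto_pow_prime_pow (norm_unit_pow_sub_one_lt (norm_units_val ℓ
      (cyclotomicCharacter Ω ℓ (τ : Ω ≃+* Ω))))).congr fun i ↦ ?_
    simp only [c]
    rw [cyclotomicCharacter_pow, Units.val_pow_eq_pow_val, PadicInt.coe_pow, ← pow_mul, ← pow_mul,
      mul_comm]
  have h3 : c ω ^ (ℓ - 1) = 1 := by
    have : NeBot (𝓝 (c ω ^ (ℓ - 1)) ⊓ 𝓝 1) := h1.clusterPt.neBot.mono (inf_le_inf_left _ h2)
    exact eq_of_nhds_neBot this
  have h4 : ω x = x := by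
    refine ((mem_cyclotomicZq_iff ℓ).1 hx).2 ω ⟨ℓ - 1, by have := hℓ.out.one_lt; omega, ?_⟩
    exact Units.ext (Subtype.ext (by simpa [c] using h3))
  have h5 : {σ : Gal(Ω/k) | σ x = ω x} ∈ 𝓝 ω := by
    have ho := (stabilizer_isOpen_of_isIntegral (K := k) x)
    have : {σ : Gal(Ω/k) | σ x = ω x} =
        (fun σ ↦ ω⁻¹ * σ) ⁻¹' (MulAction.stabilizer Gal(Ω/k) x : Set Gal(Ω/k)) := by
      ext σ
      simp only [Set.mem_ofPred_eq, Set.mem_preimage, SetLike.mem_coe, MulAction.mem_stabilizer_iff,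
        mul_smul, inv_smul_eq_iff]
      rfl
    rw [this]
    exact (ho.preimage (continuous_const_mul _)).mem_nhds (by simp)
  obtain ⟨i, hi⟩ := (hω.frequently h5).exists
  exact ⟨i, (hi : (τ ^ ℓ ^ i) x = ω x).trans h4⟩

omit [IsAlgClosed Ω] [CharZero Ω] in
omit [IsGalois k Ω] in
theorem pow_mul_apply_eq_self {τ : Gal(Ω/k)} {x : Ω} {r : ℕ} (h : (τ ^ r) x = x) (s : ℕ) :
    (τ ^ (r * s)) x = x := by
  rw [pow_mul]
  exact (MulAction.stabilizer Gal(Ω/k) x).pow_mem (x := τ ^ r) h s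

/-- On the $\mathbb Z_\ell$-part $\tau$ is trivial, and on the $\mathbb Z_q$-parts with $q\ne\ell$
it has $q$-power order at each element. Exponents prime to $\ell$ can be multiplied, so the elements
with the property form a field. -/
theorem exists_coprime_pow_apply_eq_self {τ : Gal(Ω/k)} (hτ : logChar k Ω ℓ τ = 0) {x : Ω}
    (hx : x ∈ cyclotomicZHat k Ω) : ∃ r : ℕ, r.Coprime ℓ ∧ (τ ^ r) x = x := by
  let S : IntermediateField k Ω :=
    { carrier := {x | ∃ r : ℕ, r.Coprime ℓ ∧ (τ ^ r) x = x}
      mul_mem' := by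
        rintro x y ⟨r, hr, hx⟩ ⟨s, hs, hy⟩
        refine ⟨r * s, hr.mul_left hs, ?_⟩
        rw [map_mul, pow_mul_apply_eq_self hx, mul_comm r, pow_mul_apply_eq_self hy]
      add_mem' := by
        rintro x y ⟨r, hr, hx⟩ ⟨s, hs, hy⟩
        refine ⟨r * s, hr.mul_left hs, ?_⟩
        rw [map_add, pow_mul_apply_eq_self hx, mul_comm r, pow_mul_apply_eq_self hy]
      algebraMap_mem' := fun x ↦ ⟨1, by simp, by simp⟩
      inv_mem' := by
        rintro x ⟨r, hr, hx⟩
        exact ⟨r, hr, by rw [map_inv₀, hx]⟩ }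
  have hS : cyclotomicZHat k Ω ≤ S := by
    refine iSup_le fun q y hy ↦ ?_
    have : Fact (q : ℕ).Prime := ⟨q.2⟩
    by_cases h : (q : ℕ) = ℓ
    · refine ⟨1, by simp, ?_⟩
      rw [h] at hy
      rw [pow_one]
      exact apply_eq_self_of_logChar_eq_zero ℓ hτ hy
    · obtain ⟨i, hi⟩ := exists_prime_pow_apply_eq_self (q : ℕ) τ hy
      exact ⟨_, Nat.Coprime.pow_left _ ((Nat.coprime_primes q.2 hℓ.out).2 h), hi⟩
  exact hS hx

end Galois
end LogChar

/-! ### The $\ell$-part of the logarithmic inertia degree as an index -/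

section InertiaIndex
variable {k Ω : Type*} [Field k] [Field Ω] [Algebra k Ω] (ℓ : ℕ) [hℓ : Fact ℓ.Prime]

theorem exists_norm_logChar_max [IsGalois k Ω] (E : IntermediateField k Ω) :
    ∃ σ ∈ E.fixingSubgroup, ∀ τ ∈ E.fixingSubgroup, ‖logChar k Ω ℓ τ‖ ≤ ‖logChar k Ω ℓ σ‖ := by
  obtain ⟨σ, hσ, h⟩ := (InfiniteGalois.fixingSubgroup_isClosed E).isCompact.exists_isMaxOn
    ⟨1, E.fixingSubgroup.one_mem⟩ (continuous_logChar (k := k) (Ω := Ω) ℓ).norm.continuousOn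
  exact ⟨σ, hσ, fun τ hτ ↦ h hτ⟩

/-- The image of the compact group is closed and contains the multiples
$n\operatorname{Log}\chi(\sigma)$, $n\in\mathbb N$, hence all of $\mathbb
Z_\ell\operatorname{Log}\chi(\sigma)$. -/
theorem exists_logChar_eq [IsGalois k Ω] (E : IntermediateField k Ω) {σ : Gal(Ω/k)}
    (hσ : σ ∈ E.fixingSubgroup) {x : ℚ_[ℓ]} (hx : ‖x‖ ≤ ‖logChar k Ω ℓ σ‖) :
    ∃ τ ∈ E.fixingSubgroup, logChar k Ω ℓ τ = x := by
  rcases eq_or_ne (logChar k Ω ℓ σ) 0 with h0 | h0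
  · rw [h0, norm_zero, norm_le_zero_iff] at hx
    exact ⟨σ, hσ, by rw [h0, hx]⟩
  have hS : IsClosed (logChar k Ω ℓ '' (E.fixingSubgroup : Set Gal(Ω/k))) :=
    ((InfiniteGalois.fixingSubgroup_isClosed E).isCompact.image (continuous_logChar ℓ)).isClosed
  let u : ℤ_[ℓ] := ⟨x / logChar k Ω ℓ σ, by
    rw [norm_div]; exact div_le_one_of_le₀ hx (norm_nonneg _)⟩
  let f : ℤ_[ℓ] → ℚ_[ℓ] := fun u ↦ (u : ℚ_[ℓ]) * logChar k Ω ℓ σ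
  have hf : Continuous f :=
    (continuous_subtype_val (p := fun x : ℚ_[ℓ] ↦ ‖x‖ ≤ 1)).mul continuous_const
  have h1 : ∀ v : ℤ_[ℓ], f v ∈ logChar k Ω ℓ '' (E.fixingSubgroup : Set Gal(Ω/k)) := by
    intro v
    refine (hS.preimage hf).closure_subset_iff.2 ?_ (PadicInt.denseRange_natCast (p := ℓ) v)
    rintro _ ⟨n, rfl⟩
    exact ⟨σ ^ n, E.fixingSubgroup.pow_mem hσ n, by simp [f, logChar_pow]⟩
  obtain ⟨τ, hτ, h2⟩ := h1 u
  exact ⟨τ, hτ, h2.trans (div_mul_cancel₀ x h0)⟩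

/-- The automorphisms at which `logChar` is at most as large as at `σ`. -/
noncomputable def logCharBall (σ : Gal(Ω/k)) : Subgroup Gal(Ω/k) where
  carrier := {τ | ‖logChar k Ω ℓ τ‖ ≤ ‖logChar k Ω ℓ σ‖}
  mul_mem' := fun {a b} ha hb ↦ by
    change ‖_‖ ≤ _
    rw [logChar_mul]
    exact (Padic.nonarchimedean _ _).trans (max_le ha hb)
  one_mem' := by
    change ‖_‖ ≤ _
    rw [logChar_one, norm_zero]
    exact norm_nonneg _
  inv_mem' := fun {a} ha ↦ by
    change ‖_‖ ≤ _
    rw [logChar_inv, norm_neg]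
    exact ha

/-- Dividing by the maximal value at $\sigma_0$ gives a surjection onto $\mathbb Z/\ell^c$ with
kernel the ball, where $c$ is the valuation of the quotient of the values at $\sigma_1$ and
$\sigma_0$. -/
theorem exists_index_logCharBall {σ₀ σ₁ : Gal(Ω/k)} (h₀ : ∀ τ, ‖logChar k Ω ℓ τ‖ ≤ ‖logChar k Ω ℓ σ₀‖)
    (h₁ : logChar k Ω ℓ σ₁ ≠ 0) :
    ∃ c : ℕ, (logCharBall ℓ σ₁).index = ℓ ^ c ∧
      ‖((ℓ ^ c : ℕ) : ℚ_[ℓ])‖ * ‖logChar k Ω ℓ σ₀‖ = ‖logChar k Ω ℓ σ₁‖ := by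
  have h00 : logChar k Ω ℓ σ₀ ≠ 0 := by
    intro h
    have := h₀ σ₁
    rw [h, norm_zero, norm_le_zero_iff] at this
    exact h₁ this
  let g : Gal(Ω/k) → ℤ_[ℓ] := fun τ ↦ ⟨logChar k Ω ℓ τ / logChar k Ω ℓ σ₀, by
    rw [norm_div]; exact div_le_one_of_le₀ (h₀ τ) (norm_nonneg _)⟩
  have hg : ∀ τ, ((g τ : ℤ_[ℓ]) : ℚ_[ℓ]) = logChar k Ω ℓ τ / logChar k Ω ℓ σ₀ := fun τ ↦ rfl
  have hgn : ∀ τ, ‖g τ‖ = ‖logChar k Ω ℓ τ‖ / ‖logChar k Ω ℓ σ₀‖ := fun τ ↦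
    norm_div (logChar k Ω ℓ τ) (logChar k Ω ℓ σ₀)
  have hg1 : g σ₁ ≠ 0 := by
    intro h
    have := hg σ₁
    rw [h, PadicInt.coe_zero, eq_comm, div_eq_zero_iff] at this
    exact this.elim h₁ h00
  set c := (g σ₁).valuation with hc
  have hnorm := PadicInt.norm_eq_zpow_neg_valuation hg1
  let φ : Gal(Ω/k) →* Multiplicative (ZMod (ℓ ^ c)) :=
    { toFun := fun τ ↦ .ofAdd ((g τ).toZModPow c)
      map_one' := by
        have : g 1 = 0 := Subtype.ext (by
          change logChar k Ω ℓ 1 / _ = 0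
          rw [logChar_one, zero_div])
        rw [this, map_zero]; rfl
      map_mul' := fun a b ↦ by
        have : g (a * b) = g a + g b := Subtype.ext (by
          change logChar k Ω ℓ (a * b) / _ = logChar k Ω ℓ a / _ + logChar k Ω ℓ b / _
          rw [logChar_mul, add_div])
        rw [this, map_add]; rfl }
  have hφ : ∀ τ, φ τ = 1 ↔ ‖logChar k Ω ℓ τ‖ ≤ ‖logChar k Ω ℓ σ₁‖ := by
    intro τ
    have e1 : φ τ = 1 ↔ (g τ).toZModPow c = 0 := Iff.rfl
    rw [e1, ← RingHom.mem_ker, PadicInt.ker_toZModPow, ← PadicInt.norm_le_pow_iff_mem_span_pow,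
      ← hnorm, hgn, hgn, div_le_div_iff_of_pos_right (norm_pos_iff.2 h00)]
  have hker : φ.ker = logCharBall ℓ σ₁ := by
    ext τ
    rw [MonoidHom.mem_ker, hφ]; rfl
  have hsurj : Function.Surjective φ := by
    intro z
    have hn : NeZero (ℓ ^ c) := ⟨pow_ne_zero _ hℓ.out.ne_zero⟩
    refine ⟨σ₀ ^ (z.toAdd).val, ?_⟩
    rw [map_pow]
    have : φ σ₀ = .ofAdd 1 := by
      have : g σ₀ = 1 := Subtype.ext (div_self h00)
      change Multiplicative.ofAdd ((g σ₀).toZModPow c) = _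
      rw [this, map_one]
    rw [this, ← ofAdd_nsmul, nsmul_one, ZMod.natCast_val, ZMod.cast_id]
    rfl
  refine ⟨c, ?_, ?_⟩
  · rw [← hker, Subgroup.index_ker, MonoidHom.range_eq_top.2 hsurj]
    simp
  · rw [hgn, div_eq_iff (norm_ne_zero_iff.2 h00)] at hnorm
    rw [hnorm]
    congr 1
    simp [hc]

variable [IsAlgClosed Ω] [CharZero Ω] [IsGalois k Ω]

omit [IsAlgClosed Ω] [CharZero Ω] in
theorem fixingSubgroup_fixedField_of_le {E : IntermediateField k Ω} [FiniteDimensional k E]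
    {H : Subgroup Gal(Ω/k)} (h : E.fixingSubgroup ≤ H) :
    (IntermediateField.fixedField H).fixingSubgroup = H ∧ IntermediateField.fixedField H ≤ E := by
  have h1 : IsOpen (H : Set Gal(Ω/k)) := Subgroup.isOpen_mono h E.fixingSubgroup_isOpen
  refine ⟨InfiniteGalois.fixingSubgroup_fixedField ⟨H, Subgroup.isClosed_of_isOpen _ h1⟩, ?_⟩
  rw [← InfiniteGalois.fixedField_fixingSubgroup E]
  exact IntermediateField.fixedField_le h

/-- The action on roots of unity goes through the cyclotomic characters, which have abelian values.
It makes the group of $E\cap\widehat k^c$ normal. -/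
theorem fixingSubgroup_cyclotomicZHat_commutator :
    commutator Gal(Ω/k) ≤ (cyclotomicZHat k Ω).fixingSubgroup := by
  intro σ hσ
  rw [← Subgroup.zpowers_le, ← IntermediateField.le_iff_le]
  refine iSup_le fun q y hy ↦ ?_
  have : Fact (q : ℕ).Prime := ⟨q.2⟩
  have h1 : σ ∈ MulAction.stabilizer Gal(Ω/k) y :=
    apply_eq_self_of_mem_qPowerCyclotomic (q : ℕ) (Abelianization.commutator_subset_ker
      ((cyclotomicCharacter Ω (q : ℕ)).comp (MulSemiringAction.toRingAut Gal(Ω/k) Ω)) hσ)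
      ((mem_cyclotomicZq_iff (q : ℕ)).1 hy).1
  rw [IntermediateField.mem_fixedField_iff]
  exact fun τ hτ ↦ Subgroup.zpowers_le.2 h1 hτ

/-- $D$ is the fixed field of the ball around $0$ of radius $\|\operatorname{Log}\chi(\sigma_1)\|$.
This ball contains $G_E$ and everything with torsion character, so $D$ lies in $E$ and in the
$\mathbb Z_\ell$-extension, and its degree is the index of the ball. The remaining degree of
$E\cap\widehat k^c$ over $D$ is prime to $\ell$. -/
theorem logInertia_aux (E : IntermediateField k Ω) [FiniteDimensional k E] {σ₀ σ₁ : Gal(Ω/k)}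
    (h₀ : ∀ τ, ‖logChar k Ω ℓ τ‖ ≤ ‖logChar k Ω ℓ σ₀‖) (hE : σ₁ ∈ E.fixingSubgroup)
    (h₁ : ∀ τ ∈ E.fixingSubgroup, ‖logChar k Ω ℓ τ‖ ≤ ‖logChar k Ω ℓ σ₁‖)
    (h₁0 : logChar k Ω ℓ σ₁ ≠ 0) :
    (‖(Module.finrank k (E ⊓ cyclotomicZHat k Ω : IntermediateField k Ω) : ℚ_[ℓ])‖ *
        ‖logChar k Ω ℓ σ₀‖ = ‖logChar k Ω ℓ σ₁‖) ∧
      ∃ D : IntermediateField k Ω, D ≤ E ∧ D ≤ qPowerCyclotomic k Ω ℓ ∧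
        (∀ σ, ‖logChar k Ω ℓ σ‖ ≤ ‖logChar k Ω ℓ σ₁‖ → σ ∈ D.fixingSubgroup) ∧
        ‖(Module.finrank k D : ℚ_[ℓ])‖ * ‖logChar k Ω ℓ σ₀‖ = ‖logChar k Ω ℓ σ₁‖ := by
  have hH : E.fixingSubgroup ≤ logCharBall ℓ σ₁ := h₁
  obtain ⟨hD1, hD2⟩ := fixingSubgroup_fixedField_of_le hH
  obtain ⟨c, hc1, hc2⟩ := exists_index_logCharBall ℓ h₀ h₁0
  set D := IntermediateField.fixedField (logCharBall (k := k) (Ω := Ω) ℓ σ₁) with hD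
  have hball : ∀ σ, logChar k Ω ℓ σ = 0 → σ ∈ logCharBall ℓ σ₁ := fun σ hσ ↦ by
    change ‖_‖ ≤ _
    rw [hσ, norm_zero]
    exact norm_nonneg _
  have hlog : ∀ σ : Gal(Ω/k), (∃ n ≠ 0, cyclotomicCharacter Ω ℓ (σ : Ω ≃+* Ω) ^ n = 1) →
      logChar k Ω ℓ σ = 0 := by
    rintro σ ⟨n, hn, h⟩
    refine iwasawaLog_eq_zero_of_pow_eq_one hn ?_
    rw [← PadicInt.coe_pow, ← Units.val_pow_eq_pow_val, h]
    simp
  have hDq : D ≤ qPowerCyclotomic k Ω ℓ := by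
    rw [← InfiniteGalois.fixedField_fixingSubgroup (qPowerCyclotomic k Ω ℓ)]
    refine IntermediateField.fixedField_le fun σ hσ ↦ hball σ (hlog σ ⟨1, one_ne_zero, ?_⟩)
    rw [pow_one]
    refine cyclotomicCharacter_eq_one ℓ fun n ζ hζ ↦ ?_
    exact (IntermediateField.mem_fixingSubgroup_iff _ _).1 hσ ζ
      (IntermediateField.subset_adjoin _ _ ⟨n, hζ⟩)
  have hDC : D ≤ cyclotomicZHat k Ω := by
    refine le_trans (fun x hx ↦ ?_) (le_iSup _ (⟨ℓ, hℓ.out⟩ : Nat.Primes))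
    refine (mem_cyclotomicZq_iff ℓ).2 ⟨hDq hx, fun σ hσ ↦ ?_⟩
    exact (IntermediateField.mem_fixedField_iff _ _).1 hx σ (hball σ (hlog σ hσ))
  have hDf : Module.finrank k D = ℓ ^ c := by
    rw [IntermediateField.finrank_eq_fixingSubgroup_index, hD1, hc1]
  refine ⟨?_, D, hD2, hDq, fun σ hσ ↦ by rw [hD1]; exact hσ, by rw [hDf, hc2]⟩
  set M : IntermediateField k Ω := E ⊓ cyclotomicZHat k Ω with hM
  have hME : M ≤ E := inf_le_left
  have : FiniteDimensional k M := FiniteDimensional.of_injective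
    (IntermediateField.inclusion hME).toLinearMap
    (IntermediateField.inclusion_injective hME)
  have hG : M.fixingSubgroup ≤ logCharBall ℓ σ₁ := by
    rw [← hD1]; exact IntermediateField.fixingSubgroup_le (le_inf hD2 hDC)
  have hN : M.fixingSubgroup.Normal := Subgroup.Normal.of_commutator_le _
    (fixingSubgroup_cyclotomicZHat_commutator.trans
      (IntermediateField.fixingSubgroup_le inf_le_right))
  have hidx := Subgroup.relIndex_mul_index hG
  rw [hc1, ← IntermediateField.finrank_eq_fixingSubgroup_index] at hidx
  -- Otherwise some $\sigma\in G_D$ has order $\ell$ modulo $G_M$. Take $\sigma'\in G_E$ with the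
  -- same logarithm. Then $\sigma\sigma'^{-1}$ has a power of exponent prime to $\ell$ in $G_M$, and
  -- so has $\sigma$, because $\sigma'\in G_M$.
  have hcop : ¬ ℓ ∣ M.fixingSubgroup.relIndex (logCharBall ℓ σ₁) := by
    intro hdvd
    have hne : M.fixingSubgroup.relIndex (logCharBall ℓ σ₁) ≠ 0 := by
      intro h0
      rw [h0, zero_mul] at hidx
      exact (Module.finrank_pos (R := k) (M := M)).ne hidx
    have : Finite (logCharBall ℓ σ₁ ⧸ M.fixingSubgroup.subgroupOf (logCharBall ℓ σ₁)) :=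
      Nat.finite_of_card_ne_zero hne
    obtain ⟨x, hx⟩ := exists_prime_orderOf_dvd_card' ℓ hdvd
    obtain ⟨⟨σ, hσ⟩, rfl⟩ := QuotientGroup.mk_surjective x
    obtain ⟨σ', hσ', hσ2⟩ := exists_logChar_eq ℓ E hE (x := logChar k Ω ℓ σ) hσ
    have hτ : logChar k Ω ℓ (σ * σ'⁻¹) = 0 := by rw [logChar_mul, logChar_inv, hσ2, add_neg_cancel]
    obtain ⟨α, hα⟩ := Field.exists_primitive_element k M
    obtain ⟨r, hr, hrα⟩ := exists_coprime_pow_apply_eq_self ℓ hτ (x := (α : Ω)) α.2.2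
    have hmem : (σ * σ'⁻¹) ^ r ∈ M.fixingSubgroup := by
      rw [← Subgroup.zpowers_le, ← IntermediateField.le_iff_le]
      have hMα : M = IntermediateField.adjoin k {(α : Ω)} := by
        rw [← IntermediateField.lift_adjoin_simple, hα, IntermediateField.lift_top]
      rw [hMα, IntermediateField.adjoin_simple_le_iff, IntermediateField.mem_fixedField_iff]
      have : (σ * σ'⁻¹) ^ r ∈ MulAction.stabilizer Gal(Ω/k) (α : Ω) := hrα
      exact fun τ hτ ↦ Subgroup.zpowers_le.2 this hτ
    have hσ'M : σ' ∈ M.fixingSubgroup := IntermediateField.fixingSubgroup_le inf_le_left hσ'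
    have hσr : σ ^ r ∈ M.fixingSubgroup := by
      rw [← QuotientGroup.eq_one_iff] at hmem hσ'M ⊢
      rw [QuotientGroup.mk_pow, QuotientGroup.mk_mul, QuotientGroup.mk_inv, hσ'M] at hmem
      rw [QuotientGroup.mk_pow]
      simpa using hmem
    have h1 : ((⟨σ, hσ⟩ : logCharBall ℓ σ₁) :
        logCharBall ℓ σ₁ ⧸ M.fixingSubgroup.subgroupOf (logCharBall ℓ σ₁)) ^ r = 1 := by
      rw [← QuotientGroup.mk_pow, QuotientGroup.eq_one_iff, Subgroup.mem_subgroupOf]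
      exact hσr
    have h2 := orderOf_dvd_of_pow_eq_one h1
    rw [hx] at h2
    exact hℓ.out.one_lt.ne' (Nat.dvd_one.1 (hr ▸ Nat.dvd_gcd h2 dvd_rfl))
  rw [← hc2, ← hidx, Nat.cast_mul, norm_mul]
  have : ‖(M.fixingSubgroup.relIndex (logCharBall ℓ σ₁) : ℚ_[ℓ])‖ = 1 := by
    rw [Padic.norm_natCast_eq_one_iff]
    exact (Nat.Prime.coprime_iff_not_dvd hℓ.out).2 hcop
  rw [this, one_mul]

end InertiaIndex

/-! ### The valuation ring of an ultrametric field -/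

section UnitBall
variable (Ω : Type*) [NormedField Ω] [IsUltrametricDist Ω]

/-- The valuation ring `‖x‖ ≤ 1` of an ultrametric normed field. -/
noncomputable abbrev unitBall : ValuationSubring Ω := (NormedField.valuation (K := Ω)).valuationSubring

variable {Ω}

theorem mem_unitBall {x : Ω} : x ∈ unitBall Ω ↔ ‖x‖ ≤ 1 := Iff.rfl

theorem isUnit_unitBall_iff {x : unitBall Ω} : IsUnit x ↔ ‖(x : Ω)‖ = 1 := by
  constructor
  · rintro ⟨u, rfl⟩
    refine le_antisymm (u : unitBall Ω).2 ?_
    have h1 : ‖((u : unitBall Ω) : Ω)‖ * ‖((u⁻¹ : (unitBall Ω)ˣ) : unitBall Ω).1‖ = 1 := by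
      rw [← norm_mul, ← norm_one (α := Ω)]
      exact congrArg (fun y : unitBall Ω ↦ ‖(y : Ω)‖) u.mul_inv
    rw [← h1]
    exact mul_le_of_le_one_right (norm_nonneg _) ((u⁻¹ : (unitBall Ω)ˣ) : unitBall Ω).2
  · intro h
    have h0 : (x : Ω) ≠ 0 := by
      intro h0; rw [h0, norm_zero] at h; exact zero_ne_one h
    refine IsUnit.of_mul_eq_one ⟨(x : Ω)⁻¹, mem_unitBall.2 (by rw [norm_inv, h, inv_one])⟩
      (Subtype.ext ?_)
    exact mul_inv_cancel₀ h0

theorem residue_unitBall_eq_iff {x y : unitBall Ω} :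
    IsLocalRing.residue (unitBall Ω) x = IsLocalRing.residue (unitBall Ω) y ↔
      ‖(x : Ω) - y‖ < 1 := by
  rw [← sub_eq_zero, ← map_sub, IsLocalRing.residue_eq_zero_iff, IsLocalRing.mem_maximalIdeal,
    mem_nonunits_iff, isUnit_unitBall_iff]
  have := (x - y).2
  exact ⟨fun h ↦ lt_of_le_of_ne this h, fun h ↦ h.ne⟩

end UnitBall

/-! ### Residue degrees of finite extensions of $\mathbb Q_p$ -/

section Local
variable {p : ℕ} [hp : Fact p.Prime] {Ω : Type*} [NormedField Ω] [NormedAlgebra ℚ_[p] Ω]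
  [Algebra.IsAlgebraic ℚ_[p] Ω]

/-- The norm is the spectral norm, which depends on the minimal polynomial alone. -/
theorem norm_algHom_apply {K : IntermediateField ℚ_[p] Ω} (f : K →ₐ[ℚ_[p]] Ω) (x : K) :
    ‖f x‖ = ‖(x : Ω)‖ := by
  rw [NormedAlgebra.norm_eq_spectralNorm ℚ_[p], NormedAlgebra.norm_eq_spectralNorm ℚ_[p],
    spectralNorm, spectralNorm, minpoly.algHom_eq f f.injective]
  exact congrArg _ (minpoly.algHom_eq K.val K.val.injective x).symm

theorem norm_algEquiv_apply (σ : Gal(Ω/ℚ_[p])) (x : Ω) : ‖σ x‖ = ‖x‖ := by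
  rw [NormedAlgebra.norm_eq_spectralNorm ℚ_[p], NormedAlgebra.norm_eq_spectralNorm ℚ_[p],
    ← spectralNorm_eq_of_equiv σ x]

theorem norm_algebraNorm [IsAlgClosed Ω] (K : IntermediateField ℚ_[p] Ω)
    [FiniteDimensional ℚ_[p] K] (x : K) :
    ‖Algebra.norm ℚ_[p] x‖ = ‖(x : Ω)‖ ^ Module.finrank ℚ_[p] K := by
  rw [← norm_algebraMap' Ω, Algebra.norm_eq_prod_embeddings ℚ_[p] Ω, norm_prod,
    Finset.prod_congr rfl fun f _ ↦ norm_algHom_apply f x, Finset.prod_const, Finset.card_univ,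
    AlgHom.card]

theorem norm_le_one_iff_isIntegral [Algebra ℤ_[p] Ω] [IsScalarTower ℤ_[p] ℚ_[p] Ω]
    [IsUltrametricDist Ω] {x : Ω} : ‖x‖ ≤ 1 ↔ IsIntegral ℤ_[p] x := by
  constructor
  · intro h
    rw [NormedAlgebra.norm_eq_spectralNorm ℚ_[p], spectralNorm,
      spectralValue_le_one_iff (minpoly.monic (Algebra.IsIntegral.isIntegral x))] at h
    have h1 : minpoly ℚ_[p] x ∈ Polynomial.lifts (algebraMap ℤ_[p] ℚ_[p]) := by
      rw [Polynomial.lifts_iff_coeff_lifts]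
      exact fun n ↦ ⟨⟨_, h n⟩, rfl⟩
    obtain ⟨P, hP, -, hm⟩ := Polynomial.lifts_and_degree_eq_and_monic h1
      (minpoly.monic (Algebra.IsIntegral.isIntegral x))
    refine ⟨P, hm, ?_⟩
    rw [IsScalarTower.algebraMap_eq ℤ_[p] ℚ_[p] Ω, ← Polynomial.eval₂_map, hP]
    exact minpoly.aeval _ _
  · intro h
    have h1 : IsIntegral (unitBall Ω) x := by
      obtain ⟨P, hP, hx⟩ := h
      have h2 : ∀ c : ℤ_[p], algebraMap ℤ_[p] Ω c ∈ unitBall Ω := fun c ↦ by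
        rw [mem_unitBall, IsScalarTower.algebraMap_apply ℤ_[p] ℚ_[p] Ω, norm_algebraMap']
        exact c.2
      refine ⟨P.map ((algebraMap ℤ_[p] Ω).codRestrict (unitBall Ω).toSubring h2), hP.map _, ?_⟩
      rw [Polynomial.eval₂_map]
      exact hx
    obtain ⟨y, rfl⟩ := IsIntegrallyClosed.isIntegral_iff.1 h1
    exact y.2

theorem valuation_eq_iff_norm {x : ℚ_[p]} (hx : x ≠ 0) {n : ℤ} :
    x.valuation = n ↔ ‖x‖ = (p : ℝ) ^ (-n) := by
  have hp1 : (1 : ℝ) < p := by exact_mod_cast hp.out.one_lt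
  rw [Padic.norm_eq_zpow_neg_valuation hx, zpow_right_inj₀ (by linarith) hp1.ne', neg_inj]

/-- The $q$ elements of the image of $k$ already exhaust the roots of $X^q-X$. -/
theorem pow_card_eq_self_iff_mem_range {k κ : Type*} [Field k] [Field κ] (φ : k →+* κ) {q : ℕ}
    (hq : 1 < q) (hcard : Nat.card k = q) (x : κ) : x ^ q = x ↔ ∃ z, φ z = x := by
  have hfin : Finite k := Nat.finite_of_card_ne_zero (by omega)
  let _ := Fintype.ofFinite k
  rw [Nat.card_eq_fintype_card] at hcard
  constructor
  · intro hx
    classical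
    have h0 : (Polynomial.X ^ q - Polynomial.X : Polynomial κ) ≠ 0 :=
      FiniteField.X_pow_card_sub_X_ne_zero κ hq
    have hsub : Finset.univ.image φ ⊆
        (Polynomial.X ^ q - Polynomial.X : Polynomial κ).roots.toFinset := by
      intro y hy
      obtain ⟨z, -, rfl⟩ := Finset.mem_image.1 hy
      rw [Multiset.mem_toFinset, Polynomial.mem_roots h0]
      simp [← map_pow, ← hcard, FiniteField.pow_card]
    have heq := Finset.eq_of_subset_of_card_le hsub (by
      rw [Finset.card_image_of_injective _ φ.injective, Finset.card_univ, hcard]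
      refine (Multiset.toFinset_card_le _).trans ((Polynomial.card_roots' _).trans ?_)
      rw [FiniteField.X_pow_card_sub_X_natDegree_eq κ hq])
    have hx' : x ∈ Finset.univ.image φ := by
      rw [heq, Multiset.mem_toFinset, Polynomial.mem_roots h0]
      simp [hx]
    simpa using hx'
  · rintro ⟨z, rfl⟩
    rw [← map_pow, ← hcard, FiniteField.pow_card]

theorem exists_card_residueField_eq_pow {B : Type*} [CommRing B] [IsDomain B]
    [IsDiscreteValuationRing B] [Algebra ℤ_[p] B] [Module.Finite ℤ_[p] B]
    [Module.IsTorsionFree ℤ_[p] B] :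
    ∃ f : ℕ, f ≠ 0 ∧ Nat.card (B ⧸ IsLocalRing.maximalIdeal B) = p ^ f ∧
      ∀ ϖ : B, Irreducible ϖ →
        Associated (Algebra.intNorm ℤ_[p] B ϖ) ((p : ℤ_[p]) ^ f) := by
  set P := IsLocalRing.maximalIdeal B with hP
  set m := IsLocalRing.maximalIdeal ℤ_[p] with hm
  have hover : P.LiesOver m := by
    have : Algebra.IsIntegral ℤ_[p] B := inferInstance
    have h1 : (P.under ℤ_[p]).IsMaximal := Ideal.IsMaximal.under ℤ_[p] P
    exact ⟨(IsLocalRing.eq_maximalIdeal h1).symm⟩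
  refine ⟨P.inertiaDeg ℤ_[p], ?_, ?_, fun ϖ hϖ ↦ ?_⟩
  · let _ := Ideal.Quotient.field m
    rw [Ideal.inertiaDeg_eq_of_isMaximal m P]
    exact Module.finrank_pos.ne'
  · let _ := Ideal.Quotient.field m
    rw [Ideal.inertiaDeg_eq_of_isMaximal m P,
      Module.natCard_eq_pow_finrank (K := ℤ_[p] ⧸ m)]
    congr 1
    exact (Nat.card_congr (PadicInt.residueField (p := p)).toEquiv).trans (by simp)
  · have hrel := Ideal.relNorm_eq_pow_of_isMaximal P m
    rw [hP, hϖ.maximalIdeal_eq, Ideal.relNorm_singleton, ← hϖ.maximalIdeal_eq, ← hP, hm,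
      PadicInt.maximalIdeal_eq_span_p, Ideal.span_singleton_pow,
      Ideal.span_singleton_eq_span_singleton] at hrel
    exact hrel

/-- The residue degree in the two forms needed later: as generator of the valuations of norms, and
through the description of the residue field of $K$ inside that of $\Omega$ as the fixed points of
$x\mapsto x^{p^f}$. It comes from the relative norm of the maximal ideal in the ring of integers of
$K$. -/
theorem exists_residueDegree [IsAlgClosed Ω] [IsUltrametricDist Ω] (K : IntermediateField ℚ_[p] Ω)
    [FiniteDimensional ℚ_[p] K] : ∃ f : ℕ, f ≠ 0 ∧
      (∀ x : K, x ≠ 0 → (f : ℤ) ∣ (Algebra.norm ℚ_[p] x).valuation) ∧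
      (∃ x : K, x ≠ 0 ∧ (Algebra.norm ℚ_[p] x).valuation = f) ∧
      ∀ x : Ω, ‖x‖ ≤ 1 → (‖x ^ p ^ f - x‖ < 1 ↔ ∃ c ∈ K, ‖c‖ ≤ 1 ∧ ‖x - c‖ < 1) := by
  let _ : Algebra ℤ_[p] Ω := ((algebraMap ℚ_[p] Ω).comp (algebraMap ℤ_[p] ℚ_[p])).toAlgebra
  have : IsScalarTower ℤ_[p] ℚ_[p] Ω := .of_algebraMap_eq fun _ ↦ rfl
  let _ : Algebra ℤ_[p] K := ((algebraMap ℚ_[p] K).comp (algebraMap ℤ_[p] ℚ_[p])).toAlgebra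
  have : IsScalarTower ℤ_[p] ℚ_[p] K := .of_algebraMap_eq fun _ ↦ rfl
  have : IsScalarTower ℤ_[p] K Ω := .of_algebraMap_eq fun _ ↦ rfl
  let B := integralClosure ℤ_[p] K
  have hB : ∀ x : K, x ∈ B ↔ ‖(x : Ω)‖ ≤ 1 := fun x ↦ by
    rw [norm_le_one_iff_isIntegral (p := p)]
    exact (isIntegral_algebraMap_iff (algebraMap K Ω).injective).symm
  have hDed : IsDedekindDomain B := integralClosure.isDedekindDomain ℤ_[p] ℚ_[p] K
  have hfin : Module.Finite ℤ_[p] B := IsIntegralClosure.finite ℤ_[p] ℚ_[p] K B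
  have hfrac : IsFractionRing B K := integralClosure.isFractionRing_of_finite_extension ℚ_[p] K
  let ι : B →+* unitBall Ω :=
    ((algebraMap K Ω).comp (algebraMap B K)).codRestrict (unitBall Ω).toSubring
      (fun b ↦ (hB b).1 b.2)
  have hι : ∀ b : B, ((ι b : unitBall Ω) : Ω) = ((b : K) : Ω) := fun b ↦ rfl
  have hunit : ∀ b : B, IsUnit b ↔ ‖((b : K) : Ω)‖ = 1 := by
    intro b
    refine ⟨fun h ↦ isUnit_unitBall_iff.1 (h.map ι), fun h ↦ ?_⟩
    have h0 : (b : K) ≠ 0 := by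
      intro h0; rw [h0] at h; simp at h
    refine IsUnit.of_mul_eq_one ⟨(b : K)⁻¹, (hB _).2 (by simp [h])⟩ (Subtype.ext ?_)
    exact mul_inv_cancel₀ h0
  have hnon : ∀ b : B, b ∈ nonunits B ↔ ‖((b : K) : Ω)‖ < 1 := fun b ↦ by
    rw [mem_nonunits_iff, hunit]
    exact ⟨fun h ↦ lt_of_le_of_ne ((hB b).1 b.2) h, fun h ↦ h.ne⟩
  -- The non-units are exactly the elements of norm less than 1, so locality follows from the
  -- ultrametric inequality. Being Dedekind and local, $B$ is a discrete valuation ring.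
  have hloc : IsLocalRing B := IsLocalRing.of_nonunits_add fun a b ha hb ↦ by
    rw [hnon] at ha hb ⊢
    exact (IsUltrametricDist.norm_add_le_max _ _).trans_lt (max_lt ha hb)
  have hPmem : ∀ b : B, b ∈ IsLocalRing.maximalIdeal B ↔ ‖((b : K) : Ω)‖ < 1 := fun b ↦ by
    rw [IsLocalRing.mem_maximalIdeal, hnon]
  have hnf : ¬ IsField B := by
    intro h
    have hpB : (p : B) ∈ IsLocalRing.maximalIdeal B := by
      rw [hPmem]
      have : (((p : B) : K) : Ω) = algebraMap ℚ_[p] Ω (p : ℚ_[p]) := by simp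
      rw [this, norm_algebraMap']
      exact Padic.norm_p_lt_one
    rw [IsLocalRing.isField_iff_maximalIdeal_eq.1 h, Ideal.mem_bot] at hpB
    have : ((p : B) : K) = 0 := by rw [hpB]; rfl
    have h2 : (p : K) = 0 := by simpa using this
    have : CharZero K := algebraRat.charZero K
    exact hp.out.ne_zero (by exact_mod_cast h2)
  have hDVR : IsDiscreteValuationRing B := ((IsDiscreteValuationRing.TFAE B hnf).out 0 2).2 hDed
  have htf : Module.IsTorsionFree ℤ_[p] B := by
    refine Module.isTorsionFree_iff_algebraMap_injective.2
      (Function.Injective.of_comp (f := algebraMap B K) ?_)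
    exact (algebraMap ℚ_[p] K).injective.comp Subtype.val_injective
  obtain ⟨ϖ, hϖ⟩ := IsDiscreteValuationRing.exists_irreducible B
  obtain ⟨f, hf, hcard, hrel⟩ := exists_card_residueField_eq_pow (p := p) (B := B)
  obtain ⟨u, hu⟩ := hrel ϖ hϖ
  have hnϖ : Algebra.norm ℚ_[p] (ϖ : K) * ((u : ℤ_[p]) : ℚ_[p]) = (p : ℚ_[p]) ^ f := by
    have h1 : algebraMap ℤ_[p] ℚ_[p] (Algebra.intNorm ℤ_[p] B ϖ) = Algebra.norm ℚ_[p] (ϖ : K) :=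
      Algebra.algebraMap_intNorm (L := K) ϖ
    have h2 := congrArg (algebraMap ℤ_[p] ℚ_[p]) hu
    rw [map_mul, h1] at h2
    simpa using h2
  have hϖ0 : (ϖ : K) ≠ 0 := by
    intro h; exact hϖ.ne_zero (Subtype.ext h)
  have hN0 : ∀ x : K, x ≠ 0 → Algebra.norm ℚ_[p] x ≠ 0 := fun x hx ↦ Algebra.norm_ne_zero_iff.2 hx
  have hvϖ : (Algebra.norm ℚ_[p] (ϖ : K)).valuation = f := by
    rw [valuation_eq_iff_norm (hN0 _ hϖ0)]
    have h2 := congrArg norm hnϖ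
    have h3 : ‖((u : ℤ_[p]) : ℚ_[p])‖ = 1 := PadicInt.norm_units u
    rw [norm_mul, h3, mul_one, Padic.norm_p_pow] at h2
    exact h2
  have hvB : ∀ b : B, b ≠ 0 → (f : ℤ) ∣ (Algebra.norm ℚ_[p] (b : K)).valuation := by
    intro b hb
    obtain ⟨n, w, rfl⟩ := IsDiscreteValuationRing.eq_unit_mul_pow_irreducible hb hϖ
    have hw := (hunit w).1 w.isUnit
    have hw0 : ((w : B) : K) ≠ 0 := by
      intro h; rw [h] at hw; simp at hw
    have hvw : (Algebra.norm ℚ_[p] ((w : B) : K)).valuation = 0 := by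
      rw [valuation_eq_iff_norm (hN0 _ hw0), norm_algebraNorm, hw]
      simp
    have e : (((w : B) * ϖ ^ n : B) : K) = ((w : B) : K) * (ϖ : K) ^ n := rfl
    rw [e, map_mul, map_pow, Padic.valuation_mul (hN0 _ hw0) (pow_ne_zero _ (hN0 _ hϖ0)), hvw,
      Padic.valuation_pow, hvϖ, zero_add]
    exact dvd_mul_left _ _
  refine ⟨f, hf, fun x hx ↦ ?_, ⟨ϖ, hϖ0, hvϖ⟩, fun x hx ↦ ?_⟩
  · obtain ⟨a, b, hb, rfl⟩ := IsFractionRing.div_surjective (A := B) x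
    have hb0 : b ≠ 0 := nonZeroDivisors.ne_zero hb
    have ha0 : a ≠ 0 := by rintro rfl; simp at hx
    have ha1 : (a : K) ≠ 0 := fun h ↦ ha0 (Subtype.ext h)
    have hb1 : (b : K) ≠ 0 := fun h ↦ hb0 (Subtype.ext h)
    have e : Algebra.norm ℚ_[p] (algebraMap B K a / algebraMap B K b) *
        Algebra.norm ℚ_[p] (b : K) = Algebra.norm ℚ_[p] (a : K) := by
      rw [← map_mul]
      exact congrArg _ (div_mul_cancel₀ _ hb1)
    have h2 := hvB a ha0
    rw [← e, Padic.valuation_mul (hN0 _ hx) (hN0 _ hb1)] at h2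
    exact (dvd_add_left (hvB b hb0)).1 h2
  · have hres : ∀ b b' : B, IsLocalRing.residue (unitBall Ω) (ι b) =
        IsLocalRing.residue (unitBall Ω) (ι b') ↔ b - b' ∈ IsLocalRing.maximalIdeal B :=
      fun b b' ↦ by rw [residue_unitBall_eq_iff, hPmem]; rfl
    let φ : B ⧸ IsLocalRing.maximalIdeal B →+* IsLocalRing.ResidueField (unitBall Ω) :=
      Ideal.Quotient.lift _ ((IsLocalRing.residue (unitBall Ω)).comp ι) fun b hb ↦ by
        have := (hres b 0).2 (by simpa using hb)
        simpa using this
    let _ := Ideal.Quotient.field (IsLocalRing.maximalIdeal B)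
    have hφ : Function.Injective φ := φ.injective
    have hroot := pow_card_eq_self_iff_mem_range φ (Nat.one_lt_pow hf hp.out.one_lt) hcard
    let y : unitBall Ω := ⟨x, hx⟩
    have h1 : ‖x ^ p ^ f - x‖ < 1 ↔ IsLocalRing.residue (unitBall Ω) y ^ p ^ f =
        IsLocalRing.residue (unitBall Ω) y := by
      rw [← map_pow, residue_unitBall_eq_iff]; rfl
    rw [h1, hroot]
    constructor
    · rintro ⟨z, hz⟩
      obtain ⟨b, rfl⟩ := Ideal.Quotient.mk_surjective z
      exact ⟨(b : K), (b : K).2, (hB b).1 b.2, residue_unitBall_eq_iff.1 hz.symm⟩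
    · rintro ⟨c, hcK, hc, hxc⟩
      refine ⟨Ideal.Quotient.mk _ ⟨⟨c, hcK⟩, (hB _).2 hc⟩, ?_⟩
      exact (residue_unitBall_eq_iff (x := y).2 hxc).symm

end Local

/-! ### Endomorphisms of the residue field fixing a finite subfield -/

section ResidueFixed
variable {p : ℕ} {κ : Type*} [Field κ] [ExpChar κ p] {f : ℕ}

theorem eval_pow_of_coeff_pow {R : Polynomial κ} (h : ∀ i, R.coeff i ^ p ^ f = R.coeff i)
    (y : κ) : R.eval (y ^ p ^ f) = R.eval y ^ p ^ f := by
  have hR : R.map (iterateFrobenius κ p f) = R := by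
    ext i
    rw [Polynomial.coeff_map, iterateFrobenius_def, h]
  rw [← iterateFrobenius_def, ← iterateFrobenius_def]
  conv_lhs => rw [← hR]
  rw [Polynomial.eval_map, Polynomial.eval₂_at_apply]

/-- The polynomial $\prod_{i<N}(X-y^{q^i})$, $q=p^f$, is stable under the $q$-Frobenius, which
permutes its factors cyclically. So $g$ fixes its coefficients and $g(y)$ is a root of it. -/
theorem exists_eq_pow_pow_of_fixed {g : κ →+* κ} (hg : ∀ c, c ^ p ^ f = c → g c = c) {y : κ} {N : ℕ}
    (hN0 : N ≠ 0) (hN : y ^ (p ^ f) ^ N = y) : ∃ i : ℕ, g y = y ^ (p ^ f) ^ i := by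
  set S : Polynomial κ :=
    ∏ i ∈ Finset.range N, (Polynomial.X - Polynomial.C (y ^ (p ^ f) ^ i)) with hS
  have hSφ : S.map (iterateFrobenius κ p f) = S := by
    have e : S.map (iterateFrobenius κ p f) = ∏ i ∈ Finset.range N,
        (Polynomial.X - Polynomial.C (y ^ (p ^ f) ^ (i + 1))) := by
      rw [hS, Polynomial.map_prod]
      refine Finset.prod_congr rfl fun i _ ↦ ?_
      rw [Polynomial.map_sub, Polynomial.map_X, Polynomial.map_C, iterateFrobenius_def, ← pow_mul,
        ← pow_succ]
    rw [e]
    obtain ⟨M, rfl⟩ : ∃ M, N = M + 1 := ⟨N - 1, by omega⟩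
    rw [hS, Finset.prod_range_succ, Finset.prod_range_succ', hN, pow_zero, pow_one]
  have hSg : S.map g = S := by
    ext i
    rw [Polynomial.coeff_map]
    refine hg _ ?_
    have := congrArg (fun P ↦ Polynomial.coeff P i) hSφ
    simp only [Polynomial.coeff_map] at this
    rwa [iterateFrobenius_def] at this
  have hroot : S.eval (g y) = 0 := by
    conv_lhs => rw [← hSg]
    rw [Polynomial.eval_map, Polynomial.eval₂_at_apply]
    have : S.eval y = 0 := by
      rw [hS, Polynomial.eval_prod]
      exact Finset.prod_eq_zero (Finset.mem_range.2 (Nat.pos_of_ne_zero hN0)) (by simp)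
    rw [this, map_zero]
  rw [hS, Polynomial.eval_prod, Finset.prod_eq_zero_iff] at hroot
  obtain ⟨i, -, hi⟩ := hroot
  exact ⟨i, by simpa [sub_eq_zero] using hi⟩

end ResidueFixed

/-! ### Frobenius lifts and roots of unity of order prime to $p$ -/

section Frobenius
variable {p : ℕ} [hp : Fact p.Prime] {Ω : Type*} [NormedField Ω] [NormedAlgebra ℚ_[p] Ω]
  [Algebra.IsAlgebraic ℚ_[p] Ω] [IsUltrametricDist Ω]

omit [IsUltrametricDist Ω] in
theorem norm_eq_one_of_pow_eq_one' {x : Ω} {n : ℕ} (hn : n ≠ 0) (h : x ^ n = 1) : ‖x‖ = 1 := by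
  have := congrArg norm h
  rw [norm_pow, norm_one] at this
  exact (pow_eq_one_iff_of_nonneg (norm_nonneg _) hn).1 this

omit [Algebra.IsAlgebraic ℚ_[p] Ω] [IsUltrametricDist Ω] in
theorem norm_natCast_eq_one_of_coprime {n : ℕ} (hn : n.Coprime p) : ‖(n : Ω)‖ = 1 := by
  rw [← map_natCast (algebraMap ℚ_[p] Ω), norm_algebraMap', Padic.norm_natCast_eq_one_iff]
  exact hn.symm

/-- The residue field of an ultrametric normed field. -/
abbrev UnitBallResidue (Ω : Type*) [NormedField Ω] [IsUltrametricDist Ω] : Type _ :=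
  IsLocalRing.ResidueField (unitBall Ω)

/-- The ring endomorphism of the valuation ring induced by an automorphism. -/
noncomputable def unitBallMap (σ : Gal(Ω/ℚ_[p])) : unitBall Ω →+* unitBall Ω :=
  ((σ : Ω →+* Ω).comp (unitBall Ω).subtype).codRestrict (unitBall Ω).toSubring fun x ↦ by
    change ‖σ x‖ ≤ 1
    rw [norm_algEquiv_apply]
    exact x.2

theorem coe_unitBallMap (σ : Gal(Ω/ℚ_[p])) (x : unitBall Ω) :
    (unitBallMap σ x : Ω) = σ x := rfl

instance (σ : Gal(Ω/ℚ_[p])) : IsLocalHom (unitBallMap σ) where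
  map_nonunit x hx := by
    rw [isUnit_unitBall_iff, coe_unitBallMap, norm_algEquiv_apply] at hx
    exact isUnit_unitBall_iff.2 hx

variable (p Ω) in
omit [Algebra.IsAlgebraic ℚ_[p] Ω] in
theorem charP_residueField_unitBall : CharP (UnitBallResidue Ω) p := by
  have h := (residue_unitBall_eq_iff (x := (p : unitBall Ω)) (y := 0)).2 (by
    have : (((p : unitBall Ω) : Ω) - ((0 : unitBall Ω) : Ω)) = algebraMap ℚ_[p] Ω (p : ℚ_[p]) := by
      simp
    rw [this, norm_algebraMap']
    exact Padic.norm_p_lt_one)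
  have h' : (p : UnitBallResidue Ω) = 0 := by simpa using h
  exact (CharP.ringChar_of_prime_eq_zero hp.out h') ▸ ringChar.charP (UnitBallResidue Ω)

omit [Algebra.IsAlgebraic ℚ_[p] Ω] in
-- If $x\ne y$, then $\sum x^iy^{n-1-i}=0$. This sum reduces to $ny^{n-1}$, which is not zero in the
-- residue field.
theorem eq_of_norm_sub_lt_one {x y : Ω} {n : ℕ} (hn : n.Coprime p) (hn0 : n ≠ 0) (hx : x ^ n = 1)
    (hy : y ^ n = 1) (h : ‖x - y‖ < 1) : x = y := by
  by_contra hxy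
  have h1 : ∑ i ∈ Finset.range n, x ^ i * y ^ (n - 1 - i) = 0 := by
    have := Commute.geom_sum₂_mul (Commute.all x y) n
    rw [hx, hy, sub_self] at this
    exact (mul_eq_zero.1 this).resolve_right (sub_ne_zero.2 hxy)
  have hnx := norm_eq_one_of_pow_eq_one' hn0 hx
  have hny := norm_eq_one_of_pow_eq_one' hn0 hy
  let a : unitBall Ω := ⟨x, hnx.le⟩
  let b : unitBall Ω := ⟨y, hny.le⟩
  have hab := (residue_unitBall_eq_iff (x := a) (y := b)).2 h
  have h2 : ∑ i ∈ Finset.range n, a ^ i * b ^ (n - 1 - i) = 0 := Subtype.ext (by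
    push_cast; exact h1)
  have h3 := congrArg (IsLocalRing.residue (unitBall Ω)) h2
  rw [map_sum, map_zero, Finset.sum_congr rfl (g := fun _ ↦
    IsLocalRing.residue (unitBall Ω) b ^ (n - 1)) (fun i hi ↦ ?_)] at h3
  · rw [Finset.sum_const, Finset.card_range, nsmul_eq_mul, ← map_natCast
      (IsLocalRing.residue (unitBall Ω)), ← map_pow, ← map_mul, ← map_zero
      (IsLocalRing.residue (unitBall Ω)), residue_unitBall_eq_iff] at h3
    have : ‖(n : Ω) * y ^ (n - 1)‖ < 1 := by simpa using h3
    rw [norm_mul, norm_pow, hny, one_pow, mul_one, norm_natCast_eq_one_of_coprime hn] at this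
    exact lt_irrefl _ this
  · rw [map_mul, map_pow, map_pow, hab, ← pow_add]
    congr 1
    have := Finset.mem_range.1 hi
    omega

variable {K : IntermediateField ℚ_[p] Ω} {f : ℕ}

omit [Algebra.IsAlgebraic ℚ_[p] Ω] in
theorem residue_pow_eq_self_iff
    (hR : ∀ x : Ω, ‖x‖ ≤ 1 → (‖x ^ p ^ f - x‖ < 1 ↔ ∃ c ∈ K, ‖c‖ ≤ 1 ∧ ‖x - c‖ < 1))
    (x : IsLocalRing.ResidueField (unitBall Ω)) :
    x ^ p ^ f = x ↔ ∃ c : unitBall Ω, (c : Ω) ∈ K ∧ IsLocalRing.residue _ c = x := by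
  obtain ⟨y, rfl⟩ := IsLocalRing.residue_surjective x
  rw [← map_pow, residue_unitBall_eq_iff]
  refine (hR y y.2).trans ⟨?_, ?_⟩
  · rintro ⟨c, hc, hc1, h⟩
    exact ⟨⟨c, hc1⟩, hc, (residue_unitBall_eq_iff.2 h).symm⟩
  · rintro ⟨c, hc, h⟩
    exact ⟨c, hc, c.2, residue_unitBall_eq_iff.1 h.symm⟩

/-- The action of $\sigma$ on the residue field fixes that of $K$, so it sends the reduction of $x$
to a $p^{fi}$-th power. Roots of unity of order prime to $p$ are determined by their reductions. -/
theorem exists_apply_eq_pow_pow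
    (hR : ∀ x : Ω, ‖x‖ ≤ 1 → (‖x ^ p ^ f - x‖ < 1 ↔ ∃ c ∈ K, ‖c‖ ≤ 1 ∧ ‖x - c‖ < 1))
    {σ : Gal(Ω/ℚ_[p])} (hσ : σ ∈ K.fixingSubgroup) {n : ℕ} (hn : n.Coprime p) (hn0 : n ≠ 0)
    {x : Ω} (hx : x ^ n = 1) : ∃ i : ℕ, σ x = x ^ (p ^ f) ^ i := by
  have := charP_residueField_unitBall p Ω
  have hnx := norm_eq_one_of_pow_eq_one' hn0 hx
  let a : unitBall Ω := ⟨x, hnx.le⟩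
  set y : UnitBallResidue Ω := IsLocalRing.residue _ a with hy
  have hyn : y ^ n = 1 := by
    rw [hy, ← map_pow, ← map_one (IsLocalRing.residue (unitBall Ω))]
    exact congrArg _ (Subtype.ext hx)
  have hN : y ^ (p ^ f) ^ n.totient = y := by
    have h1 : (p ^ f) ^ n.totient ≡ 1 [MOD n] := Nat.ModEq.pow_totient (hn.symm.pow_left f)
    rw [pow_eq_pow_mod _ hyn, h1, ← pow_eq_pow_mod _ hyn, pow_one]
  have hN0 : n.totient ≠ 0 := (Nat.totient_pos.2 (Nat.pos_of_ne_zero hn0)).ne'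
  obtain ⟨i, hi⟩ := exists_eq_pow_pow_of_fixed
    (g := IsLocalRing.ResidueField.map (unitBallMap σ)) (fun c hc ↦ by
      obtain ⟨c, hcK, rfl⟩ := (residue_pow_eq_self_iff hR _).1 hc
      change IsLocalRing.residue _ (unitBallMap σ c) = _
      congr 1
      exact Subtype.ext ((IntermediateField.mem_fixingSubgroup_iff _ _).1 hσ _ hcK)) hN0 hN
  refine ⟨i, eq_of_norm_sub_lt_one hn hn0 (by rw [← map_pow, hx, map_one])
    (by rw [← pow_mul, mul_comm, pow_mul, hx, one_pow]) ?_⟩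
  have h3 : IsLocalRing.residue _ (unitBallMap σ a) = IsLocalRing.residue _ (a ^ (p ^ f) ^ i) := by
    rw [map_pow, ← hy, ← hi]
    rfl
  exact residue_unitBall_eq_iff.1 h3

/-- Let $P$ be the polynomial whose roots are the $G_K$-conjugates of a primitive $n$-th root $\xi$.
Its reduction has coefficients fixed by the $p^f$-power map, so the reduction of $\xi^{p^f}$ is one
of its roots, and $\xi^{p^f}$ is a conjugate of $\xi$. -/
theorem exists_apply_eq_pow [IsAlgClosed Ω]
    (hR : ∀ x : Ω, ‖x‖ ≤ 1 → (‖x ^ p ^ f - x‖ < 1 ↔ ∃ c ∈ K, ‖c‖ ≤ 1 ∧ ‖x - c‖ < 1))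
    {n : ℕ} (hn : n.Coprime p) (hn0 : n ≠ 0) :
    ∃ σ ∈ K.fixingSubgroup, ∀ x : Ω, x ^ n = 1 → σ x = x ^ p ^ f := by
  classical
  have := charP_residueField_unitBall p Ω
  have : CharZero Ω := charZero_of_injective_algebraMap (algebraMap ℚ_[p] Ω).injective
  have : IsAlgClosure ℚ_[p] Ω := ⟨inferInstance, inferInstance⟩
  have : Normal ℚ_[p] Ω := IsAlgClosure.normal ℚ_[p] Ω
  have hgal : IsGalois ℚ_[p] Ω := ⟨⟩
  have : NeZero n := ⟨hn0⟩
  have hnn : NeZero (n : Ω) := ⟨Nat.cast_ne_zero.2 hn0⟩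
  obtain ⟨ξ, hξ⟩ := HasEnoughRootsOfUnity.exists_primitiveRoot Ω n
  have hnx := norm_eq_one_of_pow_eq_one' hn0 hξ.pow_eq_one
  let a : unitBall Ω := ⟨ξ, hnx.le⟩
  let T : Finset (unitBall Ω) := (Polynomial.nthRootsFinset n (1 : unitBall Ω)).filter
    fun z ↦ ∃ σ ∈ K.fixingSubgroup, σ ξ = z
  have hT : ∀ z, z ∈ T ↔ z ^ n = 1 ∧ ∃ σ ∈ K.fixingSubgroup, σ ξ = z := fun z ↦ by
    rw [Finset.mem_filter, Polynomial.mem_nthRootsFinset (Nat.pos_of_ne_zero hn0)]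
  let P : Polynomial (unitBall Ω) := ∏ z ∈ T, (Polynomial.X - Polynomial.C z)
  have hPσ : ∀ σ ∈ K.fixingSubgroup, P.map (unitBallMap σ) = P := by
    intro σ hσ
    have e : T.image (unitBallMap σ) = T := by
      refine Finset.eq_of_subset_of_card_le ?_ ?_
      · intro w hw
        obtain ⟨z, hz, rfl⟩ := Finset.mem_image.1 hw
        obtain ⟨hz1, τ, hτ, hτz⟩ := (hT z).1 hz
        exact (hT _).2 ⟨by rw [← map_pow, hz1, map_one], σ * τ, mul_mem hσ hτ, by
          rw [coe_unitBallMap, ← hτz]; rfl⟩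
      · rw [Finset.card_image_of_injective]
        intro u v huv
        exact Subtype.ext (σ.injective (congrArg Subtype.val huv))
    simp only [P, Polynomial.map_prod, Polynomial.map_sub, Polynomial.map_X, Polynomial.map_C]
    conv_rhs => rw [← e]
    rw [Finset.prod_image]
    intro u _ v _ huv
    exact Subtype.ext (σ.injective (congrArg Subtype.val huv))
  have hPK : ∀ i, (P.coeff i : Ω) ∈ K := by
    intro i
    rw [← InfiniteGalois.fixedField_fixingSubgroup K, IntermediateField.mem_fixedField_iff]
    intro σ hσ
    have := congrArg (fun P ↦ Polynomial.coeff P i) (hPσ σ hσ)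
    simp only [Polynomial.coeff_map] at this
    exact congrArg Subtype.val this
  set R := P.map (IsLocalRing.residue (unitBall Ω)) with hRdef
  have hRφ : ∀ i, R.coeff i ^ p ^ f = R.coeff i := by
    intro i
    rw [residue_pow_eq_self_iff hR, hRdef, Polynomial.coeff_map]
    exact ⟨_, hPK i, rfl⟩
  have haT : a ∈ T := (hT a).2 ⟨Subtype.ext hξ.pow_eq_one, 1, one_mem _, rfl⟩
  have hReval : ∀ u : UnitBallResidue Ω, R.eval u = ∏ z ∈ T, (u - IsLocalRing.residue _ z) := fun u ↦ by
    simp only [hRdef, P, Polynomial.map_prod, Polynomial.map_sub, Polynomial.map_X,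
      Polynomial.map_C, Polynomial.eval_prod, Polynomial.eval_sub, Polynomial.eval_X,
      Polynomial.eval_C]
  have hroot : R.eval (IsLocalRing.residue _ a ^ p ^ f) = 0 := by
    rw [eval_pow_of_coeff_pow hRφ, hReval, Finset.prod_eq_zero haT (sub_self (IsLocalRing.residue _ a)),
      zero_pow (pow_ne_zero _ hp.out.ne_zero)]
  rw [hReval, Finset.prod_eq_zero_iff] at hroot
  obtain ⟨z, hz, hz0⟩ := hroot
  obtain ⟨hz1, σ, hσ, hσz⟩ := (hT z).1 hz
  rw [sub_eq_zero, ← map_pow] at hz0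
  have key : ξ ^ p ^ f = z := eq_of_norm_sub_lt_one hn hn0
    (by rw [← pow_mul, mul_comm, pow_mul, hξ.pow_eq_one, one_pow])
    (by rw [← hσz, ← map_pow, hξ.pow_eq_one, map_one]) (residue_unitBall_eq_iff.1 hz0)
  refine ⟨σ, hσ, fun x hx ↦ ?_⟩
  obtain ⟨i, -, rfl⟩ := hξ.eq_pow_of_pow_eq_one hx
  rw [map_pow, hσz, ← key, ← pow_mul, ← pow_mul, mul_comm]

end Frobenius

/-! ### Logarithmic and ordinary inertia degrees for $p\ne\ell$ -/

section AwayFromResidueChar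
variable {p : ℕ} [hp : Fact p.Prime] {Ω : Type*} [NormedField Ω] [NormedAlgebra ℚ_[p] Ω]
  [Algebra.IsAlgebraic ℚ_[p] Ω] [IsUltrametricDist Ω] [IsAlgClosed Ω]
  {K : IntermediateField ℚ_[p] Ω} {f : ℕ} {ℓ : ℕ} [hℓ : Fact ℓ.Prime]

theorem exists_norm_pow_lt {x : ℝ} (hx : 0 < x) : ∃ n : ℕ, ‖(ℓ : ℚ_[ℓ]) ^ n‖ < x := by
  obtain ⟨n, hn⟩ := exists_pow_lt_of_lt_one hx (Padic.norm_p_lt_one (p := ℓ))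
  exact ⟨n, by rwa [norm_pow]⟩

/-- On a primitive $\ell^n$-th root of unity an element of $G_K$ acts as $p^{fi}$, so its logarithm
is $i f\operatorname{Log}p$ up to an error of size $\|\ell^n\|$. -/
theorem exists_logChar_eq_norm_of_ne (hpℓ : p ≠ ℓ) (hf : f ≠ 0)
    (hR : ∀ x : Ω, ‖x‖ ≤ 1 → (‖x ^ p ^ f - x‖ < 1 ↔ ∃ c ∈ K, ‖c‖ ≤ 1 ∧ ‖x - c‖ < 1)) :
    (∃ σ ∈ K.fixingSubgroup, ‖logChar ℚ_[p] Ω ℓ σ‖ = ‖(f : ℚ_[ℓ]) * iwasawaLog ℓ p‖) ∧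
      ∀ σ ∈ K.fixingSubgroup, ‖logChar ℚ_[p] Ω ℓ σ‖ ≤ ‖(f : ℚ_[ℓ]) * iwasawaLog ℓ p‖ := by
  have : CharZero Ω := charZero_of_injective_algebraMap (algebraMap ℚ_[p] Ω).injective
  have hp0 : (p : ℚ_[ℓ]) ≠ 0 := by exact_mod_cast hp.out.ne_zero
  have hlp : iwasawaLog ℓ (p : ℚ_[ℓ]) ≠ 0 := iwasawaLog_natCast_ne_zero hp.out hpℓ
  have hx0 : (f : ℚ_[ℓ]) * iwasawaLog ℓ p ≠ 0 := mul_ne_zero (by exact_mod_cast hf) hlp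
  -- The level is high enough for the error to be negligible against $f\operatorname{Log}p$ and to
  -- stay where the logarithm is isometric.
  obtain ⟨n, hn⟩ := exists_norm_pow_lt (ℓ := ℓ) (lt_min (norm_pos_iff.2 hx0)
    (norm_pos_iff.2 (show (logConductor ℓ : ℚ_[ℓ]) ≠ 0 by exact_mod_cast logConductor_ne_zero)))
  obtain ⟨hn1, hn2⟩ := lt_min_iff.1 hn
  have hcop : (ℓ ^ n).Coprime p := ((Nat.coprime_primes hℓ.out hp.out).2 hpℓ.symm).pow_left n
  obtain ⟨ζ, hζ⟩ := HasEnoughRootsOfUnity.exists_primitiveRoot Ω (ℓ ^ n)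
  have hpn : ‖(p : ℚ_[ℓ])‖ = 1 := norm_natCast_of_prime_ne hp.out hpℓ
  have key : ∀ σ : Gal(Ω/ℚ_[p]), ∀ i : ℕ, σ ζ = ζ ^ (p ^ f) ^ i →
      ‖logChar ℚ_[p] Ω ℓ σ - i * ((f : ℚ_[ℓ]) * iwasawaLog ℓ p)‖ ≤ ‖(ℓ : ℚ_[ℓ]) ^ n‖ := by
    intro σ i hi
    have h1 := norm_cyclotomicCharacter_sub_le ℓ hζ hi
    have h2 : iwasawaLog ℓ (((p ^ f) ^ i : ℕ) : ℚ_[ℓ]) = i * ((f : ℚ_[ℓ]) * iwasawaLog ℓ p) := by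
      push_cast
      rw [iwasawaLog_pow (pow_ne_zero _ hp0), iwasawaLog_pow hp0]
    rw [← h2]
    refine (norm_iwasawaLog_sub_le ?_ (h1.trans hn2.le)).trans_le h1
    push_cast
    rw [norm_pow, norm_pow, hpn, one_pow, one_pow]
  constructor
  · obtain ⟨σ, hσ, h⟩ := exists_apply_eq_pow hR hcop (pow_ne_zero _ hℓ.out.ne_zero)
    refine ⟨σ, hσ, ?_⟩
    have h1 := key σ 1 (by rw [pow_one]; exact h ζ hζ.pow_eq_one)
    rw [Nat.cast_one, one_mul] at h1
    have h2 := h1.trans_lt hn1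
    have h3 := IsUltrametricDist.norm_add_eq_max_of_norm_ne_norm h2.ne
    rw [sub_add_cancel] at h3
    rw [h3, max_eq_right h2.le]
  · intro σ hσ
    obtain ⟨i, hi⟩ := exists_apply_eq_pow_pow hR hσ hcop (pow_ne_zero _ hℓ.out.ne_zero)
      hζ.pow_eq_one
    have h1 := (key σ i hi).trans hn1.le
    have h2 : ‖(i : ℚ_[ℓ]) * ((f : ℚ_[ℓ]) * iwasawaLog ℓ p)‖ ≤
        ‖(f : ℚ_[ℓ]) * iwasawaLog ℓ p‖ := by
      rw [norm_mul]
      refine mul_le_of_le_one_left (norm_nonneg _) ?_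
      exact_mod_cast Padic.norm_int_le_one (i : ℤ)
    have h3 := IsUltrametricDist.norm_add_le_max
      (logChar ℚ_[p] Ω ℓ σ - i * ((f : ℚ_[ℓ]) * iwasawaLog ℓ p))
      (i * ((f : ℚ_[ℓ]) * iwasawaLog ℓ p))
    rw [sub_add_cancel] at h3
    exact h3.trans (max_le h1 h2)

theorem norm_pow_sub_self_lt_one_iff (x : Ω) (hx : ‖x‖ ≤ 1) : ‖x ^ p ^ 1 - x‖ < 1 ↔
    ∃ c ∈ (⊥ : IntermediateField ℚ_[p] Ω), ‖c‖ ≤ 1 ∧ ‖x - c‖ < 1 := by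
  obtain ⟨f, hf, h1, -, h2⟩ := exists_residueDegree (⊥ : IntermediateField ℚ_[p] Ω)
  have : f = 1 := by
    have h0 : (p : ℚ_[p]) ≠ 0 := by exact_mod_cast hp.out.ne_zero
    have h := h1 (algebraMap ℚ_[p] _ (p : ℚ_[p])) ((map_ne_zero _).2 h0)
    rw [Algebra.norm_algebraMap, IntermediateField.finrank_bot, pow_one, Padic.valuation_p] at h
    exact Nat.dvd_one.1 (by exact_mod_cast h)
  exact (this ▸ h2) x hx

/-- The largest logarithms over $K$ and over $\mathbb Q_p$ have the norms of $f\operatorname{Log}p$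
and $\operatorname{Log}p$; their quotient is the $\ell$-part of $\tilde f$. -/
theorem norm_logInertia_eq_of_ne [FiniteDimensional ℚ_[p] K] (hpℓ : p ≠ ℓ) (hf : f ≠ 0)
    (hR : ∀ x : Ω, ‖x‖ ≤ 1 → (‖x ^ p ^ f - x‖ < 1 ↔ ∃ c ∈ K, ‖c‖ ≤ 1 ∧ ‖x - c‖ < 1)) :
    ‖(Module.finrank ℚ_[p] (K ⊓ cyclotomicZHat ℚ_[p] Ω : IntermediateField ℚ_[p] Ω) : ℚ_[ℓ])‖ =
      ‖(f : ℚ_[ℓ])‖ := by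
  have : CharZero Ω := charZero_of_injective_algebraMap (algebraMap ℚ_[p] Ω).injective
  have : IsAlgClosure ℚ_[p] Ω := ⟨inferInstance, inferInstance⟩
  have : Normal ℚ_[p] Ω := IsAlgClosure.normal ℚ_[p] Ω
  have hgal : IsGalois ℚ_[p] Ω := ⟨⟩
  have hlp : iwasawaLog ℓ (p : ℚ_[ℓ]) ≠ 0 := iwasawaLog_natCast_ne_zero hp.out hpℓ
  obtain ⟨⟨σ₀, -, e₀⟩, h₀⟩ := exists_logChar_eq_norm_of_ne (ℓ := ℓ) hpℓ one_ne_zero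
    (norm_pow_sub_self_lt_one_iff (p := p) (Ω := Ω))
  obtain ⟨⟨σ₁, hσ₁, e₁⟩, h₁⟩ := exists_logChar_eq_norm_of_ne (ℓ := ℓ) hpℓ hf hR
  rw [← e₀] at h₀
  rw [← e₁] at h₁
  have h0 : logChar ℚ_[p] Ω ℓ σ₁ ≠ 0 := by
    rw [← norm_ne_zero_iff, e₁, norm_ne_zero_iff]
    exact mul_ne_zero (by exact_mod_cast hf) hlp
  have h := (logInertia_aux ℓ K (fun τ ↦ h₀ τ (by
    rw [IntermediateField.fixingSubgroup_bot]; trivial)) hσ₁ h₁ h0).1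
  rw [e₀, e₁, norm_mul, norm_mul, Nat.cast_one, norm_one, one_mul] at h
  exact mul_right_cancel₀ (norm_ne_zero_iff.2 hlp) h

end AwayFromResidueChar

/-! ### The norm operator on polynomials and its congruences -/

section NormOperator
open Polynomial
variable {A : Type*} [CommRing A] [IsDomain A] {ℓ : ℕ} [hℓ : Fact ℓ.Prime]

theorem mem_roots_prime {x : A} : x ∈ nthRootsFinset ℓ (1 : A) ↔ x ^ ℓ = 1 :=
  mem_nthRootsFinset hℓ.out.pos _

variable (ℓ) in
/-- The product of the polynomials `g (ε X)` over the `ℓ`-th roots of unity `ε`. -/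
noncomputable def rootProd (g : A[X]) : A[X] :=
  ∏ ε ∈ nthRootsFinset ℓ (1 : A), g.comp (C ε * X)

variable (ℓ) in
/-- The norm operator: `normOp g (X ^ ℓ)` is the product of the `g (ε X)` over the `ℓ`-th roots of
unity `ε`. -/
noncomputable def normOp (g : A[X]) : A[X] := contract ℓ (rootProd ℓ g)

omit [IsDomain A] in
theorem comp_scale_comp_scale (g : A[X]) (a b : A) :
    (g.comp (C a * X)).comp (C b * X) = g.comp (C (a * b) * X) := by
  rw [comp_assoc, mul_comp, C_comp, X_comp, ← mul_assoc, ← C_mul]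

theorem prod_roots_mul {M : Type*} [CommMonoid M] {ε : A} (hε : ε ^ ℓ = 1) (F : A → M) :
    ∏ x ∈ nthRootsFinset ℓ (1 : A), F (x * ε) = ∏ x ∈ nthRootsFinset ℓ (1 : A), F x := by
  have h1 : ε * ε ^ (ℓ - 1) = 1 := by
    rw [← pow_succ', Nat.sub_add_cancel hℓ.out.one_le, hε]
  refine Finset.prod_nbij' (· * ε) (· * ε ^ (ℓ - 1)) ?_ ?_ ?_ ?_ ?_
  · intro x hx
    rw [mem_roots_prime] at hx ⊢
    rw [mul_pow, hx, hε, one_mul]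
  · intro x hx
    rw [mem_roots_prime] at hx ⊢
    rw [mul_pow, hx, ← pow_mul, mul_comm (ℓ - 1), pow_mul, hε, one_pow, one_mul]
  · intro x _
    rw [mul_assoc, h1, mul_one]
  · intro x _
    rw [mul_assoc, mul_comm (ε ^ _), h1, mul_one]
  · intro x _; rfl

theorem rootProd_comp_scale (g : A[X]) {ε : A} (hε : ε ^ ℓ = 1) :
    (rootProd ℓ g).comp (C ε * X) = rootProd ℓ g := by
  unfold rootProd
  rw [Polynomial.prod_comp]
  simp only [comp_scale_comp_scale]
  exact prod_roots_mul hε fun x ↦ g.comp (C x * X)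

variable {ε₀ : A} (hε₀ : IsPrimitiveRoot ε₀ ℓ)
include hε₀

/-- Invariance of the product under $X\mapsto\varepsilon_0X$ kills all coefficients of index prime
to $\ell$. -/
theorem expand_normOp (g : A[X]) : expand A ℓ (normOp ℓ g) = rootProd ℓ g := by
  ext n
  rw [coeff_expand hℓ.out.pos, normOp]
  split_ifs with h
  · rw [coeff_contract hℓ.out.ne_zero, Nat.div_mul_cancel h]
  · have h1 := congrArg (fun P ↦ coeff P n) (rootProd_comp_scale g hε₀.pow_eq_one)
    simp only [comp_C_mul_X_coeff] at h1
    have h2 : ε₀ ^ n - 1 ≠ 0 := sub_ne_zero.2 fun h2 ↦ h (hε₀.dvd_of_pow_eq_one n h2)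
    have h3 : (rootProd ℓ g).coeff n * (ε₀ ^ n - 1) = 0 := by linear_combination h1
    exact ((mul_eq_zero.1 h3).resolve_right h2).symm

theorem eval_normOp (g : A[X]) (c : A) :
    (normOp ℓ g).eval (c ^ ℓ) = ∏ ε ∈ nthRootsFinset ℓ (1 : A), g.eval (ε * c) := by
  rw [← expand_eval, expand_normOp hε₀, rootProd, eval_prod]
  simp

theorem dvd_sum_roots_pow (n : ℕ) : (ℓ : A) ∣ ∑ ε ∈ nthRootsFinset ℓ (1 : A), ε ^ n := by
  by_cases h : ℓ ∣ n
  · obtain ⟨k, rfl⟩ := h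
    rw [Finset.sum_congr rfl (g := fun _ ↦ (1 : A)) fun x hx ↦ by
      rw [pow_mul, mem_roots_prime.1 hx, one_pow], Finset.sum_const, hε₀.card_nthRootsFinset,
      nsmul_eq_mul, mul_one]
  · have h1 : (∑ ε ∈ nthRootsFinset ℓ (1 : A), ε ^ n) * (ε₀ ^ n - 1) = 0 := by
      rw [mul_sub, mul_one, sub_eq_zero, Finset.sum_mul]
      simp only [← mul_pow]
      exact prod_roots_mul (M := Multiplicative A) hε₀.pow_eq_one
        fun x ↦ Multiplicative.ofAdd (x ^ n)
    have h2 : ε₀ ^ n - 1 ≠ 0 := sub_ne_zero.2 fun h2 ↦ h (hε₀.dvd_of_pow_eq_one n h2)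
    rw [(mul_eq_zero.1 h1).resolve_right h2]
    exact dvd_zero _

/-- Each application of the operator gains a factor $\ell$. Expanding
$\prod_\varepsilon(h+\ell^kB)(\varepsilon X)$ in powers of $\ell^k$, the linear coefficient is a sum
of one polynomial over all rotations, hence divisible by $\ell$. The rest is divisible by
$\ell^{2k}$, and $2k\ge k+1$. -/
theorem pow_dvd_normOp_sub {g h : A[X]} {k : ℕ} (hk : k ≠ 0) (H : (ℓ : A[X]) ^ k ∣ g - h) :
    (ℓ : A[X]) ^ (k + 1) ∣ normOp ℓ g - normOp ℓ h := by
  classical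
  obtain ⟨B, hB⟩ := H
  have hg : g = h + (ℓ : A[X]) ^ k * B := by rw [← hB]; ring
  set μ := nthRootsFinset ℓ (1 : A) with hμ
  have key : (ℓ : A[X]) ^ (k + 1) ∣ rootProd ℓ g - rootProd ℓ h := by
    -- An auxiliary variable replaces $\ell^k$: the values of $P$ at $\ell^k$ and $0$ are the two
    -- products, and its derivative at $0$ is the linear coefficient.
    let P : A[X][X] := ∏ ε ∈ μ, (C (h.comp (C ε * X)) + C (B.comp (C ε * X)) * X)
    obtain ⟨R, hR⟩ := P.binomExpansion 0 ((ℓ : A[X]) ^ k)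
    have e1 : P.eval (0 + (ℓ : A[X]) ^ k) = rootProd ℓ g := by
      simp only [P, eval_prod, rootProd, hg]
      refine Finset.prod_congr rfl fun ε _ ↦ ?_
      simp only [eval_add, eval_mul, eval_C, eval_X, zero_add, add_comp, mul_comp, pow_comp,
        natCast_comp]
      ring
    have e2 : P.eval 0 = rootProd ℓ h := by
      simp only [P, eval_prod, rootProd]
      refine Finset.prod_congr rfl fun ε _ ↦ ?_
      simp
    let Q : A[X] := B * ∏ ε ∈ μ.erase 1, h.comp (C ε * X)
    have e3 : P.derivative.eval 0 = ∑ ε ∈ μ, Q.comp (C ε * X) := by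
      rw [derivative_prod_finset, eval_finsetSum]
      refine Finset.sum_congr rfl fun ε hε ↦ ?_
      have hε1 : ε ^ ℓ = 1 := mem_roots_prime.1 hε
      have e4 : ∏ x ∈ μ.erase ε, h.comp (C x * X) =
          ∏ x ∈ μ.erase 1, h.comp (C (x * ε) * X) := by
        rw [← Finset.filter_ne', ← Finset.filter_ne', Finset.prod_filter, Finset.prod_filter,
          ← prod_roots_mul hε1]
        refine Finset.prod_congr rfl fun x _ ↦ ?_
        have hε0 : ε ≠ 0 := by
          rintro rfl
          rw [zero_pow hℓ.out.ne_zero] at hε1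
          exact zero_ne_one hε1
        have : x * ε = ε ↔ x = 1 := by rw [mul_eq_right₀ hε0]
        simp only [ne_eq, this]
      simp only [Q, mul_comp, Polynomial.prod_comp, comp_scale_comp_scale]
      simp only [eval_mul, eval_prod, eval_add, eval_C, eval_X, mul_zero, add_zero,
        derivative_add, derivative_C, derivative_mul, derivative_X, zero_add, zero_mul, mul_one]
      rw [e4, mul_comm]
    have e5 : (ℓ : A[X]) ∣ ∑ ε ∈ μ, Q.comp (C ε * X) := by
      rw [← map_natCast (C : A →+* A[X]), C_dvd_iff_dvd_coeff]
      intro n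
      rw [finsetSum_coeff]
      simp only [comp_C_mul_X_coeff, ← Finset.mul_sum]
      exact (dvd_sum_roots_pow hε₀ n).mul_left _
    rw [e1, e2, e3] at hR
    have e6 : rootProd ℓ g - rootProd ℓ h =
        (ℓ : A[X]) ^ k * (∑ ε ∈ μ, Q.comp (C ε * X)) + R * ((ℓ : A[X]) ^ k) ^ 2 := by
      rw [hR]; ring
    rw [e6]
    refine dvd_add ?_ ?_
    · rw [pow_succ]
      exact mul_dvd_mul_left _ e5
    · rw [← pow_mul]
      exact (pow_dvd_pow _ (by omega)).mul_left _
  rw [← expand_normOp hε₀, ← expand_normOp hε₀] at key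
  rw [← Nat.cast_pow, ← map_natCast (C : A →+* A[X]), C_dvd_iff_dvd_coeff] at key ⊢
  intro n
  have := key (n * ℓ)
  rwa [coeff_sub, coeff_expand_mul hℓ.out.pos, coeff_expand_mul hℓ.out.pos, ← coeff_sub] at this

theorem pow_dvd_iterate_normOp_sub {g h : A[X]} (H : (ℓ : A[X]) ∣ g - h) (i : ℕ) :
    (ℓ : A[X]) ^ (i + 1) ∣ (normOp ℓ)^[i] g - (normOp ℓ)^[i] h := by
  induction i with
  | zero => simpa using H
  | succ i ih =>
    rw [Function.iterate_succ_apply', Function.iterate_succ_apply']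
    exact pow_dvd_normOp_sub hε₀ i.succ_ne_zero ih

variable (ℓ) in
omit hℓ hε₀ in
/-- The product of the values of `g` at the `ℓ ^ i`-th roots of unity. -/
noncomputable def rootsEval (g : A[X]) (i : ℕ) : A :=
  ∏ ξ ∈ nthRootsFinset (ℓ ^ i) (1 : A), g.eval ξ

omit hε₀ in
theorem mem_roots_prime_pow {x : A} {i : ℕ} : x ∈ nthRootsFinset (ℓ ^ i) (1 : A) ↔ x ^ ℓ ^ i = 1 :=
  mem_nthRootsFinset (pow_pos hℓ.out.pos _) _

/-- The $\ell^{i+1}$-th roots of unity are grouped by their $\ell$-th powers. Over a fibre, the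
product of the values of $g$ is the value of `normOp` of $g$ at the common power. -/
theorem rootsEval_succ (hroot : ∀ c : A, ∃ d, d ^ ℓ = c) (g : A[X]) (i : ℕ) :
    rootsEval ℓ g (i + 1) = rootsEval ℓ (normOp ℓ g) i := by
  classical
  unfold rootsEval
  rw [← Finset.prod_fiberwise_of_maps_to (t := nthRootsFinset (ℓ ^ i) (1 : A)) (g := fun x ↦ x ^ ℓ)
    (fun x hx ↦ by
      rw [mem_roots_prime_pow] at hx ⊢
      rw [← pow_mul, ← pow_succ', hx])]
  refine Finset.prod_congr rfl fun ξ hξ ↦ ?_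
  obtain ⟨c, rfl⟩ := hroot ξ
  rw [mem_roots_prime_pow] at hξ
  have hc0 : c ≠ 0 := by
    rintro rfl
    rw [zero_pow hℓ.out.ne_zero, zero_pow (pow_ne_zero _ hℓ.out.ne_zero)] at hξ
    exact zero_ne_one hξ
  rw [eval_normOp hε₀]
  symm
  refine Finset.prod_bij (fun ε _ ↦ ε * c) ?_ ?_ ?_ ?_
  · intro ε hε
    rw [mem_roots_prime] at hε
    rw [Finset.mem_filter, mem_roots_prime_pow, mul_pow, mul_pow, hε, one_mul]
    refine ⟨?_, rfl⟩
    rw [pow_succ', pow_mul, hε, one_pow, one_mul, pow_mul, hξ]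
  · intro a _ b _ hab
    exact mul_right_cancel₀ hc0 hab
  · intro b hb
    rw [Finset.mem_filter] at hb
    have h1 : b ∈ nthRoots ℓ (c ^ ℓ) := (mem_nthRoots hℓ.out.pos).2 hb.2
    rw [hε₀.nthRoots_eq rfl, Multiset.mem_map] at h1
    obtain ⟨j, -, hj⟩ := h1
    exact ⟨ε₀ ^ j, mem_roots_prime.2 (by rw [← pow_mul, mul_comm, pow_mul, hε₀.pow_eq_one,
      one_pow]), hj⟩
  · intro a _; rfl

theorem rootsEval_eq_eval_iterate (hroot : ∀ c : A, ∃ d, d ^ ℓ = c) (g : A[X]) (i : ℕ) :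
    rootsEval ℓ g i = ((normOp ℓ)^[i] g).eval 1 := by
  induction i generalizing g with
  | zero =>
    have : nthRootsFinset (ℓ ^ 0) (1 : A) = {1} := by
      ext x
      rw [mem_roots_prime_pow, Finset.mem_singleton, pow_zero, pow_one]
    rw [rootsEval, this, Finset.prod_singleton]
    rfl
  | succ i ih => rw [rootsEval_succ hε₀ hroot, ih, Function.iterate_succ_apply]

theorem pow_dvd_rootsEval_sub (hroot : ∀ c : A, ∃ d, d ^ ℓ = c) {g h : A[X]}
    (H : (ℓ : A[X]) ∣ g - h) (i : ℕ) :
    (ℓ : A) ^ (i + 1) ∣ rootsEval ℓ g i - rootsEval ℓ h i := by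
  rw [rootsEval_eq_eval_iterate hε₀ hroot, rootsEval_eq_eval_iterate hε₀ hroot, ← eval_sub]
  obtain ⟨B, hB⟩ := pow_dvd_iterate_normOp_sub hε₀ H i
  rw [hB, eval_mul]
  simp

end NormOperator

/-! ### The norm operator over unramified coefficients -/

section NormOperatorLocal
open Polynomial
variable {ℓ : ℕ} [hℓ : Fact ℓ.Prime] {Ω : Type*} [NormedField Ω] [NormedAlgebra ℚ_[ℓ] Ω]
  [Algebra.IsAlgebraic ℚ_[ℓ] Ω] [IsUltrametricDist Ω]

variable (ℓ Ω) in
omit [Algebra.IsAlgebraic ℚ_[ℓ] Ω] [IsUltrametricDist Ω] in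
theorem norm_prime : ‖(ℓ : Ω)‖ = ‖(ℓ : ℚ_[ℓ])‖ := by
  rw [← map_natCast (algebraMap ℚ_[ℓ] Ω), norm_algebraMap']

omit [Algebra.IsAlgebraic ℚ_[ℓ] Ω] in
theorem pow_dvd_unitBall_iff {x : unitBall Ω} {k : ℕ} :
    (ℓ : unitBall Ω) ^ k ∣ x ↔ ‖(x : Ω)‖ ≤ ‖(ℓ : ℚ_[ℓ])‖ ^ k := by
  have hl0 : (ℓ : Ω) ≠ 0 := by
    rw [← norm_ne_zero_iff, norm_prime ℓ Ω, norm_ne_zero_iff]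
    exact_mod_cast hℓ.out.ne_zero
  constructor
  · rintro ⟨y, rfl⟩
    push_cast
    rw [norm_mul, norm_pow, norm_prime ℓ Ω]
    exact mul_le_of_le_one_right (pow_nonneg (norm_nonneg _) _) y.2
  · intro h
    refine ⟨⟨x / (ℓ : Ω) ^ k, mem_unitBall.2 ?_⟩, Subtype.ext ?_⟩
    · rw [norm_div, norm_pow, norm_prime ℓ Ω]
      exact div_le_one_of_le₀ h (pow_nonneg (norm_nonneg _) _)
    · push_cast
      rw [mul_div_cancel₀ _ (pow_ne_zero _ hl0)]

theorem rootsEval_map (φ : Gal(Ω/ℚ_[ℓ])) (g : (unitBall Ω)[X]) (i : ℕ) :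
    rootsEval ℓ (g.map (unitBallMap φ)) i = unitBallMap φ (rootsEval ℓ g i) := by
  unfold rootsEval
  rw [map_prod]
  refine (Finset.prod_bij (fun x _ ↦ unitBallMap φ x) ?_ ?_ ?_ ?_).symm
  · intro x hx
    rw [mem_roots_prime_pow] at hx ⊢
    rw [← map_pow, hx, map_one]
  · intro x _ y _ h
    exact Subtype.ext (φ.injective (congrArg Subtype.val h))
  · intro y hy
    rw [mem_roots_prime_pow] at hy
    refine ⟨unitBallMap φ⁻¹ y, mem_roots_prime_pow.2 (by rw [← map_pow, hy, map_one]),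
      Subtype.ext ?_⟩
    exact φ.apply_symm_apply (y : Ω)
  · intro x _
    rw [eval_map, eval₂_at_apply]

variable {E : IntermediateField ℚ_[ℓ] Ω}

theorem rootProd_map (φ : Gal(Ω/ℚ_[ℓ])) (g : (unitBall Ω)[X]) :
    (rootProd ℓ g).map (unitBallMap φ) = rootProd ℓ (g.map (unitBallMap φ)) := by
  unfold rootProd
  rw [Polynomial.map_prod]
  refine (Finset.prod_bij (fun x _ ↦ unitBallMap φ x) ?_ ?_ ?_ ?_)
  · intro x hx
    rw [mem_roots_prime] at hx ⊢
    rw [← map_pow, hx, map_one]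
  · intro x _ y _ h
    exact Subtype.ext (φ.injective (congrArg Subtype.val h))
  · intro y hy
    rw [mem_roots_prime] at hy
    refine ⟨unitBallMap φ⁻¹ y, mem_roots_prime.2 (by rw [← map_pow, hy, map_one]),
      Subtype.ext ?_⟩
    exact φ.apply_symm_apply (y : Ω)
  · intro x _
    rw [Polynomial.map_comp, Polynomial.map_mul, Polynomial.map_C, Polynomial.map_X]

theorem map_eq_self_of_mem_fixingSubgroup {g : (unitBall Ω)[X]} (hg : ∀ n, (g.coeff n : Ω) ∈ E)
    {τ : Gal(Ω/ℚ_[ℓ])} (hτ : τ ∈ E.fixingSubgroup) : g.map (unitBallMap τ) = g := by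
  ext n
  rw [coeff_map]
  exact (IntermediateField.mem_fixingSubgroup_iff _ _).1 hτ _ (hg n)

variable [IsAlgClosed Ω]

variable (ℓ Ω) in
omit [IsUltrametricDist Ω] in
theorem isGalois_of_isAlgClosed : IsGalois ℚ_[ℓ] Ω := by
  have : IsAlgClosure ℚ_[ℓ] Ω := ⟨inferInstance, inferInstance⟩
  have : Normal ℚ_[ℓ] Ω := IsAlgClosure.normal ℚ_[ℓ] Ω
  exact ⟨⟩

omit [IsUltrametricDist Ω] in
theorem mem_of_forall_fixingSubgroup {x : Ω} (h : ∀ τ ∈ E.fixingSubgroup, τ x = x) : x ∈ E := by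
  have := isGalois_of_isAlgClosed ℓ Ω
  rw [← InfiniteGalois.fixedField_fixingSubgroup E, IntermediateField.mem_fixedField_iff]
  exact h

variable (ℓ Ω) in
omit [Algebra.IsAlgebraic ℚ_[ℓ] Ω] in
theorem exists_primitiveRoot_unitBall (i : ℕ) : ∃ ε : unitBall Ω, IsPrimitiveRoot ε (ℓ ^ i) := by
  have : CharZero Ω := charZero_of_injective_algebraMap (algebraMap ℚ_[ℓ] Ω).injective
  obtain ⟨ζ, hζ⟩ := HasEnoughRootsOfUnity.exists_primitiveRoot Ω (ℓ ^ i)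
  refine ⟨⟨ζ, (norm_eq_one_of_pow_eq_one' (pow_ne_zero _ hℓ.out.ne_zero)
    hζ.pow_eq_one).le⟩, ?_⟩
  rw [← IsPrimitiveRoot.map_iff_of_injective (f := (unitBall Ω).subtype) Subtype.val_injective]
  exact hζ

omit [NormedAlgebra ℚ_[ℓ] Ω] [Algebra.IsAlgebraic ℚ_[ℓ] Ω] in
theorem exists_pow_eq_unitBall (c : unitBall Ω) : ∃ d, d ^ ℓ = c := by
  obtain ⟨d, hd⟩ := IsAlgClosed.exists_pow_nat_eq (c : Ω) hℓ.out.pos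
  refine ⟨⟨d, ?_⟩, Subtype.ext hd⟩
  rw [mem_unitBall, ← pow_le_one_iff_of_nonneg (norm_nonneg _) hℓ.out.ne_zero, ← norm_pow, hd]
  exact c.2

theorem coeff_normOp_mem {g : (unitBall Ω)[X]} (hg : ∀ n, (g.coeff n : Ω) ∈ E) (n : ℕ) :
    ((normOp ℓ g).coeff n : Ω) ∈ E := by
  refine mem_of_forall_fixingSubgroup fun τ hτ ↦ ?_
  rw [normOp, coeff_contract hℓ.out.ne_zero, ← coe_unitBallMap, ← coeff_map, rootProd_map,
    map_eq_self_of_mem_fixingSubgroup hg hτ]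

theorem rootsEval_mem {g : (unitBall Ω)[X]} (hg : ∀ n, (g.coeff n : Ω) ∈ E) (i : ℕ) :
    ((rootsEval ℓ g i : unitBall Ω) : Ω) ∈ E := by
  refine mem_of_forall_fixingSubgroup fun τ hτ ↦ ?_
  rw [← coe_unitBallMap, ← rootsEval_map, map_eq_self_of_mem_fixingSubgroup hg hτ]

/-- In the residue field all $\varepsilon$ become 1, so the product becomes $g^\ell$, which is
$g^\varphi(X^\ell)$ as $\varphi$ lifts the Frobenius. Since $E$ is unramified (`hE`), being small
improves to divisibility by $\ell$. -/
theorem dvd_normOp_sub_map {g : (unitBall Ω)[X]} (hg : ∀ n, (g.coeff n : Ω) ∈ E)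
    (hE : ∀ w ∈ E, ‖w‖ < 1 → ‖w‖ ≤ ‖(ℓ : ℚ_[ℓ])‖) {φ : Gal(Ω/ℚ_[ℓ])} (hφE : ∀ w ∈ E, φ w ∈ E)
    (hφ : ∀ w ∈ E, ‖w‖ ≤ 1 → ‖φ w - w ^ ℓ‖ < 1) :
    (ℓ : (unitBall Ω)[X]) ∣ normOp ℓ g - g.map (unitBallMap φ) := by
  have := charP_residueField_unitBall ℓ Ω
  obtain ⟨ε₀, hε₀⟩ := exists_primitiveRoot_unitBall ℓ Ω 1
  rw [pow_one] at hε₀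
  have key : (rootProd ℓ g).map (IsLocalRing.residue (unitBall Ω)) =
      (expand _ ℓ (g.map (unitBallMap φ))).map (IsLocalRing.residue (unitBall Ω)) := by
    have e1 : (rootProd ℓ g).map (IsLocalRing.residue (unitBall Ω)) =
        g.map (IsLocalRing.residue (unitBall Ω)) ^ ℓ := by
      rw [rootProd, Polynomial.map_prod, Finset.prod_congr rfl
        (g := fun _ ↦ g.map (IsLocalRing.residue (unitBall Ω))) fun ε hε ↦ ?_, Finset.prod_const,
        hε₀.card_nthRootsFinset]
      rw [mem_roots_prime] at hε
      have h1 : IsLocalRing.residue (unitBall Ω) ε = 1 := by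
        have h2 := congrArg (IsLocalRing.residue (unitBall Ω)) hε
        rw [map_pow, map_one] at h2
        have h3 : (IsLocalRing.residue (unitBall Ω) ε - 1) ^ ℓ = 0 := by
          rw [sub_pow_expChar, h2, one_pow, sub_self]
        exact sub_eq_zero.1 (pow_eq_zero_iff hℓ.out.ne_zero |>.1 h3)
      rw [Polynomial.map_comp, Polynomial.map_mul, Polynomial.map_C, Polynomial.map_X, h1, C_1,
        one_mul, comp_X]
    rw [e1, map_expand, ← map_frobenius_expand, map_expand]
    congr 1
    ext n
    simp only [coeff_map]
    rw [frobenius_def, ← map_pow, eq_comm, residue_unitBall_eq_iff]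
    exact hφ _ (hg n) (g.coeff n).2
  rw [← map_natCast (C : unitBall Ω →+* (unitBall Ω)[X]), C_dvd_iff_dvd_coeff]
  intro n
  rw [← pow_one (ℓ : unitBall Ω), pow_dvd_unitBall_iff, pow_one, coeff_sub, coeff_map]
  refine hE _ (sub_mem (coeff_normOp_mem hg n) (hφE _ (hg n))) ?_
  have := congrArg (fun P ↦ coeff P (n * ℓ)) key
  rw [← expand_normOp hε₀] at this
  simp only [coeff_map, coeff_expand_mul hℓ.out.pos] at this
  exact residue_unitBall_eq_iff.1 this

/-- With $T_i=\prod_{\xi^{\ell^i}=1}g(\xi)$ this is $T_{i+1}\equiv\varphi(T_i)\bmod\ell^{i+1}$: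
apply the $i$-fold congruence to `normOp` of $g$ and $g^\varphi$. -/
theorem norm_rootsEval_succ_sub_le {g : (unitBall Ω)[X]} (hg : ∀ n, (g.coeff n : Ω) ∈ E)
    (hE : ∀ w ∈ E, ‖w‖ < 1 → ‖w‖ ≤ ‖(ℓ : ℚ_[ℓ])‖) {φ : Gal(Ω/ℚ_[ℓ])} (hφE : ∀ w ∈ E, φ w ∈ E)
    (hφ : ∀ w ∈ E, ‖w‖ ≤ 1 → ‖φ w - w ^ ℓ‖ < 1) (i : ℕ) :
    ‖((rootsEval ℓ g (i + 1) : unitBall Ω) : Ω) - φ (rootsEval ℓ g i : unitBall Ω)‖ ≤ ‖(ℓ : ℚ_[ℓ])‖ ^ (i + 1) := by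
  obtain ⟨ε₀, hε₀⟩ := exists_primitiveRoot_unitBall ℓ Ω 1
  rw [pow_one] at hε₀
  have h := pow_dvd_rootsEval_sub hε₀ exists_pow_eq_unitBall (dvd_normOp_sub_map hg hE hφE hφ) i
  rw [← rootsEval_succ hε₀ exists_pow_eq_unitBall, rootsEval_map, pow_dvd_unitBall_iff] at h
  exact h

omit [IsAlgClosed Ω] [NormedAlgebra ℚ_[ℓ] Ω] [Algebra.IsAlgebraic ℚ_[ℓ] Ω] in
theorem rootsEval_succ_eq_mul (g : (unitBall Ω)[X]) (i : ℕ) :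
    rootsEval ℓ g (i + 1) =
      rootsEval ℓ g i * ∏ ξ ∈ primitiveRoots (ℓ ^ (i + 1)) (unitBall Ω), g.eval ξ := by
  classical
  unfold rootsEval
  rw [← Finset.prod_union]
  · congr 1
    ext x
    rw [Finset.mem_union, mem_roots_prime_pow, mem_roots_prime_pow,
      mem_primitiveRoots (pow_pos hℓ.out.pos _)]
    constructor
    · intro h
      by_cases h1 : x ^ ℓ ^ i = 1
      · exact Or.inl h1
      · exact Or.inr (IsPrimitiveRoot.iff_orderOf.2 (orderOf_eq_prime_pow h1 h))
    · rintro (h | h)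
      · rw [pow_succ, pow_mul, h, one_pow]
      · exact h.pow_eq_one
  · rw [Finset.disjoint_left]
    intro x hx hx'
    rw [mem_roots_prime_pow] at hx
    rw [mem_primitiveRoots (pow_pos hℓ.out.pos _)] at hx'
    exact absurd ((Nat.pow_dvd_pow_iff_le_right hℓ.out.one_lt).1 (hx'.dvd_of_pow_eq_one _ hx))
      (by omega)

end NormOperatorLocal

/-! ### Integral elements as polynomials in an Eisenstein uniformizer -/

section IntegralGenerator
open Polynomial
variable {ℓ : ℕ} [hℓ : Fact ℓ.Prime] {Ω : Type*} [NormedField Ω] [NormedAlgebra ℚ_[ℓ] Ω]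
  [IsUltrametricDist Ω]

open scoped IntermediateField

/-- The Eisenstein argument. An element of $W[\pi]$ of norm less than 1 is divisible by $\pi$ in
$W[\pi]$, because its constant term is divisible by $\ell=\pi H$. So if $x$ is integral and $\ell
x\in W[\pi]$, one can extract $\pi^e=\ell B$ from $\ell x$ and cancel $\ell$. -/
theorem mem_adjoin_of_norm_le_one {W : Subring Ω} {π H B : Ω} {e : ℕ} (hW1 : ∀ w ∈ W, ‖w‖ ≤ 1)
    (hW : ∀ w ∈ W, ‖w‖ < 1 → ∃ c ∈ W, w = ℓ * c) (hπ : ‖π‖ < 1)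
    (hH : H ∈ Algebra.adjoin W {π}) (hπH : (ℓ : Ω) = π * H) (hB : B ∈ Algebra.adjoin W {π})
    (hπB : π ^ e = ℓ * B) (he : ‖π‖ ^ e = ‖(ℓ : ℚ_[ℓ])‖) {x : Ω} (hx : ‖x‖ ≤ 1) {r : ℕ}
    (hr : (ℓ : Ω) ^ r * x ∈ Algebra.adjoin W {π}) : x ∈ Algebra.adjoin W {π} := by
  have hl0 : (ℓ : Ω) ≠ 0 := by
    rw [← norm_ne_zero_iff, norm_prime ℓ Ω, norm_ne_zero_iff]
    exact_mod_cast hℓ.out.ne_zero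
  have hπ0 : π ≠ 0 := by
    rintro rfl
    rw [zero_mul] at hπH
    exact hl0 hπH
  set R := Algebra.adjoin W {π} with hR
  have hWR : ∀ w ∈ W, w ∈ R := fun w hw ↦ R.algebraMap_mem ⟨w, hw⟩
  have hπR : π ∈ R := Algebra.subset_adjoin rfl
  have hR1 : ∀ y ∈ R, ‖y‖ ≤ 1 := by
    intro y hy
    induction hy using Algebra.adjoin_induction with
    | mem x hx => rw [Set.mem_singleton_iff.1 hx]; exact hπ.le
    | algebraMap r => exact hW1 r r.2
    | add x y _ _ hx hy => exact (IsUltrametricDist.norm_add_le_max x y).trans (max_le hx hy)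
    | mul x y _ _ hx hy => rw [norm_mul]; exact mul_le_one₀ hx (norm_nonneg _) hy
  have hdiv : ∀ y ∈ R, ‖y‖ < 1 → ∃ y' ∈ R, y = π * y' := by
    intro y hy hy1
    rw [hR, Algebra.adjoin_singleton_eq_range_aeval] at hy
    obtain ⟨P, rfl⟩ := hy
    have e1 : aeval π P = π * aeval π P.divX + (P.coeff 0 : Ω) := by
      conv_lhs => rw [← X_mul_divX_add P]
      rw [map_add, map_mul, aeval_X, aeval_C]; rfl
    have hm : aeval π P.divX ∈ R := aeval_mem_adjoin_singleton _ _
    have h1 : ‖(P.coeff 0 : Ω)‖ < 1 := by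
      have e2 : (P.coeff 0 : Ω) = aeval π P - π * aeval π P.divX := by rw [e1]; ring
      rw [e2, sub_eq_add_neg]
      refine (IsUltrametricDist.norm_add_le_max _ _).trans_lt (max_lt hy1 ?_)
      rw [norm_neg, norm_mul]
      exact (mul_le_of_le_one_right (norm_nonneg _) (hR1 _ hm)).trans_lt hπ
    obtain ⟨c, hc, hc1⟩ := hW _ (P.coeff 0).2 h1
    refine ⟨aeval π P.divX + H * c, add_mem hm (mul_mem hH (hWR c hc)), ?_⟩
    rw [AlgHom.toRingHom_eq_coe, RingHom.coe_coe, e1, hc1, hπH]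
    ring
  have hstep : ∀ x : Ω, ‖x‖ ≤ 1 → (ℓ : Ω) * x ∈ R → x ∈ R := by
    intro x hx hlx
    have h1 : ∀ i ≤ e, ∃ y ∈ R, (ℓ : Ω) * x = π ^ i * y := by
      intro i
      induction i with
      | zero => exact fun _ ↦ ⟨_, hlx, by rw [pow_zero, one_mul]⟩
      | succ i ih =>
        intro hi
        obtain ⟨y, hy, hxy⟩ := ih (by omega)
        have h2 : ‖y‖ < 1 := by
          have h3 := congrArg norm hxy
          rw [norm_mul, norm_mul, norm_prime ℓ Ω, ← he, norm_pow] at h3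
          have h4 : 0 < ‖π‖ ^ i := pow_pos (norm_pos_iff.2 hπ0) _
          by_contra h5
          have h6 : ‖π‖ ^ i * 1 ≤ ‖π‖ ^ i * ‖y‖ := mul_le_mul_of_nonneg_left (not_lt.1 h5) h4.le
          have h7 : ‖π‖ ^ e ≤ ‖π‖ ^ (i + 1) :=
            pow_le_pow_of_le_one (norm_nonneg _) hπ.le hi
          have h8 : ‖π‖ ^ e * ‖x‖ ≤ ‖π‖ ^ e :=
            mul_le_of_le_one_right (pow_nonneg (norm_nonneg _) _) hx
          rw [pow_succ] at h7
          nlinarith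
        obtain ⟨y', hy', rfl⟩ := hdiv y hy h2
        exact ⟨y', hy', by rw [hxy]; ring⟩
    obtain ⟨y, hy, hxy⟩ := h1 e le_rfl
    rw [hπB, mul_assoc] at hxy
    rw [mul_left_cancel₀ hl0 hxy]
    exact mul_mem hB hy
  induction r with
  | zero => simpa using hr
  | succ r ih =>
    refine ih (hstep _ ?_ ?_)
    · rw [norm_mul, norm_pow, norm_prime ℓ Ω]
      exact mul_le_one₀ (pow_le_one₀ (norm_nonneg _) Padic.norm_p_lt_one.le) (norm_nonneg _) hx
    · rwa [← mul_assoc, ← pow_succ']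

end IntegralGenerator

/-! ### Cyclotomic extensions of $\mathbb Q_\ell$ of $\ell$-power level -/

section PrimePowerRoots
open Polynomial
open scoped IntermediateField
variable {ℓ : ℕ} [hℓ : Fact ℓ.Prime] {Ω : Type*} [NormedField Ω] [NormedAlgebra ℚ_[ℓ] Ω]
  [IsUltrametricDist Ω] {i : ℕ} {ζ : Ω}

theorem norm_pow_sub_one_le_norm_sub_one {x : Ω} (hx : ‖x‖ ≤ 1) (n : ℕ) :
    ‖x ^ n - 1‖ ≤ ‖x - 1‖ := by
  rw [← mul_geom_sum, norm_mul]
  refine mul_le_of_le_one_right (norm_nonneg _) ?_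
  refine IsUltrametricDist.norm_sum_le_of_forall_le_of_nonneg zero_le_one fun k _ ↦ ?_
  rw [norm_pow]
  exact pow_le_one₀ (norm_nonneg _) hx

omit [NormedAlgebra ℚ_[ℓ] Ω] in
theorem norm_primitiveRoot_sub_one_eq (hζ : IsPrimitiveRoot ζ (ℓ ^ i)) {ξ : Ω}
    (hξ : IsPrimitiveRoot ξ (ℓ ^ i)) : ‖ξ - 1‖ = ‖ζ - 1‖ := by
  have hl : ℓ ^ i ≠ 0 := pow_ne_zero _ hℓ.out.ne_zero
  have : NeZero (ℓ ^ i) := ⟨hl⟩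
  have h : ∀ {a b : Ω}, IsPrimitiveRoot a (ℓ ^ i) → IsPrimitiveRoot b (ℓ ^ i) →
      ‖b - 1‖ ≤ ‖a - 1‖ := by
    intro a b ha hb
    obtain ⟨n, -, rfl⟩ := ha.eq_pow_of_pow_eq_one hb.pow_eq_one
    exact norm_pow_sub_one_le_norm_sub_one (norm_eq_one_of_pow_eq_one' hl ha.pow_eq_one).le n
  exact le_antisymm (h hζ hξ) (h hξ hζ)

omit [NormedAlgebra ℚ_[ℓ] Ω] [IsUltrametricDist Ω] in
theorem prod_one_sub_primitiveRoots (hζ : IsPrimitiveRoot ζ (ℓ ^ (i + 1))) :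
    ∏ ξ ∈ primitiveRoots (ℓ ^ (i + 1)) Ω, (1 - ξ) = ℓ := by
  have h := eval_one_cyclotomic_prime_pow (R := Ω) (p := ℓ) i
  rw [cyclotomic_eq_prod_X_sub_primitiveRoots hζ, eval_prod] at h
  rw [← h]
  simp

theorem norm_primitiveRoot_sub_one_pow (hζ : IsPrimitiveRoot ζ (ℓ ^ (i + 1))) :
    ‖ζ - 1‖ ^ (ℓ ^ (i + 1)).totient = ‖(ℓ : ℚ_[ℓ])‖ := by
  have h := congrArg norm (prod_one_sub_primitiveRoots hζ)
  rw [norm_prod, Finset.prod_congr rfl (g := fun _ ↦ ‖ζ - 1‖) fun ξ hξ ↦ by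
    rw [norm_sub_rev]
    exact norm_primitiveRoot_sub_one_eq hζ (isPrimitiveRoot_of_mem_primitiveRoots hξ),
    Finset.prod_const, hζ.card_primitiveRoots, norm_prime ℓ Ω] at h
  exact h

theorem norm_primitiveRoot_sub_one_lt (hζ : IsPrimitiveRoot ζ (ℓ ^ (i + 1))) : ‖ζ - 1‖ < 1 := by
  by_contra h
  have h1 := one_le_pow₀ (n := (ℓ ^ (i + 1)).totient) (not_lt.1 h)
  rw [norm_primitiveRoot_sub_one_pow hζ] at h1
  exact absurd (Padic.norm_p_lt_one (p := ℓ)) (not_lt.2 h1)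

omit [NormedAlgebra ℚ_[ℓ] Ω] [IsUltrametricDist Ω] in
-- $\Phi_{\ell^{i+1}}(1)=\ell$, so $X-1$ divides $\ell-\Phi_{\ell^{i+1}}$.
theorem exists_int_prime_eq_mul : ∃ P : ℤ[X], ∀ ζ : Ω, IsPrimitiveRoot ζ (ℓ ^ (i + 1)) →
    (ℓ : Ω) = (ζ - 1) * aeval ζ P := by
  have h1 := eval_one_cyclotomic_prime_pow (R := ℤ) (p := ℓ) i
  obtain ⟨P, hP⟩ := (dvd_iff_isRoot (p := C (ℓ : ℤ) - cyclotomic (ℓ ^ (i + 1)) ℤ) (a := 1)).2 (by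
    simp [h1])
  refine ⟨P, fun ζ hζ ↦ ?_⟩
  have h2 := congrArg (aeval ζ) hP
  have h3 : aeval ζ (cyclotomic (ℓ ^ (i + 1)) ℤ) = 0 := by
    rw [aeval_def, eval₂_eq_eval_map, map_cyclotomic]
    exact hζ.isRoot_cyclotomic (pow_pos hℓ.out.pos _)
  simpa [h3] using h2

omit [NormedAlgebra ℚ_[ℓ] Ω] [IsUltrametricDist Ω] in
-- $\Phi_{\ell^{i+1}}\equiv(X-1)^{\varphi(\ell^{i+1})}\bmod\ell$.
theorem exists_int_pow_eq_mul : ∃ P : ℤ[X], ∀ ζ : Ω, IsPrimitiveRoot ζ (ℓ ^ (i + 1)) →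
    (ζ - 1) ^ (ℓ ^ (i + 1)).totient = ℓ * aeval ζ P := by
  have h1 : (C (ℓ : ℤ)) ∣ (X - 1) ^ (ℓ ^ (i + 1)).totient - cyclotomic (ℓ ^ (i + 1)) ℤ := by
    rw [C_dvd_iff_dvd_coeff]
    intro n
    rw [← ZMod.intCast_zmod_eq_zero_iff_dvd]
    have h2 := cyclotomic_mul_prime_pow_eq (ZMod ℓ) (p := ℓ) (m := 1)
      (by simpa using hℓ.out.one_lt.ne') (Nat.succ_pos i)
    rw [mul_one, cyclotomic_one] at h2
    have h3 : (ℓ ^ (i + 1)).totient = ℓ ^ (i + 1) - ℓ ^ (i + 1 - 1) := by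
      rw [Nat.totient_prime_pow_succ hℓ.out, Nat.mul_sub, mul_one, pow_succ, Nat.add_sub_cancel]
    rw [← eq_intCast (Int.castRingHom (ZMod ℓ)), ← coeff_map, Polynomial.map_sub, map_cyclotomic, h2, h3]
    simp
  obtain ⟨P, hP⟩ := h1
  refine ⟨P, fun ζ hζ ↦ ?_⟩
  have h2 := congrArg (aeval ζ) hP
  have h3 : aeval ζ (cyclotomic (ℓ ^ (i + 1)) ℤ) = 0 := by
    rw [aeval_def, eval₂_eq_eval_map, map_cyclotomic]
    exact hζ.isRoot_cyclotomic (pow_pos hℓ.out.pos _)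
  simpa [h3] using h2

variable [Algebra.IsAlgebraic ℚ_[ℓ] Ω] [IsAlgClosed Ω]

omit [IsUltrametricDist Ω] in
omit [Algebra.IsAlgebraic ℚ_[ℓ] Ω] [IsAlgClosed Ω] in
theorem aeval_cyclotomic_primitiveRoot (hζ : IsPrimitiveRoot ζ (ℓ ^ (i + 1))) :
    aeval ζ (cyclotomic (ℓ ^ (i + 1)) ℚ_[ℓ]) = 0 := by
  rw [aeval_def, eval₂_eq_eval_map, map_cyclotomic]
  exact hζ.isRoot_cyclotomic (pow_pos hℓ.out.pos _)

theorem totient_mul_valuation_eq_finrank (hζ : IsPrimitiveRoot ζ (ℓ ^ (i + 1)))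
    {K : IntermediateField ℚ_[ℓ] Ω} [FiniteDimensional ℚ_[ℓ] K] {z : K} (hz : ‖(z : Ω)‖ = ‖ζ - 1‖) :
    ((ℓ ^ (i + 1)).totient : ℤ) * (Algebra.norm ℚ_[ℓ] z).valuation = Module.finrank ℚ_[ℓ] K := by
  have h1 := norm_algebraNorm K z
  have h2 := norm_primitiveRoot_sub_one_pow hζ
  have hφ : (ℓ ^ (i + 1)).totient ≠ 0 := (Nat.totient_pos.2 (pow_pos hℓ.out.pos _)).ne'
  have hN : Algebra.norm ℚ_[ℓ] z ≠ 0 := by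
    rw [← norm_ne_zero_iff, h1, hz]
    refine pow_ne_zero _ fun h ↦ ?_
    rw [h, zero_pow hφ] at h2
    exact norm_ne_zero_iff.2 (by exact_mod_cast hℓ.out.ne_zero) h2.symm
  have h3 : ‖Algebra.norm ℚ_[ℓ] z‖ ^ (ℓ ^ (i + 1)).totient =
      ‖(ℓ : ℚ_[ℓ])‖ ^ Module.finrank ℚ_[ℓ] K := by
    rw [h1, hz, ← h2, ← pow_mul, ← pow_mul, mul_comm]
  rw [Padic.norm_eq_zpow_neg_valuation hN, Padic.norm_p, ← zpow_natCast, ← zpow_mul, inv_pow,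
    ← zpow_natCast, ← zpow_neg] at h3
  have hl : (1 : ℝ) < ℓ := by exact_mod_cast hℓ.out.one_lt
  have h4 := zpow_right_injective₀ (by linarith) hl.ne' h3
  linarith

/-- The totient divides the degree because the norm of $\zeta-1$ has integral valuation, and the
cyclotomic polynomial bounds the degree from above. -/
theorem finrank_adjoin_primitiveRoot (hζ : IsPrimitiveRoot ζ (ℓ ^ (i + 1))) :
    Module.finrank ℚ_[ℓ] ℚ_[ℓ]⟮ζ⟯ = (ℓ ^ (i + 1)).totient := by
  have hint : IsIntegral ℚ_[ℓ] ζ := Algebra.IsIntegral.isIntegral ζ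
  have := IntermediateField.adjoin.finiteDimensional hint
  have h1 := totient_mul_valuation_eq_finrank hζ
    (z := IntermediateField.AdjoinSimple.gen ℚ_[ℓ] ζ - 1) rfl
  have h2 : ((ℓ ^ (i + 1)).totient : ℤ) ∣ Module.finrank ℚ_[ℓ] ℚ_[ℓ]⟮ζ⟯ := ⟨_, h1.symm⟩
  refine le_antisymm ?_ (Nat.le_of_dvd Module.finrank_pos (by exact_mod_cast h2))
  rw [IntermediateField.adjoin.finrank hint, ← natDegree_cyclotomic (ℓ ^ (i + 1)) ℚ_[ℓ]]
  exact natDegree_le_of_dvd (minpoly.dvd _ _ (aeval_cyclotomic_primitiveRoot hζ))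
    (cyclotomic_ne_zero _ _)

theorem minpoly_primitiveRoot (hζ : IsPrimitiveRoot ζ (ℓ ^ (i + 1))) :
    minpoly ℚ_[ℓ] ζ = cyclotomic (ℓ ^ (i + 1)) ℚ_[ℓ] := by
  have hint : IsIntegral ℚ_[ℓ] ζ := Algebra.IsIntegral.isIntegral ζ
  refine eq_of_monic_of_dvd_of_natDegree_le (minpoly.monic hint) (cyclotomic.monic _ _)
    (minpoly.dvd _ _ (aeval_cyclotomic_primitiveRoot hζ)) ?_ |>.symm
  rw [natDegree_cyclotomic, ← finrank_adjoin_primitiveRoot hζ,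
    IntermediateField.adjoin.finrank hint]

theorem exists_apply_primitiveRoot_eq (hζ : IsPrimitiveRoot ζ (ℓ ^ (i + 1))) {ξ : Ω}
    (hξ : IsPrimitiveRoot ξ (ℓ ^ (i + 1))) : ∃ σ : Gal(Ω/ℚ_[ℓ]), σ ζ = ξ := by
  have := isGalois_of_isAlgClosed ℓ Ω
  have h : IsConjRoot ℚ_[ℓ] ξ ζ := by
    rw [isConjRoot_def, minpoly_primitiveRoot hζ, minpoly_primitiveRoot hξ]
  obtain ⟨σ, hσ⟩ := h.exists_algEquiv
  exact ⟨σ, hσ⟩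

/-- The norm of $\zeta-1$ has valuation 1, so $\mathbb Q_\ell(\zeta)$ has residue degree 1 and its
Galois group contains a lift of the $\ell$-Frobenius. -/
theorem exists_frobenius_fixing_primitiveRoot (hζ : IsPrimitiveRoot ζ (ℓ ^ (i + 1))) {n : ℕ}
    (hn : n.Coprime ℓ) (hn0 : n ≠ 0) :
    ∃ φ : Gal(Ω/ℚ_[ℓ]), φ ζ = ζ ∧ ∀ x : Ω, x ^ n = 1 → φ x = x ^ ℓ := by
  have hint : IsIntegral ℚ_[ℓ] ζ := Algebra.IsIntegral.isIntegral ζ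
  have := IntermediateField.adjoin.finiteDimensional hint
  obtain ⟨f, hf0, hf1, -, hR⟩ := exists_residueDegree ℚ_[ℓ]⟮ζ⟯
  have hf : f = 1 := by
    set z := IntermediateField.AdjoinSimple.gen ℚ_[ℓ] ζ - 1 with hz
    have h1 := totient_mul_valuation_eq_finrank hζ (z := z) rfl
    rw [finrank_adjoin_primitiveRoot hζ] at h1
    have hφ : ((ℓ ^ (i + 1)).totient : ℤ) ≠ 0 := by
      exact_mod_cast (Nat.totient_pos.2 (pow_pos hℓ.out.pos _)).ne'
    have h2 : (Algebra.norm ℚ_[ℓ] z).valuation = 1 := mul_left_cancel₀ hφ (by rw [h1, mul_one])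
    have h3 := hf1 z (by rintro h; rw [h] at h2; simp at h2)
    rw [h2] at h3
    exact_mod_cast Int.eq_one_of_dvd_one (by positivity) h3
  obtain ⟨φ, hφ, h⟩ := exists_apply_eq_pow hR hn hn0
  refine ⟨φ, (IntermediateField.mem_fixingSubgroup_iff _ _).1 hφ ζ
    (IntermediateField.mem_adjoin_simple_self _ ζ), ?_⟩
  simpa [hf] using h

end PrimePowerRoots

/-! ### Norms from cyclotomic fields as products over roots of unity -/

section LogNormCyclotomic
open Polynomial
open scoped IntermediateField
variable {ℓ : ℕ} [hℓ : Fact ℓ.Prime] {Ω : Type*} [NormedField Ω] [NormedAlgebra ℚ_[ℓ] Ω]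
  [IsUltrametricDist Ω] {E : IntermediateField ℚ_[ℓ] Ω}

theorem norm_eq_norm_prime_zpow {x : ℚ_[ℓ]} (hx : x ≠ 0) :
    ‖x‖ = ‖(ℓ : ℚ_[ℓ])‖ ^ x.valuation := by
  rw [Padic.norm_eq_zpow_neg_valuation hx, Padic.norm_p, inv_zpow, zpow_neg]

omit [IsUltrametricDist Ω] in
theorem aeval_int_mem {S : Type*} [SetLike S Ω] [SubringClass S Ω] (R : S) {x : Ω} (hx : x ∈ R)
    (P : ℤ[X]) : aeval x P ∈ R := by
  rw [aeval_eq_sum_range]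
  exact sum_mem fun n _ ↦ zsmul_mem (pow_mem hx n) _

theorem exists_pow_mul_mem_adjoin {x : Ω} (c : ℤ) {u : Ω}
    (hu : u ∈ Algebra.adjoin ℚ_[ℓ] ((E : Set Ω) ∪ {x})) :
    ∃ r : ℕ, (ℓ : Ω) ^ r * u ∈
      Algebra.adjoin ((unitBall Ω).toSubring ⊓ E.toSubring : Subring Ω) {x - (c : Ω)} := by
  set R := Algebra.adjoin ((unitBall Ω).toSubring ⊓ E.toSubring : Subring Ω) {x - (c : Ω)} with hR
  have hE : ∀ e ∈ E, ∃ r : ℕ, (ℓ : Ω) ^ r * e ∈ R := by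
    intro e he
    obtain ⟨r, hr⟩ := exists_norm_pow_lt (ℓ := ℓ) (x := (‖e‖ + 1)⁻¹) (by positivity)
    refine ⟨r, R.algebraMap_mem ⟨_, ⟨mem_unitBall.2 ?_, ?_⟩⟩⟩
    · change ‖(ℓ : Ω) ^ r * e‖ ≤ 1
      rw [norm_mul, norm_pow, norm_prime ℓ Ω, ← norm_pow]
      have h1 : 0 < ‖e‖ + 1 := by positivity
      calc _ ≤ (‖e‖ + 1)⁻¹ * (‖e‖ + 1) := by gcongr; linarith
        _ = 1 := inv_mul_cancel₀ h1.ne'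
    · exact mul_mem (pow_mem (natCast_mem E ℓ) r) he
  have hl : ∀ n : ℕ, (ℓ : Ω) ^ n ∈ R := fun n ↦ pow_mem (natCast_mem R ℓ) n
  induction hu using Algebra.adjoin_induction with
  | mem y hy =>
    rcases hy with hy | hy
    · exact hE y hy
    · rw [Set.mem_singleton_iff.1 hy]
      refine ⟨0, ?_⟩
      rw [pow_zero, one_mul, ← sub_add_cancel x (c : Ω)]
      exact add_mem (Algebra.subset_adjoin rfl) (intCast_mem R c)
  | algebraMap q => exact hE _ (E.algebraMap_mem q)
  | add y z _ _ hy hz =>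
    obtain ⟨r, hr⟩ := hy
    obtain ⟨s, hs⟩ := hz
    refine ⟨r + s, ?_⟩
    rw [show (ℓ : Ω) ^ (r + s) * (y + z) = ℓ ^ s * (ℓ ^ r * y) + ℓ ^ r * (ℓ ^ s * z) by ring]
    exact add_mem (mul_mem (hl s) hr) (mul_mem (hl r) hs)
  | mul y z _ _ hy hz =>
    obtain ⟨r, hr⟩ := hy
    obtain ⟨s, hs⟩ := hz
    refine ⟨r + s, ?_⟩
    rw [show (ℓ : Ω) ^ (r + s) * (y * z) = (ℓ ^ r * y) * (ℓ ^ s * z) by ring]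
    exact mul_mem hr hs

/-- Here $x-c$ is the Eisenstein uniformizer. It is used with $x=\zeta$, $c=1$ and with
$x=\zeta+\zeta^{-1}$, $c=2$. -/
theorem exists_polynomial_eval_eq {x : unitBall Ω} {c : ℤ} {P Q : ℤ[X]} {e : ℕ}
    (hE : ∀ w ∈ E, ‖w‖ < 1 → ‖w‖ ≤ ‖(ℓ : ℚ_[ℓ])‖) (hP : (ℓ : Ω) = ((x : Ω) - c) * aeval (x : Ω) P)
    (hQ : ((x : Ω) - c) ^ e = ℓ * aeval (x : Ω) Q) (hx : ‖(x : Ω) - c‖ ^ e = ‖(ℓ : ℚ_[ℓ])‖)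
    {u : Ω} (hu : u ∈ Algebra.adjoin ℚ_[ℓ] ((E : Set Ω) ∪ {(x : Ω)})) (hu1 : ‖u‖ ≤ 1) :
    ∃ g : (unitBall Ω)[X], (∀ n, (g.coeff n : Ω) ∈ E) ∧ ((g.eval x : unitBall Ω) : Ω) = u := by
  have hl0 : (ℓ : Ω) ≠ 0 := by
    rw [← norm_ne_zero_iff, norm_prime ℓ Ω, norm_ne_zero_iff]
    exact_mod_cast hℓ.out.ne_zero
  set W : Subring Ω := (unitBall Ω).toSubring ⊓ E.toSubring with hW
  set R := Algebra.adjoin W {(x : Ω) - c} with hR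
  have hxR : (x : Ω) ∈ R := by
    rw [← sub_add_cancel (x : Ω) (c : Ω)]
    exact add_mem (Algebra.subset_adjoin rfl) (intCast_mem R c)
  have hπ : ‖(x : Ω) - c‖ < 1 := by
    by_contra h
    have h1 := one_le_pow₀ (n := e) (not_lt.1 h)
    rw [hx] at h1
    exact absurd (Padic.norm_p_lt_one (p := ℓ)) (not_lt.2 h1)
  obtain ⟨r, hr⟩ := exists_pow_mul_mem_adjoin c hu
  have huR : u ∈ R := by
    refine mem_adjoin_of_norm_le_one (W := W) (fun w hw ↦ hw.1) (fun w hw hw1 ↦ ?_) hπ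
      (aeval_int_mem R hxR P) hP (aeval_int_mem R hxR Q) hQ hx hu1 hr
    refine ⟨w / ℓ, ⟨mem_unitBall.2 ?_, E.div_mem hw.2 (natCast_mem E ℓ)⟩, (mul_div_cancel₀ w hl0).symm⟩
    rw [norm_div, norm_prime ℓ Ω]
    exact div_le_one_of_le₀ (hE w hw.2 hw1) (norm_nonneg _)
  have hle : R ≤ Algebra.adjoin W {(x : Ω)} := by
    refine Algebra.adjoin_le (Set.singleton_subset_iff.2 ?_)
    exact sub_mem (Algebra.subset_adjoin rfl) (intCast_mem _ c)
  have hu2 := hle huR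
  rw [Algebra.adjoin_singleton_eq_range_aeval] at hu2
  obtain ⟨G, hG⟩ := hu2
  refine ⟨G.map (Subring.inclusion (inf_le_left : W ≤ (unitBall Ω).toSubring)), fun n ↦ ?_, ?_⟩
  · rw [coeff_map]
    exact (G.coeff n).2.2
  · rw [← hG, eval_map]
    change (unitBall Ω).subtype _ = _
    rw [hom_eval₂]
    rfl

variable [Algebra.IsAlgebraic ℚ_[ℓ] Ω] [IsAlgClosed Ω]

omit [IsUltrametricDist Ω] in
-- Taking norms of $\pi$ shows that $e$ divides the degree. So the degree is $e$, and $M$ is totally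
-- ramified with uniformizer $\pi$.
theorem norm_eq_zpow_of_finrank_le {M : IntermediateField ℚ_[ℓ] Ω} [FiniteDimensional ℚ_[ℓ] M]
    {π : Ω} (hπM : π ∈ M) {e : ℕ} (he : Module.finrank ℚ_[ℓ] M ≤ e)
    (hπ : ‖π‖ ^ e = ‖(ℓ : ℚ_[ℓ])‖) {y : Ω} (hy : y ∈ M) (hy0 : y ≠ 0) :
    ∃ s : ℤ, ‖y‖ = ‖π‖ ^ s := by
  have hd : 0 < Module.finrank ℚ_[ℓ] M := Module.finrank_pos
  have hl0 : ‖(ℓ : ℚ_[ℓ])‖ ≠ 0 := norm_ne_zero_iff.2 (by exact_mod_cast hℓ.out.ne_zero)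
  have hl : ‖(ℓ : ℚ_[ℓ])‖ < 1 := Padic.norm_p_lt_one
  have hπ0 : π ≠ 0 := by
    rintro rfl
    rw [norm_zero, zero_pow (by omega)] at hπ
    exact hl0 hπ.symm
  have h1 : ∀ z : M, z ≠ 0 → ‖(z : Ω)‖ ^ Module.finrank ℚ_[ℓ] M =
      ‖(ℓ : ℚ_[ℓ])‖ ^ (Algebra.norm ℚ_[ℓ] z).valuation := by
    intro z hz
    rw [← norm_algebraNorm, norm_eq_norm_prime_zpow (Algebra.norm_ne_zero_iff.2 hz)]
  have h2 := h1 ⟨π, hπM⟩ (fun h ↦ hπ0 (congrArg Subtype.val h))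
  have h3 : (e : ℤ) * (Algebra.norm ℚ_[ℓ] (⟨π, hπM⟩ : M)).valuation = Module.finrank ℚ_[ℓ] M := by
    have h4 := congrArg (· ^ e) h2
    simp only at h4
    rw [← pow_mul, mul_comm, pow_mul, hπ, ← zpow_natCast, ← zpow_natCast, ← zpow_mul] at h4
    have h5 := zpow_right_injective₀ (norm_pos_iff.2 (norm_ne_zero_iff.1 hl0)) hl.ne h4
    linarith
  have h4 : Module.finrank ℚ_[ℓ] M = e := by
    refine le_antisymm he (Nat.le_of_dvd hd ?_)
    have h5 : (e : ℤ) ∣ Module.finrank ℚ_[ℓ] M := ⟨_, h3.symm⟩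
    exact Int.natCast_dvd_natCast.1 h5
  have h5 := h1 ⟨y, hy⟩ (fun h ↦ hy0 (congrArg Subtype.val h))
  refine ⟨(Algebra.norm ℚ_[ℓ] (⟨y, hy⟩ : M)).valuation, ?_⟩
  refine (pow_left_inj₀ (norm_nonneg _) (zpow_nonneg (norm_nonneg _) _) hd.ne').1 ?_
  rw [h5, ← zpow_natCast, ← zpow_mul, mul_comm, zpow_mul, zpow_natCast, h4, hπ]

variable {i : ℕ} {ζ : Ω}

theorem algebraNorm_adjoin_primitiveRoot (hζ : IsPrimitiveRoot ζ (ℓ ^ (i + 1))) (y : ℚ_[ℓ]⟮ζ⟯)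
    {G : Ω → Ω} (hG : ∀ σ : Gal(Ω/ℚ_[ℓ]), σ y = G (σ ζ)) :
    algebraMap ℚ_[ℓ] Ω (Algebra.norm ℚ_[ℓ] y) = ∏ ξ ∈ primitiveRoots (ℓ ^ (i + 1)) Ω, G ξ := by
  have hint : IsIntegral ℚ_[ℓ] ζ := Algebra.IsIntegral.isIntegral ζ
  have := IntermediateField.adjoin.finiteDimensional hint
  have hpos : 0 < ℓ ^ (i + 1) := pow_pos hℓ.out.pos _
  rw [Algebra.norm_eq_prod_embeddings ℚ_[ℓ] Ω]
  choose! σ hσ using fun ξ (hξ : IsPrimitiveRoot ξ (ℓ ^ (i + 1))) ↦ exists_apply_primitiveRoot_eq hζ hξ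
  symm
  refine Finset.prod_bij (fun ξ _ ↦ (σ ξ : Ω →ₐ[ℚ_[ℓ]] Ω).comp ℚ_[ℓ]⟮ζ⟯.val)
    (fun _ _ ↦ Finset.mem_univ _) ?_ ?_ ?_
  · intro a ha b hb h
    have := DFunLike.congr_fun h (IntermediateField.AdjoinSimple.gen ℚ_[ℓ] ζ)
    rw [mem_primitiveRoots hpos] at ha hb
    rw [← hσ a ha, ← hσ b hb]
    exact this
  · intro τ _
    have hτ : IsPrimitiveRoot (τ (IntermediateField.AdjoinSimple.gen ℚ_[ℓ] ζ)) (ℓ ^ (i + 1)) := by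
      refine IsPrimitiveRoot.map_of_injective (f := τ) ?_ τ.injective
      exact (IsPrimitiveRoot.map_iff_of_injective (f := ℚ_[ℓ]⟮ζ⟯.val)
        ℚ_[ℓ]⟮ζ⟯.val.injective).1 hζ
    refine ⟨_, (mem_primitiveRoots hpos).2 hτ, ?_⟩
    refine IntermediateField.algHom_ext_of_eq_adjoin _ rfl ?_
    rintro _ rfl
    exact hσ _ hτ
  · intro ξ hξ
    rw [mem_primitiveRoots hpos] at hξ
    change G ξ = σ ξ y
    rw [hG, hσ ξ hξ]

omit [IsUltrametricDist Ω] [IsAlgClosed Ω] in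
theorem iwasawaLog_algebraNorm_mul {M : IntermediateField ℚ_[ℓ] Ω} [FiniteDimensional ℚ_[ℓ] M]
    {x y : M} (hx : x ≠ 0) (hy : y ≠ 0) : iwasawaLog ℓ (Algebra.norm ℚ_[ℓ] (x * y)) =
      iwasawaLog ℓ (Algebra.norm ℚ_[ℓ] x) + iwasawaLog ℓ (Algebra.norm ℚ_[ℓ] y) := by
  rw [map_mul, iwasawaLog_mul (Algebra.norm_ne_zero_iff.2 hx) (Algebra.norm_ne_zero_iff.2 hy)]

omit [IsUltrametricDist Ω] [IsAlgClosed Ω] in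
theorem iwasawaLog_algebraNorm_zpow {M : IntermediateField ℚ_[ℓ] Ω} [FiniteDimensional ℚ_[ℓ] M]
    {x : M} (h : iwasawaLog ℓ (Algebra.norm ℚ_[ℓ] x) = 0) (s : ℤ) :
    iwasawaLog ℓ (Algebra.norm ℚ_[ℓ] (x ^ s)) = 0 := by
  rcases eq_or_ne x 0 with rfl | hx
  · rcases eq_or_ne s 0 with rfl | hs
    · simp [iwasawaLog_one]
    · rw [zero_zpow _ hs]; exact h
  · have hinv : Algebra.norm ℚ_[ℓ] x⁻¹ = (Algebra.norm ℚ_[ℓ] x)⁻¹ :=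
      eq_inv_of_mul_eq_one_left (by rw [← map_mul, inv_mul_cancel₀ hx, map_one])
    have hN := Algebra.norm_ne_zero_iff (R := ℚ_[ℓ]).2 hx
    cases s with
    | ofNat n => rw [Int.ofNat_eq_natCast, zpow_natCast, map_pow, iwasawaLog_pow hN, h, mul_zero]
    | negSucc n =>
      rw [zpow_negSucc, ← inv_pow, map_pow, hinv, iwasawaLog_pow (inv_ne_zero hN),
        iwasawaLog_inv hN, h, neg_zero, mul_zero]

/-- The norm is $\pm\ell$, on which the logarithm vanishes. -/
theorem iwasawaLog_algebraNorm_primitiveRoot_sub_one (hζ : IsPrimitiveRoot ζ (ℓ ^ (i + 1))) :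
    iwasawaLog ℓ (Algebra.norm ℚ_[ℓ] (IntermediateField.AdjoinSimple.gen ℚ_[ℓ] ζ - 1)) = 0 := by
  have h := algebraNorm_adjoin_primitiveRoot hζ (IntermediateField.AdjoinSimple.gen ℚ_[ℓ] ζ - 1)
    (G := fun x ↦ x - 1) (fun σ ↦ by simp)
  have h1 : ∏ ξ ∈ primitiveRoots (ℓ ^ (i + 1)) Ω, (ξ - 1) =
      algebraMap ℚ_[ℓ] Ω ((-1) ^ (primitiveRoots (ℓ ^ (i + 1)) Ω).card * ℓ) := by
    rw [map_mul, map_natCast, ← prod_one_sub_primitiveRoots hζ, map_pow, map_neg, map_one,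
      ← Finset.prod_const, ← Finset.prod_mul_distrib]
    exact Finset.prod_congr rfl fun ξ _ ↦ by ring
  rw [(algebraMap ℚ_[ℓ] Ω).injective (h.trans h1)]
  rcases neg_one_pow_eq_or ℚ_[ℓ] (primitiveRoots (ℓ ^ (i + 1)) Ω).card with h2 | h2 <;>
  simp [h2, iwasawaLog_self, iwasawaLog_neg, hℓ.out.ne_zero]

/-- The product $P$ over primitive roots satisfies $T_{i+1}=T_iP$, while $T_{i+1}\equiv
T_i\bmod\ell^{i+1}$, and $T_i$ is a unit. -/
theorem norm_prod_primitiveRoots_eval_sub_one_le {g : (unitBall Ω)[X]}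
    (hg : ∀ n, (g.coeff n : Ω) ∈ E) (hE : ∀ w ∈ E, ‖w‖ < 1 → ‖w‖ ≤ ‖(ℓ : ℚ_[ℓ])‖)
    (hφ : ∀ w ∈ E, ‖w‖ ≤ 1 → ‖w - w ^ ℓ‖ < 1) (i : ℕ) (hT : ‖((rootsEval ℓ g i : unitBall Ω) : Ω)‖ = 1) :
    ‖((∏ ξ ∈ primitiveRoots (ℓ ^ (i + 1)) (unitBall Ω), g.eval ξ : unitBall Ω) : Ω) - 1‖ ≤
      ‖(ℓ : ℚ_[ℓ])‖ ^ (i + 1) := by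
  have h := norm_rootsEval_succ_sub_le hg hE (φ := 1) (fun w hw ↦ hw) hφ i
  rw [rootsEval_succ_eq_mul, AlgEquiv.one_apply] at h
  rwa [MulMemClass.coe_mul, ← mul_sub_one, norm_mul, hT, one_mul] at h

end LogNormCyclotomic

/-! ### The bound on logarithms of norms for odd $\ell$ -/

section LogNormCyclotomicOdd
open Polynomial
open scoped IntermediateField
variable {ℓ : ℕ} [hℓ : Fact ℓ.Prime] {Ω : Type*} [NormedField Ω] [NormedAlgebra ℚ_[ℓ] Ω]
  [IsUltrametricDist Ω]

theorem norm_eval_eq_one {g : (unitBall Ω)[X]} {x y : unitBall Ω} (hxy : ‖(x : Ω) - y‖ < 1)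
    (hx : ‖((g.eval x : unitBall Ω) : Ω)‖ = 1) : ‖((g.eval y : unitBall Ω) : Ω)‖ = 1 := by
  rw [← isUnit_unitBall_iff] at hx ⊢
  rw [← residue_unitBall_eq_iff] at hxy
  rw [← isUnit_map_iff (IsLocalRing.residue (unitBall Ω))] at hx ⊢
  rwa [← eval_map_apply, ← hxy, eval_map_apply]

theorem primitiveRoots_eq_map_unitBall {n : ℕ} (hn : n ≠ 0) :
    primitiveRoots n Ω = (primitiveRoots n (unitBall Ω)).map ⟨Subtype.val, Subtype.val_injective⟩ := by
  ext ξ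
  rw [mem_primitiveRoots (Nat.pos_of_ne_zero hn), Finset.mem_map]
  have h (x : unitBall Ω) : IsPrimitiveRoot (x : Ω) n ↔ IsPrimitiveRoot x n :=
    IsPrimitiveRoot.map_iff_of_injective (f := (unitBall Ω).subtype) Subtype.val_injective
  constructor
  · intro hξ
    refine ⟨⟨ξ, (norm_eq_one_of_pow_eq_one' hn hξ.pow_eq_one).le⟩, ?_, rfl⟩
    rw [mem_primitiveRoots (Nat.pos_of_ne_zero hn), ← h]
    exact hξ
  · rintro ⟨x, hx, rfl⟩
    rw [mem_primitiveRoots (Nat.pos_of_ne_zero hn)] at hx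
    exact (h x).2 hx

variable (ℓ) in
theorem norm_sub_one_lt_of_mem_roots_prime_pow [IsAlgClosed Ω] {i : ℕ} {ξ : Ω}
    (hξ : ξ ^ ℓ ^ i = 1) : ‖ξ - 1‖ < 1 := by
  have : CharZero Ω := charZero_of_injective_algebraMap (algebraMap ℚ_[ℓ] Ω).injective
  obtain ⟨ζ, hζ⟩ := HasEnoughRootsOfUnity.exists_primitiveRoot Ω (ℓ ^ (i + 1))
  have : NeZero (ℓ ^ (i + 1)) := ⟨pow_ne_zero _ hℓ.out.ne_zero⟩
  obtain ⟨n, -, rfl⟩ := hζ.eq_pow_of_pow_eq_one (ξ := ξ) (by rw [pow_succ, pow_mul, hξ, one_pow])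
  exact (norm_pow_sub_one_le_norm_sub_one (norm_eq_one_of_pow_eq_one' (NeZero.ne _)
    hζ.pow_eq_one).le n).trans_lt (norm_primitiveRoot_sub_one_lt hζ)

theorem norm_rootsEval_eq_one [IsAlgClosed Ω] {g : (unitBall Ω)[X]}
    (hg : ‖((g.eval 1 : unitBall Ω) : Ω)‖ = 1) (i : ℕ) :
    ‖((rootsEval ℓ g i : unitBall Ω) : Ω)‖ = 1 := by
  rw [rootsEval, ← ValuationSubring.subtype_apply, map_prod, norm_prod]
  refine Finset.prod_eq_one fun ξ hξ ↦ norm_eval_eq_one (x := 1) ?_ hg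
  rw [mem_roots_prime_pow] at hξ
  rw [norm_sub_rev]
  exact norm_sub_one_lt_of_mem_roots_prime_pow ℓ (i := i) (congrArg Subtype.val hξ)

omit [IsUltrametricDist Ω] in
theorem norm_le_norm_prime_of_mem_bot {w : Ω} (hw : w ∈ (⊥ : IntermediateField ℚ_[ℓ] Ω))
    (h : ‖w‖ < 1) : ‖w‖ ≤ ‖(ℓ : ℚ_[ℓ])‖ := by
  obtain ⟨q, rfl⟩ := IntermediateField.mem_bot.1 hw
  rw [norm_algebraMap'] at h ⊢
  have h1 := (Padic.norm_le_pow_iff_norm_lt_pow_add_one q (-1)).2 (by simpa using h)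
  rwa [zpow_neg_one, ← Padic.norm_p] at h1

variable [Algebra.IsAlgebraic ℚ_[ℓ] Ω] [IsAlgClosed Ω]

theorem norm_sub_pow_lt_one_of_mem_bot {w : Ω} (hw : w ∈ (⊥ : IntermediateField ℚ_[ℓ] Ω))
    (h : ‖w‖ ≤ 1) : ‖w - w ^ ℓ‖ < 1 := by
  have := (norm_pow_sub_self_lt_one_iff (p := ℓ) w h).2 ⟨w, hw, h, by simp⟩
  rwa [pow_one, norm_sub_rev] at this

variable {i : ℕ} {ζ : Ω}

omit [IsUltrametricDist Ω] [IsAlgClosed Ω] in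
theorem mem_adjoin_of_mem_simple {x u : Ω} (hu : u ∈ ℚ_[ℓ]⟮x⟯) (E : IntermediateField ℚ_[ℓ] Ω) :
    u ∈ Algebra.adjoin ℚ_[ℓ] ((E : Set Ω) ∪ {x}) := by
  have h := IntermediateField.adjoin_simple_toSubalgebra_of_isAlgebraic
    (Algebra.IsAlgebraic.isAlgebraic (R := ℚ_[ℓ]) x)
  have h1 : u ∈ (ℚ_[ℓ]⟮x⟯).toSubalgebra := hu
  rw [h] at h1
  exact Algebra.adjoin_mono Set.subset_union_right h1

/-- Write $y=(\zeta-1)^su$ with $u=g(\zeta)$ a unit and $g$ over $\mathbb Z_\ell$. The power of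
$\zeta-1$ contributes nothing, and $N(u)=\prod g(\xi)\equiv1\bmod\ell^{i+1}$. -/
theorem norm_iwasawaLog_algebraNorm_cyclotomic_le (hℓ2 : ℓ ≠ 2) (hζ : IsPrimitiveRoot ζ (ℓ ^ (i + 1)))
    {y : ℚ_[ℓ]⟮ζ⟯} (hy : y ≠ 0) :
    ‖iwasawaLog ℓ (Algebra.norm ℚ_[ℓ] y)‖ ≤ ‖(ℓ : ℚ_[ℓ])‖ ^ (i + 1) := by
  have hint : IsIntegral ℚ_[ℓ] ζ := Algebra.IsIntegral.isIntegral ζ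
  have := IntermediateField.adjoin.finiteDimensional hint
  have hn0 : ℓ ^ (i + 1) ≠ 0 := pow_ne_zero _ hℓ.out.ne_zero
  have hζ1 := norm_primitiveRoot_sub_one_pow hζ
  set gen := IntermediateField.AdjoinSimple.gen ℚ_[ℓ] ζ with hgen
  have hπ0 : gen - 1 ≠ 0 := by
    intro h
    have : ζ - 1 = 0 := congrArg Subtype.val h
    rw [this, norm_zero, zero_pow (Nat.totient_pos.2 (Nat.pos_of_ne_zero hn0)).ne'] at hζ1
    exact norm_ne_zero_iff.2 (by exact_mod_cast hℓ.out.ne_zero) hζ1.symm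
  obtain ⟨s, hs⟩ := norm_eq_zpow_of_finrank_le (M := ℚ_[ℓ]⟮ζ⟯) (gen - 1).2
    (finrank_adjoin_primitiveRoot hζ).le hζ1 y.2 (fun h ↦ hy (Subtype.ext h))
  set u : ℚ_[ℓ]⟮ζ⟯ := y / (gen - 1) ^ s with hu
  have hu1 : ‖(u : Ω)‖ = 1 := by
    have h1 : (u : Ω) = (y : Ω) / ((gen - 1 : ℚ_[ℓ]⟮ζ⟯) : Ω) ^ s := by rw [hu]; push_cast; rfl
    rw [h1, norm_div, norm_zpow, hs, div_self]
    exact zpow_ne_zero _ (norm_ne_zero_iff.2 fun h ↦ hπ0 (Subtype.ext h))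
  have hu0 : u ≠ 0 := by
    intro h
    rw [h] at hu1
    simp at hu1
  have hyu : y = (gen - 1) ^ s * u := by rw [hu, mul_div_cancel₀ _ (zpow_ne_zero _ hπ0)]
  have hlog : iwasawaLog ℓ (Algebra.norm ℚ_[ℓ] y) = iwasawaLog ℓ (Algebra.norm ℚ_[ℓ] u) := by
    rw [hyu, iwasawaLog_algebraNorm_mul (zpow_ne_zero _ hπ0) hu0,
      iwasawaLog_algebraNorm_zpow (iwasawaLog_algebraNorm_primitiveRoot_sub_one hζ), zero_add]
  rw [hlog]
  obtain ⟨P, hP⟩ := exists_int_prime_eq_mul (ℓ := ℓ) (Ω := Ω) (i := i)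
  obtain ⟨Q, hQ⟩ := exists_int_pow_eq_mul (ℓ := ℓ) (Ω := Ω) (i := i)
  have hζn := norm_eq_one_of_pow_eq_one' hn0 hζ.pow_eq_one
  obtain ⟨g, hg, hgu⟩ := exists_polynomial_eval_eq (E := ⊥) (x := ⟨ζ, hζn.le⟩) (c := 1)
    (fun w hw h ↦ norm_le_norm_prime_of_mem_bot hw h) (by simpa using hP ζ hζ)
    (by simpa using hQ ζ hζ) (by simpa using hζ1) (mem_adjoin_of_mem_simple u.2 ⊥) hu1.le
  have hN := algebraNorm_adjoin_primitiveRoot hζ u (G := fun x ↦ (g.map (unitBall Ω).subtype).eval x)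
    (fun σ ↦ by
      have h1 : g.map (unitBallMap σ) = g := map_eq_self_of_mem_fixingSubgroup hg
        (by rw [IntermediateField.fixingSubgroup_bot]; trivial)
      rw [← hgu, ← coe_unitBallMap, ← eval_map_apply, h1]
      exact (eval_map_apply (f := (unitBall Ω).subtype) (p := g) (unitBallMap σ ⟨ζ, hζn.le⟩)).symm)
  have h1 : ‖((g.eval 1 : unitBall Ω) : Ω)‖ = 1 := by
    refine norm_eval_eq_one (x := ⟨ζ, hζn.le⟩) ?_ (by rw [hgu, hu1])
    exact norm_primitiveRoot_sub_one_lt hζ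
  have h2 := norm_prod_primitiveRoots_eval_sub_one_le hg
    (fun w hw h ↦ norm_le_norm_prime_of_mem_bot hw h)
    (fun w hw h ↦ norm_sub_pow_lt_one_of_mem_bot hw h) i (norm_rootsEval_eq_one h1 i)
  have h3 : ((∏ ξ ∈ primitiveRoots (ℓ ^ (i + 1)) (unitBall Ω), g.eval ξ : unitBall Ω) : Ω) =
      algebraMap ℚ_[ℓ] Ω (Algebra.norm ℚ_[ℓ] u) := by
    rw [hN, primitiveRoots_eq_map_unitBall hn0, Finset.prod_map, ← ValuationSubring.subtype_apply,
      map_prod]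
    exact Finset.prod_congr rfl fun ξ _ ↦
      (eval_map_apply (f := (unitBall Ω).subtype) (p := g) ξ).symm
  rw [h3, ← map_one (algebraMap ℚ_[ℓ] Ω), ← map_sub, norm_algebraMap'] at h2
  rw [norm_iwasawaLog]
  · exact h2
  · refine h2.trans ?_
    rw [logConductor, if_neg hℓ2]
    exact pow_le_of_le_one (norm_nonneg _) Padic.norm_p_lt_one.le (by omega)

end LogNormCyclotomicOdd

/-! ### The norm operator in the variable $\zeta+\zeta^{-1}$, for $\ell=2$ -/

section TraceNormOperator
open Polynomial
variable {A : Type*} [CommRing A] [IsDomain A] [CharZero A]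

theorem expand_normOp_two (g : A[X]) : expand A 2 (normOp 2 g) = g * g.comp (-X) := by
  classical
  have hneg : IsPrimitiveRoot (-1 : A) 2 := IsPrimitiveRoot.neg_one 0 (by norm_num)
  have h1 : (1 : A) ∉ ({-1} : Finset A) := by
    rw [Finset.mem_singleton]
    intro h
    exact hneg.ne_one one_lt_two h.symm
  have h2 : nthRootsFinset 2 (1 : A) = {1, -1} := by
    ext x
    rw [mem_roots_prime, Finset.mem_insert, Finset.mem_singleton, sq_eq_one_iff]
  rw [expand_normOp hneg, rootProd, h2, Finset.prod_insert h1, Finset.prod_singleton]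
  simp

/-- The operator `g ↦ g'` on polynomials such that `g' (T ^ 2 - 2) = g T * g (-T)`. -/
noncomputable def traceNormOp (g : A[X]) : A[X] := (normOp 2 g).comp (X + 2)

theorem aeval_traceNormOp {K : Type*} [CommRing K] [Algebra A K] (g : A[X]) (c : K) :
    aeval (c ^ 2 - 2) (traceNormOp g) = aeval c g * aeval (-c) g := by
  have h : aeval c (g.comp (-X)) = aeval (-c) g := by rw [aeval_comp]; simp
  rw [traceNormOp, aeval_comp, ← h, ← map_mul, ← expand_normOp_two, expand_aeval,
    map_add, aeval_X, map_ofNat, sub_add_cancel]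

theorem eval_two_traceNormOp (g : A[X]) :
    (traceNormOp g).eval 2 = g.eval 2 * g.eval (-2) := by
  have := aeval_traceNormOp g (2 : A)
  simp only [coe_aeval_eq_eval] at this
  rw [← this]
  norm_num

omit [IsDomain A] [CharZero A] in
theorem eval_neg_two_congr (g : A[X]) : ∃ c, g.eval (-2) = g.eval 2 + 4 * c := by
  obtain ⟨c, hc⟩ := sub_dvd_eval_sub (-2) 2 g
  exact ⟨-c, by linear_combination hc⟩

/-- The value at $2=1+1^{-1}$ carries one more factor of 2 than the coefficients. This is preserved
because the new value is $g(2)g(-2)$ and $g(-2)\equiv g(2)\bmod4$. -/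
theorem traceNormOp_congr {g h : A[X]} {k : ℕ} (hk : k ≠ 0) (H1 : (2 : A[X]) ^ k ∣ g - h)
    (H2 : (2 : A) ^ (k + 1) ∣ g.eval 2 - h.eval 2) :
    (2 : A[X]) ^ (k + 1) ∣ traceNormOp g - traceNormOp h ∧
      (2 : A) ^ (k + 2) ∣ (traceNormOp g).eval 2 - (traceNormOp h).eval 2 := by
  have hneg : IsPrimitiveRoot (-1 : A) 2 := IsPrimitiveRoot.neg_one 0 (by norm_num)
  constructor
  · obtain ⟨B, hB⟩ := pow_dvd_normOp_sub hneg hk H1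
    refine ⟨B.comp (X + 2), ?_⟩
    rw [traceNormOp, traceNormOp, ← sub_comp, hB, mul_comp]
    simp
  · obtain ⟨B, hB⟩ := H1
    have hg : g = h + 2 ^ k * B := by rw [← hB]; ring
    have e (x : A) : g.eval x = h.eval x + 2 ^ k * B.eval x := by rw [hg]; simp
    obtain ⟨b, hb⟩ := H2
    have hB2 : B.eval 2 = 2 * b := by
      refine mul_left_cancel₀ (pow_ne_zero k (two_ne_zero (α := A))) ?_
      rw [e] at hb
      linear_combination hb
    obtain ⟨c, hc⟩ := eval_neg_two_congr B
    obtain ⟨d, hd⟩ := eval_neg_two_congr h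
    refine ⟨b * h.eval 2 + h.eval 2 * c + 2 * b * d + 2 ^ k * b * (b + 2 * c), ?_⟩
    rw [eval_two_traceNormOp, eval_two_traceNormOp, e, e, hc, hd, hB2]
    ring

omit [IsDomain A] [CharZero A] in
theorem two_dvd_comp_sub (g : A[X]) : (2 : A[X]) ∣ g.comp (X + 2) - g := by
  have h := sub_dvd_eval_sub (X + 2) X (g.map C)
  rw [add_sub_cancel_left, eval_map, eval_map, eval₂_C_X] at h
  exact h

theorem iterate_traceNormOp_congr {g : A[X]} (H1 : (2 : A[X]) ∣ normOp 2 g - g)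
    (H2 : (4 : A) ∣ g.eval 2 - 1) (n : ℕ) :
    (2 : A[X]) ^ (n + 1) ∣ traceNormOp^[n + 1] g - traceNormOp^[n] g ∧
      (2 : A) ^ (n + 2) ∣ (traceNormOp^[n + 1] g).eval 2 - (traceNormOp^[n] g).eval 2 := by
  induction n with
  | zero =>
    constructor
    · obtain ⟨B, hB⟩ := H1
      obtain ⟨D, hD⟩ := two_dvd_comp_sub g
      refine ⟨B.comp (X + 2) + D, ?_⟩
      have h : (normOp 2 g).comp (X + 2) - g.comp (X + 2) = 2 * B.comp (X + 2) := by
        rw [← sub_comp, hB, mul_comp]; simp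
      simp only [zero_add, Function.iterate_one, Function.iterate_zero, id_eq, pow_one, traceNormOp]
      linear_combination h + hD
    · obtain ⟨b, hb⟩ := H2
      obtain ⟨c, hc⟩ := eval_neg_two_congr g
      refine ⟨g.eval 2 * (b + c), ?_⟩
      simp only [zero_add, Function.iterate_one, Function.iterate_zero, id_eq]
      rw [eval_two_traceNormOp, hc]
      linear_combination g.eval 2 * hb
  | succ n ih =>
    rw [Function.iterate_succ_apply' _ (n + 1), Function.iterate_succ_apply' _ n]
    rw [Function.iterate_succ_apply' _ n] at ih
    have := traceNormOp_congr (Nat.succ_ne_zero n) ih.1 ih.2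
    exact this

/-- Pairing $\pm a$ over $a^2$ replaces $g$ by `traceNormOp` of $g$, as $(a+a^{-1})^2-2=a^2+a^{-2}$.
After $n$ steps only $\xi=-1$ is left, with $\xi+\xi^{-1}=-2$. -/
theorem prod_primitiveRoots_aeval_add_inv {K : Type*} [Field K] [IsAlgClosed K] [CharZero K]
    [Algebra A K] (g : A[X]) (n : ℕ) :
    ∏ ξ ∈ primitiveRoots (2 ^ (n + 1)) K, aeval (ξ + ξ⁻¹) g = aeval (-2 : K) (traceNormOp^[n] g) := by
  classical
  induction n generalizing g with
  | zero =>
    have h : primitiveRoots (2 ^ (0 + 1)) K = {-1} := by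
      ext x
      rw [zero_add, pow_one, mem_primitiveRoots two_pos, Finset.mem_singleton]
      constructor
      · exact fun h ↦ h.eq_neg_one_of_two_right
      · rintro rfl
        exact IsPrimitiveRoot.neg_one 0 (by norm_num)
    rw [h, Finset.prod_singleton]
    norm_num
  | succ n ih =>
    rw [Function.iterate_succ_apply, ← ih]
    have hpos (m : ℕ) : 0 < 2 ^ m := by positivity
    rw [← Finset.prod_fiberwise_of_maps_to (t := primitiveRoots (2 ^ (n + 1)) K)
      (g := fun x ↦ x ^ 2)]
    · refine Finset.prod_congr rfl fun η hη ↦ ?_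
      rw [mem_primitiveRoots (hpos _)] at hη
      obtain ⟨a, rfl⟩ := IsAlgClosed.exists_pow_nat_eq η two_pos
      have ha0 : a ≠ 0 := by
        rintro rfl
        exact hη.ne_zero (pow_ne_zero _ two_ne_zero) (by norm_num)
      have ha : ∀ b : K, b ^ 2 = a ^ 2 → IsPrimitiveRoot b (2 ^ (n + 1 + 1)) := by
        intro b hb
        refine IsPrimitiveRoot.iff_orderOf.2 (orderOf_eq_prime_pow (p := 2) ?_ ?_)
        · rw [pow_succ', pow_mul, hb]
          exact hη.pow_ne_one_of_pos_of_lt (hpos _).ne' (Nat.pow_lt_pow_right one_lt_two (by omega))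
        · rw [pow_succ', pow_mul, hb, hη.pow_eq_one]
      have hfib : {x ∈ primitiveRoots (2 ^ (n + 1 + 1)) K | x ^ 2 = a ^ 2} = {a, -a} := by
        ext x
        rw [Finset.mem_filter, mem_primitiveRoots (hpos _), Finset.mem_insert, Finset.mem_singleton,
          ← sq_eq_sq_iff_eq_or_eq_neg]
        exact ⟨fun h ↦ h.2, fun h ↦ ⟨ha x h, h⟩⟩
      have hne : a ∉ ({-a} : Finset K) := by
        rw [Finset.mem_singleton]
        intro h
        exact ha0 (self_eq_neg.1 h)
      rw [hfib, Finset.prod_insert hne, Finset.prod_singleton, inv_neg, ← neg_add,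
        ← aeval_traceNormOp]
      congr 2
      field_simp
      ring
    · intro x hx
      rw [mem_primitiveRoots (hpos _)] at hx ⊢
      exact hx.pow (hpos _) (pow_succ' 2 (n + 1))

/-- The $n$-fold iterate of $T\mapsto T^2-2$ sends $\zeta+\zeta^{-1}$ to
$\zeta^{2^n}+\zeta^{-2^n}=0$, since $\zeta^{2^n}$ has order 4. The other properties say that the
polynomial is Eisenstein at $T=2$. -/
theorem exists_int_poly_add_inv (n : ℕ) : ∃ f : ℤ[X], f.Monic ∧ f.natDegree = 2 ^ n ∧ f.eval 2 = 2 ∧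
    (2 : ℤ[X]) ∣ f - X ^ 2 ^ n ∧ ∀ {K : Type*} [Field K], ∀ ζ : K, IsPrimitiveRoot ζ (2 ^ (n + 2)) →
      aeval (ζ + ζ⁻¹) f = 0 := by
  induction n with
  | zero =>
    refine ⟨X, monic_X, natDegree_X, eval_X, by simp, fun ζ hζ ↦ ?_⟩
    have h := hζ.pow (by norm_num) (show 2 ^ 2 = 2 * 2 by norm_num)
    have h1 := h.eq_neg_one_of_two_right
    have h0 := hζ.ne_zero (by norm_num)
    rw [aeval_X]
    field_simp
    rw [h1]
    ring
  | succ n ih =>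
    obtain ⟨f, hf1, hf2, hf3, ⟨B, hB⟩, hf5⟩ := ih
    have hq : (X ^ 2 - 2 : ℤ[X]) = X ^ 2 - C 2 := rfl
    have hd : (X ^ 2 - 2 : ℤ[X]).natDegree = 2 := by rw [hq]; exact natDegree_X_pow_sub_C
    have hm : (X ^ 2 - 2 : ℤ[X]).Monic := by rw [hq]; exact monic_X_pow_sub_C _ two_ne_zero
    refine ⟨f.comp (X ^ 2 - 2), hf1.comp hm (by omega), ?_, ?_, ?_, fun ζ hζ ↦ ?_⟩
    · rw [natDegree_comp, hf2, hd, pow_succ]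
    · rw [eval_comp]
      norm_num [hf3]
    · have h1 : (f - X ^ 2 ^ n).comp (X ^ 2 - 2) = 2 * B.comp (X ^ 2 - 2) := by
        rw [hB, mul_comp]; simp
      rw [sub_comp] at h1
      obtain ⟨D, hD⟩ := sub_dvd_pow_sub_pow (X ^ 2 - 2 : ℤ[X]) (X ^ 2) (2 ^ n)
      refine ⟨B.comp (X ^ 2 - 2) - D, ?_⟩
      have h2 : (X ^ 2 ^ n : ℤ[X]).comp (X ^ 2 - 2) = (X ^ 2 - 2) ^ 2 ^ n := by simp
      rw [h2] at h1
      have h3 : (X : ℤ[X]) ^ 2 ^ (n + 1) = (X ^ 2) ^ 2 ^ n := by rw [← pow_mul, ← pow_succ']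
      rw [h3]
      linear_combination h1 + hD
    · have h0 := hζ.ne_zero (by positivity)
      rw [aeval_comp]
      have h1 : aeval (ζ + ζ⁻¹) (X ^ 2 - 2 : ℤ[X]) = ζ ^ 2 + (ζ ^ 2)⁻¹ := by
        simp only [map_sub, map_pow, aeval_X, map_ofNat]
        field_simp
        ring
      rw [h1]
      exact hf5 _ (hζ.pow (by positivity) (by rw [← pow_succ']))

end TraceNormOperator

/-! ### The bound on logarithms of norms for $\ell=2$ -/

section LogNormCyclotomicTwo
open Polynomial
open scoped IntermediateField
variable {Ω : Type*} [NormedField Ω] [NormedAlgebra ℚ_[2] Ω] [IsUltrametricDist Ω]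

theorem norm_four_eq : ‖(4 : ℚ_[2])‖ = ‖((2 : ℕ) : ℚ_[2])‖ ^ 2 := by
  rw [← norm_pow]; norm_num

theorem exists_sign_norm_sub_le {q : ℚ_[2]} (hq : ‖q‖ = 1) :
    ∃ ε : ℤ, (ε = 1 ∨ ε = -1) ∧ ‖ε * q - 1‖ ≤ ‖((2 : ℕ) : ℚ_[2])‖ ^ 2 := by
  have key (z : ℤ_[2]) (h : z.toZModPow 2 = 0) : ‖(z : ℚ_[2])‖ ≤ ‖((2 : ℕ) : ℚ_[2])‖ ^ 2 := by
    have := norm_le_pow_of_toZModPow_eq_zero 2 h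
    rwa [norm_pow] at this
  let z : ℤ_[2] := ⟨q, hq.le⟩
  have hz : IsUnit (z.toZModPow 2) := (PadicInt.isUnit_iff.2 (show ‖z‖ = 1 from hq)).map _
  have h4 : ∀ a : ZMod (2 ^ 2), IsUnit a → a = 1 ∨ a = -1 := by decide
  rcases h4 _ hz with h | h
  · refine ⟨1, Or.inl rfl, ?_⟩
    rw [Int.cast_one, one_mul]
    exact key (z - 1) (by rw [map_sub, h, map_one, sub_self])
  · refine ⟨-1, Or.inr rfl, ?_⟩
    have := key (-z - 1) (by rw [map_sub, map_neg, h, map_one, neg_neg, sub_self])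
    rw [Int.cast_neg, Int.cast_one, neg_one_mul]
    exact this

omit [NormedAlgebra ℚ_[2] Ω] in
theorem eval_mem_of_coeff_mem {ℓ : ℕ} [Fact ℓ.Prime] [NormedAlgebra ℚ_[ℓ] Ω]
    {E : IntermediateField ℚ_[ℓ] Ω} {g : (unitBall Ω)[X]} (hg : ∀ n, (g.coeff n : Ω) ∈ E)
    {x : unitBall Ω} (hx : (x : Ω) ∈ E) : ((g.eval x : unitBall Ω) : Ω) ∈ E := by
  rw [eval_eq_sum_range]
  push_cast
  exact sum_mem fun n _ ↦ mul_mem (hg n) (pow_mem hx n)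

variable [Algebra.IsAlgebraic ℚ_[2] Ω] [IsAlgClosed Ω] {i : ℕ} {ζ : Ω}

/-- The odd argument, with uniformizer $\zeta+\zeta^{-1}-2$. Since $u$ is a polynomial $g$ in
$\zeta+\zeta^{-1}$, its norm from $\mathbb Q_2(\zeta)$ is the value at $-2$ of an iterate of
`traceNormOp`, which is $1$ modulo $2^{i+3}$. -/
theorem norm_iwasawaLog_algebraNorm_cyclotomic_two_le (hζ : IsPrimitiveRoot ζ (2 ^ (i + 2)))
    {y : ℚ_[2]⟮ζ⟯} (hyM : (y : Ω) ∈ ℚ_[2]⟮ζ + ζ⁻¹⟯) (hy : y ≠ 0) :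
    ‖iwasawaLog 2 (Algebra.norm ℚ_[2] y)‖ ≤ ‖((2 : ℕ) : ℚ_[2])‖ ^ (i + 3) := by
  have : CharZero Ω := charZero_of_injective_algebraMap (algebraMap ℚ_[2] Ω).injective
  have hint : IsIntegral ℚ_[2] ζ := Algebra.IsIntegral.isIntegral ζ
  have := IntermediateField.adjoin.finiteDimensional hint
  set t := ζ + ζ⁻¹ with ht
  have hintt : IsIntegral ℚ_[2] t := Algebra.IsIntegral.isIntegral t
  have := IntermediateField.adjoin.finiteDimensional hintt
  have hn0 : 2 ^ (i + 2) ≠ 0 := by positivity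
  have hζ0 : ζ ≠ 0 := hζ.ne_zero hn0
  have hζn : ‖ζ‖ = 1 := norm_eq_one_of_pow_eq_one' hn0 hζ.pow_eq_one
  obtain ⟨f, hf1, hf2, hf3, ⟨B, hB⟩, hf5⟩ := exists_int_poly_add_inv i
  have hft : aeval t f = 0 := hf5 ζ hζ
  have hfin : Module.finrank ℚ_[2] ℚ_[2]⟮t⟯ ≤ 2 ^ i := by
    rw [IntermediateField.adjoin.finrank hintt, ← hf2,
      ← hf1.natDegree_map (algebraMap ℤ ℚ_[2])]
    exact natDegree_le_of_dvd (minpoly.dvd _ _ (by rw [aeval_map_algebraMap, hft]))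
      (hf1.map _).ne_zero
  have hπ : t - 2 = ζ⁻¹ * (ζ - 1) ^ 2 := by rw [ht]; field_simp; ring
  have hπn : ‖t - 2‖ ^ 2 ^ i = ‖((2 : ℕ) : ℚ_[2])‖ := by
    rw [hπ, norm_mul, norm_inv, hζn, inv_one, one_mul, norm_pow, ← pow_mul, ← pow_succ',
      ← norm_primitiveRoot_sub_one_pow hζ, Nat.totient_prime_pow_succ Nat.prime_two]
    simp
  have hπ0 : t - 2 ≠ 0 := by
    intro h
    rw [h, norm_zero, zero_pow (by positivity)] at hπn
    exact norm_ne_zero_iff.2 (by norm_num) hπn.symm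
  have htM : t ∈ ℚ_[2]⟮ζ⟯ := add_mem (IntermediateField.mem_adjoin_simple_self _ ζ)
    (inv_mem (IntermediateField.mem_adjoin_simple_self _ ζ))
  have hMZ : ℚ_[2]⟮t⟯ ≤ ℚ_[2]⟮ζ⟯ := IntermediateField.adjoin_simple_le_iff.2 htM
  have hπM : t - 2 ∈ ℚ_[2]⟮t⟯ := sub_mem (IntermediateField.mem_adjoin_simple_self _ t)
    (ofNat_mem _ 2)
  have hlogπ : iwasawaLog 2 (Algebra.norm ℚ_[2] (⟨t - 2, hMZ hπM⟩ : ℚ_[2]⟮ζ⟯)) = 0 := by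
    set gen := IntermediateField.AdjoinSimple.gen ℚ_[2] ζ with hgen
    have h0 : gen ≠ 0 := fun h ↦ hζ0 (congrArg Subtype.val h)
    have h1 : gen - 1 ≠ 0 := by
      intro h
      have h2 : ζ - 1 = 0 := congrArg Subtype.val h
      rw [hπ, h2] at hπ0
      simp at hπ0
    have e : (⟨t - 2, hMZ hπM⟩ : ℚ_[2]⟮ζ⟯) = gen ^ (-1 : ℤ) * (gen - 1) ^ (2 : ℤ) := by
      apply Subtype.ext
      rw [zpow_neg_one, zpow_ofNat]
      exact hπ
    rw [e, iwasawaLog_algebraNorm_mul (zpow_ne_zero _ h0) (zpow_ne_zero _ h1),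
      iwasawaLog_algebraNorm_zpow (iwasawaLog_algebraNorm_primitiveRoot_sub_one hζ),
      iwasawaLog_algebraNorm_zpow, add_zero]
    refine iwasawaLog_eq_zero_of_pow_eq_one hn0 ?_
    have h2 : gen ^ 2 ^ (i + 2) = 1 := Subtype.ext hζ.pow_eq_one
    rw [← map_pow, h2, map_one]
  obtain ⟨s, hs⟩ := norm_eq_zpow_of_finrank_le hπM hfin hπn hyM (fun h ↦ hy (Subtype.ext h))
  have huM : (y : Ω) / (t - 2) ^ s ∈ ℚ_[2]⟮t⟯ := div_mem hyM (zpow_mem hπM s)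
  have hu1 : ‖(y : Ω) / (t - 2) ^ s‖ = 1 := by
    rw [norm_div, norm_zpow, hs, div_self (zpow_ne_zero _ (norm_ne_zero_iff.2 hπ0))]
  set u₀ := (y : Ω) / (t - 2) ^ s with hu₀
  have htn : t ∈ unitBall Ω := by
    rw [mem_unitBall]
    refine (IsUltrametricDist.norm_add_le_max _ _).trans ?_
    rw [norm_inv, hζn, inv_one, max_self]
  have hπlt : ‖t - 2‖ < 1 := by
    by_contra h
    have h1 := one_le_pow₀ (n := 2 ^ i) (not_lt.1 h)
    rw [hπn] at h1
    exact absurd (Padic.norm_p_lt_one (p := 2)) (not_lt.2 h1)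
  have h2t : aeval t (2 : ℤ[X]) = 2 := map_ofNat _ 2
  obtain ⟨P, hP⟩ := (dvd_iff_isRoot (p := C (2 : ℤ) - f) (a := 2)).2 (by simp [hf3])
  have hP' : ((2 : ℕ) : Ω) = (t - (2 : ℤ)) * aeval t P := by
    simpa [hft, h2t] using congrArg (aeval t) hP
  obtain ⟨D, hD⟩ := sub_dvd_pow_sub_pow (X - 2 : ℤ[X]) X (2 ^ i)
  have hQ : (t - (2 : ℤ)) ^ 2 ^ i = ((2 : ℕ) : Ω) * aeval t (-D - B) := by
    have h1 : (X - 2 : ℤ[X]) ^ 2 ^ i = f + 2 * (-D - B) := by linear_combination hD - hB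
    simpa [hft, h2t] using congrArg (aeval t) h1
  obtain ⟨g₀, hg₀, hgu₀⟩ := exists_polynomial_eval_eq (ℓ := 2) (E := ⊥) (x := ⟨t, htn⟩) (c := 2)
    (fun w hw h ↦ norm_le_norm_prime_of_mem_bot hw h) hP' hQ (by simpa using hπn)
    (mem_adjoin_of_mem_simple huM ⊥) hu1.le
  have hg2 : ‖((g₀.eval 2 : unitBall Ω) : Ω)‖ = 1 := by
    refine norm_eval_eq_one (x := ⟨t, htn⟩) ?_ (by rw [hgu₀, hu1])
    exact hπlt
  obtain ⟨q, hq⟩ := IntermediateField.mem_bot.1 (eval_mem_of_coeff_mem hg₀ (x := 2) (ofNat_mem ⊥ 2))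
  rw [← hq, norm_algebraMap'] at hg2
  -- The sign makes $g(2)\equiv1\bmod4$, which starts the induction on congruences. The logarithm
  -- does not see it.
  obtain ⟨ε, hε, hεq⟩ := exists_sign_norm_sub_le hg2
  have hε2 : ε * ε = 1 := by rcases hε with rfl | rfl <;> norm_num
  set g : (unitBall Ω)[X] := C (ε : unitBall Ω) * g₀ with hgdef
  have hg : ∀ n, (g.coeff n : Ω) ∈ (⊥ : IntermediateField ℚ_[2] Ω) := by
    intro n
    rw [hgdef, coeff_C_mul, MulMemClass.coe_mul]
    exact mul_mem (intCast_mem (⊥ : IntermediateField ℚ_[2] Ω) ε) (hg₀ n)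
  have hcong := dvd_normOp_sub_map (ℓ := 2) hg
    (fun w hw h ↦ norm_le_norm_prime_of_mem_bot hw h) (φ := 1) (fun w hw ↦ hw)
    (fun w hw h ↦ norm_sub_pow_lt_one_of_mem_bot hw h)
  rw [map_eq_self_of_mem_fixingSubgroup hg (one_mem _)] at hcong
  have hcong2 : (4 : unitBall Ω) ∣ g.eval 2 - 1 := by
    have h1 : ((2 : ℕ) : unitBall Ω) ^ 2 ∣ g.eval 2 - 1 := by
      rw [pow_dvd_unitBall_iff]
      have e : (((g.eval 2 - 1 : unitBall Ω)) : Ω) = algebraMap ℚ_[2] Ω (ε * q - 1) := by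
        rw [map_sub, map_mul, hq, map_intCast, map_one, hgdef, eval_mul, eval_C]
        rfl
      rw [e, norm_algebraMap']
      exact hεq
    norm_num at h1
    exact h1
  have hnorm : ∀ n : ℕ, ‖(((traceNormOp^[n] g).eval 2 : unitBall Ω) : Ω)‖ = 1 := by
    have h4 : ‖((2 : unitBall Ω) : Ω) - ((-2 : unitBall Ω) : Ω)‖ < 1 := by
      have e : ((2 : unitBall Ω) : Ω) - ((-2 : unitBall Ω) : Ω) = algebraMap ℚ_[2] Ω 4 := by
        rw [map_ofNat]
        change (2 : Ω) - (-2) = 4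
        norm_num
      rw [e, norm_algebraMap', norm_four_eq]
      exact pow_lt_one₀ (norm_nonneg _) Padic.norm_p_lt_one two_ne_zero
    intro n
    induction n with
    | zero =>
      rw [Function.iterate_zero, id_eq, hgdef, eval_mul, eval_C, MulMemClass.coe_mul, norm_mul,
        ← hq, norm_algebraMap', hg2, mul_one]
      rcases hε with rfl | rfl <;> simp
    | succ n ih =>
      rw [Function.iterate_succ_apply', eval_two_traceNormOp, MulMemClass.coe_mul, norm_mul, ih,
        norm_eval_eq_one h4 ih, one_mul]
  -- For $h$ the $(i+1)$-st iterate this reads $h(2)h(-2)\equiv h(2)\bmod2^{i+3}$, and $h(2)$ is a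
  -- unit.
  have hfinal := (iterate_traceNormOp_congr (by exact_mod_cast hcong) hcong2 (i + 1)).2
  rw [Function.iterate_succ_apply', eval_two_traceNormOp] at hfinal
  set h := traceNormOp^[i + 1] g with hh
  have hfinal2 : ‖((h.eval (-2) : unitBall Ω) : Ω) - 1‖ ≤ ‖((2 : ℕ) : ℚ_[2])‖ ^ (i + 3) := by
    have h1 := (pow_dvd_unitBall_iff (ℓ := 2) (Ω := Ω) (k := i + 3)
      (x := h.eval 2 * h.eval (-2) - h.eval 2)).1 (by rw [Nat.cast_ofNat]; exact hfinal)
    have h2 : ((h.eval 2 * h.eval (-2) - h.eval 2 : unitBall Ω) : Ω) =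
        ((h.eval 2 : unitBall Ω) : Ω) * (((h.eval (-2) : unitBall Ω) : Ω) - 1) := by
      push_cast; ring
    rwa [h2, norm_mul, hnorm, one_mul] at h1
  set u : ℚ_[2]⟮ζ⟯ := ε * ⟨u₀, hMZ huM⟩ with hu
  have hεZ : (ε : ℚ_[2]⟮ζ⟯) * ε = 1 := by exact_mod_cast congrArg (Int.cast : ℤ → ℚ_[2]⟮ζ⟯) hε2
  have hε0 : (ε : ℚ_[2]⟮ζ⟯) ≠ 0 := left_ne_zero_of_mul_eq_one hεZ
  have hu₀0 : (⟨u₀, hMZ huM⟩ : ℚ_[2]⟮ζ⟯) ≠ 0 := by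
    intro h0
    have h1 : u₀ = 0 := congrArg Subtype.val h0
    rw [h1] at hu1
    simp at hu1
  have hπZ : (⟨t - 2, hMZ hπM⟩ : ℚ_[2]⟮ζ⟯) ≠ 0 := fun h0 ↦ hπ0 (congrArg Subtype.val h0)
  have hu0 : u ≠ 0 := mul_ne_zero hε0 hu₀0
  have hyu : y = ε * ((⟨t - 2, hMZ hπM⟩ : ℚ_[2]⟮ζ⟯) ^ s * u) := by
    have h1 : y = (⟨t - 2, hMZ hπM⟩ : ℚ_[2]⟮ζ⟯) ^ s * ⟨u₀, hMZ huM⟩ := by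
      apply Subtype.ext
      have h2 : (y : Ω) = (t - 2) ^ s * u₀ := (mul_div_cancel₀ _ (zpow_ne_zero _ hπ0)).symm
      rw [h2]
      push_cast
      rfl
    rw [hu]
    linear_combination h1 - (⟨t - 2, hMZ hπM⟩ : ℚ_[2]⟮ζ⟯) ^ s * ⟨u₀, hMZ huM⟩ * hεZ
  have hlogε : iwasawaLog 2 (Algebra.norm ℚ_[2] (ε : ℚ_[2]⟮ζ⟯)) = 0 :=
    iwasawaLog_eq_zero_of_pow_eq_one two_ne_zero (by rw [← map_pow, sq, hεZ, map_one])
  rw [hyu, iwasawaLog_algebraNorm_mul hε0 (mul_ne_zero (zpow_ne_zero _ hπZ) hu0),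
    iwasawaLog_algebraNorm_mul (zpow_ne_zero _ hπZ) hu0, iwasawaLog_algebraNorm_zpow hlogπ, hlogε,
    zero_add, zero_add]
  have haeval (x : unitBall Ω) (k : (unitBall Ω)[X]) :
      aeval (x : Ω) k = ((k.eval x : unitBall Ω) : Ω) :=
    (aeval_def _ _).trans ((eval₂_eq_eval_map _).trans
      (eval_map_apply (f := (unitBall Ω).subtype) (p := k) x))
  have hN := algebraNorm_adjoin_primitiveRoot (i := i + 1) hζ u (G := fun x ↦ aeval (x + x⁻¹) g)
    (fun σ ↦ by
      have h1 : g.map (unitBallMap σ) = g := map_eq_self_of_mem_fixingSubgroup hg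
        (by rw [IntermediateField.fixingSubgroup_bot]; trivial)
      have h2 : (u : Ω) = ((g.eval ⟨t, htn⟩ : unitBall Ω) : Ω) := by
        change (ε : Ω) * u₀ = _
        rw [hgdef, eval_mul, eval_C, MulMemClass.coe_mul, hgu₀]
        rfl
      rw [h2, ← coe_unitBallMap, ← eval_map_apply, h1, ← haeval, coe_unitBallMap, ← map_inv₀,
        ← map_add])
  rw [prod_primitiveRoots_aeval_add_inv, ← hh] at hN
  have hN2 : algebraMap ℚ_[2] Ω (Algebra.norm ℚ_[2] u) = ((h.eval (-2) : unitBall Ω) : Ω) :=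
    hN.trans (haeval (-2) h)
  rw [← hN2, ← map_one (algebraMap ℚ_[2] Ω), ← map_sub, norm_algebraMap'] at hfinal2
  rw [norm_iwasawaLog]
  · exact hfinal2
  · refine hfinal2.trans ?_
    rw [logConductor, if_pos rfl, show ((4 : ℕ) : ℚ_[2]) = 4 by norm_num, norm_four_eq]
    exact pow_le_pow_of_le_one (norm_nonneg _) Padic.norm_p_lt_one.le (by omega)

end LogNormCyclotomicTwo

/-! ### Norms in towers -/

section NormTower
variable {k Ω : Type*} [Field k] [Field Ω] [Algebra k Ω] {D K : IntermediateField k Ω}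
  [FiniteDimensional k K]

theorem exists_algebraNorm_inclusion (h : D ≤ K) (y : D) :
    ∃ m : ℕ, m * Module.finrank k D = Module.finrank k K ∧
      Algebra.norm k (IntermediateField.inclusion h y) = Algebra.norm k y ^ m := by
  let _ : Algebra D K := (IntermediateField.inclusion h).toRingHom.toAlgebra
  have : IsScalarTower k D K := .of_algebraMap_eq fun _ ↦ rfl
  have : FiniteDimensional D K := FiniteDimensional.right k D K
  have : FiniteDimensional k D := FiniteDimensional.left k D K
  have : Module.Free D K := Module.Free.of_divisionRing D K
  refine ⟨Module.finrank D K, ?_, ?_⟩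
  · rw [mul_comm, Module.finrank_mul_finrank]
  · have h1 : IntermediateField.inclusion h y = algebraMap D K y := rfl
    rw [h1, ← Algebra.norm_norm (S := D), Algebra.norm_algebraMap, map_pow]

theorem exists_algebraNorm_eq (h : D ≤ K) {x : K} (hx : x ≠ 0) :
    ∃ y : D, y ≠ 0 ∧ Algebra.norm k x = Algebra.norm k y := by
  let _ : Algebra D K := (IntermediateField.inclusion h).toRingHom.toAlgebra
  have : IsScalarTower k D K := .of_algebraMap_eq fun _ ↦ rfl
  have : FiniteDimensional D K := FiniteDimensional.right k D K
  have : FiniteDimensional k D := FiniteDimensional.left k D K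
  have : Module.Free D K := Module.Free.of_divisionRing D K
  exact ⟨Algebra.norm D x, Algebra.norm_ne_zero_iff.2 hx, (Algebra.norm_norm (S := D)).symm⟩

end NormTower

/-! ### The inclusion $\operatorname{Log}N(K^\times)\subseteq\operatorname{Log}\chi(G_K)$ -/

section LogNormBound
open Polynomial
open scoped IntermediateField
variable {ℓ : ℕ} [hℓ : Fact ℓ.Prime] {Ω : Type*} [NormedField Ω] [NormedAlgebra ℚ_[ℓ] Ω]
  [IsUltrametricDist Ω] [Algebra.IsAlgebraic ℚ_[ℓ] Ω] [IsAlgClosed Ω]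

omit [IsUltrametricDist Ω] [Algebra.IsAlgebraic ℚ_[ℓ] Ω] [IsAlgClosed Ω] in
theorem norm_logChar_le (σ : Gal(Ω/ℚ_[ℓ])) :
    ‖logChar ℚ_[ℓ] Ω ℓ σ‖ ≤ ‖(logConductor ℓ : ℚ_[ℓ])‖ :=
  norm_iwasawaLog_le (norm_units_val ℓ _)

omit [IsUltrametricDist Ω] in
-- The character is $\pm1$ modulo $\ell^{i+2}$, and the logarithm does not see the sign.
theorem norm_logChar_le_pow {σ : Gal(Ω/ℚ_[ℓ])} {i : ℕ} {ζ : Ω} (hζ : IsPrimitiveRoot ζ (ℓ ^ (i + 2)))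
    (h : σ ζ = ζ ∨ σ ζ = ζ⁻¹) : ‖logChar ℚ_[ℓ] Ω ℓ σ‖ ≤ ‖(ℓ : ℚ_[ℓ]) ^ (i + 2)‖ := by
  have : CharZero Ω := charZero_of_injective_algebraMap (algebraMap ℚ_[ℓ] Ω).injective
  have hq : ‖(ℓ : ℚ_[ℓ]) ^ (i + 2)‖ ≤ ‖(logConductor ℓ : ℚ_[ℓ])‖ := by
    rw [logConductor, norm_pow]
    split_ifs with h2
    · subst h2
      rw [show ((4 : ℕ) : ℚ_[2]) = 4 by norm_num, norm_four_eq]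
      exact pow_le_pow_of_le_one (norm_nonneg _) Padic.norm_p_lt_one.le (by omega)
    · exact pow_le_of_le_one (norm_nonneg _) Padic.norm_p_lt_one.le (by omega)
  rw [logChar]
  set u := ((cyclotomicCharacter Ω ℓ (σ : Ω ≃+* Ω) : ℤ_[ℓ]) : ℚ_[ℓ]) with hu
  rcases h with h | h
  · have h1 := norm_cyclotomicCharacter_sub_le ℓ (a := 1) hζ (by rw [h, pow_one])
    rw [← hu, Nat.cast_one] at h1
    rw [norm_iwasawaLog (h1.trans hq)]
    exact h1
  · have hpos : 1 ≤ ℓ ^ (i + 2) := Nat.one_le_pow _ _ hℓ.out.pos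
    have h1 := norm_cyclotomicCharacter_sub_le ℓ (a := ℓ ^ (i + 2) - 1) hζ (by
      rw [h]
      refine inv_eq_of_mul_eq_one_right ?_
      rw [← pow_succ', Nat.sub_add_cancel hpos, hζ.pow_eq_one])
    rw [← hu, Nat.cast_sub hpos] at h1
    push_cast at h1
    have h2 : ‖-u - 1‖ ≤ ‖(ℓ : ℚ_[ℓ]) ^ (i + 2)‖ := by
      have e : -u - 1 = -(u - ((ℓ : ℚ_[ℓ]) ^ (i + 2) - 1)) + -(ℓ : ℚ_[ℓ]) ^ (i + 2) := by ring
      rw [e]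
      refine (Padic.nonarchimedean _ _).trans (max_le ?_ ?_) <;> rw [norm_neg]
      exact h1
    rw [← iwasawaLog_neg (units_val_ne_zero ℓ _), ← hu, norm_iwasawaLog (h2.trans hq)]
    exact h2

variable (ℓ Ω) in
-- Take $\sigma$ with $\chi(\sigma)\equiv1+q\bmod\ell^3$, where $q$ is the conductor. Level 3
-- suffices because $\ell^3$ is strictly smaller than $q$, even for $\ell=2$.
theorem exists_norm_logChar_eq_logConductor :
    ∃ σ : Gal(Ω/ℚ_[ℓ]), ‖logChar ℚ_[ℓ] Ω ℓ σ‖ = ‖(logConductor ℓ : ℚ_[ℓ])‖ := by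
  have : CharZero Ω := charZero_of_injective_algebraMap (algebraMap ℚ_[ℓ] Ω).injective
  obtain ⟨ζ, hζ⟩ := HasEnoughRootsOfUnity.exists_primitiveRoot Ω (ℓ ^ (2 + 1))
  have hdvd : ℓ ∣ logConductor ℓ := by
    unfold logConductor
    split_ifs with h
    · rw [h]; norm_num
    · exact dvd_rfl
  have hcop : (1 + logConductor ℓ).Coprime (ℓ ^ (2 + 1)) := by
    refine Nat.Coprime.pow_right _ ?_
    obtain ⟨c, hc⟩ := hdvd
    rw [hc]
    simp
  obtain ⟨σ, hσ⟩ := exists_apply_primitiveRoot_eq hζ (hζ.pow_of_coprime _ hcop)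
  have h1 := norm_cyclotomicCharacter_sub_le ℓ hζ hσ
  refine ⟨σ, ?_⟩
  rw [logChar]
  set u := ((cyclotomicCharacter Ω ℓ (σ : Ω ≃+* Ω) : ℤ_[ℓ]) : ℚ_[ℓ]) with hu
  have hlt : ‖(ℓ : ℚ_[ℓ]) ^ (2 + 1)‖ < ‖(logConductor ℓ : ℚ_[ℓ])‖ := by
    have h0 : 0 < ‖(ℓ : ℚ_[ℓ])‖ := norm_pos_iff.2 (by exact_mod_cast hℓ.out.ne_zero)
    rw [logConductor, norm_pow]
    split_ifs with h2
    · subst h2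
      rw [show ((4 : ℕ) : ℚ_[2]) = 4 by norm_num, norm_four_eq]
      exact pow_lt_pow_right_of_lt_one₀ h0 Padic.norm_p_lt_one (by omega)
    · nth_rewrite 2 [← pow_one ‖(ℓ : ℚ_[ℓ])‖]
      exact pow_lt_pow_right_of_lt_one₀ h0 Padic.norm_p_lt_one (by omega)
  have h2 : ‖u - 1‖ = ‖(logConductor ℓ : ℚ_[ℓ])‖ := by
    have e : u - 1 = (u - ((1 + logConductor ℓ : ℕ) : ℚ_[ℓ])) + logConductor ℓ := by push_cast; ring
    have h3 := h1.trans_lt hlt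
    rw [e, IsUltrametricDist.norm_add_eq_max_of_norm_ne_norm h3.ne, max_eq_right h3.le]
  rw [norm_iwasawaLog h2.le, h2]

theorem norm_totient_mul_logConductor (i : ℕ) :
    ‖(((ℓ ^ (i + 2)).totient : ℕ) : ℚ_[ℓ])‖ * ‖(logConductor ℓ : ℚ_[ℓ])‖ =
      ‖(ℓ : ℚ_[ℓ])‖ ^ (if ℓ = 2 then i + 3 else i + 2) := by
  have h1 : ‖((ℓ - 1 : ℕ) : ℚ_[ℓ])‖ = 1 := by
    rw [Padic.norm_natCast_eq_one_iff]
    have : (ℓ - 1).Coprime (ℓ - 1 + 1) := by simp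
    rw [Nat.sub_add_cancel hℓ.out.one_le] at this
    exact this.symm
  rw [Nat.totient_prime_pow_succ hℓ.out, Nat.cast_mul, norm_mul, h1, mul_one, Nat.cast_pow, norm_pow,
    logConductor]
  split_ifs with h
  · subst h
    rw [show ((4 : ℕ) : ℚ_[2]) = 4 by norm_num, norm_four_eq, ← pow_add]
  · rw [← pow_succ]

/-- For odd $\ell$, $M$ is the whole cyclotomic field. For $\ell=2$ it is the subfield generated by
$\zeta+\zeta^{-1}$, where the bound is sharper; the fields to be embedded in $M$ are fixed by
automorphisms inverting $\zeta$ anyway. -/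
theorem exists_subfield_adjoin_primitiveRoot {i : ℕ} {ζ : Ω} (hζ : IsPrimitiveRoot ζ (ℓ ^ (i + 2))) :
    ∃ M : IntermediateField ℚ_[ℓ] Ω, M ≤ ℚ_[ℓ]⟮ζ⟯ ∧
      (∀ y : ℚ_[ℓ]⟮ζ⟯, (y : Ω) ∈ M → y ≠ 0 → ‖iwasawaLog ℓ (Algebra.norm ℚ_[ℓ] y)‖ ≤
        ‖(((ℓ ^ (i + 2)).totient : ℕ) : ℚ_[ℓ])‖ * ‖(logConductor ℓ : ℚ_[ℓ])‖) ∧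
      ∀ σ ∈ M.fixingSubgroup, ‖logChar ℚ_[ℓ] Ω ℓ σ‖ ≤ ‖(ℓ : ℚ_[ℓ]) ^ (i + 2)‖ := by
  simp only [norm_totient_mul_logConductor]
  have hζ0 : ζ ≠ 0 := hζ.ne_zero (pow_ne_zero _ hℓ.out.ne_zero)
  have hmem := IntermediateField.mem_adjoin_simple_self ℚ_[ℓ] ζ
  split_ifs with h
  · subst h
    refine ⟨ℚ_[2]⟮ζ + ζ⁻¹⟯, ?_, fun y hyM hy ↦
      norm_iwasawaLog_algebraNorm_cyclotomic_two_le hζ hyM hy, fun σ hσ ↦ ?_⟩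
    · exact IntermediateField.adjoin_simple_le_iff.2 (add_mem hmem (inv_mem hmem))
    · refine norm_logChar_le_pow hζ ?_
      have h1 := (IntermediateField.mem_fixingSubgroup_iff _ _).1 hσ _
        (IntermediateField.mem_adjoin_simple_self _ _)
      rw [map_add, map_inv₀] at h1
      have h2 : σ ζ ≠ 0 := (map_ne_zero σ).2 hζ0
      have h3 : (σ ζ - ζ) * (σ ζ - ζ⁻¹) = 0 := by
        field_simp at h1 ⊢
        linear_combination h1
      rcases mul_eq_zero.1 h3 with h4 | h4
      · exact Or.inl (sub_eq_zero.1 h4)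
      · exact Or.inr (sub_eq_zero.1 h4)
  · refine ⟨ℚ_[ℓ]⟮ζ⟯, le_rfl, fun y _ hy ↦
      norm_iwasawaLog_algebraNorm_cyclotomic_le h hζ hy, fun σ hσ ↦ norm_logChar_le_pow hζ (Or.inl ?_)⟩
    exact (IntermediateField.mem_fixingSubgroup_iff _ _).1 hσ _ hmem

variable (K : IntermediateField ℚ_[ℓ] Ω) [FiniteDimensional ℚ_[ℓ] K]

theorem exists_logChar_ne_zero_mem_fixingSubgroup :
    ∃ σ ∈ K.fixingSubgroup, logChar ℚ_[ℓ] Ω ℓ σ ≠ 0 := by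
  have := isGalois_of_isAlgClosed ℓ Ω
  obtain ⟨σ, hσ⟩ := exists_norm_logChar_eq_logConductor ℓ Ω
  have hK : K.fixingSubgroup.index ≠ 0 := by
    rw [← IntermediateField.finrank_eq_fixingSubgroup_index]
    exact Module.finrank_pos.ne'
  obtain ⟨n, hn, -, hn2⟩ := Subgroup.exists_pow_mem_of_index_ne_zero hK σ
  refine ⟨_, hn2, ?_⟩
  rw [logChar_pow, ← norm_ne_zero_iff, norm_mul, hσ]
  refine mul_ne_zero (norm_ne_zero_iff.2 (by exact_mod_cast hn.ne')) (norm_ne_zero_iff.2 ?_)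
  exact_mod_cast logConductor_ne_zero (p := ℓ)

/-- A norm from $K$ is a norm from the field $D$ of `logInertia_aux`, and $D$ lies in a cyclotomic
field. The bound there concerns the $m$-th power of the norm from $D$, where $m$ is the relative
degree; the factor $m$ cancels and leaves $\|[D:\mathbb Q_\ell]\,q\|$. -/
theorem norm_logInertia_eq_and_norm_iwasawaLog_algebraNorm_le {σ₁ : Gal(Ω/ℚ_[ℓ])}
    (hσ₁ : σ₁ ∈ K.fixingSubgroup)
    (h₁ : ∀ τ ∈ K.fixingSubgroup, ‖logChar ℚ_[ℓ] Ω ℓ τ‖ ≤ ‖logChar ℚ_[ℓ] Ω ℓ σ₁‖) :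
    logChar ℚ_[ℓ] Ω ℓ σ₁ ≠ 0 ∧
    ‖(Module.finrank ℚ_[ℓ] (K ⊓ cyclotomicZHat ℚ_[ℓ] Ω : IntermediateField ℚ_[ℓ] Ω) : ℚ_[ℓ])‖ *
      ‖(logConductor ℓ : ℚ_[ℓ])‖ = ‖logChar ℚ_[ℓ] Ω ℓ σ₁‖ ∧
    ∀ x : K, x ≠ 0 → ‖iwasawaLog ℓ (Algebra.norm ℚ_[ℓ] x)‖ ≤ ‖logChar ℚ_[ℓ] Ω ℓ σ₁‖ := by
  have : CharZero Ω := charZero_of_injective_algebraMap (algebraMap ℚ_[ℓ] Ω).injective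
  have := isGalois_of_isAlgClosed ℓ Ω
  obtain ⟨σ, hσ, hσ0⟩ := exists_logChar_ne_zero_mem_fixingSubgroup K
  have h10 : logChar ℚ_[ℓ] Ω ℓ σ₁ ≠ 0 := by
    rw [← norm_pos_iff] at hσ0 ⊢
    exact hσ0.trans_le (h₁ σ hσ)
  obtain ⟨σ₀, hσ₀⟩ := exists_norm_logChar_eq_logConductor ℓ Ω
  obtain ⟨hf, D, hDK, -, hD, hDf⟩ := logInertia_aux ℓ K
    (fun τ ↦ (norm_logChar_le τ).trans hσ₀.ge) hσ₁ h₁ h10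
  rw [hσ₀] at hf hDf
  refine ⟨h10, hf, fun x hx ↦ ?_⟩
  obtain ⟨y, hy, hxy⟩ := exists_algebraNorm_eq hDK hx
  have : FiniteDimensional ℚ_[ℓ] D := FiniteDimensional.of_injective
    (IntermediateField.inclusion hDK).toLinearMap (IntermediateField.inclusion_injective hDK)
  obtain ⟨i, hi⟩ := exists_norm_pow_lt (ℓ := ℓ) (norm_pos_iff.2 h10)
  obtain ⟨ζ, hζ⟩ := HasEnoughRootsOfUnity.exists_primitiveRoot Ω (ℓ ^ (i + 2))
  obtain ⟨M, hMZ, hM1, hM2⟩ := exists_subfield_adjoin_primitiveRoot hζ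
  -- At this level an automorphism fixing $M$ has a logarithm inside the ball that defines $D$.
  have hDM : D ≤ M := by
    intro z hz
    refine mem_of_forall_fixingSubgroup fun τ hτ ↦ ?_
    refine (IntermediateField.mem_fixingSubgroup_iff _ _).1 (hD τ ((hM2 τ hτ).trans ?_)) z hz
    refine le_trans ?_ hi.le
    rw [norm_pow, norm_pow]
    exact pow_le_pow_of_le_one (norm_nonneg _) Padic.norm_p_lt_one.le (by omega)
  have := IntermediateField.adjoin.finiteDimensional
    (Algebra.IsIntegral.isIntegral (R := ℚ_[ℓ]) ζ)
  obtain ⟨m, hm1, hm2⟩ := exists_algebraNorm_inclusion (hDM.trans hMZ) y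
  have hb := hM1 (IntermediateField.inclusion (hDM.trans hMZ) y) (hDM y.2)
    ((_root_.map_ne_zero _).2 hy)
  rw [hm2, iwasawaLog_pow (Algebra.norm_ne_zero_iff.2 hy), norm_mul,
    ← finrank_adjoin_primitiveRoot hζ, ← hm1, Nat.cast_mul, norm_mul, mul_assoc, hDf] at hb
  have hm0 : (m : ℚ_[ℓ]) ≠ 0 := by
    rintro h0
    have : m = 0 := by exact_mod_cast h0
    rw [this, zero_mul] at hm1
    exact Module.finrank_pos.ne hm1
  rw [hxy]
  exact le_of_mul_le_mul_left hb (norm_pos_iff.2 hm0)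

end LogNormBound

/-! ### Unramified extensions generated by roots of unity of order $\ell^N-1$ -/

section Unramified
open Polynomial
open scoped IntermediateField

theorem exists_algEquiv_extending {k Ω : Type*} [Field k] [Field Ω] [Algebra k Ω] [Normal k Ω]
    {L : IntermediateField k Ω} (τ : L →ₐ[k] Ω) : ∃ σ : Gal(Ω/k), ∀ x : L, σ x = τ x := by
  have hb := Algebra.IsAlgebraic.algHom_bijective (τ.liftNormal Ω)
  exact ⟨AlgEquiv.ofBijective _ hb, fun x ↦ τ.liftNormal_commutes Ω x⟩

variable {ℓ : ℕ} [hℓ : Fact ℓ.Prime]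

variable (ℓ) in
theorem coprime_prime_pow_sub_one {N : ℕ} (hN : N ≠ 0) : (ℓ ^ N - 1).Coprime ℓ := by
  have h1 : (ℓ ^ N - 1).Coprime (ℓ ^ N - 1 + 1) := by simp
  rw [Nat.sub_add_cancel (Nat.one_le_pow _ _ hℓ.out.pos)] at h1
  exact (Nat.coprime_pow_right_iff (Nat.pos_of_ne_zero hN) _ _).1 h1

variable (ℓ) in
theorem prime_pow_sub_one_ne_zero {N : ℕ} (hN : N ≠ 0) : ℓ ^ N - 1 ≠ 0 :=
  Nat.sub_ne_zero_of_lt (Nat.one_lt_pow hN hℓ.out.one_lt)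

theorem pow_prime_pow_eq_self {M : Type*} [CommMonoid M] {x : M} {N : ℕ} (hx : x ^ (ℓ ^ N - 1) = 1) :
    x ^ ℓ ^ N = x := by
  rw [← Nat.sub_add_cancel (Nat.one_le_pow N ℓ hℓ.out.pos), pow_succ, hx, one_mul]

theorem pow_prime_pow_mod {M : Type*} [CommMonoid M] {x : M} {N : ℕ} (hx : x ^ (ℓ ^ N - 1) = 1)
    (a : ℕ) : x ^ ℓ ^ (a % N) = x ^ ℓ ^ a := by
  have key : ∀ k : ℕ, x ^ ℓ ^ (N * k) = x := by
    intro k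
    induction k with
    | zero => simp
    | succ k ih => rw [mul_add_one, pow_add, pow_mul, ih, pow_prime_pow_eq_self hx]
  conv_rhs => rw [← Nat.mod_add_div a N, pow_add, mul_comm, pow_mul, key]

theorem pow_prime_pow_eq_iff {M : Type*} [CommMonoid M] {η : M} {N a b : ℕ} (hN : N ≠ 0)
    (hη : IsPrimitiveRoot η (ℓ ^ N - 1)) : η ^ ℓ ^ a = η ^ ℓ ^ b ↔ a ≡ b [MOD N] := by
  rw [← pow_prime_pow_mod hη.pow_eq_one a, ← pow_prime_pow_mod hη.pow_eq_one b]
  constructor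
  · intro h
    rcases eq_or_ne N 1 with rfl | hN1
    · exact Nat.modEq_one
    have hlt : ∀ c : ℕ, ℓ ^ (c % N) < ℓ ^ N - 1 := by
      intro c
      have h1 : ℓ ^ (c % N) ≤ ℓ ^ (N - 1) :=
        Nat.pow_le_pow_right hℓ.out.pos (by have := Nat.mod_lt c (Nat.pos_of_ne_zero hN); omega)
      have h2 : 2 ≤ ℓ ^ (N - 1) := hℓ.out.two_le.trans (Nat.le_self_pow (by omega) ℓ)
      have h3 : ℓ ^ N = ℓ ^ (N - 1) * ℓ := by rw [← pow_succ]; congr 1; omega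
      have h4 : ℓ ^ (N - 1) * 2 ≤ ℓ ^ (N - 1) * ℓ := Nat.mul_le_mul_left _ hℓ.out.two_le
      omega
    exact Nat.pow_right_injective hℓ.out.two_le (hη.pow_inj (hlt a) (hlt b) h)
  · intro h
    have h : a % N = b % N := h
    rw [h]

variable {Ω : Type*} [NormedField Ω] [NormedAlgebra ℚ_[ℓ] Ω]
  [IsUltrametricDist Ω] [Algebra.IsAlgebraic ℚ_[ℓ] Ω] [IsAlgClosed Ω] {N : ℕ} {η : Ω}

theorem exists_lt_apply_eq_pow (hN : N ≠ 0) (hη : η ^ (ℓ ^ N - 1) = 1) (σ : Gal(Ω/ℚ_[ℓ])) :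
    ∃ b < N, σ η = η ^ ℓ ^ b := by
  obtain ⟨b, hb⟩ := exists_apply_eq_pow_pow (K := ⊥) (norm_pow_sub_self_lt_one_iff (p := ℓ) (Ω := Ω))
    (σ := σ) (by rw [IntermediateField.fixingSubgroup_bot]; trivial)
    (coprime_prime_pow_sub_one ℓ hN) (prime_pow_sub_one_ne_zero ℓ hN) hη
  rw [pow_one, ← pow_prime_pow_mod hη] at hb
  exact ⟨_, Nat.mod_lt _ (Nat.pos_of_ne_zero hN), hb⟩

theorem finrank_adjoin_le_of_pow_eq_one (hN : N ≠ 0) (hη : η ^ (ℓ ^ N - 1) = 1) :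
    Module.finrank ℚ_[ℓ] ℚ_[ℓ]⟮η⟯ ≤ N := by
  have := IntermediateField.adjoin.finiteDimensional (Algebra.IsIntegral.isIntegral (R := ℚ_[ℓ]) η)
  have := isGalois_of_isAlgClosed ℓ Ω
  rw [← AlgHom.card ℚ_[ℓ] ℚ_[ℓ]⟮η⟯ Ω]
  have h : ∀ τ : ℚ_[ℓ]⟮η⟯ →ₐ[ℚ_[ℓ]] Ω, ∃ b : Fin N,
      τ (IntermediateField.AdjoinSimple.gen ℚ_[ℓ] η) = η ^ ℓ ^ (b : ℕ) := by
    intro τ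
    obtain ⟨σ, hσ⟩ := exists_algEquiv_extending τ
    obtain ⟨b, hb, h⟩ := exists_lt_apply_eq_pow hN hη σ
    exact ⟨⟨b, hb⟩, by rw [← hσ, ← h]; rfl⟩
  choose b hb using h
  refine (Fintype.card_le_of_injective b fun τ τ' hττ' ↦ ?_).trans_eq (Fintype.card_fin N)
  refine IntermediateField.algHom_ext_of_eq_adjoin _ rfl ?_
  rintro x rfl
  exact (hb τ).trans ((congrArg (fun c : Fin N ↦ x ^ ℓ ^ (c : ℕ)) hττ').trans (hb τ').symm)

/-- $N$ divides the residue degree since $\eta$ has exact order $\ell^N-1$, the residue degree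
divides the degree, and the degree is at most $N$. So all three agree and the field is unramified.
-/
theorem norm_le_and_residue_of_mem_adjoin (hN : N ≠ 0) (hη : IsPrimitiveRoot η (ℓ ^ N - 1)) {w : Ω}
    (hw : w ∈ ℚ_[ℓ]⟮η⟯) : (‖w‖ < 1 → ‖w‖ ≤ ‖(ℓ : ℚ_[ℓ])‖) ∧
      (‖w‖ ≤ 1 → ‖w ^ ℓ ^ N - w‖ < 1) := by
  have := IntermediateField.adjoin.finiteDimensional (Algebra.IsIntegral.isIntegral (R := ℚ_[ℓ]) η)
  have hle := finrank_adjoin_le_of_pow_eq_one hN hη.pow_eq_one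
  obtain ⟨f, hf0, hf1, -, hR⟩ := exists_residueDegree ℚ_[ℓ]⟮η⟯
  have hηn : ‖η‖ = 1 := norm_eq_one_of_pow_eq_one' (prime_pow_sub_one_ne_zero ℓ hN) hη.pow_eq_one
  have hNf : N ∣ f := by
    have h1 := (hR η hηn.le).2 ⟨η, IntermediateField.mem_adjoin_simple_self _ η, hηn.le, by simp⟩
    have h2 := eq_of_norm_sub_lt_one (coprime_prime_pow_sub_one ℓ hN)
      (prime_pow_sub_one_ne_zero ℓ hN) (by rw [← pow_mul, mul_comm, pow_mul, hη.pow_eq_one, one_pow])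
      hη.pow_eq_one h1
    have h3 : η ^ ℓ ^ f = η ^ ℓ ^ 0 := by rw [h2, pow_zero, pow_one]
    exact (Nat.modEq_zero_iff_dvd).1 ((pow_prime_pow_eq_iff hN hη).1 h3)
  have hfd : (f : ℤ) ∣ Module.finrank ℚ_[ℓ] ℚ_[ℓ]⟮η⟯ := by
    have h1 := hf1 (algebraMap ℚ_[ℓ] _ ℓ) ((_root_.map_ne_zero _).2 (by exact_mod_cast hℓ.out.ne_zero))
    rw [Algebra.norm_algebraMap, Padic.valuation_pow, Padic.valuation_p, mul_one] at h1
    exact h1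
  have hfN : f = N := by
    have h1 := Nat.le_of_dvd Module.finrank_pos (by exact_mod_cast hfd)
    have h2 := Nat.le_of_dvd (Nat.pos_of_ne_zero hf0) hNf
    omega
  have hdN : Module.finrank ℚ_[ℓ] ℚ_[ℓ]⟮η⟯ = N := by
    have h1 := Nat.le_of_dvd Module.finrank_pos (by exact_mod_cast hfd)
    omega
  subst hfN
  constructor
  · intro hw1
    rcases eq_or_ne w 0 with rfl | hw0
    · rw [norm_zero]; exact norm_nonneg _
    have hz0 : (⟨w, hw⟩ : ℚ_[ℓ]⟮η⟯) ≠ 0 := fun h ↦ hw0 (congrArg Subtype.val h)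
    have h1 := norm_algebraNorm _ (⟨w, hw⟩ : ℚ_[ℓ]⟮η⟯)
    rw [norm_eq_norm_prime_zpow (Algebra.norm_ne_zero_iff.2 hz0), hdN] at h1
    obtain ⟨c, hc⟩ := hf1 _ hz0
    have hl0 : 0 < ‖(ℓ : ℚ_[ℓ])‖ := norm_pos_iff.2 (by exact_mod_cast hℓ.out.ne_zero)
    have h2 : ‖w‖ = ‖(ℓ : ℚ_[ℓ])‖ ^ c := by
      refine (pow_left_inj₀ (norm_nonneg _) (zpow_nonneg hl0.le _) hf0).1 ?_
      rw [← h1, hc, ← zpow_natCast, ← zpow_mul, mul_comm]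
    rw [h2] at hw1 ⊢
    rw [zpow_lt_one_iff_right_of_lt_one₀ hl0 Padic.norm_p_lt_one] at hw1
    calc _ ≤ ‖(ℓ : ℚ_[ℓ])‖ ^ (1 : ℤ) := zpow_le_zpow_right_of_le_one₀ hl0 Padic.norm_p_lt_one.le hw1
      _ = _ := zpow_one _
  · intro hw1
    exact (hR w hw1).2 ⟨w, hw, hw1, by simp⟩

/-- A unit $w$ is congruent to some $\eta^c$, because $w^{\ell^N-1}\equiv1$ and $X^{\ell^N-1}-1$ is
the product of the $X-\eta^c$. On $\eta^c$ the claim is an equality. -/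
theorem norm_frobenius_sub_pow_lt_one (hN : N ≠ 0) (hη : IsPrimitiveRoot η (ℓ ^ N - 1))
    {φ : Gal(Ω/ℚ_[ℓ])} (hφ : φ η = η ^ ℓ) {w : Ω} (hw : w ∈ ℚ_[ℓ]⟮η⟯) (hw1 : ‖w‖ ≤ 1) :
    ‖φ w - w ^ ℓ‖ < 1 := by
  have hadd {x y : Ω} (hx : ‖x‖ < 1) (hy : ‖y‖ < 1) : ‖x + y‖ < 1 :=
    (IsUltrametricDist.norm_add_le_max x y).trans_lt (max_lt hx hy)
  rcases hw1.lt_or_eq with h | h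
  · rw [sub_eq_add_neg]
    refine hadd ?_ ?_
    · rwa [norm_algEquiv_apply]
    · rw [norm_neg, norm_pow]
      exact pow_lt_one₀ (norm_nonneg _) h hℓ.out.ne_zero
  have h0 : w ≠ 0 := by rw [← norm_ne_zero_iff, h]; exact one_ne_zero
  have h1 : ‖w ^ (ℓ ^ N - 1) - 1‖ < 1 := by
    have h2 := (norm_le_and_residue_of_mem_adjoin hN hη hw).2 hw1
    rw [← Nat.sub_add_cancel (Nat.one_le_pow N ℓ hℓ.out.pos), pow_succ, ← sub_one_mul, norm_mul, h,
      mul_one] at h2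
    exact h2
  obtain ⟨c, hc⟩ : ∃ c : ℕ, ‖w - η ^ c‖ < 1 := by
    by_contra! hcon
    have hpos := Nat.pos_of_ne_zero (prime_pow_sub_one_ne_zero ℓ hN)
    have h2 := congrArg (eval w) (X_pow_sub_one_eq_prod hpos hη)
    rw [eval_prod] at h2
    simp only [eval_sub, eval_pow, eval_X, eval_one, eval_C] at h2
    rw [h2, norm_prod] at h1
    refine absurd h1 (not_lt.2 (Finset.prod_const_one.symm.le.trans
      (Finset.prod_le_prod (fun _ _ ↦ zero_le_one) fun ξ hξ ↦ ?_)))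
    have : NeZero (ℓ ^ N - 1) := ⟨hpos.ne'⟩
    obtain ⟨c, -, rfl⟩ := hη.eq_pow_of_pow_eq_one ((mem_nthRootsFinset hpos _).1 hξ)
    exact hcon c
  have h2 : φ w - w ^ ℓ = φ (w - η ^ c) + -(w ^ ℓ - (η ^ c) ^ ℓ) := by
    rw [map_sub, map_pow, hφ]; ring
  rw [h2]
  refine hadd (by rwa [norm_algEquiv_apply]) ?_
  rw [norm_neg]
  obtain ⟨y, hy⟩ := sub_dvd_pow_sub_pow (⟨w, hw1⟩ : unitBall Ω)
    ⟨η ^ c, mem_unitBall.2 (by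
      rw [norm_pow, norm_eq_one_of_pow_eq_one' (prime_pow_sub_one_ne_zero ℓ hN) hη.pow_eq_one,
        one_pow])⟩ ℓ
  have h3 : w ^ ℓ - (η ^ c) ^ ℓ = (w - η ^ c) * y := congrArg Subtype.val hy
  rw [h3, norm_mul]
  exact (mul_le_of_le_one_right (norm_nonneg _) y.2).trans_lt hc

end Unramified

/-! ### Polynomials agreeing at the primitive roots -/

section RootsEvalCongruence
open Polynomial
variable {A : Type*} [CommRing A] [IsDomain A] {ℓ : ℕ} [hℓ : Fact ℓ.Prime]

/-- $h-g$ is $\Phi_{\ell^{i+1}}r$, and $\Phi_{\ell^{i+1}}$ takes the value $\ell$ at every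
$\ell^i$-th root of unity. So there $h$ has the values of $g+\ell r$. -/
theorem pow_dvd_rootsEval_sub_of_eq_on_primitiveRoots {ε₀ : A} (hε₀ : IsPrimitiveRoot ε₀ ℓ)
    (hroot : ∀ c : A, ∃ d, d ^ ℓ = c) {i : ℕ} {ζ : A} (hζ : IsPrimitiveRoot ζ (ℓ ^ (i + 1)))
    {g h : A[X]} (H : ∀ ξ ∈ primitiveRoots (ℓ ^ (i + 1)) A, h.eval ξ = g.eval ξ) :
    (ℓ : A) ^ (i + 1) ∣ rootsEval ℓ h i - rootsEval ℓ g i := by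
  have hdvd : cyclotomic (ℓ ^ (i + 1)) A ∣ h - g := by
    rw [cyclotomic_eq_prod_X_sub_primitiveRoots hζ]
    rcases eq_or_ne (h - g) 0 with h0 | h0
    · rw [h0]; exact dvd_zero _
    refine Multiset.prod_X_sub_C_dvd_iff_le_roots h0 _ |>.2 ?_
    rw [Multiset.le_iff_subset (primitiveRoots _ A).nodup]
    intro ξ hξ
    rw [mem_roots h0, IsRoot, eval_sub, H ξ hξ, sub_self]
  obtain ⟨r, hr⟩ := hdvd
  have h1 : rootsEval ℓ h i = rootsEval ℓ (g + (ℓ : A[X]) * r) i := by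
    refine Finset.prod_congr rfl fun ξ hξ ↦ ?_
    rw [mem_roots_prime_pow] at hξ
    have h2 : h = g + cyclotomic (ℓ ^ (i + 1)) A * r := by rw [← hr]; ring
    have h3 : (cyclotomic (ℓ ^ (i + 1)) A).eval ξ = ℓ := by
      rw [cyclotomic_prime_pow_eq_geom_sum hℓ.out, eval_finsetSum]
      simp [hξ]
    rw [h2, eval_add, eval_mul, h3, eval_add, eval_mul, eval_natCast]
  rw [h1]
  exact pow_dvd_rootsEval_sub hε₀ hroot ⟨r, by ring⟩ i

theorem exists_pow_pow_eq_self {n a : ℕ} (hn : n ≠ 0) (ha : a.Coprime n) :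
    ∃ b, ∀ {M : Type*} [Monoid M] (ξ : M), ξ ^ n = 1 → (ξ ^ a) ^ b = ξ := by
  obtain ⟨b, -, hb⟩ := Nat.exists_mul_mod_eq_of_coprime 1 ha hn
  refine ⟨b, fun ξ hξ ↦ ?_⟩
  rw [← pow_mul, pow_eq_pow_mod _ hξ, hb, ← pow_eq_pow_mod _ hξ, pow_one]

theorem prod_nthRootsFinset_pow {M : Type*} [CommMonoid M] {n a : ℕ} (hn : 0 < n) (ha : a.Coprime n)
    (F : A → M) : ∏ ξ ∈ nthRootsFinset n (1 : A), F (ξ ^ a) = ∏ ξ ∈ nthRootsFinset n (1 : A), F ξ := by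
  obtain ⟨b, hb⟩ := exists_pow_pow_eq_self hn.ne' ha
  refine Finset.prod_nbij' (· ^ a) (· ^ b) ?_ ?_ ?_ ?_ fun _ _ ↦ rfl
  · intro ξ hξ
    rw [mem_nthRootsFinset hn] at hξ ⊢
    rw [← pow_mul, mul_comm, pow_mul, hξ, one_pow]
  · intro ξ hξ
    rw [mem_nthRootsFinset hn] at hξ ⊢
    rw [← pow_mul, mul_comm, pow_mul, hξ, one_pow]
  · intro ξ hξ
    exact hb ξ ((mem_nthRootsFinset hn _).1 hξ)
  · intro ξ hξ
    rw [← pow_mul, mul_comm, pow_mul]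
    exact hb ξ ((mem_nthRootsFinset hn _).1 hξ)

/-- Raising to the power $a$ permutes the roots, so $\prod_{\xi\ne1}(\xi^a-1)/(\xi-1)=1$. The factor
$a$ is the value of the geometric sum at $\xi=1$. -/
theorem rootsEval_geom_sum_mul_comp (i : ℕ) {a : ℕ} (ha : a.Coprime ℓ) (g : A[X]) :
    rootsEval ℓ ((∑ k ∈ Finset.range a, X ^ k) * g.comp (X ^ a)) i = a * rootsEval ℓ g i := by
  classical
  have hpos : 0 < ℓ ^ i := pow_pos hℓ.out.pos _
  have hcop : a.Coprime (ℓ ^ i) := ha.pow_right i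
  have h1 : ∏ ξ ∈ nthRootsFinset (ℓ ^ i) (1 : A), (∑ k ∈ Finset.range a, X ^ k : A[X]).eval ξ = a := by
    have hmem : (1 : A) ∈ nthRootsFinset (ℓ ^ i) (1 : A) := by
      rw [mem_roots_prime_pow, one_pow]
    rw [← Finset.mul_prod_erase _ _ hmem]
    have h2 : ∏ ξ ∈ (nthRootsFinset (ℓ ^ i) (1 : A)).erase 1, (ξ - 1) ≠ 0 :=
      Finset.prod_ne_zero_iff.2 fun ξ hξ ↦ sub_ne_zero.2 (Finset.ne_of_mem_erase hξ)
    have h3 := prod_nthRootsFinset_pow hpos hcop (fun ξ : A ↦ if ξ = 1 then 1 else ξ - 1)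
    rw [← Finset.mul_prod_erase _ _ hmem, ← Finset.mul_prod_erase _ _ hmem, one_pow, if_pos rfl,
      one_mul, one_mul] at h3
    obtain ⟨b, hb⟩ := exists_pow_pow_eq_self hpos.ne' hcop
    have h4 : (∏ ξ ∈ (nthRootsFinset (ℓ ^ i) (1 : A)).erase 1,
        (∑ k ∈ Finset.range a, X ^ k : A[X]).eval ξ) = 1 := by
      refine mul_right_cancel₀ h2 ?_
      rw [one_mul, ← Finset.prod_mul_distrib]
      refine Eq.trans ?_ (h3.trans ?_)
      · refine Finset.prod_congr rfl fun ξ hξ ↦ ?_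
        have h5 : ξ ^ a ≠ 1 := by
          intro h6
          have h7 := hb ξ (mem_roots_prime_pow.1 (Finset.mem_of_mem_erase hξ))
          rw [h6, one_pow] at h7
          exact Finset.ne_of_mem_erase hξ h7.symm
        rw [if_neg h5, ← geom_sum_mul, eval_geom_sum]
      · exact Finset.prod_congr rfl fun ξ hξ ↦ if_neg (Finset.ne_of_mem_erase hξ)
    rw [h4, mul_one, eval_geom_sum]
    simp
  rw [rootsEval, rootsEval, ← h1, ← prod_nthRootsFinset_pow hpos hcop (fun ξ ↦ g.eval ξ),
    ← Finset.prod_mul_distrib]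
  refine Finset.prod_congr rfl fun ξ _ ↦ ?_
  rw [eval_mul, eval_comp, eval_pow, eval_X]

end RootsEvalCongruence

/-! ### The norm of a uniformizer fixed by a Frobenius lift -/

section LogNormFrobenius
open Polynomial
open scoped IntermediateField
variable {ℓ : ℕ} [hℓ : Fact ℓ.Prime] {Ω : Type*} [NormedField Ω] [NormedAlgebra ℚ_[ℓ] Ω]
  [IsUltrametricDist Ω] [Algebra.IsAlgebraic ℚ_[ℓ] Ω] {E : IntermediateField ℚ_[ℓ] Ω} {i : ℕ}

theorem eval_unitBallMap_of_fixing {g : (unitBall Ω)[X]} {τ : Gal(Ω/ℚ_[ℓ])}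
    (hg : g.map (unitBallMap τ) = g) (x : unitBall Ω) :
    τ ((g.eval x : unitBall Ω) : Ω) = ((g.eval (unitBallMap τ x) : unitBall Ω) : Ω) := by
  rw [← coe_unitBallMap, ← eval_map_apply, hg]

theorem norm_prod_iterate_mul_sub_le {φ : Gal(Ω/ℚ_[ℓ])} {P y : Ω} {ε : ℝ} (hP : ‖P‖ ≤ 1)
    (h : ‖P * y - φ y‖ ≤ ε) (d : ℕ) :
    ‖(∏ b ∈ Finset.range d, (φ ^ b) P) * y - (φ ^ d) y‖ ≤ ε := by
  induction d with
  | zero =>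
    rw [Finset.prod_range_zero, one_mul, pow_zero, AlgEquiv.one_apply, sub_self, norm_zero]
    exact (norm_nonneg _).trans h
  | succ d ih =>
    have e : (∏ b ∈ Finset.range (d + 1), (φ ^ b) P) * y - (φ ^ (d + 1)) y =
        (φ ^ d) P * ((∏ b ∈ Finset.range d, (φ ^ b) P) * y - (φ ^ d) y) +
          (φ ^ d) (P * y - φ y) := by
      rw [Finset.prod_range_succ, map_sub, map_mul, pow_succ, AlgEquiv.mul_apply]
      ring
    rw [e]
    refine (IsUltrametricDist.norm_add_le_max _ _).trans (max_le ?_ ?_)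
    · rw [norm_mul, norm_algEquiv_apply]
      exact (mul_le_of_le_one_left (norm_nonneg _) hP).trans ih
    · rwa [norm_algEquiv_apply]

variable [IsAlgClosed Ω]

/-- Invariance of $(\zeta-1)g(\zeta)$ under $\sigma$ says that $\frac{X^a-1}{X-1}g^\sigma(X^a)$ and
$g$ agree at $\zeta$, hence at its conjugates over $E$. Comparing the products over $\ell^i$-th
roots of unity gives $a\,\sigma(y)\equiv y$, with $y$ the product for $g$. -/
theorem norm_mul_rootsEval_sub_le {g : (unitBall Ω)[X]} (hg : ∀ n, (g.coeff n : Ω) ∈ E)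
    {ζ : unitBall Ω} (hζ : IsPrimitiveRoot ζ (ℓ ^ (i + 1))) {σ : Gal(Ω/ℚ_[ℓ])} {a : ℕ}
    (ha : a.Coprime ℓ) (hσζ : σ ζ = (ζ : Ω) ^ a) (hσE : ∀ w ∈ E, σ w ∈ E)
    (hτ : ∀ ξ : Ω, IsPrimitiveRoot ξ (ℓ ^ (i + 1)) → ∃ τ ∈ E.fixingSubgroup, τ (ζ : Ω) = ξ)
    (hz : σ (((ζ : Ω) - 1) * (g.eval ζ : unitBall Ω)) = ((ζ : Ω) - 1) * (g.eval ζ : unitBall Ω)) :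
    ‖a * σ (rootsEval ℓ g i : unitBall Ω) - (rootsEval ℓ g i : unitBall Ω)‖ ≤
      ‖(ℓ : ℚ_[ℓ])‖ ^ (i + 1) := by
  set h : (unitBall Ω)[X] := (∑ k ∈ Finset.range a, X ^ k) * (g.map (unitBallMap σ)).comp (X ^ a)
    with hh
  have hζ1 : (ζ : Ω) - 1 ≠ 0 := by
    intro h0
    have h1 : ζ = 1 := Subtype.ext (sub_eq_zero.1 h0)
    exact hζ.ne_one (Nat.one_lt_pow (by omega) hℓ.out.one_lt) h1
  have hσζ' : unitBallMap σ ζ = ζ ^ a := Subtype.ext hσζ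
  have h1 : h.eval ζ = g.eval ζ := by
    apply Subtype.ext
    refine mul_left_cancel₀ hζ1 ?_
    rw [← hz, map_mul, map_sub, map_one, hσζ, ← coe_unitBallMap σ (g.eval ζ), ← eval_map_apply,
      hσζ', hh, eval_mul, eval_comp, eval_pow, eval_X, eval_geom_sum, ← mul_geom_sum]
    push_cast
    ring
  have h2 : ∀ ξ ∈ primitiveRoots (ℓ ^ (i + 1)) (unitBall Ω), h.eval ξ = g.eval ξ := by
    intro ξ hξ
    rw [mem_primitiveRoots (pow_pos hℓ.out.pos _)] at hξ
    have hξ' : IsPrimitiveRoot (ξ : Ω) (ℓ ^ (i + 1)) :=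
      hξ.map_of_injective (f := (unitBall Ω).subtype) Subtype.val_injective
    obtain ⟨τ, hτE, hτζ⟩ := hτ ξ hξ'
    have hg1 : g.map (unitBallMap τ) = g := map_eq_self_of_mem_fixingSubgroup hg hτE
    have hg2 : (g.map (unitBallMap σ)).map (unitBallMap τ) = g.map (unitBallMap σ) :=
      map_eq_self_of_mem_fixingSubgroup (fun n ↦ by
        rw [coeff_map]
        exact hσE _ (hg n)) hτE
    have hh1 : h.map (unitBallMap τ) = h := by
      rw [hh, Polynomial.map_mul, map_comp, hg2, Polynomial.map_sum, Polynomial.map_pow, map_X]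
      congr 1
      exact Finset.sum_congr rfl fun k _ ↦ by rw [Polynomial.map_pow, map_X]
    have hτζ' : unitBallMap τ ζ = ξ := Subtype.ext hτζ
    rw [← hτζ']
    apply Subtype.ext
    rw [← eval_unitBallMap_of_fixing hh1, h1, eval_unitBallMap_of_fixing hg1]
  obtain ⟨ε₀, hε₀⟩ := exists_primitiveRoot_unitBall ℓ Ω 1
  rw [pow_one] at hε₀
  have h3 := pow_dvd_rootsEval_sub_of_eq_on_primitiveRoots hε₀ exists_pow_eq_unitBall hζ h2
  rw [hh, rootsEval_geom_sum_mul_comp i ha, rootsEval_map, pow_dvd_unitBall_iff] at h3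
  exact_mod_cast h3

/-- Explicit reciprocity for a uniformizer $z=(\zeta-1)g(\zeta)$ fixed by $\sigma$. Let
$y=\prod_{\xi^{\ell^i}=1}g(\xi)$ and $P$ the product over primitive $\xi$. Then $Py\equiv\varphi(y)$
telescopes to $\prod_{b<d}\varphi^b(P)\,y\equiv\varphi^d(y)=\sigma(y)$, while $a\,\sigma(y)\equiv
y$. So $a\prod_{b<d}\varphi^b(P)\equiv1\bmod\ell^{i+1}$. The norm of $z$ is this product times
$(\pm\ell)^d$, so its logarithm is $-\operatorname{Log}a$ up to a smaller term. -/
theorem norm_iwasawaLog_algebraNorm_eq {L : IntermediateField ℚ_[ℓ] Ω} [FiniteDimensional ℚ_[ℓ] L]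
    {ζ : Ω} (hζ : IsPrimitiveRoot ζ (ℓ ^ (i + 1)))
    (hE : ∀ w ∈ E, ‖w‖ < 1 → ‖w‖ ≤ ‖(ℓ : ℚ_[ℓ])‖) {φ σ : Gal(Ω/ℚ_[ℓ])} (hφζ : φ ζ = ζ)
    (hφE : ∀ w ∈ E, φ w ∈ E) (hφ : ∀ w ∈ E, ‖w‖ ≤ 1 → ‖φ w - w ^ ℓ‖ < 1) {d a : ℕ}
    (ha : a.Coprime ℓ) (hσζ : σ ζ = ζ ^ a) (hσE : ∀ w ∈ E, σ w = (φ ^ d) w)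
    {τ : Ω → Gal(Ω/ℚ_[ℓ])} (hτE : ∀ ξ, τ ξ ∈ E.fixingSubgroup)
    (hτ : ∀ ξ, IsPrimitiveRoot ξ (ℓ ^ (i + 1)) → τ ξ ζ = ξ)
    (hL : ∀ z : L, algebraMap ℚ_[ℓ] Ω (Algebra.norm ℚ_[ℓ] z) =
      ∏ b ∈ Finset.range d, ∏ ξ ∈ primitiveRoots (ℓ ^ (i + 1)) Ω, (φ ^ b) (τ ξ z))
    {z : L} (hσz : σ z = z) (hzE : (z : Ω) ∈ Algebra.adjoin ℚ_[ℓ] ((E : Set Ω) ∪ {ζ}))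
    (hz : ‖(z : Ω)‖ = ‖ζ - 1‖) (hlog : ‖(ℓ : ℚ_[ℓ])‖ ^ (i + 1) < ‖iwasawaLog ℓ (a : ℚ_[ℓ])‖) :
    ‖iwasawaLog ℓ (Algebra.norm ℚ_[ℓ] z)‖ = ‖iwasawaLog ℓ (a : ℚ_[ℓ])‖ := by
  have hpos : 0 < ℓ ^ (i + 1) := pow_pos hℓ.out.pos _
  have hζn : ‖ζ‖ = 1 := norm_eq_one_of_pow_eq_one' hpos.ne' hζ.pow_eq_one
  have hζ1 : ζ - 1 ≠ 0 := sub_ne_zero.2 (hζ.ne_one (Nat.one_lt_pow (by omega) hℓ.out.one_lt))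
  have hφb : ∀ (b : ℕ), (φ ^ b) ζ = ζ := by
    intro b
    induction b with
    | zero => rfl
    | succ b ih => rw [pow_succ, AlgEquiv.mul_apply, hφζ, ih]
  have hφE' : ∀ b : ℕ, ∀ w ∈ E, (φ ^ b) w ∈ E := by
    intro b
    induction b with
    | zero => exact fun w hw ↦ hw
    | succ b ih =>
      intro w hw
      rw [pow_succ, AlgEquiv.mul_apply]
      exact ih _ (hφE w hw)
  obtain ⟨P, hP⟩ := exists_int_prime_eq_mul (ℓ := ℓ) (Ω := Ω) (i := i)
  obtain ⟨Q, hQ⟩ := exists_int_pow_eq_mul (ℓ := ℓ) (Ω := Ω) (i := i)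
  set ζ' : unitBall Ω := ⟨ζ, mem_unitBall.2 hζn.le⟩ with hζ'
  have hζ'p : IsPrimitiveRoot ζ' (ℓ ^ (i + 1)) :=
    (IsPrimitiveRoot.map_iff_of_injective (f := (unitBall Ω).subtype) Subtype.val_injective).1 hζ
  have hu1 : ‖(z : Ω) / (ζ - 1)‖ = 1 := by
    rw [norm_div, hz, div_self (norm_ne_zero_iff.2 hζ1)]
  have huE : (z : Ω) / (ζ - 1) ∈ Algebra.adjoin ℚ_[ℓ] ((E : Set Ω) ∪ {ζ}) := by
    set R := Algebra.adjoin ℚ_[ℓ] ((E : Set Ω) ∪ {ζ})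
    have h1 : ζ - 1 ∈ R := sub_mem (Algebra.subset_adjoin (Set.mem_union_right _ rfl)) (one_mem _)
    have h2 : (ζ - 1)⁻¹ ∈ R := R.inv_mem_of_algebraic (x := ⟨_, h1⟩)
      (Algebra.IsAlgebraic.isAlgebraic _)
    rw [div_eq_mul_inv]
    exact mul_mem hzE h2
  obtain ⟨g, hg, hgu⟩ := exists_polynomial_eval_eq (E := E) (x := ζ') (c := 1) hE
    (by simpa using hP ζ hζ) (by simpa using hQ ζ hζ)
    (by simpa using norm_primitiveRoot_sub_one_pow hζ) huE hu1.le
  have hzg : (z : Ω) = (ζ - 1) * (g.eval ζ' : unitBall Ω) := by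
    rw [hgu, mul_div_cancel₀ _ hζ1]
  have hg1 : ‖((g.eval 1 : unitBall Ω) : Ω)‖ = 1 := by
    refine norm_eval_eq_one (x := ζ') ?_ (by rw [hgu, hu1])
    exact norm_primitiveRoot_sub_one_lt hζ
  set y : unitBall Ω := rootsEval ℓ g i with hy
  have hy1 : ‖(y : Ω)‖ = 1 := norm_rootsEval_eq_one hg1 i
  have hyE : (y : Ω) ∈ E := rootsEval_mem hg i
  have hD := norm_mul_rootsEval_sub_le hg hζ'p ha hσζ
    (fun w hw ↦ by rw [hσE w hw]; exact hφE' d w hw) (fun ξ hξ ↦ ⟨τ ξ, hτE ξ, hτ ξ hξ⟩)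
    (by change σ ((ζ - 1) * _) = (ζ - 1) * _; rw [← hzg, hσz])
  rw [← hy, hσE _ hyE] at hD
  set Pr : unitBall Ω := ∏ ξ ∈ primitiveRoots (ℓ ^ (i + 1)) (unitBall Ω), g.eval ξ with hPr
  have hPy : ‖(Pr : Ω) * y - φ y‖ ≤ ‖(ℓ : ℚ_[ℓ])‖ ^ (i + 1) := by
    have h1 := norm_rootsEval_succ_sub_le hg hE hφE hφ i
    rw [rootsEval_succ_eq_mul, ← hy, ← hPr, MulMemClass.coe_mul, mul_comm] at h1
    exact h1
  have hC := norm_prod_iterate_mul_sub_le Pr.2 hPy d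
  have hgE (b : ℕ) : (φ ^ b) (Pr : Ω) = ∏ ξ ∈ primitiveRoots (ℓ ^ (i + 1)) Ω,
      (φ ^ b) ((g.map (unitBall Ω).subtype).eval ξ) := by
    rw [← map_prod, primitiveRoots_eq_map_unitBall hpos.ne', Finset.prod_map, hPr,
      ← ValuationSubring.subtype_apply, map_prod]
    congr 1
    exact Finset.prod_congr rfl fun ξ _ ↦
      (eval_map_apply (f := (unitBall Ω).subtype) (p := g) ξ).symm
  set c : ℚ_[ℓ] := (-1) ^ (primitiveRoots (ℓ ^ (i + 1)) Ω).card * ℓ with hc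
  have hc0 : c ≠ 0 := mul_ne_zero (pow_ne_zero _ (by simp)) (by exact_mod_cast hℓ.out.ne_zero)
  have hc1 : ∏ ξ ∈ primitiveRoots (ℓ ^ (i + 1)) Ω, (ξ - 1) = algebraMap ℚ_[ℓ] Ω c := by
    rw [hc, map_mul, map_natCast, ← prod_one_sub_primitiveRoots hζ, map_pow, map_neg, map_one,
      ← Finset.prod_const, ← Finset.prod_mul_distrib]
    exact Finset.prod_congr rfl fun ξ _ ↦ by ring
  have hclog : iwasawaLog ℓ c = 0 := by
    rcases neg_one_pow_eq_or ℚ_[ℓ] (primitiveRoots (ℓ ^ (i + 1)) Ω).card with h2 | h2 <;>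
    simp [hc, h2, iwasawaLog_self, iwasawaLog_neg, hℓ.out.ne_zero]
  have hN : algebraMap ℚ_[ℓ] Ω (Algebra.norm ℚ_[ℓ] z / c ^ d) =
      ∏ b ∈ Finset.range d, (φ ^ b) (Pr : Ω) := by
    have hc0' : algebraMap ℚ_[ℓ] Ω c ≠ 0 := (_root_.map_ne_zero _).2 hc0
    rw [map_div₀, map_pow, div_eq_iff (pow_ne_zero _ hc0'), hL]
    conv_rhs => rw [← Finset.card_range d, ← Finset.prod_const, Finset.card_range,
      ← Finset.prod_mul_distrib]
    refine Finset.prod_congr rfl fun b _ ↦ ?_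
    rw [hgE, ← AlgEquiv.commutes (φ ^ b) c, ← hc1, map_prod, ← Finset.prod_mul_distrib]
    refine Finset.prod_congr rfl fun ξ hξ ↦ ?_
    rw [mem_primitiveRoots hpos] at hξ
    rw [← map_mul, hzg, map_mul, map_sub, map_one, hτ ξ hξ, mul_comm]
    congr 2
    rw [eval_unitBallMap_of_fixing (map_eq_self_of_mem_fixingSubgroup hg (hτE ξ))]
    refine (eval_map_apply (f := (unitBall Ω).subtype) (p := g) _).symm.trans ?_
    congr 1
    exact hτ ξ hξ
  set q := Algebra.norm ℚ_[ℓ] z / c ^ d with hq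
  rw [← hN] at hC
  have ha1 : ‖(a : ℚ_[ℓ])‖ = 1 := by rw [Padic.norm_natCast_eq_one_iff]; exact ha.symm
  have haq : ‖a * q - 1‖ ≤ ‖(ℓ : ℚ_[ℓ])‖ ^ (i + 1) := by
    have e : algebraMap ℚ_[ℓ] Ω (a * q - 1) * y = a * (algebraMap ℚ_[ℓ] Ω q * y - (φ ^ d) y) +
        (a * (φ ^ d) y - y) := by
      rw [map_sub, map_mul, map_natCast, map_one]; ring
    rw [← norm_algebraMap' Ω, ← mul_one ‖algebraMap ℚ_[ℓ] Ω (a * q - 1)‖, ← hy1, ← norm_mul, e]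
    refine (IsUltrametricDist.norm_add_le_max _ _).trans (max_le ?_ hD)
    rw [norm_mul, ← map_natCast (algebraMap ℚ_[ℓ] Ω), norm_algebraMap', ha1, one_mul]
    exact hC
  have ha0 : (a : ℚ_[ℓ]) ≠ 0 := by rw [← norm_ne_zero_iff, ha1]; exact one_ne_zero
  have hz0 : z ≠ 0 := by
    rintro rfl
    simp only [ZeroMemClass.coe_zero, norm_zero] at hz
    exact hζ1 (norm_eq_zero.1 hz.symm)
  have hN0 := Algebra.norm_ne_zero_iff (R := ℚ_[ℓ]).2 hz0
  have hq0 : q ≠ 0 := div_ne_zero hN0 (pow_ne_zero _ hc0)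
  have hlogq : iwasawaLog ℓ q = iwasawaLog ℓ (Algebra.norm ℚ_[ℓ] z) := by
    rw [hq, iwasawaLog_div hN0 (pow_ne_zero _ hc0), iwasawaLog_pow hc0, hclog, mul_zero, sub_zero]
  rw [← hlogq]
  have h1 : ‖iwasawaLog ℓ (a * q)‖ < ‖iwasawaLog ℓ (a : ℚ_[ℓ])‖ := by
    rw [norm_iwasawaLog (haq.trans (hlog.le.trans (norm_iwasawaLog_le ha1)))]
    exact haq.trans_lt hlog
  rw [iwasawaLog_mul ha0 hq0] at h1
  have h2 : iwasawaLog ℓ q = (iwasawaLog ℓ (a : ℚ_[ℓ]) + iwasawaLog ℓ q) +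
    -iwasawaLog ℓ (a : ℚ_[ℓ]) := by ring
  rw [h2, IsUltrametricDist.norm_add_eq_max_of_norm_ne_norm (by rw [norm_neg]; exact h1.ne),
    norm_neg, max_eq_right h1.le]

end LogNormFrobenius

/-! ### Automorphisms acting on two roots of unity -/

section RootOfUnityAction
variable {k Ω : Type*} [Field k] [Field Ω] [Algebra k Ω]

theorem pow_apply_eq_pow_pow {σ : Gal(Ω/k)} {x : Ω} {m : ℕ} (h : σ x = x ^ m) (t : ℕ) :
    (σ ^ t) x = x ^ m ^ t := by
  induction t with
  | zero => simp
  | succ t ih => rw [pow_succ', AlgEquiv.mul_apply, ih, map_pow, h, ← pow_mul, pow_succ']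

theorem mem_fixingSubgroup_adjoin {S : Set Ω} {g : Gal(Ω/k)} (hg : ∀ x ∈ S, g x = x) :
    g ∈ (IntermediateField.adjoin k S).fixingSubgroup :=
  (IntermediateField.mem_fixingSubgroup_iff _ _).2
    ((IntermediateField.forall_mem_adjoin_smul_eq_self_iff k g).2 hg)

theorem apply_apply_comm {x : Ω} {n : ℕ} [NeZero n] (hx : IsPrimitiveRoot x n) (g h : Gal(Ω/k)) :
    g (h x) = h (g x) := by
  obtain ⟨a, -, ha⟩ := hx.eq_pow_of_pow_eq_one (ξ := g x) (by rw [← map_pow, hx.pow_eq_one, map_one])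
  obtain ⟨b, -, hb⟩ := hx.eq_pow_of_pow_eq_one (ξ := h x) (by rw [← map_pow, hx.pow_eq_one, map_one])
  rw [← ha, ← hb, map_pow, map_pow, ← ha, ← hb, ← pow_mul, ← pow_mul, mul_comm]

/-- The automorphisms acting on the roots of unity `η` and `ζ` as some power of `σ`. -/
def powersOnRoots (σ : Gal(Ω/k)) {η ζ : Ω} {n m N : ℕ} [NeZero n] [NeZero m]
    (hη : IsPrimitiveRoot η n) (hζ : IsPrimitiveRoot ζ m) (hN : N ≠ 0) (hση : (σ ^ N) η = η)
    (hσζ : (σ ^ N) ζ = ζ) : Subgroup Gal(Ω/k) where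
  carrier := {g | ∃ t : ℕ, g η = (σ ^ t) η ∧ g ζ = (σ ^ t) ζ}
  one_mem' := ⟨0, rfl, rfl⟩
  mul_mem' := by
    rintro g h ⟨t, h1, h2⟩ ⟨s, h3, h4⟩
    refine ⟨s + t, ?_, ?_⟩
    · rw [AlgEquiv.mul_apply, h3, apply_apply_comm hη, h1, pow_add, AlgEquiv.mul_apply]
    · rw [AlgEquiv.mul_apply, h4, apply_apply_comm hζ, h2, pow_add, AlgEquiv.mul_apply]
  inv_mem' := by
    rintro g ⟨t, h1, h2⟩
    have key : ∀ {x : Ω} {r : ℕ} [NeZero r], IsPrimitiveRoot x r → (σ ^ N) x = x →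
        g x = (σ ^ t) x → g⁻¹ x = (σ ^ (t * (N - 1))) x := by
      intro x r _ hx h3 h4
      have h5 : (σ ^ (t * N)) x = x := by
        rw [mul_comm, pow_mul]
        generalize σ ^ N = ρ at h3
        induction t with
        | zero => rfl
        | succ t ih =>
          rw [pow_succ, AlgEquiv.mul_apply, h3]
          clear ih h4 h1 h2
          induction t with
          | zero => rfl
          | succ t ih => rw [pow_succ, AlgEquiv.mul_apply, h3, ih]
      apply g.injective
      rw [← AlgEquiv.mul_apply, mul_inv_cancel, AlgEquiv.one_apply, apply_apply_comm hx, h4,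
        ← AlgEquiv.mul_apply, ← pow_add, ← Nat.mul_add_one, Nat.sub_add_cancel (by omega), h5]
    exact ⟨t * (N - 1), key hη hση h1, key hζ hσζ h2⟩

end RootOfUnityAction

/-! ### The inclusion $\operatorname{Log}\chi(G_K)\subseteq\operatorname{Log}N(K^\times)$ -/

section LogNormSurjective
open scoped IntermediateField
variable {ℓ : ℕ} [hℓ : Fact ℓ.Prime] {Ω : Type*} [NormedField Ω] [NormedAlgebra ℚ_[ℓ] Ω]
  [IsUltrametricDist Ω] [Algebra.IsAlgebraic ℚ_[ℓ] Ω] [IsAlgClosed Ω]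

/-- If the Frobenius lift $\rho$ does not have maximal logarithm, use $\rho\,\rho^{-j}\sigma_1$,
where $\sigma_1$ acts on $x$ as $\rho^j$. It still acts as $\rho$ on $x$, and the term of $\sigma_1$
dominates its logarithm. -/
theorem exists_apply_eq_pow_norm_logChar_eq {K : IntermediateField ℚ_[ℓ] Ω} {f : ℕ}
    (hR : ∀ x : Ω, ‖x‖ ≤ 1 → (‖x ^ ℓ ^ f - x‖ < 1 ↔ ∃ c ∈ K, ‖c‖ ≤ 1 ∧ ‖x - c‖ < 1))
    {σ₁ : Gal(Ω/ℚ_[ℓ])} (hσ₁ : σ₁ ∈ K.fixingSubgroup)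
    (h₁ : ∀ τ ∈ K.fixingSubgroup, ‖logChar ℚ_[ℓ] Ω ℓ τ‖ ≤ ‖logChar ℚ_[ℓ] Ω ℓ σ₁‖)
    {x : Ω} {n : ℕ} (hn : n.Coprime ℓ) (hn0 : n ≠ 0) (hx : x ^ n = 1) :
    ∃ σ ∈ K.fixingSubgroup, σ x = x ^ ℓ ^ f ∧
      ‖logChar ℚ_[ℓ] Ω ℓ σ‖ = ‖logChar ℚ_[ℓ] Ω ℓ σ₁‖ := by
  obtain ⟨ρ, hρ, hρx⟩ := exists_apply_eq_pow hR hn hn0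
  rcases (h₁ ρ hρ).eq_or_lt with h | h
  · exact ⟨ρ, hρ, hρx x hx, h⟩
  obtain ⟨j, hj⟩ := exists_apply_eq_pow_pow hR hσ₁ hn hn0 hx
  refine ⟨ρ * (ρ ^ j)⁻¹ * σ₁, mul_mem (mul_mem hρ (inv_mem (pow_mem hρ j))) hσ₁, ?_, ?_⟩
  · rw [AlgEquiv.mul_apply, AlgEquiv.mul_apply, hj, ← pow_apply_eq_pow_pow (hρx x hx) j,
      ← AlgEquiv.mul_apply (ρ ^ j)⁻¹, inv_mul_cancel, AlgEquiv.one_apply, hρx x hx]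
  · have h2 : ‖(1 - j : ℚ_[ℓ]) * logChar ℚ_[ℓ] Ω ℓ ρ‖ < ‖logChar ℚ_[ℓ] Ω ℓ σ₁‖ := by
      rw [norm_mul]
      refine (mul_le_of_le_one_left (norm_nonneg _) ?_).trans_lt h
      have := Padic.norm_int_le_one (p := ℓ) (1 - j)
      push_cast at this
      exact this
    have e : logChar ℚ_[ℓ] Ω ℓ (ρ * (ρ ^ j)⁻¹ * σ₁) =
        (1 - j : ℚ_[ℓ]) * logChar ℚ_[ℓ] Ω ℓ ρ + logChar ℚ_[ℓ] Ω ℓ σ₁ := by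
      rw [logChar_mul, logChar_mul, logChar_inv, logChar_pow]; ring
    rw [e, IsUltrametricDist.norm_add_eq_max_of_norm_ne_norm h2.ne, max_eq_right h2.le]

omit [IsUltrametricDist Ω] [Algebra.IsAlgebraic ℚ_[ℓ] Ω] in
theorem exists_apply_eq_pow_norm_iwasawaLog_eq {i : ℕ} {ζ : Ω}
    (hζ : IsPrimitiveRoot ζ (ℓ ^ (i + 1))) {σ : Gal(Ω/ℚ_[ℓ])}
    (hσ : ‖(ℓ : ℚ_[ℓ])‖ ^ (i + 1) < ‖logChar ℚ_[ℓ] Ω ℓ σ‖) :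
    ∃ a : ℕ, a.Coprime ℓ ∧ σ ζ = ζ ^ a ∧
      ‖iwasawaLog ℓ (a : ℚ_[ℓ])‖ = ‖logChar ℚ_[ℓ] Ω ℓ σ‖ := by
  have : NeZero (ℓ ^ (i + 1)) := ⟨pow_ne_zero _ hℓ.out.ne_zero⟩
  have hσζ : IsPrimitiveRoot (σ ζ) (ℓ ^ (i + 1)) := hζ.map_of_injective σ.injective
  have : CharZero Ω := charZero_of_injective_algebraMap (algebraMap ℚ_[ℓ] Ω).injective
  obtain ⟨a, -, hac, ha⟩ := hζ.isPrimitiveRoot_iff.1 hσζ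
  refine ⟨a, Nat.Coprime.coprime_dvd_right (dvd_pow_self ℓ (by omega)) hac, ha.symm, ?_⟩
  have h1 := norm_cyclotomicCharacter_sub_le ℓ hζ ha.symm
  rw [norm_pow] at h1
  have hle := norm_logChar_le σ
  set u : ℚ_[ℓ] := ((cyclotomicCharacter Ω ℓ (σ : Ω ≃+* Ω) : ℤ_[ℓ]) : ℚ_[ℓ]) with hu
  have hu1 : ‖u‖ = 1 := norm_units_val ℓ _
  have h2 : ‖(a : ℚ_[ℓ]) - u‖ ≤ ‖(ℓ : ℚ_[ℓ])‖ ^ (i + 1) := by rw [norm_sub_rev]; exact h1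
  have h3 := norm_iwasawaLog_sub_le hu1 (h2.trans (hσ.le.trans hle))
  have h4 : ‖iwasawaLog ℓ (a : ℚ_[ℓ]) - iwasawaLog ℓ u‖ < ‖iwasawaLog ℓ u‖ := by
    rw [h3]; exact h2.trans_lt hσ
  have e : iwasawaLog ℓ (a : ℚ_[ℓ]) = (iwasawaLog ℓ (a : ℚ_[ℓ]) - iwasawaLog ℓ u) +
    iwasawaLog ℓ u := by ring
  rw [e, IsUltrametricDist.norm_add_eq_max_of_norm_ne_norm h4.ne, max_eq_right h4.le]
  rfl

/-- The embeddings of the subfield of `ℚ_[ℓ]⟮η, ζ⟯` fixed by `σ`, where `σ` is the `d`-th power of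
the Frobenius on `η`. -/
theorem exists_intermediateField_norm_eq_prod {i N d a : ℕ} {η ζ : Ω} (hN : N ≠ 0)
    (hη : IsPrimitiveRoot η (ℓ ^ N - 1)) (hζ : IsPrimitiveRoot ζ (ℓ ^ (i + 1)))
    (hdN : d * (ℓ ^ (i + 1)).totient ∣ N) {σ φ : Gal(Ω/ℚ_[ℓ])} (ha : a.Coprime ℓ)
    (hση : σ η = η ^ ℓ ^ d) (hσζ : σ ζ = ζ ^ a) (hφη : φ η = η ^ ℓ) (hφζ : φ ζ = ζ)
    {τ : Ω → Gal(Ω/ℚ_[ℓ])} (hτη : ∀ ξ, τ ξ η = η)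
    (hτ : ∀ ξ, IsPrimitiveRoot ξ (ℓ ^ (i + 1)) → τ ξ ζ = ξ) :
    ∃ L : IntermediateField ℚ_[ℓ] Ω, L ≤ ℚ_[ℓ]⟮η, ζ⟯ ∧ (∀ x ∈ L, σ x = x) ∧
      Module.finrank ℚ_[ℓ] L = d * (ℓ ^ (i + 1)).totient ∧
      ∀ z : L, algebraMap ℚ_[ℓ] Ω (Algebra.norm ℚ_[ℓ] z) =
        ∏ b ∈ Finset.range d, ∏ ξ ∈ primitiveRoots (ℓ ^ (i + 1)) Ω,
          (φ ^ b) (τ ξ z) := by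
  have : IsGalois ℚ_[ℓ] Ω := isGalois_of_isAlgClosed ℓ Ω
  have : NeZero (ℓ ^ N - 1) := ⟨prime_pow_sub_one_ne_zero ℓ hN⟩
  have hpos : 0 < ℓ ^ (i + 1) := pow_pos hℓ.out.pos _
  have : NeZero (ℓ ^ (i + 1)) := ⟨hpos.ne'⟩
  have hd : d ≠ 0 := by rintro rfl; rw [zero_mul] at hdN; exact hN (zero_dvd_iff.1 hdN)
  obtain ⟨c, hc⟩ := hdN
  set N' := (ℓ ^ (i + 1)).totient * c with hN'
  have hNd : N = d * N' := by rw [hc, hN', mul_assoc]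
  have hN'0 : N' ≠ 0 := by rintro h; rw [h, mul_zero] at hNd; exact hN hNd
  have hσtη (t : ℕ) : (σ ^ t) η = η ^ ℓ ^ (d * t) := by
    rw [pow_apply_eq_pow_pow hση, ← pow_mul]
  have hφtη (t : ℕ) : (φ ^ t) η = η ^ ℓ ^ t := pow_apply_eq_pow_pow hφη t
  have hφtζ (t : ℕ) : (φ ^ t) ζ = ζ := by
    simpa using pow_apply_eq_pow_pow (σ := φ) (x := ζ) (m := 1) (by simpa using hφζ) t
  -- The totient divides $N'=N/d$, so $\sigma^{N'}$ fixes both $\zeta$ and $\eta$.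
  have hσN'ζ (t : ℕ) : (σ ^ (N' * t)) ζ = ζ := by
    have h1 : a ^ (N' * t) ≡ 1 [MOD ℓ ^ (i + 1)] := by
      rw [hN', mul_assoc, pow_mul]
      simpa using (Nat.ModEq.pow_totient (Nat.Coprime.pow_right (i + 1) ha)).pow (c * t)
    rw [hζ.eq_orderOf] at h1
    rw [pow_apply_eq_pow_pow hσζ, ← pow_mod_orderOf, h1, pow_mod_orderOf, pow_one]
  set H := powersOnRoots σ hη hζ hN'0 (by rw [hσtη, ← hNd, pow_prime_pow_eq_self hη.pow_eq_one])
    (by simpa using hσN'ζ 1) with hH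
  have hmemH {g : Gal(Ω/ℚ_[ℓ])} : g ∈ H ↔ ∃ t : ℕ, g η = (σ ^ t) η ∧ g ζ = (σ ^ t) ζ := Iff.rfl
  set M : IntermediateField ℚ_[ℓ] Ω := ℚ_[ℓ]⟮η, ζ⟯ with hM
  have hηM : η ∈ M := IntermediateField.subset_adjoin _ _ (by simp)
  have hζM : ζ ∈ M := IntermediateField.subset_adjoin _ _ (by simp)
  have : FiniteDimensional ℚ_[ℓ] M :=
    IntermediateField.finiteDimensional_adjoin fun x _ ↦ Algebra.IsIntegral.isIntegral x
  have hMfix {g : Gal(Ω/ℚ_[ℓ])} (h1 : g η = η) (h2 : g ζ = ζ) : g ∈ M.fixingSubgroup :=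
    mem_fixingSubgroup_adjoin (by rintro x (rfl | rfl); exacts [h1, h2])
  have hMH : M.fixingSubgroup ≤ H := fun g hg ↦
    ⟨0, (IntermediateField.mem_fixingSubgroup_iff _ _).1 hg _ hηM,
      (IntermediateField.mem_fixingSubgroup_iff _ _).1 hg _ hζM⟩
  obtain ⟨hfix, hLM⟩ := fixingSubgroup_fixedField_of_le hMH
  set L := IntermediateField.fixedField H with hL
  have : FiniteDimensional ℚ_[ℓ] L := FiniteDimensional.of_injective (IntermediateField.inclusion hLM).toLinearMap (IntermediateField.inclusion_injective hLM)
  have hLH {g : Gal(Ω/ℚ_[ℓ])} (hg : g ∈ H) {x : Ω} (hx : x ∈ L) : g x = x :=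
    (IntermediateField.mem_fixedField_iff _ _).1 hx g hg
  let Φ (b : ℕ) (ξ : Ω) : L →ₐ[ℚ_[ℓ]] Ω := ((φ ^ b * τ ξ : Gal(Ω/ℚ_[ℓ])) : Ω →ₐ[ℚ_[ℓ]] Ω).comp L.val
  have hΦη (b : ℕ) (ξ : Ω) : (φ ^ b * τ ξ) η = η ^ ℓ ^ b := by
    rw [AlgEquiv.mul_apply, hτη, hφtη]
  have hΦζ (b : ℕ) {ξ : Ω} (hξ : IsPrimitiveRoot ξ (ℓ ^ (i + 1))) : (φ ^ b * τ ξ) ζ = ξ := by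
    rw [AlgEquiv.mul_apply, hτ ξ hξ]
    obtain ⟨r, -, rfl⟩ := hζ.eq_pow_of_pow_eq_one hξ.pow_eq_one
    rw [map_pow, hφtζ]
  -- Equal restrictions to $L$ differ by some $\sigma^t$ on $\eta$ and $\zeta$. Frobenius exponents
  -- on $\eta$ modulo $d$ give $b=b'$; modulo $N$ they give $N'\mid t$, so $\sigma^t$ fixes $\zeta$
  -- and $\xi=\xi'$.
  have hinj : ∀ b < d, ∀ b' < d, ∀ ξ ξ', IsPrimitiveRoot ξ (ℓ ^ (i + 1)) →
      IsPrimitiveRoot ξ' (ℓ ^ (i + 1)) → Φ b ξ = Φ b' ξ' → b = b' ∧ ξ = ξ' := by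
    intro b hb b' hb' ξ ξ' hξ hξ' h
    have h1 : (φ ^ b * τ ξ)⁻¹ * (φ ^ b' * τ ξ') ∈ H := by
      rw [← hfix, IntermediateField.mem_fixingSubgroup_iff]
      intro x hx
      have h2 : (φ ^ b * τ ξ) x = (φ ^ b' * τ ξ') x := DFunLike.congr_fun h (⟨x, hx⟩ : L)
      rw [AlgEquiv.mul_apply, ← h2, ← AlgEquiv.mul_apply, inv_mul_cancel, AlgEquiv.one_apply]
    obtain ⟨t, ht1, ht2⟩ := hmemH.1 h1
    have key : ∀ {x : Ω}, ((φ ^ b * τ ξ)⁻¹ * (φ ^ b' * τ ξ')) x = (σ ^ t) x →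
        (φ ^ b' * τ ξ') x = (φ ^ b * τ ξ) ((σ ^ t) x) := by
      intro x hx
      rw [← hx, AlgEquiv.mul_apply (φ ^ b * τ ξ)⁻¹, ← AlgEquiv.mul_apply (φ ^ b * τ ξ),
        mul_inv_cancel, AlgEquiv.one_apply]
    have h2 := key ht1
    rw [hΦη, hσtη, map_pow, hΦη, ← pow_mul, ← pow_add, pow_prime_pow_eq_iff hN hη] at h2
    have hbb : b = b' := by
      have h3 := h2.of_dvd (Dvd.intro N' hNd.symm : d ∣ N)
      have h4 : b + d * t ≡ b [MOD d] := by
        rw [Nat.ModEq, Nat.add_mul_mod_self_left]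
      exact (Nat.ModEq.eq_of_lt_of_lt (h3.trans h4) hb' hb).symm
    subst hbb
    refine ⟨rfl, ?_⟩
    have h3 : d * t ≡ 0 [MOD d * N'] := by
      rw [← hNd]
      exact (Nat.ModEq.add_left_cancel' b (by simpa using h2)).symm
    obtain ⟨s, rfl⟩ : N' ∣ t :=
      (Nat.modEq_zero_iff_dvd).1 (Nat.ModEq.mul_left_cancel' hd (by simpa using h3))
    have h4 := key ht2
    rw [hσN'ζ, hΦζ b hξ, hΦζ b hξ'] at h4
    exact h4.symm
  have hsurj : ∀ ψ : L →ₐ[ℚ_[ℓ]] Ω, ∃ b < d, ∃ ξ, IsPrimitiveRoot ξ (ℓ ^ (i + 1)) ∧ Φ b ξ = ψ := by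
    intro ψ
    obtain ⟨g, hg⟩ := exists_algEquiv_extending ψ
    obtain ⟨e, -, he⟩ := exists_lt_apply_eq_pow hN hη.pow_eq_one g
    set t := e / d
    have hgσ : IsPrimitiveRoot (g ((σ ^ t)⁻¹ ζ)) (ℓ ^ (i + 1)) :=
      (hζ.map_of_injective (σ ^ t)⁻¹.injective).map_of_injective g.injective
    refine ⟨e % d, Nat.mod_lt _ (Nat.pos_of_ne_zero hd), g ((σ ^ t)⁻¹ ζ), hgσ, ?_⟩
    set ρ := φ ^ (e % d) * τ (g ((σ ^ t)⁻¹ ζ)) with hρ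
    have h2 : (ρ * σ ^ t)⁻¹ * g ∈ M.fixingSubgroup := by
      have key : ∀ {x : Ω}, g x = (ρ * σ ^ t) x → ((ρ * σ ^ t)⁻¹ * g) x = x := by
        intro x hx
        rw [AlgEquiv.mul_apply, hx, ← AlgEquiv.mul_apply, inv_mul_cancel, AlgEquiv.one_apply]
      refine hMfix (key ?_) (key ?_)
      · rw [he, AlgEquiv.mul_apply, hσtη, map_pow, hΦη, ← pow_mul, ← pow_add, Nat.mod_add_div]
      · rw [AlgEquiv.mul_apply, apply_apply_comm hζ, hΦζ _ hgσ, apply_apply_comm hζ,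
          ← AlgEquiv.mul_apply, mul_inv_cancel, AlgEquiv.one_apply]
    ext x
    have hσH : σ ^ t ∈ H := ⟨t, rfl, rfl⟩
    have h3 : g x = (ρ * σ ^ t) x := by
      have h4 := hLH (hMH h2) x.2
      rw [AlgEquiv.mul_apply] at h4
      conv_rhs => rw [← h4]
      rw [← AlgEquiv.mul_apply, mul_inv_cancel, AlgEquiv.one_apply]
    rw [← hg x, h3, AlgEquiv.mul_apply, hLH hσH x.2]
    rfl
  have hbij : Set.BijOn (fun x : ℕ × Ω ↦ Φ x.1 x.2)
      ↑(Finset.range d ×ˢ primitiveRoots (ℓ ^ (i + 1)) Ω)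
      ↑(Finset.univ : Finset (L →ₐ[ℚ_[ℓ]] Ω)) := by
    refine ⟨fun _ _ ↦ Finset.mem_coe.2 (Finset.mem_univ _), ?_, ?_⟩
    · rintro ⟨b, ξ⟩ h ⟨b', ξ'⟩ h' he
      simp only [Finset.coe_product, Set.mem_prod, Finset.mem_coe, Finset.mem_range,
        mem_primitiveRoots hpos] at h h'
      obtain ⟨h1, h2⟩ := hinj b h.1 b' h'.1 ξ ξ' h.2 h'.2 he
      rw [h1, h2]
    · intro ψ _
      obtain ⟨b, hb, ξ, hξ, h⟩ := hsurj ψ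
      refine ⟨(b, ξ), ?_, h⟩
      simp only [Finset.coe_product, Set.mem_prod, Finset.mem_coe, Finset.mem_range,
        mem_primitiveRoots hpos]
      exact ⟨hb, hξ⟩
  refine ⟨L, hLM, fun x hx ↦ hLH ⟨1, by rw [pow_one], by rw [pow_one]⟩ hx, ?_, fun z ↦ ?_⟩
  · rw [← AlgHom.card ℚ_[ℓ] L Ω, ← Finset.card_univ,
      ← Finset.card_nbij _ hbij.mapsTo hbij.injOn hbij.surjOn, Finset.card_product,
      Finset.card_range, hζ.card_primitiveRoots]
  · rw [Algebra.norm_eq_prod_embeddings, ← Finset.prod_product']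
    exact (Finset.prod_nbij _ hbij.mapsTo hbij.injOn hbij.surjOn fun _ _ ↦ rfl).symm

/-- Choose $\sigma\in G_K$ with maximal logarithm acting as the $d$-th power of Frobenius on $\eta$,
where $d$ is the residue degree of $K$, and let $L_0\subset\mathbb Q_\ell(\eta,\zeta)$ be its fixed
field. The residue degree of $L=KL_0$ is still $d$, so some $x\in L$ has a norm of valuation $d$.
Its norm $z$ to $L_0$ is a uniformizer to which `norm_iwasawaLog_algebraNorm_eq` applies. Its norm
$y$ to $K$ has the same norm to $\mathbb Q_\ell$. -/
theorem exists_norm_iwasawaLog_algebraNorm_eq (K : IntermediateField ℚ_[ℓ] Ω)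
    [FiniteDimensional ℚ_[ℓ] K] {σ₁ : Gal(Ω/ℚ_[ℓ])} (hσ₁ : σ₁ ∈ K.fixingSubgroup)
    (h₁ : ∀ τ ∈ K.fixingSubgroup, ‖logChar ℚ_[ℓ] Ω ℓ τ‖ ≤ ‖logChar ℚ_[ℓ] Ω ℓ σ₁‖) :
    ∃ x : K, x ≠ 0 ∧ ‖iwasawaLog ℓ (Algebra.norm ℚ_[ℓ] x)‖ = ‖logChar ℚ_[ℓ] Ω ℓ σ₁‖ := by
  have : CharZero Ω := charZero_of_injective_algebraMap (algebraMap ℚ_[ℓ] Ω).injective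
  have : IsGalois ℚ_[ℓ] Ω := isGalois_of_isAlgClosed ℓ Ω
  obtain ⟨h0, -, -⟩ := norm_logInertia_eq_and_norm_iwasawaLog_algebraNorm_le K hσ₁ h₁
  obtain ⟨d, hd0, hddvd, -, hRK⟩ := exists_residueDegree K
  obtain ⟨i, hi⟩ := exists_norm_pow_lt (ℓ := ℓ) (norm_pos_iff.2 h0)
  have hi1 : ‖(ℓ : ℚ_[ℓ])‖ ^ (i + 1) < ‖logChar ℚ_[ℓ] Ω ℓ σ₁‖ := by
    rw [norm_pow] at hi
    exact (pow_le_pow_of_le_one (norm_nonneg _) Padic.norm_p_lt_one.le (Nat.le_succ i)).trans_lt hi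
  have hpos : 0 < ℓ ^ (i + 1) := pow_pos hℓ.out.pos _
  have : NeZero (ℓ ^ (i + 1)) := ⟨hpos.ne'⟩
  have : NeZero ((ℓ ^ (i + 1) : ℕ) : Ω) := NeZero.charZero
  obtain ⟨ζ, hζ⟩ := HasEnoughRootsOfUnity.exists_primitiveRoot Ω (ℓ ^ (i + 1))
  set ϕ := (ℓ ^ (i + 1)).totient with hϕ
  have hϕ0 : ϕ ≠ 0 := (Nat.totient_pos.2 hpos).ne'
  -- $B$ bounds the degree of $L$, hence its residue degree. The factor $B!$ ensures that this
  -- residue degree divides $N$.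
  set B := Module.finrank ℚ_[ℓ] K * (d * ϕ) with hB
  set N := d * ϕ * B.factorial with hN
  have hN0 : N ≠ 0 := mul_ne_zero (mul_ne_zero hd0 hϕ0) (Nat.factorial_ne_zero _)
  have hn0 := prime_pow_sub_one_ne_zero ℓ hN0
  have hn := coprime_prime_pow_sub_one ℓ hN0
  have : NeZero (ℓ ^ N - 1) := ⟨hn0⟩
  have : NeZero ((ℓ ^ N - 1 : ℕ) : Ω) := NeZero.charZero
  obtain ⟨η, hη⟩ := HasEnoughRootsOfUnity.exists_primitiveRoot Ω (ℓ ^ N - 1)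
  obtain ⟨σ, hσ, hση, hσlog⟩ :=
    exists_apply_eq_pow_norm_logChar_eq hRK hσ₁ h₁ hn hn0 hη.pow_eq_one
  obtain ⟨a, ha, hσζ, halog⟩ := exists_apply_eq_pow_norm_iwasawaLog_eq hζ (hσlog ▸ hi1)
  obtain ⟨φ, hφζ, hφ⟩ := exists_frobenius_fixing_primitiveRoot hζ hn hn0
  have hφη := hφ η hη.pow_eq_one
  have hφt (t : ℕ) : (φ ^ t) η = η ^ ℓ ^ t ∧ (φ ^ t) ζ = ζ :=
    ⟨pow_apply_eq_pow_pow hφη t,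
      by simpa using pow_apply_eq_pow_pow (σ := φ) (x := ζ) (m := 1) (by simpa using hφζ) t⟩
  have hτex : ∀ ξ : Ω, ∃ τ : Gal(Ω/ℚ_[ℓ]), τ η = η ∧
      (IsPrimitiveRoot ξ (ℓ ^ (i + 1)) → τ ζ = ξ) := by
    intro ξ
    by_cases hξ : IsPrimitiveRoot ξ (ℓ ^ (i + 1))
    · obtain ⟨τ, hτ⟩ := exists_apply_primitiveRoot_eq hζ hξ
      obtain ⟨b, -, hb⟩ := exists_lt_apply_eq_pow hN0 hη.pow_eq_one τ
      refine ⟨τ * (φ ^ b)⁻¹, ?_, fun _ ↦ ?_⟩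
      · rw [AlgEquiv.mul_apply, apply_apply_comm hη, hb, ← (hφt b).1, ← AlgEquiv.mul_apply,
          inv_mul_cancel, AlgEquiv.one_apply]
      · rw [AlgEquiv.mul_apply, apply_apply_comm hζ]
        nth_rewrite 1 [← (hφt b).2]
        rw [apply_apply_comm hζ, ← AlgEquiv.mul_apply, inv_mul_cancel, AlgEquiv.one_apply, hτ]
    · exact ⟨1, rfl, fun h ↦ absurd h hξ⟩
  choose τ hτη hτζ using hτex
  obtain ⟨L₀, hL₀M, hσL₀, hfin, hnorm⟩ := exists_intermediateField_norm_eq_prod hN0 hη hζ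
    (Dvd.intro _ rfl) ha hση hσζ hφη hφζ hτη hτζ
  have : FiniteDimensional ℚ_[ℓ] L₀ := FiniteDimensional.of_finrank_pos (by
    rw [hfin]; exact Nat.pos_of_ne_zero (mul_ne_zero hd0 hϕ0))
  set L := K ⊔ L₀ with hL
  have hσL : σ ∈ L.fixingSubgroup := by
    rw [hL, IntermediateField.fixingSubgroup_sup]
    exact ⟨hσ, (IntermediateField.mem_fixingSubgroup_iff _ _).2 hσL₀⟩
  obtain ⟨f, hf0, hfdvd, ⟨x, hx0, hxf⟩, hRL⟩ := exists_residueDegree L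
  obtain ⟨y, hy0, hxy⟩ := exists_algebraNorm_eq (le_sup_left : K ≤ L) hx0
  obtain ⟨z, hz0, hxz⟩ := exists_algebraNorm_eq (le_sup_right : L₀ ≤ L) hx0
  have hdf : d ∣ f := by
    have := hddvd y hy0
    rw [← hxy, hxf] at this
    exact_mod_cast this
  have hfB : f ≤ B := by
    have h2 := hfdvd (algebraMap ℚ_[ℓ] L ℓ) (by simpa using hℓ.out.ne_zero)
    rw [Algebra.norm_algebraMap, Padic.valuation_pow, Padic.valuation_p, mul_one] at h2
    refine (Nat.le_of_dvd Module.finrank_pos (by exact_mod_cast h2)).trans ?_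
    rw [hB, hϕ, ← hfin]
    exact IntermediateField.finrank_sup_le _ _
  -- As $\sigma$ fixes $L$, it acts on $\eta$ by a power of $\ell^f$, so $d\equiv fj\bmod N$ for
  -- some $j$, and $f\mid N$.
  have hfd : f ∣ d := by
    obtain ⟨j, hj⟩ := exists_apply_eq_pow_pow hRL hσL hn hn0 hη.pow_eq_one
    rw [hση, ← pow_mul, pow_prime_pow_eq_iff hN0 hη] at hj
    have hfN : f ∣ N := (Nat.dvd_factorial (Nat.pos_of_ne_zero hf0) hfB).mul_left _
    have h2 := hj.of_dvd hfN
    exact Nat.modEq_zero_iff_dvd.1 (h2.trans (Nat.modEq_zero_iff_dvd.2 (Dvd.intro _ rfl)))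
  obtain rfl : f = d := Nat.dvd_antisymm hfd hdf
  -- The norm of $z$ has valuation $d$ and $L_0$ has degree $d\,\varphi(\ell^{i+1})$.
  have hzn : ‖(z : Ω)‖ = ‖ζ - 1‖ := by
    have h2 := norm_algebraNorm L₀ z
    have h3 := Algebra.norm_ne_zero_iff (R := ℚ_[ℓ]).2 hz0
    rw [hfin, Padic.norm_eq_zpow_neg_valuation h3, ← hxz, hxf, zpow_neg, zpow_natCast, ← inv_pow,
      ← Padic.norm_p, ← norm_primitiveRoot_sub_one_pow hζ, ← pow_mul, mul_comm] at h2
    exact ((pow_left_inj₀ (norm_nonneg _) (norm_nonneg _) (mul_ne_zero hd0 hϕ0)).1 h2).symm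
  refine ⟨y, hy0, ?_⟩
  rw [← hxy, hxz, ← hσlog, ← halog]
  have hηE : η ∈ ℚ_[ℓ]⟮η⟯ := IntermediateField.mem_adjoin_simple_self _ _
  have hEφ : ∀ w ∈ ℚ_[ℓ]⟮η⟯, φ w ∈ ℚ_[ℓ]⟮η⟯ := by
    have h2 : ℚ_[ℓ]⟮η⟯ ≤ (ℚ_[ℓ]⟮η⟯).comap (φ : Ω →ₐ[ℚ_[ℓ]] Ω) := by
      rw [IntermediateField.adjoin_simple_le_iff]
      change φ η ∈ ℚ_[ℓ]⟮η⟯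
      rw [hφη]
      exact pow_mem hηE ℓ
    exact fun w hw ↦ h2 hw
  have hEfix : ∀ {g : Gal(Ω/ℚ_[ℓ])}, g η = η → g ∈ (ℚ_[ℓ]⟮η⟯).fixingSubgroup := by
    intro g hg
    exact mem_fixingSubgroup_adjoin fun x hx ↦ by rwa [Set.mem_singleton_iff.1 hx]
  have hEσ : ∀ w ∈ ℚ_[ℓ]⟮η⟯, σ w = (φ ^ f) w := by
    have h2 : (φ ^ f)⁻¹ * σ ∈ (ℚ_[ℓ]⟮η⟯).fixingSubgroup := by
      apply hEfix
      rw [AlgEquiv.mul_apply, hση, ← (hφt f).1, ← AlgEquiv.mul_apply, inv_mul_cancel,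
        AlgEquiv.one_apply]
    intro w hw
    have h3 := (IntermediateField.mem_fixingSubgroup_iff _ _).1 h2 w hw
    conv_rhs => rw [← h3]
    rw [← AlgEquiv.mul_apply, mul_inv_cancel_left]
  have hEτ : ∀ ξ, τ ξ ∈ (ℚ_[ℓ]⟮η⟯).fixingSubgroup := fun ξ ↦ hEfix (hτη ξ)
  refine norm_iwasawaLog_algebraNorm_eq (E := ℚ_[ℓ]⟮η⟯) hζ
    (fun w hw ↦ (norm_le_and_residue_of_mem_adjoin hN0 hη hw).1) hφζ hEφ
    (fun w hw ↦ norm_frobenius_sub_pow_lt_one hN0 hη hφη hw) ha hσζ hEσ hEτ hτζ hnorm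
    (hσL₀ _ z.2) ?_ hzn ?_
  · have h2 : (z : Ω) ∈ (ℚ_[ℓ]⟮η, ζ⟯).toSubalgebra := hL₀M z.2
    rw [IntermediateField.adjoin_toSubalgebra] at h2
    refine Algebra.adjoin_mono ?_ h2
    rintro w (rfl | rfl)
    exacts [Or.inl hηE, Or.inr rfl]
  · rwa [halog, hσlog]

end LogNormSurjective

/-! ### The local results for abstract finite extensions of $\mathbb Q_p$ -/

section LogInertiaDegree
universe u
variable {p : ℕ} [hp : Fact p.Prime] (L : Type u) [Field L] [Algebra ℚ_[p] L]
  [FiniteDimensional ℚ_[p] L]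

/-- A finite extension of `ℚ_[p]` as a subfield of an algebraic closure with the spectral norm. -/
theorem exists_intermediateField_logInertiaDegree_eq :
    ∃ (Ω : Type u) (_ : NormedField Ω) (_ : NormedAlgebra ℚ_[p] Ω) (_ : IsUltrametricDist Ω)
      (_ : Algebra.IsAlgebraic ℚ_[p] Ω) (_ : IsAlgClosed Ω) (K : IntermediateField ℚ_[p] Ω)
      (_e : L ≃ₐ[ℚ_[p]] K), logInertiaDegree ℚ_[p] L =
        Module.finrank ℚ_[p] (K ⊓ cyclotomicZHat ℚ_[p] Ω : IntermediateField ℚ_[p] Ω) := by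
  have : Algebra.IsAlgebraic ℚ_[p] (AlgebraicClosure L) :=
    Algebra.IsAlgebraic.trans ℚ_[p] L (AlgebraicClosure L)
  have hc : IsAlgClosed (AlgebraicClosure L) := inferInstance
  let e := AlgEquiv.ofInjectiveField (IsScalarTower.toAlgHom ℚ_[p] L (AlgebraicClosure L))
  refine ⟨AlgebraicClosure L, spectralNorm.normedField ℚ_[p] _, spectralNorm.normedAlgebra ℚ_[p] _,
    ?_, this, hc, (IsScalarTower.toAlgHom ℚ_[p] L (AlgebraicClosure L)).fieldRange, e, rfl⟩
  let _ := spectralNorm.normedField ℚ_[p] (AlgebraicClosure L)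
  exact IsUltrametricDist.isUltrametricDist_of_isNonarchimedean_norm
    (isNonarchimedean_spectralNorm (K := ℚ_[p]) (L := AlgebraicClosure L))

theorem norm_logInertiaDegree_eq_of_ne {ℓ : ℕ} [Fact ℓ.Prime] (hpℓ : p ≠ ℓ) {f : ℕ} (hf : f ≠ 0)
    (h₁ : ∀ x : L, x ≠ 0 → (f : ℤ) ∣ (Algebra.norm ℚ_[p] x).valuation)
    (h₂ : ∃ x : L, x ≠ 0 ∧ (Algebra.norm ℚ_[p] x).valuation = f) :
    ‖(logInertiaDegree ℚ_[p] L : ℚ_[ℓ])‖ = ‖(f : ℚ_[ℓ])‖ := by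
  obtain ⟨Ω, _, _, _, _, _, K, e, he⟩ := exists_intermediateField_logInertiaDegree_eq (p := p) L
  have : FiniteDimensional ℚ_[p] K := e.toLinearEquiv.finiteDimensional
  obtain ⟨g, hg0, hg₁, ⟨x, hx0, hx⟩, hR⟩ := exists_residueDegree K
  obtain ⟨y, hy0, hy⟩ := h₂
  have h3 : g ∣ f := by
    have := hg₁ (e y) (by simpa using hy0)
    rw [Algebra.norm_eq_of_algEquiv, hy] at this
    exact_mod_cast this
  have h4 : f ∣ g := by
    have := h₁ (e.symm x) (by simpa using hx0)
    rw [Algebra.norm_eq_of_algEquiv, hx] at this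
    exact_mod_cast this
  obtain rfl := Nat.dvd_antisymm h3 h4
  rw [he, norm_logInertia_eq_of_ne hpℓ hg0 hR]

theorem logInertiaDegree_ne_zero_and_norm_iwasawaLog_algebraNorm_le :
    logInertiaDegree ℚ_[p] L ≠ 0 ∧
      (∀ x : L, x ≠ 0 → ‖iwasawaLog p (Algebra.norm ℚ_[p] x)‖ ≤
        ‖(logInertiaDegree ℚ_[p] L * logConductor p : ℚ_[p])‖) ∧
      ∃ x : L, x ≠ 0 ∧ ‖iwasawaLog p (Algebra.norm ℚ_[p] x)‖ =
        ‖(logInertiaDegree ℚ_[p] L * logConductor p : ℚ_[p])‖ := by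
  obtain ⟨Ω, _, _, _, _, _, K, e, he⟩ := exists_intermediateField_logInertiaDegree_eq (p := p) L
  have : FiniteDimensional ℚ_[p] K := e.toLinearEquiv.finiteDimensional
  have : IsGalois ℚ_[p] Ω := isGalois_of_isAlgClosed p Ω
  obtain ⟨σ, hσ, hmax⟩ := exists_norm_logChar_max p K
  obtain ⟨h0, h1, h2⟩ := norm_logInertia_eq_and_norm_iwasawaLog_algebraNorm_le K hσ hmax
  obtain ⟨x, hx0, hx⟩ := exists_norm_iwasawaLog_algebraNorm_eq K hσ hmax
  rw [norm_mul, he, h1]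
  refine ⟨?_, fun y hy ↦ ?_, e.symm x, by simpa using hx0, ?_⟩
  · intro h
    rw [h, Nat.cast_zero, norm_zero, zero_mul] at h1
    exact h0 (norm_eq_zero.1 h1.symm)
  · have := h2 (e y) (by simpa using hy)
    rwa [Algebra.norm_eq_of_algEquiv] at this
  · rw [Algebra.norm_eq_of_algEquiv, hx]

end LogInertiaDegree

/-! ### Places and embeddings of a number field into $p$-adic fields -/

section NormProduct
variable {F : Type*} [Field F] [NumberField F] {p : ℕ} [hp : Fact p.Prime]

section
variable {Ω : Type*} [NormedField Ω] [NormedAlgebra ℚ_[p] Ω] [IsUltrametricDist Ω]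

omit [NumberField F] hp [NormedAlgebra ℚ_[p] Ω] in
theorem norm_ringHom_le_one (ρ : F →+* Ω) (a : 𝓞 F) : ‖ρ a‖ ≤ 1 := by
  have h : IsIntegral (unitBall Ω) (ρ a) := by
    obtain ⟨P, hP, hx⟩ := RingOfIntegers.isIntegral_coe a
    refine ⟨P.map (Int.castRingHom _), hP.map _, ?_⟩
    rw [Polynomial.eval₂_map]
    have := congrArg ρ hx
    rw [map_zero, Polynomial.hom_eval₂] at this
    rw [← this]
    exact Polynomial.eval₂_congr (RingHom.ext_int _ _) rfl rfl
  obtain ⟨y, hy⟩ := IsIntegrallyClosed.isIntegral_iff.1 h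
  rw [← hy]
  exact mem_unitBall.1 y.2

omit hp [NormedAlgebra ℚ_[p] Ω] in
theorem mem_asIdeal_iff_norm_lt_one {ρ : F →+* Ω} {v : HeightOneSpectrum (𝓞 F)}
    (h : ∀ a ∈ v.asIdeal, ‖ρ (a : F)‖ < 1) (a : 𝓞 F) : a ∈ v.asIdeal ↔ ‖ρ a‖ < 1 := by
  refine ⟨h a, fun ha ↦ ?_⟩
  by_contra hav
  obtain ⟨b, hb⟩ := v.isMaximal.exists_inv hav
  obtain ⟨c, hc, hbc⟩ := hb
  have h1 : ‖ρ ((b * a : 𝓞 F) : F)‖ < 1 := by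
    change ‖ρ ((b : F) * (a : F))‖ < 1
    rw [map_mul, norm_mul]
    exact mul_lt_one_of_nonneg_of_lt_one_right (norm_ringHom_le_one ρ b) (norm_nonneg _) ha
  have h2 : ρ ((b * a : 𝓞 F) : F) + ρ (c : F) = 1 := by
    rw [← map_add]
    change ρ ((b * a + c : 𝓞 F) : F) = 1
    rw [hbc]
    exact map_one ρ
  have h3 := IsUltrametricDist.norm_add_le_max (ρ ((b * a : 𝓞 F) : F)) (ρ (c : F))
  rw [h2, norm_one] at h3
  exact absurd h3 (not_le.2 (max_lt h1 (h c hc)))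

omit hp [NormedAlgebra ℚ_[p] Ω] in
theorem norm_ringHom_le_one_of_valuation_le_one {ρ : F →+* Ω} {v : HeightOneSpectrum (𝓞 F)}
    (h : ∀ a ∈ v.asIdeal, ‖ρ (a : F)‖ < 1) {x : F} (hx : v.valuation F x ≤ 1) : ‖ρ x‖ ≤ 1 := by
  obtain ⟨n, ⟨d, hd⟩, hnd⟩ := v.exists_primeCompl_mul_eq_of_integer x hx
  have hd1 : ‖ρ (d : F)‖ = 1 := (norm_ringHom_le_one ρ d).eq_of_not_lt fun h1 ↦
    hd ((mem_asIdeal_iff_norm_lt_one h d).2 h1)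
  have h2 := congrArg (fun y ↦ ‖ρ y‖) hnd
  simp only [map_mul, norm_mul] at h2
  rw [hd1, mul_one] at h2
  rw [h2]
  exact norm_ringHom_le_one ρ n

omit hp [NormedAlgebra ℚ_[p] Ω] in
theorem norm_ringHom_eq_one_of_valuation_eq_one {ρ : F →+* Ω} {v : HeightOneSpectrum (𝓞 F)}
    (h : ∀ a ∈ v.asIdeal, ‖ρ (a : F)‖ < 1) {x : F} (hx : v.valuation F x = 1) : ‖ρ x‖ = 1 := by
  refine (norm_ringHom_le_one_of_valuation_le_one h hx.le).antisymm ?_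
  have h1 := norm_ringHom_le_one_of_valuation_le_one h (x := x⁻¹) (by rw [map_inv₀, hx, inv_one])
  have hx0 : ρ x ≠ 0 := (map_ne_zero _).2 fun h0 ↦ by simp [h0] at hx
  rwa [map_inv₀, norm_inv, inv_le_one₀ (norm_pos_iff.2 hx0)] at h1

/-- The place is the centre of the valuation pulled back along $\rho$: the integers of norm less
than 1. -/
theorem exists_place_of_ringHom (ρ : F →+* Ω) : ∃ v : HeightOneSpectrum (𝓞 F),
    (p : 𝓞 F) ∈ v.asIdeal ∧ ∀ a ∈ v.asIdeal, ‖ρ (a : F)‖ < 1 := by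
  have hpn : ‖ρ ((p : 𝓞 F) : F)‖ < 1 := by
    have e : ρ ((p : 𝓞 F) : F) = algebraMap ℚ_[p] Ω p := by simp
    rw [e, norm_algebraMap']
    exact Padic.norm_p_lt_one
  have hle (a : 𝓞 F) := norm_ringHom_le_one ρ a
  let I : Ideal (𝓞 F) :=
    { carrier := {a | ‖ρ (a : F)‖ < 1}
      zero_mem' := by simp
      add_mem' := fun {a b} ha hb ↦ by
        simp only [Set.mem_ofPred_eq, map_add] at *
        exact (IsUltrametricDist.norm_add_le_max _ _).trans_lt (max_lt ha hb)
      smul_mem' := fun c a ha ↦ by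
        simp only [Set.mem_ofPred_eq, smul_eq_mul, map_mul, norm_mul] at *
        exact mul_lt_one_of_nonneg_of_lt_one_right (hle c) (norm_nonneg _) ha }
  have hI (a : 𝓞 F) : a ∈ I ↔ ‖ρ (a : F)‖ < 1 := Iff.rfl
  refine ⟨⟨I, ⟨?_, ?_⟩, ?_⟩, hpn, fun a ha ↦ ha⟩
  · rw [Ideal.ne_top_iff_one, hI]
    simp
  · intro a b hab
    rw [hI] at hab
    change ‖ρ ((a : F) * (b : F))‖ < 1 at hab
    rw [map_mul, norm_mul] at hab
    rw [hI, hI]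
    by_contra! hcon
    rw [(hle a).antisymm hcon.1, (hle b).antisymm hcon.2, one_mul] at hab
    exact lt_irrefl _ hab
  · intro h
    have : (p : 𝓞 F) ∈ I := hpn
    rw [h, Ideal.mem_bot] at this
    exact hp.out.ne_zero (by exact_mod_cast this)

end

section
variable {v : HeightOneSpectrum (𝓞 F)} [Algebra ℚ_[p] (v.adicCompletion F)]
  [ContinuousSMul ℚ_[p] (v.adicCompletion F)]

/-- The $\mathbb Q_p$-span of $F$ is generated by a $\mathbb Q$-basis of $F$. Being
finite-dimensional it is closed, and it is dense. -/
theorem finiteDimensional_adicCompletion : FiniteDimensional ℚ_[p] (v.adicCompletion F) := by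
  set S := Submodule.span ℚ_[p] (Set.range (algebraMap F (v.adicCompletion F))) with hS
  let b := Module.finBasis ℚ F
  have h1 : S ≤ Submodule.span ℚ_[p] (Set.range fun i ↦ algebraMap F (v.adicCompletion F) (b i)) := by
    rw [hS, Submodule.span_le]
    rintro _ ⟨x, rfl⟩
    rw [← b.sum_repr x, map_sum]
    refine Submodule.sum_mem _ fun i _ ↦ ?_
    have e : algebraMap F (v.adicCompletion F) (b.repr x i • b i) =
        ((b.repr x i : ℚ) : ℚ_[p]) • algebraMap F (v.adicCompletion F) (b i) := by
      rw [Algebra.smul_def, Algebra.smul_def, map_mul]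
      simp
    rw [e]
    exact Submodule.smul_mem _ _ (Submodule.subset_span ⟨i, rfl⟩)
  have : FiniteDimensional ℚ_[p] S := by
    have := FiniteDimensional.span_of_finite ℚ_[p]
      (Set.finite_range fun i ↦ algebraMap F (v.adicCompletion F) (b i))
    exact Submodule.finiteDimensional_of_le h1
  have h2 : IsClosed (S : Set (v.adicCompletion F)) := S.closed_of_finiteDimensional
  have h3 : S = ⊤ := by
    rw [eq_top_iff]
    intro x _
    have := (v.denseRange_algebraMap F).closure_eq ▸ Set.mem_univ x
    exact h2.closure_subset_iff.2 Submodule.subset_span this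
  rw [h3] at this
  exact Module.finite_def.2 (Module.Finite.iff_fg.1 this)

variable {Ω : Type*} [NormedField Ω] [NormedAlgebra ℚ_[p] Ω]

theorem continuous_algHom_adicCompletion (ψ : v.adicCompletion F →ₐ[ℚ_[p]] Ω) : Continuous ψ := by
  have : FiniteDimensional ℚ_[p] (v.adicCompletion F) := finiteDimensional_adicCompletion
  exact ψ.toLinearMap.continuous_of_finiteDimensional

/-- The powers of $a$ tend to 0 in the completion and $\psi$ is continuous. -/
theorem norm_algHom_adicCompletion_lt_one (ψ : v.adicCompletion F →ₐ[ℚ_[p]] Ω) {a : 𝓞 F}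
    (ha : a ∈ v.asIdeal) : ‖ψ (algebraMap F _ (a : F))‖ < 1 := by
  have h1 : Valued.v (algebraMap F (v.adicCompletion F) (a : F)) < 1 := by
    have := v.valuedAdicCompletion_eq_valuation' (K := F) (a : F)
    rw [← v.valuation_lt_one_iff_mem (K := F)] at ha
    rw [← this] at ha
    exact ha
  have h2 : Tendsto (fun n : ℕ ↦ algebraMap F (v.adicCompletion F) (a : F) ^ n) atTop (𝓝 0) :=
    Valued.tendsto_zero_pow_of_v_lt_one h1
  have h3 := ((continuous_algHom_adicCompletion ψ).tendsto 0).comp h2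
  rw [map_zero] at h3
  by_contra! hcon
  have h4 := h3.norm
  rw [norm_zero] at h4
  refine absurd (ge_of_tendsto' h4 fun n ↦ ?_) (not_le.2 zero_lt_one)
  simpa using one_le_pow₀ hcon

theorem algHom_adicCompletion_ext {ψ₁ ψ₂ : v.adicCompletion F →ₐ[ℚ_[p]] Ω}
    (h : ∀ x : F, ψ₁ (algebraMap F _ x) = ψ₂ (algebraMap F _ x)) : ψ₁ = ψ₂ := by
  refine DFunLike.coe_injective ((v.denseRange_algebraMap F).equalizer
    (continuous_algHom_adicCompletion ψ₁) (continuous_algHom_adicCompletion ψ₂) ?_)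
  exact funext h

/-- If $p^{-n}x$ is integral at $v$, then $\|\rho(x)\|\le\|p^n\|$. So $\rho$ is uniformly continuous
for the $v$-adic topology and extends by density; it is $\mathbb Q_p$-linear because $\mathbb Q$ is
dense in $\mathbb Q_p$. -/
theorem exists_algHom_adicCompletion_extending [IsUltrametricDist Ω] [CompleteSpace Ω]
    {ρ : F →+* Ω}
    (h : ∀ a ∈ v.asIdeal, ‖ρ (a : F)‖ < 1) :
    ∃ ψ : v.adicCompletion F →ₐ[ℚ_[p]] Ω, ∀ x : F, ψ (algebraMap F _ x) = ρ x := by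
  let _ : UniformSpace F := .comap (algebraMap F (v.adicCompletion F)) inferInstance
  have hi : IsUniformInducing (algebraMap F (v.adicCompletion F)) := ⟨rfl⟩
  have : IsUniformAddGroup F := hi.isUniformAddGroup (algebraMap F (v.adicCompletion F))
  have hp0 : (p : F) ≠ 0 := by exact_mod_cast hp.out.ne_zero
  have hρ : UniformContinuous ρ := by
    refine uniformContinuous_of_continuousAt_zero ρ ?_
    rw [ContinuousAt, map_zero, Metric.tendsto_nhds]
    intro ε hε
    obtain ⟨n, hn⟩ := exists_norm_pow_lt (ℓ := p) hε
    set c : F := ((p : F) ^ n)⁻¹ with hc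
    have hO : IsOpen {y : v.adicCompletion F | Valued.v y ≤ 1} :=
      Valued.isOpen_integer (v.adicCompletion F)
    have hcont : Continuous fun x : F ↦ algebraMap F (v.adicCompletion F) c *
        algebraMap F (v.adicCompletion F) x := continuous_const.mul hi.isInducing.continuous
    filter_upwards [(hO.preimage hcont).mem_nhds (by simp)] with x hx
    rw [dist_zero_right]
    have h3 : v.valuation F (c * x) ≤ 1 := by
      have := v.valuedAdicCompletion_eq_valuation' (K := F) (c * x)
      rw [← this]
      rw [Set.mem_preimage, ← map_mul] at hx
      exact hx
    have h4 := norm_ringHom_le_one_of_valuation_le_one h h3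
    have e : ρ ((p : F) ^ n) = algebraMap ℚ_[p] Ω (p ^ n) := by simp
    have hpos : 0 < ‖(p : ℚ_[p]) ^ n‖ :=
      norm_pos_iff.2 (pow_ne_zero _ (by exact_mod_cast hp.out.ne_zero))
    rw [map_mul, norm_mul, hc, map_inv₀, norm_inv, e, norm_algebraMap', inv_mul_le_one₀ hpos] at h4
    exact h4.trans_lt hn
  let ψ : v.adicCompletion F →+* Ω :=
    IsDenseInducing.extendRingHom hi (v.denseRange_algebraMap F) hρ
  have hψ (x : F) : ψ (algebraMap F _ x) = ρ x :=
    (hi.isDenseInducing (v.denseRange_algebraMap F)).extend_eq hρ.continuous x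
  have hψc : Continuous ψ :=
    (uniformContinuous_uniformly_extend hi (v.denseRange_algebraMap F) hρ).continuous
  refine ⟨{ ψ with commutes' := fun c ↦ ?_ }, hψ⟩
  have h1 : (fun c ↦ ψ (algebraMap ℚ_[p] _ c)) = algebraMap ℚ_[p] Ω := by
    refine (Padic.denseRange_ratCast p).equalizer (hψc.comp ?_) (continuous_algebraMap _ _) ?_
    · exact continuous_algebraMap _ _
    · funext q
      simp
  exact congrFun h1 c

end
end NormProduct

/-! ### Local norms and the global norm -/

section LocalNorm
variable {F : Type*} [Field F] [NumberField F] (p : ℕ) [hp : Fact p.Prime]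

theorem continuousSMul_adicCompletion (v : HeightOneSpectrum (𝓞 F)) (hv : (p : 𝓞 F) ∈ v.asIdeal) :
    letI := (padicToCompletion p v hv).toAlgebra
    ContinuousSMul ℚ_[p] (v.adicCompletion F) := by
  let _ := (padicToCompletion p v hv).toAlgebra
  exact continuousSMul_of_algebraMap _ _ (continuous_padicToCompletion p v hv)

theorem algebraMap_localNorm (v : HeightOneSpectrum (𝓞 F)) (hv : (p : 𝓞 F) ∈ v.asIdeal)
    (x : v.adicCompletion F) :
    letI := (padicToCompletion p v hv).toAlgebra
    haveI := continuousSMul_adicCompletion p v hv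
    haveI : FiniteDimensional ℚ_[p] (v.adicCompletion F) := finiteDimensional_adicCompletion
    algebraMap ℚ_[p] ℂ_[p] (localNorm p v hv x) =
      ∏ ψ : v.adicCompletion F →ₐ[ℚ_[p]] ℂ_[p], ψ x := by
  let _ := (padicToCompletion p v hv).toAlgebra
  have := continuousSMul_adicCompletion p v hv
  have : FiniteDimensional ℚ_[p] (v.adicCompletion F) := finiteDimensional_adicCompletion
  exact Algebra.norm_eq_prod_embeddings ℚ_[p] ℂ_[p] x

theorem norm_localNorm_eq_one (v : HeightOneSpectrum (𝓞 F)) (hv : (p : 𝓞 F) ∈ v.asIdeal)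
    {x : F} (hx : v.valuation F x = 1) : ‖localNorm p v hv (algebraMap F _ x)‖ = 1 := by
  let _ := (padicToCompletion p v hv).toAlgebra
  have := continuousSMul_adicCompletion p v hv
  have : FiniteDimensional ℚ_[p] (v.adicCompletion F) := finiteDimensional_adicCompletion
  rw [← norm_algebraMap' ℂ_[p], algebraMap_localNorm, norm_prod]
  refine Finset.prod_eq_one fun ψ _ ↦ ?_
  exact norm_ringHom_eq_one_of_valuation_eq_one
    (ρ := (ψ : v.adicCompletion F →+* ℂ_[p]).comp (algebraMap F _))
    (fun a ha ↦ norm_algHom_adicCompletion_lt_one ψ ha) hx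

theorem continuous_localNorm (v : HeightOneSpectrum (𝓞 F)) (hv : (p : 𝓞 F) ∈ v.asIdeal) :
    Continuous (localNorm p v hv) := by
  let _ := (padicToCompletion p v hv).toAlgebra
  have := continuousSMul_adicCompletion p v hv
  have : FiniteDimensional ℚ_[p] (v.adicCompletion F) := finiteDimensional_adicCompletion
  rw [(algebraMap_isometry ℚ_[p] ℂ_[p]).isEmbedding.isInducing.continuous_iff]
  have e : algebraMap ℚ_[p] ℂ_[p] ∘ localNorm p v hv =
      fun x ↦ ∏ ψ : v.adicCompletion F →ₐ[ℚ_[p]] ℂ_[p], ψ x :=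
    funext fun x ↦ algebraMap_localNorm p v hv x
  rw [e]
  exact continuous_finsetProd _ fun ψ _ ↦ continuous_algHom_adicCompletion ψ

instance : Finite {v : HeightOneSpectrum (𝓞 F) // (p : 𝓞 F) ∈ v.asIdeal} :=
  finite_dvd p hp.out.ne_zero

/-- The global norm is the product of the local norms over `p`. -/
theorem algebraNorm_eq_prod_localNorm
    [Fintype {v : HeightOneSpectrum (𝓞 F) // (p : 𝓞 F) ∈ v.asIdeal}] (x : F) :
    ((Algebra.norm ℚ x : ℚ) : ℚ_[p]) =
      ∏ v : {v : HeightOneSpectrum (𝓞 F) // (p : 𝓞 F) ∈ v.asIdeal},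
        localNorm p v.1 v.2 (algebraMap F _ x) := by
  let _ (v : {v : HeightOneSpectrum (𝓞 F) // (p : 𝓞 F) ∈ v.asIdeal}) :
    Algebra ℚ_[p] (v.1.adicCompletion F) := (padicToCompletion p v.1 v.2).toAlgebra
  have (v : {v : HeightOneSpectrum (𝓞 F) // (p : 𝓞 F) ∈ v.asIdeal}) :
    ContinuousSMul ℚ_[p] (v.1.adicCompletion F) := continuousSMul_adicCompletion p v.1 v.2
  have (v : {v : HeightOneSpectrum (𝓞 F) // (p : 𝓞 F) ∈ v.asIdeal}) :
    FiniteDimensional ℚ_[p] (v.1.adicCompletion F) := finiteDimensional_adicCompletion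
  apply (algebraMap ℚ_[p] ℂ_[p]).injective
  rw [map_prod]
  have h1 : algebraMap ℚ_[p] ℂ_[p] ((Algebra.norm ℚ x : ℚ) : ℚ_[p]) =
      algebraMap ℚ ℂ_[p] (Algebra.norm ℚ x) := by simp
  rw [h1, Algebra.norm_eq_prod_embeddings ℚ ℂ_[p] x]
  have h2 (v : {v : HeightOneSpectrum (𝓞 F) // (p : 𝓞 F) ∈ v.asIdeal}) :
      algebraMap ℚ_[p] ℂ_[p] (localNorm p v.1 v.2 (algebraMap F _ x)) =
        ∏ ψ : v.1.adicCompletion F →ₐ[ℚ_[p]] ℂ_[p], ψ (algebraMap F _ x) :=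
    algebraMap_localNorm p v.1 v.2 _
  simp_rw [h2]
  rw [← Fintype.prod_sigma']
  -- An embedding of $F$ into $\mathbb C_p$ is the same as a place over $p$ together with an
  -- embedding of its completion; the place is recovered as the centre.
  let Φ : (Σ v : {v : HeightOneSpectrum (𝓞 F) // (p : 𝓞 F) ∈ v.asIdeal},
      v.1.adicCompletion F →ₐ[ℚ_[p]] ℂ_[p]) → (F →ₐ[ℚ] ℂ_[p]) := fun s ↦
    ((s.2 : s.1.1.adicCompletion F →+* ℂ_[p]).comp (algebraMap F _)).toRatAlgHom
  refine (Fintype.prod_bijective Φ ⟨?_, ?_⟩ _ _ fun s ↦ rfl).symm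
  · rintro ⟨v, ψ⟩ ⟨w, ψ'⟩ h
    have hx (x : F) : ψ (algebraMap F _ x) = ψ' (algebraMap F _ x) := DFunLike.congr_fun h x
    have hvw : v = w := by
      apply Subtype.ext
      apply HeightOneSpectrum.ext
      ext a
      rw [mem_asIdeal_iff_norm_lt_one
        (ρ := (ψ : v.1.adicCompletion F →+* ℂ_[p]).comp (algebraMap F _))
        (fun a ha ↦ norm_algHom_adicCompletion_lt_one ψ ha),
        mem_asIdeal_iff_norm_lt_one
        (ρ := (ψ' : w.1.adicCompletion F →+* ℂ_[p]).comp (algebraMap F _))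
        (fun a ha ↦ norm_algHom_adicCompletion_lt_one ψ' ha)]
      change ‖ψ _‖ < 1 ↔ ‖ψ' _‖ < 1
      rw [hx]
    subst hvw
    rw [algHom_adicCompletion_ext hx]
  · intro ρ
    obtain ⟨v, hv, h⟩ := exists_place_of_ringHom (p := p) (ρ : F →+* ℂ_[p])
    obtain ⟨ψ, hψ⟩ := exists_algHom_adicCompletion_extending (p := p) (v := (⟨v, hv⟩ :
      {v : HeightOneSpectrum (𝓞 F) // (p : 𝓞 F) ∈ v.asIdeal}).1) h
    refine ⟨⟨⟨v, hv⟩, ψ⟩, ?_⟩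
    ext x
    exact hψ x

end LocalNorm

/-! ### Weak approximation at finite places -/

section WeakApproximation
variable {F : Type*} [Field F] [NumberField F]

theorem exists_forall_adicAbv_sub_lt (S : Finset (HeightOneSpectrum (𝓞 F)))
    (b : HeightOneSpectrum (𝓞 F) → F) {r : ℝ} (hr : 0 < r) :
    ∃ a : F, ∀ v ∈ S, NumberField.HeightOneSpectrum.adicAbv F v (a - b v) < r := by
  have h := AbsoluteValue.denseRange_algebraMap_pi (ι := S) (v := fun v ↦ NumberField.HeightOneSpectrum.adicAbv F v.1) ?_ ?_
  · obtain ⟨a, ha⟩ := Metric.denseRange_iff.1 h (fun v ↦ WithAbs.toAbs _ (b v.1)) r hr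
    refine ⟨a, fun v hv ↦ ?_⟩
    have h1 := (dist_pi_lt_iff hr).1 ha ⟨v, hv⟩
    rw [dist_comm, dist_eq_norm] at h1
    exact h1
  · intro v
    obtain ⟨a, ha, ha0⟩ := Submodule.exists_mem_ne_zero_of_ne_bot v.1.ne_bot
    refine ⟨a, by simpa using ha0, ?_⟩
    exact ((v.1.adicAbv_coe_lt_one_iff (K := F)
      (NumberField.HeightOneSpectrum.one_lt_absNorm_nnreal v.1) a).2 ha).ne
  · intro v w hvw h
    apply hvw
    apply Subtype.ext
    apply HeightOneSpectrum.ext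
    ext a
    rw [← v.1.adicAbv_coe_lt_one_iff (K := F) (NumberField.HeightOneSpectrum.one_lt_absNorm_nnreal v.1),
      ← w.1.adicAbv_coe_lt_one_iff (K := F) (NumberField.HeightOneSpectrum.one_lt_absNorm_nnreal w.1)]
    exact h.lt_one_iff

end WeakApproximation

/-! ### Valuations of local norms -/

section GlobalNorm
variable {F : Type*} [Field F] [NumberField F]

theorem residueChar_pow_inertiaDeg (v : HeightOneSpectrum (𝓞 F)) :
    residueChar v ^ v.asIdeal.inertiaDeg ℤ = Ideal.absNorm v.asIdeal :=
  Ideal.absNorm_pow_inertiaDeg (v.asIdeal.under ℤ) v.asIdeal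

theorem inertiaDeg_ne_zero (v : HeightOneSpectrum (𝓞 F)) : v.asIdeal.inertiaDeg ℤ ≠ 0 :=
  (Ideal.inertiaDeg_pos (R := ℤ) v.asIdeal).ne'

theorem residueChar_eq (p : ℕ) [hp : Fact p.Prime] {v : HeightOneSpectrum (𝓞 F)}
    (hv : (p : 𝓞 F) ∈ v.asIdeal) : residueChar v = p := by
  by_contra h
  have hc : IsCoprime (residueChar v : ℤ) p := by
    rw [Nat.isCoprime_iff_coprime]
    exact (Nat.coprime_primes Fact.out hp.out).2 h
  obtain ⟨a, b, hab⟩ := hc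
  apply v.isPrime.ne_top
  rw [Ideal.eq_top_iff_one]
  have h1 : (1 : 𝓞 F) = a * residueChar v + b * p := by exact_mod_cast congrArg (Int.cast) hab.symm
  rw [h1]
  exact add_mem (Ideal.mul_mem_left _ _ (residueChar_mem v)) (Ideal.mul_mem_left _ _ hv)

theorem ord_eq_zero_iff {v : HeightOneSpectrum (𝓞 F)} {x : F} (hx : x ≠ 0) :
    ord v x = 0 ↔ v.valuation F x = 1 := by
  have h0 := (Valuation.ne_zero_iff (v.valuation F)).2 hx
  rw [ord, neg_eq_zero]
  refine ⟨fun h ↦ ?_, fun h ↦ by rw [h, WithZero.log_one]⟩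
  rw [← WithZero.exp_log h0, h, WithZero.exp_zero]

theorem ord_mul {v : HeightOneSpectrum (𝓞 F)} {x y : F} (hx : x ≠ 0) (hy : y ≠ 0) :
    ord v (x * y) = ord v x + ord v y := by
  have h1 := (Valuation.ne_zero_iff (v.valuation F)).2 hx
  have h2 := (Valuation.ne_zero_iff (v.valuation F)).2 hy
  rw [ord, map_mul, WithZero.log_mul h1 h2, neg_add]
  rfl

theorem adicAbv_eq_zpow (v : HeightOneSpectrum (𝓞 F)) {x : F} (hx : x ≠ 0) :
    NumberField.HeightOneSpectrum.adicAbv F v x =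
      (((residueChar v : ℚ) ^ (v.asIdeal.inertiaDeg ℤ * ord v x) : ℚ) : ℝ)⁻¹ := by
  have h0 := (Valuation.ne_zero_iff (v.valuation F)).2 hx
  rw [NumberField.HeightOneSpectrum.adicAbv_def, WithZeroMulInt.toNNReal_neg_apply _ h0,
    zpow_mul, zpow_natCast, ← Nat.cast_pow, residueChar_pow_inertiaDeg]
  have e : Multiplicative.toAdd (WithZero.unzero h0) = - ord v x := by
    rw [ord, neg_neg]
    generalize v.valuation F x = y at h0
    induction y using WithZero.recZeroCoe with
    | zero => exact absurd rfl h0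
    | coe a => rfl
  rw [e]
  push_cast
  rw [zpow_neg]

theorem finite_ord_support {x : F} (hx : x ≠ 0) :
    {v : HeightOneSpectrum (𝓞 F) | ord v x ≠ 0}.Finite := by
  refine ((HeightOneSpectrum.Support.finite (𝓞 F) x).union
    (HeightOneSpectrum.Support.finite (𝓞 F) x⁻¹)).subset fun v hv ↦ ?_
  by_contra hcon
  rw [Set.mem_union, not_or] at hcon
  have h1 : v.valuation F x ≤ 1 := not_lt.1 hcon.1
  have h2 : (v.valuation F x)⁻¹ ≤ 1 := by rw [← map_inv₀]; exact not_lt.1 hcon.2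
  exact hv ((ord_eq_zero_iff hx).2 (le_antisymm h1
    ((inv_le_one₀ (zero_lt_iff.2 ((Valuation.ne_zero_iff _).2 hx))).1 h2)))

theorem abs_algebraNorm_eq_prod {x : F} (hx : x ≠ 0) {S : Finset (HeightOneSpectrum (𝓞 F))}
    (hS : ∀ v, ord v x ≠ 0 → v ∈ S) :
    |Algebra.norm ℚ x| = ∏ v ∈ S, (residueChar v : ℚ) ^ (v.asIdeal.inertiaDeg ℤ * ord v x) := by
  have h1 := FinitePlace.prod_eq_inv_abs_norm hx
  rw [← finprod_comp_equiv FinitePlace.equivHeightOneSpectrum.symm] at h1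
  simp only [FinitePlace.equivHeightOneSpectrum_symm_apply, FinitePlace.norm_embedding,
    adicAbv_eq_zpow _ hx] at h1
  rw [finprod_eq_prod_of_mulSupport_subset (s := S), Finset.prod_inv_distrib] at h1
  · rw [Rat.cast_inv, inv_inj] at h1
    exact_mod_cast h1.symm
  · intro v hv
    refine hS v fun h ↦ hv ?_
    simp [h]

theorem valuation_prod_eq_sum {p : ℕ} [Fact p.Prime] {ι : Type*} (s : Finset ι) {f : ι → ℚ_[p]}
    (hf : ∀ i ∈ s, f i ≠ 0) : (∏ i ∈ s, f i).valuation = ∑ i ∈ s, (f i).valuation := by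
  classical
  induction s using Finset.induction_on with
  | empty => simp
  | insert a s ha ih =>
    have hs : ∀ i ∈ s, f i ≠ 0 := fun i hi ↦ hf i (Finset.mem_insert_of_mem hi)
    rw [Finset.prod_insert ha, Finset.sum_insert ha, Padic.valuation_mul
      (hf a (Finset.mem_insert_self _ _)) (Finset.prod_ne_zero_iff.2 hs), ih hs]

theorem iwasawaLog_prod {p : ℕ} [Fact p.Prime] {ι : Type*} (s : Finset ι) {f : ι → ℚ_[p]}
    (hf : ∀ i ∈ s, f i ≠ 0) : iwasawaLog p (∏ i ∈ s, f i) = ∑ i ∈ s, iwasawaLog p (f i) := by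
  classical
  induction s using Finset.induction_on with
  | empty => simp [iwasawaLog_one]
  | insert a s ha ih =>
    have hs : ∀ i ∈ s, f i ≠ 0 := fun i hi ↦ hf i (Finset.mem_insert_of_mem hi)
    rw [Finset.prod_insert ha, Finset.sum_insert ha, iwasawaLog_mul
      (hf a (Finset.mem_insert_self _ _)) (Finset.prod_ne_zero_iff.2 hs), ih hs]

section
variable (p : ℕ) [hp : Fact p.Prime]

theorem valuation_localNorm_eq_zero_of_ord {v : HeightOneSpectrum (𝓞 F)}
    (hv : (p : 𝓞 F) ∈ v.asIdeal) {x : F} (hx0 : x ≠ 0) (hx : ord v x = 0) :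
    (localNorm p v hv (algebraMap F _ x)).valuation = 0 := by
  have h1 := norm_localNorm_eq_one p v hv ((ord_eq_zero_iff hx0).1 hx)
  have h0 : localNorm p v hv (algebraMap F _ x) ≠ 0 := by
    rw [← norm_ne_zero_iff, h1]; exact one_ne_zero
  have hp1 : (1 : ℝ) < p := by exact_mod_cast hp.out.one_lt
  rw [Padic.norm_eq_zpow_neg_valuation h0, zpow_eq_one_iff_right₀ (by linarith) hp1.ne'] at h1
  simpa using h1

/-- An element of valuation `1` at `v` and `0` at the other places of a finite set. -/
theorem exists_ord_eq_one (v : HeightOneSpectrum (𝓞 F)) (S : Finset (HeightOneSpectrum (𝓞 F))) :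
    ∃ x : F, x ≠ 0 ∧ ord v x = 1 ∧ ∀ w ∈ S, w ≠ v → ord w x = 0 := by
  classical
  obtain ⟨π, hπ⟩ := v.valuation_exists_uniformizer F
  have hπ0 : π ≠ 0 := by
    rintro rfl
    rw [map_zero] at hπ
    exact WithZero.exp_ne_zero hπ.symm
  have hlt {w : HeightOneSpectrum (𝓞 F)} {a b : F} : NumberField.HeightOneSpectrum.adicAbv F w a <
      NumberField.HeightOneSpectrum.adicAbv F w b ↔ w.valuation F a < w.valuation F b := by
    rw [NumberField.HeightOneSpectrum.adicAbv_def, NumberField.HeightOneSpectrum.adicAbv_def,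
      NNReal.coe_lt_coe]
    exact (WithZeroMulInt.toNNReal_strictMono
      (NumberField.HeightOneSpectrum.one_lt_absNorm_nnreal w)).lt_iff_lt
  have hr : 0 < min 1 (NumberField.HeightOneSpectrum.adicAbv F v π) :=
    lt_min one_pos ((AbsoluteValue.pos_iff _).2 hπ0)
  obtain ⟨a, ha⟩ := exists_forall_adicAbv_sub_lt (insert v S) (fun w ↦ if w = v then π else 1) hr
  have h1 : v.valuation F a = v.valuation F π := by
    have h2 := (ha v (Finset.mem_insert_self _ _)).trans_le (min_le_right _ _)
    rw [if_pos rfl, hlt] at h2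
    exact Valuation.map_eq_of_sub_lt _ h2
  have ha0 : a ≠ 0 := by
    rw [← Valuation.ne_zero_iff (v.valuation F), h1, Valuation.ne_zero_iff]
    exact hπ0
  refine ⟨a, ha0, by rw [ord, h1, hπ, WithZero.log_exp, neg_neg], fun w hw hwv ↦ ?_⟩
  have h2 := (ha w (Finset.mem_insert_of_mem hw)).trans_le (min_le_left _ _)
  rw [if_neg hwv, ← map_one (NumberField.HeightOneSpectrum.adicAbv F w), hlt] at h2
  rw [ord_eq_zero_iff ha0, Valuation.map_eq_of_sub_lt _ h2, map_one]

/-- For an element of valuation 1 at $v$ and 0 at the other places over $p$, compare the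
factorizations of the global norm into local norms and into powers of residue characteristics.
Dividing by a power of it reduces the general case to units at $v$. -/
theorem valuation_localNorm_eq (v : HeightOneSpectrum (𝓞 F)) (hv : (p : 𝓞 F) ∈ v.asIdeal) {x : F}
    (hx : x ≠ 0) :
    (localNorm p v hv (algebraMap F _ x)).valuation = v.asIdeal.inertiaDeg ℤ * ord v x := by
  classical
  have := Fintype.ofFinite {v : HeightOneSpectrum (𝓞 F) // (p : 𝓞 F) ∈ v.asIdeal}
  set T : Finset (HeightOneSpectrum (𝓞 F)) := (finite_dvd p hp.out.ne_zero).toFinset with hT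
  have hmemT (w : HeightOneSpectrum (𝓞 F)) : w ∈ T ↔ (p : 𝓞 F) ∈ w.asIdeal := by simp [hT]
  have hN0 {w : HeightOneSpectrum (𝓞 F)} (hw : (p : 𝓞 F) ∈ w.asIdeal) {y : F} (hy : y ≠ 0) :
      localNorm p w hw (algebraMap F _ y) ≠ 0 :=
    localNorm_ne_zero p w hw ((map_ne_zero _).2 hy)
  obtain ⟨π, hπ0, hπv, hπ⟩ := exists_ord_eq_one v T
  have hkey : (localNorm p v hv (algebraMap F _ π)).valuation = v.asIdeal.inertiaDeg ℤ := by
    have h1 : ((Algebra.norm ℚ π : ℚ) : ℚ_[p]).valuation =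
        (localNorm p v hv (algebraMap F _ π)).valuation := by
      rw [algebraNorm_eq_prod_localNorm, valuation_prod_eq_sum _ fun w _ ↦ hN0 w.2 hπ0]
      refine Finset.sum_eq_single (⟨v, hv⟩ : {v : HeightOneSpectrum (𝓞 F) // (p : 𝓞 F) ∈ v.asIdeal})
        (fun w _ hw ↦ ?_) (by simp)
      exact valuation_localNorm_eq_zero_of_ord p w.2 hπ0
        (hπ w.1 ((hmemT _).2 w.2) fun h ↦ hw (Subtype.ext h))
    set S := insert v (finite_ord_support hπ0).toFinset with hS
    have h2 := abs_algebraNorm_eq_prod hπ0 (S := S) (fun w hw ↦ by simp [hS, hw])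
    have h3 : ((Algebra.norm ℚ π : ℚ) : ℚ_[p]).valuation =
        ((|Algebra.norm ℚ π| : ℚ) : ℚ_[p]).valuation := by
      rcases abs_choice (Algebra.norm ℚ π) with h | h <;> rw [h]
      rw [Rat.cast_neg, ← neg_one_mul, Padic.valuation_mul (by simp) (by
        rw [Rat.cast_ne_zero]; exact Algebra.norm_ne_zero_iff.2 hπ0)]
      simpa [padicValInt] using Padic.valuation_intCast (p := p) (-1)
    have hr0 (w : HeightOneSpectrum (𝓞 F)) : (residueChar w : ℚ_[p]) ≠ 0 := by
      exact_mod_cast (Fact.out : (residueChar w).Prime).ne_zero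
    rw [← h1, h3, h2, Rat.cast_prod, valuation_prod_eq_sum _ (fun w _ ↦ by
      push_cast; exact zpow_ne_zero _ (hr0 w)), Finset.sum_eq_single v]
    · push_cast
      rw [Padic.valuation_zpow, residueChar_eq p hv, Padic.valuation_p, hπv]
      simp
    · intro w _ hwv
      push_cast
      rw [Padic.valuation_zpow]
      by_cases hw : (p : 𝓞 F) ∈ w.asIdeal
      · rw [hπ w ((hmemT w).2 hw) hwv, mul_zero, zero_mul]
      · rw [Padic.valuation_natCast, padicValNat.eq_zero_of_not_dvd, Nat.cast_zero, mul_zero]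
        intro h
        apply hw
        rw [(Nat.prime_dvd_prime_iff_eq hp.out Fact.out).1 h]
        exact residueChar_mem w
    · exact fun h ↦ absurd (by simp [hS]) h
  have hpow (k : ℕ) : ord v (π ^ k) = k := by
    induction k with
    | zero => simp [ord]
    | succ k ih => rw [pow_succ, ord_mul (pow_ne_zero k hπ0) hπ0, ih, hπv]; simp
  have hNpow (k : ℕ) : (localNorm p v hv (algebraMap F _ (π ^ k))).valuation =
      v.asIdeal.inertiaDeg ℤ * k := by
    rw [map_pow, map_pow, Padic.valuation_pow, hkey, mul_comm]
  have hNmul {y z : F} (hy : y ≠ 0) (hz : z ≠ 0) :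
      (localNorm p v hv (algebraMap F _ (y * z))).valuation =
        (localNorm p v hv (algebraMap F _ y)).valuation +
          (localNorm p v hv (algebraMap F _ z)).valuation := by
    rw [map_mul, map_mul, Padic.valuation_mul (hN0 hv hy) (hN0 hv hz)]
  obtain ⟨k, hk | hk⟩ := Int.eq_nat_or_neg (ord v x)
  · have hy0 : x / π ^ k ≠ 0 := div_ne_zero hx (pow_ne_zero k hπ0)
    have e : x / π ^ k * π ^ k = x := div_mul_cancel₀ _ (pow_ne_zero k hπ0)
    have h1 := ord_mul (v := v) hy0 (pow_ne_zero k hπ0)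
    rw [e, hpow, hk] at h1
    have h2 := hNmul hy0 (pow_ne_zero k hπ0)
    rw [e, hNpow, valuation_localNorm_eq_zero_of_ord p hv hy0 (by omega), zero_add] at h2
    rw [h2, hk]
  · have h1 := ord_mul (v := v) hx (pow_ne_zero k hπ0)
    rw [hpow, hk, neg_add_cancel] at h1
    have h2 := hNmul hx (pow_ne_zero k hπ0)
    rw [hNpow, valuation_localNorm_eq_zero_of_ord p hv (mul_ne_zero hx (pow_ne_zero k hπ0)) h1] at h2
    rw [hk, mul_neg, ← add_eq_zero_iff_eq_neg, ← h2]

end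
end GlobalNorm

/-! ### Logarithmic valuations: integrality, unit values and the product formula -/

section LogVal
variable {F : Type*} [Field F] [NumberField F] {ℓ : ℕ} [hℓ : Fact ℓ.Prime]
  {v : HeightOneSpectrum (𝓞 F)}

theorem norm_eq_of_norm_sub_lt {p : ℕ} [Fact p.Prime] {x y : ℚ_[p]} (h : ‖x - y‖ < ‖y‖) :
    ‖x‖ = ‖y‖ := by
  rw [sub_eq_add_neg] at h
  rw [← norm_neg y] at h ⊢
  exact IsUltrametricDist.norm_eq_of_add_norm_lt_max (h.trans_le (le_max_right _ _))

theorem localNorm_zero (p : ℕ) [Fact p.Prime] (hv : (p : 𝓞 F) ∈ v.asIdeal) :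
    localNorm p v hv 0 = 0 := by
  let _ := (padicToCompletion p v hv).toAlgebra
  have := continuousSMul_adicCompletion p v hv
  have : FiniteDimensional ℚ_[p] (v.adicCompletion F) := finiteDimensional_adicCompletion
  exact Algebra.norm_zero (R := ℚ_[p]) (S := v.adicCompletion F)

/-- The norm is continuous, so an element of $F$ close to $y$ has a norm of the same valuation,
where the formula for $F$ applies. -/
theorem inertiaDeg_dvd_valuation_localNorm (p : ℕ) [Fact p.Prime] (hv : (p : 𝓞 F) ∈ v.asIdeal)
    {y : v.adicCompletion F} (hy : y ≠ 0) :
    (v.asIdeal.inertiaDeg ℤ : ℤ) ∣ (localNorm p v hv y).valuation := by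
  have h0 := localNorm_ne_zero p v hv hy
  have hO : IsOpen {z | ‖localNorm p v hv z - localNorm p v hv y‖ < ‖localNorm p v hv y‖} :=
    isOpen_lt ((continuous_localNorm p v hv).sub continuous_const).norm continuous_const
  obtain ⟨x, hx⟩ := (v.denseRange_algebraMap F).exists_mem_open hO ⟨y, by simpa using h0⟩
  have h1 := norm_eq_of_norm_sub_lt hx
  have hNx0 : localNorm p v hv (algebraMap F _ x) ≠ 0 := by
    rw [← norm_ne_zero_iff, h1]; exact norm_ne_zero_iff.2 h0
  have hx0 : x ≠ 0 := by
    rintro rfl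
    rw [map_zero, localNorm_zero] at hNx0
    exact hNx0 rfl
  have hp1 : (1 : ℝ) < p := by exact_mod_cast (Fact.out : p.Prime).one_lt
  rw [Padic.norm_eq_zpow_neg_valuation hNx0, Padic.norm_eq_zpow_neg_valuation h0,
    zpow_right_inj₀ (by linarith) hp1.ne', neg_inj] at h1
  rw [← h1, valuation_localNorm_eq p v hv hx0]
  exact dvd_mul_right _ _

theorem localLogInertia_eq (p : ℕ) [Fact p.Prime] (hv : (p : 𝓞 F) ∈ v.asIdeal) :
    letI := (padicToCompletion p v hv).toAlgebra
    localLogInertia v = logInertiaDegree ℚ_[p] (v.adicCompletion F) := by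
  obtain rfl := residueChar_eq p hv
  rfl

theorem norm_localLogInertia_eq (hv : (ℓ : 𝓞 F) ∉ v.asIdeal) :
    ‖(localLogInertia v : ℚ_[ℓ])‖ = ‖(v.asIdeal.inertiaDeg ℤ : ℚ_[ℓ])‖ := by
  let _ := (padicToCompletion (residueChar v) v (residueChar_mem v)).toAlgebra
  have := continuousSMul_adicCompletion (residueChar v) v (residueChar_mem v)
  have : FiniteDimensional ℚ_[residueChar v] (v.adicCompletion F) := finiteDimensional_adicCompletion
  have hne : residueChar v ≠ ℓ := fun h ↦ hv (h ▸ residueChar_mem v)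
  refine norm_logInertiaDegree_eq_of_ne (p := residueChar v) _ hne (inertiaDeg_ne_zero v)
    (fun x hx ↦ inertiaDeg_dvd_valuation_localNorm (residueChar v) (residueChar_mem v) hx) ?_
  obtain ⟨π, hπ0, hπ, -⟩ := exists_ord_eq_one v ∅
  refine ⟨algebraMap F _ π, (map_ne_zero _).2 hπ0, ?_⟩
  have := valuation_localNorm_eq (residueChar v) v (residueChar_mem v) hπ0
  rw [hπ, mul_one] at this
  exact this

theorem norm_lambdaPlace (hv : (ℓ : 𝓞 F) ∉ v.asIdeal) : ‖lambdaPlace F ℓ v‖ = 1 := by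
  have h0 : (v.asIdeal.inertiaDeg ℤ : ℚ_[ℓ]) ≠ 0 := by exact_mod_cast inertiaDeg_ne_zero v
  rw [lambdaPlace, norm_div, norm_localLogInertia_eq hv, div_self (norm_ne_zero_iff.2 h0)]

theorem localLogInertia_ne_zero_of_notMem (hv : (ℓ : 𝓞 F) ∉ v.asIdeal) :
    (localLogInertia v : ℚ_[ℓ]) ≠ 0 := by
  rw [← norm_ne_zero_iff, norm_localLogInertia_eq hv, norm_ne_zero_iff]
  exact_mod_cast inertiaDeg_ne_zero v

theorem degPlace_of_notMem (hv : (ℓ : 𝓞 F) ∉ v.asIdeal) :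
    degPlace F ℓ v = localLogInertia v * iwasawaLog ℓ (residueChar v : ℚ_[ℓ]) ∧
      iwasawaLog ℓ (residueChar v : ℚ_[ℓ]) ≠ 0 := by
  have h : residueChar v ≠ ℓ := fun h ↦ hv (h ▸ residueChar_mem v)
  exact ⟨by rw [degPlace, degPrime, if_neg h], iwasawaLog_natCast_ne_zero Fact.out h⟩

theorem logAbs_of_notMem (hv : (ℓ : 𝓞 F) ∉ v.asIdeal) {x : F} (hx : x ≠ 0) :
    logAbs F ℓ v (algebraMap F _ x) =
      -(v.asIdeal.inertiaDeg ℤ * ord v x * iwasawaLog ℓ (residueChar v : ℚ_[ℓ])) := by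
  have hp : (residueChar v : ℚ_[ℓ]) ≠ 0 := by
    exact_mod_cast (Fact.out : (residueChar v).Prime).ne_zero
  rw [logAbs, dif_neg hv, valuation_localNorm_eq _ v _ hx, iwasawaLog_zpow hp]
  push_cast
  ring

theorem logVal_of_notMem (hv : (ℓ : 𝓞 F) ∉ v.asIdeal) {x : F} (hx : x ≠ 0) :
    logVal F ℓ v (algebraMap F _ x) = ord v x * lambdaPlace F ℓ v := by
  obtain ⟨h1, h2⟩ := degPlace_of_notMem hv
  have h3 := localLogInertia_ne_zero_of_notMem hv
  rw [logVal, logAbs_of_notMem hv hx, h1, lambdaPlace]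
  field_simp

/-- This is $\operatorname{Log}_\ell N(F_v^\times)=\tilde f_vq\,\mathbb Z_\ell$ in the form of an
upper bound that is attained. -/
theorem localLogInertia_spec (hv : (ℓ : 𝓞 F) ∈ v.asIdeal) :
    localLogInertia v ≠ 0 ∧
      (∀ x : v.adicCompletion F, x ≠ 0 → ‖iwasawaLog ℓ (localNorm ℓ v hv x)‖ ≤
        ‖(localLogInertia v * logConductor ℓ : ℚ_[ℓ])‖) ∧
      ∃ x : v.adicCompletion F, x ≠ 0 ∧ ‖iwasawaLog ℓ (localNorm ℓ v hv x)‖ =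
        ‖(localLogInertia v * logConductor ℓ : ℚ_[ℓ])‖ := by
  let _ := (padicToCompletion ℓ v hv).toAlgebra
  have := continuousSMul_adicCompletion ℓ v hv
  have : FiniteDimensional ℚ_[ℓ] (v.adicCompletion F) := finiteDimensional_adicCompletion
  rw [localLogInertia_eq ℓ hv]
  exact logInertiaDegree_ne_zero_and_norm_iwasawaLog_algebraNorm_le (p := ℓ) (v.adicCompletion F)

theorem degPlace_of_mem (hv : (ℓ : 𝓞 F) ∈ v.asIdeal) :
    degPlace F ℓ v = localLogInertia v * logConductor ℓ ∧ degPlace F ℓ v ≠ 0 := by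
  have h1 : degPlace F ℓ v = localLogInertia v * logConductor ℓ := by
    rw [degPlace, degPrime, if_pos (residueChar_eq ℓ hv), logConductor]
    split_ifs <;> norm_cast
  refine ⟨h1, h1 ▸ mul_ne_zero (by exact_mod_cast (localLogInertia_spec hv).1) ?_⟩
  rw [logConductor]
  split_ifs
  · norm_num
  · exact_mod_cast hℓ.out.ne_zero

/-- Above $\ell$ this is the upper bound on logarithms of norms. Elsewhere $\tilde v=\lambda v$ with
$\lambda$ a unit. -/
theorem norm_logVal_le_one (x : F) (hx : x ≠ 0) : ‖logVal F ℓ v (algebraMap F _ x)‖ ≤ 1 := by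
  by_cases hv : (ℓ : 𝓞 F) ∈ v.asIdeal
  · obtain ⟨h1, h2⟩ := degPlace_of_mem hv
    rw [logVal, norm_div, norm_neg, logAbs, dif_pos hv, div_le_one (norm_pos_iff.2 h2), h1]
    exact (localLogInertia_spec hv).2.1 _ ((map_ne_zero _).2 hx)
  · rw [logVal_of_notMem hv hx, norm_mul, norm_lambdaPlace hv, mul_one]
    exact Padic.norm_int_le_one _

theorem exists_norm_logVal_eq_one (hv : (ℓ : 𝓞 F) ∈ v.asIdeal) :
    ∃ x : v.adicCompletion F, x ≠ 0 ∧ ‖logVal F ℓ v x‖ = 1 := by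
  obtain ⟨h1, h2⟩ := degPlace_of_mem hv
  obtain ⟨x, hx0, hx⟩ := (localLogInertia_spec hv).2.2
  refine ⟨x, hx0, ?_⟩
  rw [logVal, norm_div, norm_neg, logAbs, dif_pos hv, h1, hx, div_self]
  rw [← h1]
  exact norm_ne_zero_iff.2 h2

theorem exists_isOpen_norm_logVal_sub_lt_one (hv : (ℓ : 𝓞 F) ∈ v.asIdeal) {x : v.adicCompletion F}
    (hx : x ≠ 0) : ∃ U : Set (v.adicCompletion F), IsOpen U ∧ x ∈ U ∧
      ∀ y ∈ U, y ≠ 0 ∧ ‖logVal F ℓ v y - logVal F ℓ v x‖ < 1 := by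
  obtain ⟨h1, h2⟩ := degPlace_of_mem hv
  have hN0 := localNorm_ne_zero ℓ v hv hx
  have hle : ‖degPlace F ℓ v‖ ≤ ‖(logConductor ℓ : ℚ_[ℓ])‖ := by
    rw [h1, norm_mul]
    exact mul_le_of_le_one_left (norm_nonneg _) (by
      simpa using Padic.norm_int_le_one (p := ℓ) (localLogInertia v))
  refine ⟨{y | ‖localNorm ℓ v hv y / localNorm ℓ v hv x - 1‖ < ‖degPlace F ℓ v‖},
    isOpen_lt (((continuous_localNorm ℓ v hv).div_const _).sub continuous_const).norm
      continuous_const, by simpa [div_self hN0] using h2, fun y hy ↦ ?_⟩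
  have hy' : ‖localNorm ℓ v hv y / localNorm ℓ v hv x - 1‖ < ‖degPlace F ℓ v‖ := hy
  have hNy0 : localNorm ℓ v hv y ≠ 0 := by
    intro h0
    rw [h0, zero_div, zero_sub, norm_neg, norm_one] at hy'
    have : ‖(logConductor ℓ : ℚ_[ℓ])‖ ≤ 1 := by
      simpa using Padic.norm_int_le_one (p := ℓ) (logConductor ℓ)
    linarith
  refine ⟨?_, ?_⟩
  · rintro rfl
    exact hNy0 (localNorm_zero ℓ hv)
  · have e : logVal F ℓ v y - logVal F ℓ v x =
        -(iwasawaLog ℓ (localNorm ℓ v hv y / localNorm ℓ v hv x) / degPlace F ℓ v) := by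
      rw [logVal, logVal, logAbs, logAbs, dif_pos hv, dif_pos hv, iwasawaLog_div hNy0 hN0]
      ring
    rw [e, norm_neg, norm_div, div_lt_one (norm_pos_iff.2 h2), norm_iwasawaLog (hy'.le.trans hle)]
    exact hy'

theorem exists_forall_algebraMap_mem (S : Finset (HeightOneSpectrum (𝓞 F)))
    (b : HeightOneSpectrum (𝓞 F) → F) {U : ∀ v : HeightOneSpectrum (𝓞 F), Set (v.adicCompletion F)}
    (hU : ∀ v ∈ S, U v ∈ 𝓝 (algebraMap F (v.adicCompletion F) (b v))) :
    ∃ a : F, ∀ v ∈ S, algebraMap F (v.adicCompletion F) a ∈ U v := by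
  have h1 : ∀ v : HeightOneSpectrum (𝓞 F), ∃ ε : ℝ, 0 < ε ∧ (v ∈ S → ∀ a : F,
      NumberField.HeightOneSpectrum.adicAbv F v (a - b v) < ε →
        algebraMap F (v.adicCompletion F) a ∈ U v) := by
    intro v
    by_cases hv : v ∈ S
    · obtain ⟨ε, hε, h⟩ := Metric.mem_nhds_iff.1 (hU v hv)
      refine ⟨ε, hε, fun _ a ha ↦ h ?_⟩
      rw [Metric.mem_ball, dist_eq_norm, ← map_sub]
      rw [← FinitePlace.norm_embedding] at ha
      exact ha
    · exact ⟨1, one_pos, fun h ↦ absurd h hv⟩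
  choose ε hε h using h1
  have h2 : ∀ᶠ r in 𝓝[>] (0 : ℝ), ∀ v ∈ S, r < ε v := by
    rw [eventually_all_finset]
    exact fun v _ ↦ nhdsWithin_le_nhds (eventually_lt_nhds (hε v))
  obtain ⟨r, hr, hr0⟩ := (h2.and self_mem_nhdsWithin).exists
  obtain ⟨a, ha⟩ := exists_forall_adicAbv_sub_lt S b hr0
  exact ⟨a, fun v hv ↦ h v hv a ((ha v hv).trans (hr v hv))⟩

/-- An element whose logarithmic valuation is a unit at `v` and divisible by `ℓ` at the other places
over `ℓ`. -/
theorem exists_norm_logVal_eq_one_and_lt_one (hv : (ℓ : 𝓞 F) ∈ v.asIdeal) :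
    ∃ a : F, a ≠ 0 ∧ ‖logVal F ℓ v (algebraMap F _ a)‖ = 1 ∧
      ∀ w : HeightOneSpectrum (𝓞 F), (ℓ : 𝓞 F) ∈ w.asIdeal → w ≠ v →
        ‖logVal F ℓ w (algebraMap F _ a)‖ < 1 := by
  classical
  obtain ⟨x, hx0, hx⟩ := exists_norm_logVal_eq_one hv
  obtain ⟨U, hUo, hxU, hU⟩ := exists_isOpen_norm_logVal_sub_lt_one hv hx0
  obtain ⟨b, hb⟩ := (v.denseRange_algebraMap F).exists_mem_open hUo ⟨x, hxU⟩
  have hV (w : HeightOneSpectrum (𝓞 F)) (hw : (ℓ : 𝓞 F) ∈ w.asIdeal) :=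
    exists_isOpen_norm_logVal_sub_lt_one hw (one_ne_zero (α := w.adicCompletion F))
  have h1 (w : HeightOneSpectrum (𝓞 F)) : ∃ V : Set (w.adicCompletion F),
      (ℓ : 𝓞 F) ∈ w.asIdeal → (V ∈ 𝓝 (algebraMap F (w.adicCompletion F) (if w = v then b else 1)) ∧
        ∀ y ∈ V, (w = v → y ≠ 0 ∧ ‖logVal F ℓ w y‖ = 1) ∧ (w ≠ v → ‖logVal F ℓ w y‖ < 1)) := by
    by_cases hwv : w = v
    · subst hwv
      refine ⟨U, fun _ ↦ ⟨by rw [if_pos rfl]; exact hUo.mem_nhds hb, fun y hy ↦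
        ⟨fun _ ↦ ⟨(hU y hy).1, ?_⟩, fun h ↦ absurd rfl h⟩⟩⟩
      have h2 := (hU y hy).2
      rw [← hx] at h2 ⊢
      exact norm_eq_of_norm_sub_lt h2
    · by_cases hw : (ℓ : 𝓞 F) ∈ w.asIdeal
      · obtain ⟨V, hVo, h1V, hV⟩ := hV w hw
        refine ⟨V, fun _ ↦ ⟨by rw [if_neg hwv, map_one]; exact hVo.mem_nhds h1V, fun y hy ↦
          ⟨fun h ↦ absurd h hwv, fun _ ↦ ?_⟩⟩⟩
        have h2 := (hV y hy).2
        have h3 : logVal F ℓ w 1 = 0 := by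
          simpa using logVal_mul (F := F) (ℓ := ℓ) w one_ne_zero one_ne_zero
        rwa [h3, sub_zero] at h2
      · exact ⟨∅, fun h ↦ absurd h hw⟩
  choose V hV using h1
  -- The element is chosen near `b` at $v$, where $\tilde v_v$ is a unit, and near $1$ at the other
  -- places above $\ell$, where this makes the logarithmic valuation divisible by $\ell$.
  obtain ⟨a, ha⟩ := exists_forall_algebraMap_mem (finite_dvd ℓ hℓ.out.ne_zero).toFinset _
    fun w hw ↦ (hV w (by simpa using hw)).1
  have ha' (w : HeightOneSpectrum (𝓞 F)) (hw : (ℓ : 𝓞 F) ∈ w.asIdeal) :=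
    (hV w hw).2 _ (ha w (by simpa using hw))
  exact ⟨a, (map_ne_zero _).1 ((ha' v hv).1 rfl).1, ((ha' v hv).1 rfl).2, fun w hw hwv ↦
    (ha' w hw).2 hwv⟩

/-- The product formula. -/
theorem sum_degPlace_mul_logVal {x : F} (hx : x ≠ 0) {S : Finset (HeightOneSpectrum (𝓞 F))}
    (hS : ∀ v, ord v x ≠ 0 → v ∈ S) (hSℓ : ∀ v, (ℓ : 𝓞 F) ∈ v.asIdeal → v ∈ S) :
    ∑ v ∈ S, logVal F ℓ v (algebraMap F _ x) * degPlace F ℓ v = 0 := by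
  classical
  have h1 (v : HeightOneSpectrum (𝓞 F)) : logVal F ℓ v (algebraMap F _ x) * degPlace F ℓ v =
      -logAbs F ℓ v (algebraMap F _ x) := by
    refine div_mul_cancel₀ _ ?_
    by_cases hv : (ℓ : 𝓞 F) ∈ v.asIdeal
    · exact (degPlace_of_mem hv).2
    · obtain ⟨h2, h3⟩ := degPlace_of_notMem hv
      rw [h2]
      exact mul_ne_zero (localLogInertia_ne_zero_of_notMem hv) h3
  have hr0 (w : HeightOneSpectrum (𝓞 F)) : (residueChar w : ℚ_[ℓ]) ≠ 0 := by
    exact_mod_cast (Fact.out : (residueChar w).Prime).ne_zero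
  simp_rw [h1, Finset.sum_neg_distrib, neg_eq_zero]
  have hN0 : Algebra.norm ℚ x ≠ 0 := Algebra.norm_ne_zero_iff.2 hx
  -- The logarithm of the global norm is computed in two ways: from its factorization, where the
  -- places above $\ell$ drop out because $\operatorname{Log}_\ell\ell=0$, and as the sum over the
  -- local norms above $\ell$.
  have h2 : iwasawaLog ℓ ((Algebra.norm ℚ x : ℚ) : ℚ_[ℓ]) =
      ∑ v ∈ S, v.asIdeal.inertiaDeg ℤ * ord v x * iwasawaLog ℓ (residueChar v : ℚ_[ℓ]) := by
    have h3 : iwasawaLog ℓ ((Algebra.norm ℚ x : ℚ) : ℚ_[ℓ]) =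
        iwasawaLog ℓ ((|Algebra.norm ℚ x| : ℚ) : ℚ_[ℓ]) := by
      rcases abs_choice (Algebra.norm ℚ x) with h | h <;> rw [h]
      rw [Rat.cast_neg, iwasawaLog_neg (by exact_mod_cast hN0)]
    rw [h3, abs_algebraNorm_eq_prod hx hS, Rat.cast_prod, iwasawaLog_prod _ (fun w _ ↦ by
      push_cast; exact zpow_ne_zero _ (hr0 w))]
    refine Finset.sum_congr rfl fun v _ ↦ ?_
    push_cast
    rw [iwasawaLog_zpow (hr0 v)]
    push_cast
    rfl
  have := Fintype.ofFinite {v : HeightOneSpectrum (𝓞 F) // (ℓ : 𝓞 F) ∈ v.asIdeal}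
  have h4 : iwasawaLog ℓ ((Algebra.norm ℚ x : ℚ) : ℚ_[ℓ]) =
      ∑ v ∈ S with (ℓ : 𝓞 F) ∈ v.asIdeal, logAbs F ℓ v (algebraMap F _ x) := by
    rw [algebraNorm_eq_prod_localNorm ℓ, iwasawaLog_prod _ fun w _ ↦
      localNorm_ne_zero ℓ w.1 w.2 ((map_ne_zero _).2 hx)]
    have h5 (v : HeightOneSpectrum (𝓞 F)) :
        v ∈ {v ∈ S | (ℓ : 𝓞 F) ∈ v.asIdeal} ↔ (ℓ : 𝓞 F) ∈ v.asIdeal := by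
      simpa using hSℓ v
    rw [Finset.sum_subtype _ h5]
    refine Finset.sum_congr rfl fun v _ ↦ ?_
    rw [logAbs, dif_pos v.2]
  have h5 : ∑ v ∈ S with (ℓ : 𝓞 F) ∈ v.asIdeal,
      v.asIdeal.inertiaDeg ℤ * ord v x * iwasawaLog ℓ (residueChar v : ℚ_[ℓ]) = 0 := by
    refine Finset.sum_eq_zero fun v hv ↦ ?_
    rw [residueChar_eq ℓ (Finset.mem_filter.1 hv).2, iwasawaLog_self, mul_zero]
  rw [← Finset.sum_filter_add_sum_filter_not S fun v ↦ (ℓ : 𝓞 F) ∈ v.asIdeal, ← h4, h2,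
    ← Finset.sum_filter_add_sum_filter_not S fun v ↦ (ℓ : 𝓞 F) ∈ v.asIdeal, h5, zero_add,
    ← Finset.sum_add_distrib]
  refine Finset.sum_eq_zero fun v hv ↦ ?_
  rw [logAbs_of_notMem (Finset.mem_filter.1 hv).2 hx, add_neg_cancel]

end LogVal

theorem exists_linearEquiv_of_ker_eq {R M N P : Type*} [CommRing R] [AddCommGroup M]
    [AddCommGroup N] [AddCommGroup P] [Module R M] [Module R N] [Module R P] {f : M →ₗ[R] N}
    {g : M →ₗ[R] P} (hf : Function.Surjective f) (hg : Function.Surjective g)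
    (h : LinearMap.ker f = LinearMap.ker g) : ∃ e : N ≃ₗ[R] P, ∀ x, e (f x) = g x := by
  refine ⟨(f.quotKerEquivOfSurjective hf).symm ≪≫ₗ Submodule.quotEquivOfEq _ _ h ≪≫ₗ
    g.quotKerEquivOfSurjective hg, fun x ↦ ?_⟩
  have h1 : (f.quotKerEquivOfSurjective hf).symm (f x) = Submodule.Quotient.mk x := by
    rw [LinearEquiv.symm_apply_eq]
    rfl
  rw [LinearEquiv.trans_apply, LinearEquiv.trans_apply, h1]
  rfl

/-! ### Logarithmic divisors, $\ell$-ideals and the two class groups -/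

section Divisors
variable {F : Type*} [Field F] [NumberField F] {ℓ : ℕ} [hℓ : Fact ℓ.Prime]

theorem logDiv_tmul (c : ℤ_[ℓ]) (x : Additive Fˣ) (v : HeightOneSpectrum (𝓞 F)) :
    logDiv F ℓ (c ⊗ₜ x) v = c * logVal F ℓ v (algebraMap F _ (x.toMul : F)) := by
  rw [logDiv, LinearMap.liftBaseChange_tmul]
  rfl

theorem principalIdeal_tmul (c : ℤ_[ℓ]) (x : Additive Fˣ)
    (v : {v : HeightOneSpectrum (𝓞 F) // (ℓ : 𝓞 F) ∉ v.asIdeal}) :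
    principalIdeal F ℓ (c ⊗ₜ x) v = c * (ord v.1 (x.toMul : F) : ℤ_[ℓ]) := by
  rw [principalIdeal, LinearMap.liftBaseChange_tmul]
  rfl

theorem toLogDiv_single (v : {v : HeightOneSpectrum (𝓞 F) // (ℓ : 𝓞 F) ∉ v.asIdeal}) (c : ℤ_[ℓ]) :
    toLogDiv F ℓ (Finsupp.single v c) = Finsupp.single v.1 (c * lambdaPlace F ℓ v.1) := by
  rw [toLogDiv, Finsupp.lsum_single, LinearMap.toSpanSingleton_apply, Finsupp.smul_single]
  rfl

theorem toLogDiv_apply (I : LIdeals F ℓ)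
    (v : {v : HeightOneSpectrum (𝓞 F) // (ℓ : 𝓞 F) ∉ v.asIdeal}) :
    toLogDiv F ℓ I v.1 = I v * lambdaPlace F ℓ v.1 := by
  classical
  induction I using Finsupp.induction_linear with
  | zero => simp
  | add I J hI hJ => rw [map_add, Finsupp.add_apply, hI, hJ, Finsupp.add_apply, PadicInt.coe_add]; ring
  | single w c =>
    rw [toLogDiv_single]
    by_cases h : w = v
    · subst h; rw [Finsupp.single_eq_same, Finsupp.single_eq_same]
    · rw [Finsupp.single_eq_of_ne fun h' ↦ h (Subtype.ext h'.symm),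
        Finsupp.single_eq_of_ne fun h' ↦ h h'.symm]
      simp

theorem toLogDiv_apply_of_mem (I : LIdeals F ℓ) {v : HeightOneSpectrum (𝓞 F)}
    (hv : (ℓ : 𝓞 F) ∈ v.asIdeal) : toLogDiv F ℓ I v = 0 := by
  classical
  induction I using Finsupp.induction_linear with
  | zero => simp
  | add I J hI hJ => rw [map_add, Finsupp.add_apply, hI, hJ, add_zero]
  | single w c =>
    rw [toLogDiv_single, Finsupp.single_eq_of_ne]
    rintro rfl
    exact w.2 hv

theorem toLogDiv_mem (I : LIdeals F ℓ) : toLogDiv F ℓ I ∈ LogDivisors F ℓ := by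
  intro v
  by_cases hv : (ℓ : 𝓞 F) ∈ v.asIdeal
  · rw [toLogDiv_apply_of_mem I hv, norm_zero]; exact zero_le_one
  · rw [toLogDiv_apply I ⟨v, hv⟩, norm_mul, norm_lambdaPlace hv, mul_one]
    exact (I ⟨v, hv⟩).2

/-- A divisor supported away from `ℓ` comes from an `ℓ`-ideal. -/
theorem exists_toLogDiv_eq {D : HeightOneSpectrum (𝓞 F) →₀ ℚ_[ℓ]} (hD : D ∈ LogDivisors F ℓ)
    (h : ∀ v : HeightOneSpectrum (𝓞 F), (ℓ : 𝓞 F) ∈ v.asIdeal → D v = 0) :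
    ∃ I, toLogDiv F ℓ I = D := by
  have h1 (v : {v : HeightOneSpectrum (𝓞 F) // (ℓ : 𝓞 F) ∉ v.asIdeal}) :
      ‖D v.1 / lambdaPlace F ℓ v.1‖ ≤ 1 := by
    rw [norm_div, norm_lambdaPlace v.2, div_one]; exact hD v.1
  let f (v : {v : HeightOneSpectrum (𝓞 F) // (ℓ : 𝓞 F) ∉ v.asIdeal}) : ℤ_[ℓ] := ⟨_, h1 v⟩
  have h2 : (Function.support f).Finite := by
    refine (D.support.finite_toSet.preimage Subtype.val_injective.injOn).subset fun v hv ↦ ?_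
    rw [Set.mem_preimage, SetLike.mem_coe, Finsupp.mem_support_iff]
    refine fun h0 ↦ hv (Subtype.ext ?_)
    change D v.1 / lambdaPlace F ℓ v.1 = 0
    rw [h0, zero_div]
  refine ⟨Finsupp.ofSupportFinite f h2, ?_⟩
  ext v
  by_cases hv : (ℓ : 𝓞 F) ∈ v.asIdeal
  · rw [toLogDiv_apply_of_mem _ hv, h v hv]
  · have h3 : lambdaPlace F ℓ v ≠ 0 := by
      rw [← norm_ne_zero_iff, norm_lambdaPlace hv]; exact one_ne_zero
    rw [toLogDiv_apply _ ⟨v, hv⟩]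
    exact div_mul_cancel₀ _ h3

theorem logDiv_mem (a : PrincipalIdeles F ℓ) : logDiv F ℓ a ∈ LogDivisors F ℓ := by
  induction a using TensorProduct.induction_on with
  | zero => rw [map_zero]; exact Submodule.zero_mem _
  | add a b ha hb => rw [map_add]; exact Submodule.add_mem _ ha hb
  | tmul c x =>
    intro v
    rw [logDiv_tmul, norm_mul]
    exact mul_le_one₀ c.2 (norm_nonneg _) (norm_logVal_le_one _ x.toMul.ne_zero)

theorem deg_logDiv (a : PrincipalIdeles F ℓ) : deg F ℓ (logDiv F ℓ a) = 0 := by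
  classical
  induction a using TensorProduct.induction_on with
  | zero => rw [map_zero, map_zero]
  | add a b ha hb => rw [map_add, map_add, ha, hb, add_zero]
  | tmul c x =>
    have hx : (x.toMul : F) ≠ 0 := x.toMul.ne_zero
    set S := (finite_ord_support hx).toFinset ∪ (finite_dvd (F := F) ℓ hℓ.out.ne_zero).toFinset ∪
      (logDiv F ℓ (c ⊗ₜ x)).support with hS
    have h := sum_degPlace_mul_logVal (ℓ := ℓ) hx (S := S)
      (fun v hv ↦ Finset.mem_union_left _ (Finset.mem_union_left _ (by simpa using hv)))
      (fun v hv ↦ Finset.mem_union_left _ (Finset.mem_union_right _ (by simpa using hv)))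
    rw [deg, Finsupp.lsum_apply, Finsupp.sum_of_support_subset _ Finset.subset_union_right _
      (fun v _ ↦ map_zero _)]
    have h2 : ∑ v ∈ S, (LinearMap.mulRight ℤ_[ℓ] (degPlace F ℓ v)) (logDiv F ℓ (c ⊗ₜ x) v) =
        c * ∑ v ∈ S, logVal F ℓ v (algebraMap F _ (x.toMul : F)) * degPlace F ℓ v := by
      rw [Finset.mul_sum]
      refine Finset.sum_congr rfl fun v _ ↦ ?_
      rw [LinearMap.mulRight_apply, logDiv_tmul, mul_assoc]
    rw [h2, h, mul_zero]

theorem logDiv_apply_of_notMem (a : PrincipalIdeles F ℓ)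
    (v : {v : HeightOneSpectrum (𝓞 F) // (ℓ : 𝓞 F) ∉ v.asIdeal}) :
    logDiv F ℓ a v.1 = principalIdeal F ℓ a v * lambdaPlace F ℓ v.1 := by
  induction a using TensorProduct.induction_on with
  | zero => simp
  | add a b ha hb =>
    rw [map_add, Finsupp.add_apply, ha, hb, map_add, Finsupp.add_apply, PadicInt.coe_add]; ring
  | tmul c x =>
    rw [logDiv_tmul, principalIdeal_tmul, logVal_of_notMem v.2 x.toMul.ne_zero]
    push_cast
    ring

theorem toLogDiv_injective : Function.Injective (toLogDiv F ℓ) := by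
  intro I J h
  ext v
  have h3 : lambdaPlace F ℓ v.1 ≠ 0 := by
    rw [← norm_ne_zero_iff, norm_lambdaPlace v.2]; exact one_ne_zero
  have h1 := DFunLike.congr_fun h v.1
  rw [toLogDiv_apply, toLogDiv_apply] at h1
  exact PadicInt.ext (mul_right_cancel₀ h3 h1)

theorem toLogDiv_principalIdeal {a : PrincipalIdeles F ℓ}
    (ha : ∀ v : HeightOneSpectrum (𝓞 F), (ℓ : 𝓞 F) ∈ v.asIdeal → logDiv F ℓ a v = 0) :
    toLogDiv F ℓ (principalIdeal F ℓ a) = logDiv F ℓ a := by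
  ext v
  by_cases hv : (ℓ : 𝓞 F) ∈ v.asIdeal
  · rw [toLogDiv_apply_of_mem _ hv, ha v hv]
  · rw [toLogDiv_apply _ ⟨v, hv⟩, logDiv_apply_of_notMem a ⟨v, hv⟩]

/-- Divisors of $\ell$-ideals vanish above $\ell$, so any $a$ with such a divisor satisfies the
condition on $\tilde v_{\mathfrak p}(a)$, $\mathfrak p\mid\ell$, by itself. The ideal is then
recovered by injectivity. -/
theorem mem_principalLIdeals_iff {I : LIdeals F ℓ} :
    I ∈ PrincipalLIdeals F ℓ ↔ toLogDiv F ℓ I ∈ PrincipalLogDivisors F ℓ := by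
  constructor
  · rintro ⟨a, ha, rfl⟩
    exact ⟨a, (toLogDiv_principalIdeal ha).symm⟩
  · rintro ⟨a, ha⟩
    have h (v : HeightOneSpectrum (𝓞 F)) (hv : (ℓ : 𝓞 F) ∈ v.asIdeal) : logDiv F ℓ a v = 0 := by
      rw [ha, toLogDiv_apply_of_mem _ hv]
    exact ⟨a, h, toLogDiv_injective ((toLogDiv_principalIdeal h).trans ha)⟩

theorem logVal_mem (v : HeightOneSpectrum (𝓞 F)) (x : Additive Fˣ) :
    ‖logVal F ℓ v (algebraMap F _ (x.toMul : F))‖ ≤ 1 :=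
  norm_logVal_le_one _ x.toMul.ne_zero

variable (F ℓ) in
/-- The logarithmic valuations of an element of `Fˣ` at the places over `ℓ`. -/
noncomputable def logValAboveHom :
    Additive Fˣ →+ ({v : HeightOneSpectrum (𝓞 F) // (ℓ : 𝓞 F) ∈ v.asIdeal} → ℤ_[ℓ]) where
  toFun x v := ⟨_, logVal_mem v.1 x⟩
  map_zero' := by
    ext v
    simpa using logVal_mul (F := F) (ℓ := ℓ) v.1 one_ne_zero one_ne_zero
  map_add' x y := by
    ext v
    have h := logVal_mul (F := F) (ℓ := ℓ) v.1 (x := algebraMap F _ (x.toMul : F))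
      (y := algebraMap F _ (y.toMul : F)) (by simp) (by simp)
    rw [← map_mul] at h
    exact h

variable (F ℓ) in
/-- The logarithmic valuations at the places over `ℓ`. -/
noncomputable def logValAbove : PrincipalIdeles F ℓ →ₗ[ℤ_[ℓ]]
    ({v : HeightOneSpectrum (𝓞 F) // (ℓ : 𝓞 F) ∈ v.asIdeal} → ℤ_[ℓ]) :=
  (logValAboveHom F ℓ).toIntLinearMap.liftBaseChange ℤ_[ℓ]

theorem coe_logValAbove (a : PrincipalIdeles F ℓ)
    (v : {v : HeightOneSpectrum (𝓞 F) // (ℓ : 𝓞 F) ∈ v.asIdeal}) :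
    (logValAbove F ℓ a v : ℚ_[ℓ]) = logDiv F ℓ a v.1 := by
  induction a using TensorProduct.induction_on with
  | zero => simp
  | add a b ha hb =>
    rw [map_add, Pi.add_apply, PadicInt.coe_add, ha, hb, map_add, Finsupp.add_apply]
  | tmul c x =>
    rw [logDiv_tmul, logValAbove, LinearMap.liftBaseChange_tmul, Pi.smul_apply, smul_eq_mul,
      PadicInt.coe_mul]
    rfl

/-- By Nakayama's lemma it suffices to reach each coordinate vector modulo $\ell$, which the
elements from weak approximation do up to a unit. -/
theorem logValAbove_surjective : Function.Surjective (logValAbove F ℓ) := by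
  classical
  set P := {v : HeightOneSpectrum (𝓞 F) // (ℓ : 𝓞 F) ∈ v.asIdeal}
  have := Fintype.ofFinite P
  rw [← LinearMap.range_eq_top, ← top_le_iff]
  have hs (c : ℤ_[ℓ]) (v : P) : (Pi.single v c : P → ℤ_[ℓ]) = c • Pi.single v 1 := by
    rw [← Pi.single_smul', smul_eq_mul, mul_one]
  have hmem (x : P → ℤ_[ℓ]) (hx : ∀ v, x v ∈ IsLocalRing.maximalIdeal ℤ_[ℓ]) :
      x ∈ IsLocalRing.maximalIdeal ℤ_[ℓ] • (⊤ : Submodule ℤ_[ℓ] (P → ℤ_[ℓ])) := by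
    rw [← Finset.univ_sum_single x]
    refine Submodule.sum_mem _ fun v _ ↦ ?_
    rw [hs]
    exact Submodule.smul_mem_smul (hx v) trivial
  refine Submodule.le_of_le_smul_of_le_jacobson_bot Module.Finite.fg_top
    (IsLocalRing.maximalIdeal_le_jacobson _) ?_
  intro x _
  rw [← Finset.univ_sum_single x]
  refine Submodule.sum_mem _ fun v _ ↦ ?_
  rw [hs]
  refine Submodule.smul_mem _ _ ?_
  obtain ⟨a, ha0, ha1, ha⟩ := exists_norm_logVal_eq_one_and_lt_one (F := F) (ℓ := ℓ) v.2
  set α : PrincipalIdeles F ℓ := 1 ⊗ₜ Additive.ofMul (Units.mk0 a ha0)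
  have hα (w : P) : (logValAbove F ℓ α w : ℚ_[ℓ]) = logVal F ℓ w.1 (algebraMap F _ a) := by
    rw [coe_logValAbove, logDiv_tmul, PadicInt.coe_one, one_mul]
    rfl
  obtain ⟨u, hu⟩ := PadicInt.isUnit_iff.2 (show ‖logValAbove F ℓ α v‖ = 1 by
    rw [PadicInt.norm_def, hα, ha1])
  have e : (Pi.single v 1 : P → ℤ_[ℓ]) = (↑u⁻¹ : ℤ_[ℓ]) • logValAbove F ℓ α +
      (Pi.single v 1 - (↑u⁻¹ : ℤ_[ℓ]) • logValAbove F ℓ α) := by abel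
  rw [e]
  refine Submodule.add_mem_sup (Submodule.smul_mem _ _ ⟨α, rfl⟩) (hmem _ fun w ↦ ?_)
  rw [Pi.sub_apply, Pi.smul_apply, smul_eq_mul]
  by_cases hw : w = v
  · subst hw
    rw [Pi.single_eq_same, ← hu, Units.inv_mul, sub_self]
    exact Ideal.zero_mem _
  · rw [Pi.single_eq_of_ne hw, zero_sub]
    refine neg_mem (Ideal.mul_mem_left _ _ ?_)
    rw [IsLocalRing.mem_maximalIdeal, PadicInt.mem_nonunits, PadicInt.norm_def, hα]
    exact ha w.1 w.2 fun h ↦ hw (Subtype.ext h)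

/-- A principal divisor removes the part above $\ell$. The rest comes from an $\ell$-ideal because
the $\lambda_{\mathfrak p}$ are units. -/
theorem exists_logDiv_add_toLogDiv {D : HeightOneSpectrum (𝓞 F) →₀ ℚ_[ℓ]}
    (hD : D ∈ LogDivisors F ℓ) : ∃ a I, D = logDiv F ℓ a + toLogDiv F ℓ I := by
  obtain ⟨a, ha⟩ := logValAbove_surjective (F := F) (ℓ := ℓ) fun v ↦ ⟨D v.1, hD v.1⟩
  obtain ⟨I, hI⟩ := exists_toLogDiv_eq (Submodule.sub_mem _ hD (logDiv_mem a)) fun v hv ↦ by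
    rw [Finsupp.sub_apply, ← coe_logValAbove a ⟨v, hv⟩, ha, sub_self]
  exact ⟨a, I, by rw [hI]; abel⟩

theorem principalLogDivisors_le : PrincipalLogDivisors F ℓ ≤ LogDivisorsZero F ℓ := by
  rintro _ ⟨a, rfl⟩
  exact ⟨logDiv_mem a, deg_logDiv a⟩

theorem toLogDiv_mem_logDivisorsZero {I : LIdeals F ℓ} (hI : I ∈ LIdealsZero F ℓ) :
    toLogDiv F ℓ I ∈ LogDivisorsZero F ℓ := ⟨toLogDiv_mem I, hI⟩

/-- Principal divisors have degree zero, so every degree of a divisor is the degree of an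
$\ell$-ideal $J$. Dividing by $J^{\ell^m}$ brings the degree to zero. -/
theorem lIdealsPow_eq (m : ℕ) :
    LIdealsPow F ℓ m = LIdealsZero F ℓ ⊔ (ℓ : ℤ_[ℓ]) ^ m • ⊤ := by
  refine le_antisymm ?_ (sup_le ?_ ?_)
  · rintro I ⟨_, ⟨D, hD, rfl⟩, hI⟩
    obtain ⟨a, J, rfl⟩ := exists_logDiv_add_toLogDiv hD
    rw [← sub_add_cancel I ((ℓ : ℤ_[ℓ]) ^ m • J)]
    refine Submodule.add_mem_sup ?_ (Submodule.smul_mem_pointwise_smul _ _ _ trivial)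
    rw [LIdealsZero, LinearMap.mem_ker, map_sub, map_smul, ← hI, map_add, deg_logDiv, zero_add]
    exact sub_self _
  · intro I hI
    rw [LIdealsPow, Submodule.mem_comap, show _ = _ from hI]
    exact Submodule.zero_mem _
  · rintro _ ⟨I, -, rfl⟩
    rw [LIdealsPow, Submodule.mem_comap]
    refine ⟨_, ⟨_, toLogDiv_mem I, rfl⟩, ?_⟩
    exact (map_smul (deg F ℓ ∘ₗ toLogDiv F ℓ) ((ℓ : ℤ_[ℓ]) ^ m) I).symm

theorem principalLIdeals_le : PrincipalLIdeals F ℓ ≤ LIdealsZero F ℓ := fun _ hI ↦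
  (principalLogDivisors_le (mem_principalLIdeals_iff.1 hI)).2

theorem principalLIdealsPow_le (m : ℕ) : PrincipalLIdealsPow F ℓ m ≤ LIdealsPow F ℓ m := by
  rw [lIdealsPow_eq]
  exact sup_le_sup_right principalLIdeals_le _

theorem lIdealsZero_le (m : ℕ) : LIdealsZero F ℓ ≤ LIdealsPow F ℓ m := by
  rw [lIdealsPow_eq]
  exact le_sup_left

theorem Subquotient.mk_eq_zero {R M : Type*} [CommRing R] [AddCommGroup M] [Module R M]
    {A B : Submodule R M} (x : A) : Subquotient.mk A B x = 0 ↔ (x : M) ∈ B :=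
  Submodule.Quotient.mk_eq_zero _

theorem Subquotient.mk_surjective {R M : Type*} [CommRing R] [AddCommGroup M] [Module R M]
    (A B : Submodule R M) : Function.Surjective (Subquotient.mk A B) :=
  Submodule.mkQ_surjective _

variable (F ℓ) in
/-- The class of `d_F(𝔞)` for an `ℓ`-ideal `𝔞` of degree zero. -/
noncomputable def toLogClass : LIdealsZero F ℓ →ₗ[ℤ_[ℓ]] LogClassGroup F ℓ :=
  Subquotient.mk _ _ ∘ₗ (toLogDiv F ℓ).restrict fun _ ↦ toLogDiv_mem_logDivisorsZero

variable (F ℓ) in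
/-- The class modulo `P̃r^(ℓ^m)` of an `ℓ`-ideal of degree zero. -/
noncomputable def toClassPow (m : ℕ) : LIdealsZero F ℓ →ₗ[ℤ_[ℓ]]
    Subquotient (LIdealsPow F ℓ m) (PrincipalLIdealsPow F ℓ m) :=
  Subquotient.mk _ _ ∘ₗ Submodule.inclusion (lIdealsZero_le m)

theorem toLogClass_eq_zero_iff (I : LIdealsZero F ℓ) :
    toLogClass F ℓ I = 0 ↔ (I : LIdeals F ℓ) ∈ PrincipalLIdeals F ℓ :=
  (Subquotient.mk_eq_zero _).trans mem_principalLIdeals_iff.symm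

theorem toLogClass_surjective : Function.Surjective (toLogClass F ℓ) := by
  intro c
  obtain ⟨⟨D, hD⟩, rfl⟩ := Subquotient.mk_surjective _ _ c
  obtain ⟨a, I, rfl⟩ := exists_logDiv_add_toLogDiv hD.1
  have hI : I ∈ LIdealsZero F ℓ := by
    have h : deg F ℓ (logDiv F ℓ a + toLogDiv F ℓ I) = 0 := hD.2
    rwa [map_add, deg_logDiv, zero_add] at h
  refine ⟨⟨I, hI⟩, ?_⟩
  rw [toLogClass, LinearMap.comp_apply, ← sub_eq_zero, ← map_sub, Subquotient.mk_eq_zero]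
  change toLogDiv F ℓ I - (logDiv F ℓ a + toLogDiv F ℓ I) ∈ _
  rw [sub_add_cancel_right]
  exact neg_mem ⟨a, rfl⟩

theorem toClassPow_surjective (m : ℕ) : Function.Surjective (toClassPow F ℓ m) := by
  intro c
  obtain ⟨⟨I, hI⟩, rfl⟩ := Subquotient.mk_surjective _ _ c
  have hI' := hI
  rw [lIdealsPow_eq] at hI'
  obtain ⟨J, hJ, K, hK, rfl⟩ := Submodule.mem_sup.1 hI'
  refine ⟨⟨J, hJ⟩, ?_⟩
  rw [toClassPow, LinearMap.comp_apply, ← sub_eq_zero, ← map_sub, Subquotient.mk_eq_zero]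
  refine Submodule.mem_sup_right ?_
  change J - (J + K) ∈ _
  rw [sub_add_cancel_left]
  exact neg_mem hK

/-- If $I$ is principal times $J^{\ell^m}$, then $J$ has degree zero, so the class of $d_F(J)$
exists and is killed by $\ell^m$. Thus $J^{\ell^m}$ is itself principal. -/
theorem toClassPow_eq_zero_iff {m : ℕ} (hm : ∀ c : LogClassGroup F ℓ, ℓ ^ m • c = 0)
    (I : LIdealsZero F ℓ) :
    toClassPow F ℓ m I = 0 ↔ (I : LIdeals F ℓ) ∈ PrincipalLIdeals F ℓ := by
  refine (Subquotient.mk_eq_zero _).trans ⟨fun h ↦ ?_, fun h ↦ Submodule.mem_sup_left h⟩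
  obtain ⟨P, hP, _, ⟨J, -, rfl⟩, h⟩ := Submodule.mem_sup.1 h
  have hℓm : (ℓ : ℤ_[ℓ]) ^ m ≠ 0 := pow_ne_zero _ (by exact_mod_cast hℓ.out.ne_zero)
  have hJ : J ∈ LIdealsZero F ℓ := by
    have h1 : (ℓ : ℤ_[ℓ]) ^ m • J ∈ LIdealsZero F ℓ := by
      have h2 := Submodule.sub_mem _ I.2 (principalLIdeals_le hP)
      rw [Submodule.coe_inclusion] at h
      rw [← h, add_sub_cancel_left] at h2
      exact h2
    rw [LIdealsZero, LinearMap.mem_ker, map_smul, Algebra.smul_def, mul_eq_zero] at h1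
    refine h1.resolve_left fun h0 ↦ hℓm (PadicInt.ext h0)
  have h3 := hm (toLogClass F ℓ ⟨J, hJ⟩)
  rw [← map_nsmul, toLogClass_eq_zero_iff] at h3
  rw [Submodule.coe_inclusion] at h
  rw [← h]
  refine Submodule.add_mem _ hP ?_
  change (ℓ : ℤ_[ℓ]) ^ m • J ∈ _
  rw [← Nat.cast_pow, Nat.cast_smul_eq_nsmul]
  exact h3

end Divisors
end LogClass

theorem mainTheorem4 (F : Type*) [Field F] [NumberField F] (ℓ : ℕ) [Fact ℓ.Prime] (m : ℕ)
    (hm : ∀ c : LogClass.LogClassGroup F ℓ, ℓ ^ m • c = 0) :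
    LogClass.PrincipalLogDivisors F ℓ ≤ LogClass.LogDivisorsZero F ℓ ∧
    LogClass.LIdealsPow F ℓ m = LogClass.LIdealsZero F ℓ ⊔ (ℓ : ℤ_[ℓ]) ^ m • ⊤ ∧
    LogClass.PrincipalLIdealsPow F ℓ m ≤ LogClass.LIdealsPow F ℓ m ∧
    ∃ e : LogClass.LogClassGroup F ℓ ≃ₗ[ℤ_[ℓ]]
        LogClass.Subquotient (LogClass.LIdealsPow F ℓ m) (LogClass.PrincipalLIdealsPow F ℓ m),
      ∀ I ∈ LogClass.LIdealsZero F ℓ,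
        ∃ (hD : LogClass.toLogDiv F ℓ I ∈ LogClass.LogDivisorsZero F ℓ)
          (hI : I ∈ LogClass.LIdealsPow F ℓ m),
          e (LogClass.Subquotient.mk _ _ ⟨LogClass.toLogDiv F ℓ I, hD⟩) =
            LogClass.Subquotient.mk _ _ ⟨I, hI⟩ := by
  refine ⟨LogClass.principalLogDivisors_le, LogClass.lIdealsPow_eq m,
    LogClass.principalLIdealsPow_le m, ?_⟩
  -- Both maps out of $\widetilde{Id}_F$ are surjective with kernel $\widetilde{Pr}_F$.
  have hker : LinearMap.ker (LogClass.toLogClass F ℓ) =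
      LinearMap.ker (LogClass.toClassPow F ℓ m) := by
    ext I
    rw [LinearMap.mem_ker, LinearMap.mem_ker, LogClass.toLogClass_eq_zero_iff,
      LogClass.toClassPow_eq_zero_iff hm]
  obtain ⟨e, he⟩ := LogClass.exists_linearEquiv_of_ker_eq (R := ℤ_[ℓ])
    (M := LogClass.LIdealsZero F ℓ) (N := LogClass.LogClassGroup F ℓ)
    (P := LogClass.Subquotient (LogClass.LIdealsPow F ℓ m) (LogClass.PrincipalLIdealsPow F ℓ m))
    (f := LogClass.toLogClass F ℓ)
    (g := LogClass.toClassPow F ℓ m) (LogClass.toLogClass_surjective (F := F) (ℓ := ℓ))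
    (LogClass.toClassPow_surjective (F := F) (ℓ := ℓ) m) hker
  exact ⟨e, fun I hI ↦ ⟨LogClass.toLogDiv_mem_logDivisorsZero hI, LogClass.lIdealsZero_le m hI,
    he ⟨I, hI⟩⟩⟩
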